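/- **Conventions.** Let $K$ be a field and $n\ge 2$ an integer. Modules are right modules. Let $\Lambda=\bigoplus_{i\ge 0}\Lambda_i$ be a positively graded $K$-algebra with (finite) quiver $Q$: $\Lambda_0\cong KQ_0$ as algebras (a finite product of copies of $K$) and $\Lambda_1\cong KQ_1$ as bimodules, with induced graded homomorphism $\pi:KQ\to\Lambda$ and $I=\operatorname{Ker}\pi$. Here $\otimes=\otimes_{\Lambda_0}$, $Gr_\Lambda$ is the category of $\mathbb Z$-graded right $\Lambda$-modules with homomorphisms of degree $0$, $M[k]_i=M_{i+k}$, and $D(\Lambda)\in Gr_\Lambda$ is the graded dual, $D(\Lambda)_i=\operatorname{Hom}_K(\Lambda_{-i},K)$. Put $\delta(2k)=kn$, $\delta(2k+1)=kn+1$ and $\delta_m(j)=m+\delta(j)$. A graded module is *generated* (resp. *cogenerated*) in degrees belonging to a set $X\subseteq\mathbb Z$ if the support of each of its nonzero graded factors (resp. graded submodules) meets $X$. It is *presented* in degrees belonging to $X$ if it is the cokernel of a morphism between graded projectives generated in degrees belonging to $X$. It is *almost injective* if it is a direct summand of a direct sum of modules $D(\Lambda)[k]$, $k\in\mathbb Z$.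 The algebra $\Lambda$ is *$n$-homogeneous* if $\pi$ is surjective and the ideal $I$ is generated by its component $I_n$ of degree $n$. It is *$n$-Koszul* if moreover $\Lambda_0$ has a resolution $\cdots\to P_1\to P_0\to\Lambda_0\to 0$ in $Gr_\Lambda$ with each $P_j$ projective and generated in degree $\delta(j)$. Its $n$-homogeneous dual is $\Lambda^!=KQ^{op}/\langle I_n^\perp\rangle$, where $I_n^\perp\subseteq KQ_n^{op}$ is the orthogonal of $I_n\subseteq KQ_n$. With $\mathcal U=n\mathbb Z\cup(n\mathbb Z+1)$, let $\Lambda^!_{\mathcal U}=\bigoplus_{u\in\mathcal U}\Lambda^!_u$, in which the product of two homogeneous elements is their product in $\Lambda^!$ if its degree lies in $\mathcal U$ and zero otherwise; it is graded by placing $\Lambda^!_{\delta(j)}$ in degree $j$. Let $E=\bigoplus_j\operatorname{Ext}^j_\Lambda(\Lambda_0,\Lambda_0)$ be the Yoneda algebra of $\Lambda$, with product $ab=a\circ b$. For $m\in\mathbb Z$ put $\mathcal S=m+\mathcal U$. Consider $n$-complexes $(I^\cdot,d^\cdot)$ in $Gr_\Lambda$ (i.e. all compositions of $n$ consecutive maps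 $d$ are zero) such that $I^k$ is almost injective and cogenerated in degree $-k$ for all $k\in\mathbb Z$. For such an $n$-complex, $H_m(I^\cdot)$ is the cochain complex with $I^{\delta_m(j)}$ in position $j$, whose differentials are $d^{m+jn}$ from position $2j$ to $2j+1$ and $d^{m+(j+1)n-1}\circ\cdots\circ d^{m+jn+1}$ from position $2j+1$ to $2j+2$. A cochain complex in $Gr_\Lambda$ is *$H_m$-liftable* if it is isomorphic to some such $H_m(I^\cdot)$. Let $\mathcal Y(\mathcal S,\mathcal U)$ be the full subcategory of the category $C(Gr_\Lambda)$ of cochain complexes whose objects are the $H_m$-liftable complexes $(\tilde I^\cdot,\tilde d^\cdot)$ satisfying (a) if $n=2$, and both (a) and (b) if $n>2$: (a) $\tilde I^j$ is almost injective and cogenerated in degree $-\delta_m(j)$, for all $j\in\mathbb Z$; (b) $Soc^{gr}(\tilde I^{2j+1})\subseteq\operatorname{Im}(\tilde d^{2j})$ for all $j\in\mathbb Z$, where $Soc^{gr}(M)=\{x\in M: x\Lambda_i=0\text{ for all }i>0\}$. **Statement.** Let $n\ge2$, $m\in\mathbb Z$, and let $\Lambda$ be an $n$-Koszul algebra with Yoneda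 algebra $E$. Then there is an isomorphism of graded $K$-algebras $\varphi:E\to\Lambda^!_{\mathcal U}$, so that $\varphi(E_j)=\Lambda^!_{\delta(j)}$ for all $j\ge 0$. Fix any such $\varphi$ and use it to identify $E_j$ with $\Lambda^!_{\delta(j)}$. For $V\in Gr_E$ let $\tilde\mu_{2k,1}:V_{2k}\otimes E_1=V_{2k}\otimes\Lambda^!_1\to V_{2k+1}$ and $\tilde\mu_{2k,2}:V_{2k}\otimes E_2=V_{2k}\otimes\Lambda^!_n\to V_{2k+2}$ be the multiplication maps, and let $\operatorname{Ker}(\tilde\mu_{2k,1})\Lambda^!_{n-1}\subseteq V_{2k}\otimes\Lambda^!_n$ be obtained by multiplying on the right inside $V_{2k}\otimes\Lambda^!$. Let $\mathcal L_E$ be the following full subcategory of $Gr_E$: if $n=2$, $\mathcal L_E=Gr_E$; if $n>2$, its objects are the $V\in Gr_E$ which are generated in even degrees and satisfy $\operatorname{Ker}(\tilde\mu_{2k,1})\Lambda^!_{n-1}\subseteq\operatorname{Ker}(\tilde\mu_{2k,2})$ for all $k\in\mathbb Z$. Then the categories $\mathcal L_E$ and $\mathcal Y(\mathcal S,\mathcal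 U)$ are equivalent. Moreover, $\mathcal L_E$ contains all the graded $E$-modules presented in even degrees. -/

import Mathlib

open CategoryTheory

universe u v w

noncomputable section

namespace NKoszul

/-! ## Graded algebras and graded right modules, given by their homogeneous components -/

/-- An `ℕ`-graded associative unital `K`-algebra `⨁ A_i`, given by its homogeneous components
`A_i` and the multiplications `A_i × A_j → A_k` for `i + j = k`. -/
structure GrAlg (K : Type u) [Field K] where
  obj : ℕ → Type w
  [addCommGroup : ∀ i, AddCommGroup (obj i)]
  [module : ∀ i, Module K (obj i)]
  mul : ∀ {i j k : ℕ}, i + j = k → (obj i →ₗ[K] obj j →ₗ[K] obj k)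
  one : obj 0
  one_mul : ∀ {i : ℕ} (a : obj i), mul (Nat.zero_add i) one a = a
  mul_one : ∀ {i : ℕ} (a : obj i), mul (Nat.add_zero i) a one = a
  mul_assoc : ∀ {i j k ij jk l : ℕ} (hij : i + j = ij) (hjk : j + k = jk) (h : ij + k = l)
    (h' : i + jk = l) (a : obj i) (b : obj j) (c : obj k),
    mul h (mul hij a b) c = mul h' a (mul hjk b c)

attribute [instance] GrAlg.addCommGroup GrAlg.module

/-- Isomorphisms of graded `K`-algebras. -/
structure GrAlg.Iso {K : Type u} [Field K] (A : GrAlg.{u, v} K) (B : GrAlg.{u, w} K) where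
  equiv : ∀ i, A.obj i ≃ₗ[K] B.obj i
  map_one : equiv 0 A.one = B.one
  map_mul : ∀ {i j k : ℕ} (h : i + j = k) (a : A.obj i) (b : A.obj j),
    equiv k (A.mul h a b) = B.mul h (equiv i a) (equiv j b)

/-- A `ℤ`-graded right module `⨁ M_i` over a graded algebra `A`, given by its homogeneous
components and the action maps `M_i × A_j → M_l` for `i + j = l`. -/
structure GrMod {K : Type u} [Field K] (A : GrAlg.{u, u} K) where
  obj : ℤ → Type u
  [addCommGroup : ∀ i, AddCommGroup (obj i)]
  [module : ∀ i, Module K (obj i)]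
  act : ∀ {i : ℤ} {j : ℕ} {l : ℤ}, i + j = l → (obj i →ₗ[K] A.obj j →ₗ[K] obj l)
  act_one : ∀ {i : ℤ} (x : obj i), act (by simp) x A.one = x
  act_act : ∀ {i : ℤ} {j k jk : ℕ} {l l' : ℤ} (hij : i + j = l) (h : l + k = l')
    (hjk : j + k = jk) (h' : i + jk = l') (x : obj i) (a : A.obj j) (b : A.obj k),
    act h (act hij x a) b = act h' x (A.mul hjk a b)

attribute [instance] GrMod.addCommGroup GrMod.module

namespace GrMod

variable {K : Type u} [Field K] {A : GrAlg.{u, u} K}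

/-- Morphisms of graded modules (homogeneous of degree `0`). -/
@[ext]
structure Hom (M N : GrMod A) where
  app : ∀ i, M.obj i →ₗ[K] N.obj i
  comm : ∀ {i : ℤ} {j : ℕ} {l : ℤ} (h : i + j = l) (x : M.obj i) (a : A.obj j),
    app l (M.act h x a) = N.act h (app i x) a

/-- The category `Gr_A` of graded right `A`-modules. -/
instance : Category (GrMod A) where
  Hom := Hom
  id M := { app := fun _ => LinearMap.id, comm := fun _ _ _ => rfl }
  comp f g :=
    { app := fun i => (g.app i).comp (f.app i)
      comm := fun h x a => by simp [f.comm, g.comm] }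

instance (M N : GrMod A) : Zero (M ⟶ N) where
  zero := { app := fun _ => 0, comm := fun _ _ _ => by simp }

theorem hom_ext {M N : GrMod A} {f g : M ⟶ N} (h : ∀ i, f.app i = g.app i) : f = g :=
  Hom.ext (funext h)

instance : Limits.HasZeroMorphisms (GrMod A) where
  comp_zero _ _ := hom_ext fun _ => LinearMap.zero_comp _
  zero_comp _ _ _ _ := hom_ext fun _ => LinearMap.comp_zero _

/-- `M` is generated in degrees belonging to `S`: the support of every nonzero factor of `M`
meets `S`. -/
def GeneratedIn (S : Set ℤ) (M : GrMod A) : Prop :=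
  ∀ (N : GrMod A) (f : M ⟶ N), (∀ i, Function.Surjective (f.app i)) →
    (∃ i, Nontrivial (N.obj i)) → ∃ i ∈ S, Nontrivial (N.obj i)

/-- `M` is cogenerated in degrees belonging to `S`: the support of every nonzero subobject of
`M` meets `S`. -/
def CogeneratedIn (S : Set ℤ) (M : GrMod A) : Prop :=
  ∀ (N : GrMod A) (f : N ⟶ M), (∀ i, Function.Injective (f.app i)) →
    (∃ i, Nontrivial (N.obj i)) → ∃ i ∈ S, Nontrivial (N.obj i)

/-- `M` is presented in degrees belonging to `S`: it is the cokernel of a morphism between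
projective objects of `Gr_A` that are generated in degrees belonging to `S`. -/
def PresentedIn (S : Set ℤ) (M : GrMod A) : Prop :=
  ∃ (P₁ P₀ : GrMod A) (f : P₁ ⟶ P₀) (g : P₀ ⟶ M),
    Projective P₁ ∧ Projective P₀ ∧ GeneratedIn S P₁ ∧ GeneratedIn S P₀ ∧
    ∀ i, Function.Surjective (g.app i) ∧ LinearMap.ker (g.app i) = LinearMap.range (f.app i)

/-- The shift `M[k]`, with `M[k]_i = M_{i + k}`. -/
def shift (M : GrMod A) (k : ℤ) : GrMod A where
  obj i := M.obj (i + k)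
  act h := M.act (by omega)
  act_one x := M.act_one x
  act_act hij h hjk h' x a b := M.act_act _ _ hjk _ x a b

variable (A) in
/-- The graded right `A`-module `D(A)`, the graded dual of `A`. Its component of degree `i` is
the dual space of `A_{-i}` (zero if `-i < 0`), written as the space of those families of
functionals `f_p` on the components `A_p` with `f_p = 0` for `p ≠ -i`; the action is
`(f a)(x) = f (a x)`. -/
def dual : GrMod A where
  obj i := ({ carrier := { f | ∀ p : ℕ, (p : ℤ) ≠ -i → f p = 0 }
              add_mem' := fun hf hg p hp => by simp [hf p hp, hg p hp]
              zero_mem' := fun _ _ => rfl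
              smul_mem' := fun c f hf p hp => by simp [hf p hp] } :
            Submodule K (∀ p : ℕ, A.obj p →ₗ[K] K))
  act {i j l} h := LinearMap.mk₂ K
    (fun f a => ⟨fun p => (f.1 (j + p)).comp (A.mul rfl a), fun p hp =>
      (congrArg (·.comp (A.mul rfl a)) (f.2 (j + p) (by push_cast; omega))).trans
        (LinearMap.zero_comp _)⟩)
    (fun _ _ _ => rfl) (fun _ _ _ => rfl)
    (fun f a b => by ext p x; simp) (fun c f a => by ext p x; simp)
  act_one {i} f := by
    ext p x
    have key : ∀ (q : ℕ) (h : 0 + p = q), f.1 q (A.mul h A.one x) = f.1 p x := by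
      intro q h
      obtain rfl : p = q := by omega
      rw [A.one_mul]
    exact key _ rfl
  act_act {i j k jk l l'} hij h hjk h' f a b := by
    ext p x
    have key : ∀ (q : ℕ) (hq : jk + p = q) (hq' : j + (k + p) = q),
        f.1 (j + (k + p)) (A.mul rfl a (A.mul rfl b x)) = f.1 q (A.mul hq (A.mul hjk a b) x) := by
      intro q hq hq'
      subst hq'
      rw [A.mul_assoc hjk rfl hq rfl]
    exact key _ rfl (by omega)

/-- The almost injective graded modules: the objects of `Add (⨁_k D(A)[k])`, that is, the
direct summands of coproducts of shifts of `D(A)`. -/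
def IsAlmostInjective (M : GrMod A) : Prop :=
  ∃ (ι : Type u) (κ : ι → ℤ) (T : Limits.Cofan fun x => (dual A).shift (κ x)),
    Nonempty (Limits.IsColimit T) ∧ Nonempty (Retract M T.pt)

/-- The component of degree `i` of the graded socle `{x | x J = 0}`, `J = ⨁_{j > 0} A_j`. -/
def socle (M : GrMod A) (i : ℤ) : Submodule K (M.obj i) where
  carrier := { x | ∀ (j : ℕ) (l : ℤ) (h : i + j = l), 0 < j → ∀ a : A.obj j, M.act h x a = 0 }
  add_mem' hx hy j l h hj a := by simp [hx j l h hj a, hy j l h hj a]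
  zero_mem' j l h hj a := by simp
  smul_mem' c x hx j l h hj a := by simp [hx j l h hj a]

variable (A) in
/-- The graded right `A`-module `A_0 = A / ⨁_{j > 0} A_j`, concentrated in degree `0`: its
component of degree `i` is `A_0` if `i = 0`, and zero otherwise. -/
def degZero : GrMod A where
  obj i := ({ carrier := { x | i ≠ 0 → x = 0 }
              add_mem' := fun hx hy h => by rw [hx h, hy h, add_zero]
              zero_mem' := fun _ => rfl
              smul_mem' := fun c x hx h => by rw [hx h, smul_zero] } : Submodule K (A.obj 0))
  act {i j l} h := LinearMap.mk₂ K
    (fun x a => if hj : 0 + j = 0 then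
        ⟨A.mul hj x.1 a, fun hl => by rw [x.2 (by omega)]; simp⟩ else 0)
    (fun x y a => by split_ifs <;> ext <;> simp)
    (fun c x a => by split_ifs <;> ext <;> simp)
    (fun x a b => by split_ifs <;> ext <;> simp)
    (fun c x a => by split_ifs <;> ext <;> simp)
  act_one x := by ext; simp [A.mul_one]
  act_act {i j k jk l l'} hij h hjk h' x a b := by
    ext
    by_cases hj : 0 + j = 0
    · by_cases hk : 0 + k = 0
      · have hjk0 : 0 + jk = 0 := by omega
        simp only [LinearMap.mk₂_apply, dif_pos hj, dif_pos hk, dif_pos hjk0]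
        exact A.mul_assoc _ _ _ _ _ _ _
      · have hjk0 : ¬ 0 + jk = 0 := by omega
        simp only [LinearMap.mk₂_apply, dif_neg hk, dif_neg hjk0]
    · have hjk0 : ¬ 0 + jk = 0 := by omega
      simp only [LinearMap.mk₂_apply, dif_neg hj, dif_neg hjk0]
      split_ifs <;> simp

end GrMod

/-! ## The degree function `δ` and regraded algebras -/

/-- `δ(2k) = kn` and `δ(2k+1) = kn + 1`, on natural numbers. -/
def delta (n j : ℕ) : ℕ := (j / 2) * n + j % 2

/-- `δ_m(2k) = m + kn` and `δ_m(2k+1) = m + kn + 1`, on integers. -/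
def deltaZ (n : ℕ) (m j : ℤ) : ℤ := m + (j / 2) * n + j % 2

theorem delta_add_iff (n : ℕ) {i j k : ℕ} (h : i + j = k) :
    delta n i + delta n j = delta n k ↔ n = 2 ∨ ¬ (i % 2 = 1 ∧ j % 2 = 1) := by
  subst h
  unfold delta
  rcases Nat.mod_two_eq_zero_or_one i with hi | hi <;>
  rcases Nat.mod_two_eq_zero_or_one j with hj | hj
  · have h1 : (i + j) / 2 = i / 2 + j / 2 := by omega
    have h2 : (i + j) % 2 = 0 := by omega
    simp only [h1, h2, hi, hj, add_mul]; simp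
  · have h1 : (i + j) / 2 = i / 2 + j / 2 := by omega
    have h2 : (i + j) % 2 = 1 := by omega
    simp only [h1, h2, hi, hj, add_mul]
    constructor
    · intro _; right; omega
    · intro _; omega
  · have h1 : (i + j) / 2 = i / 2 + j / 2 := by omega
    have h2 : (i + j) % 2 = 1 := by omega
    simp only [h1, h2, hi, hj, add_mul]
    constructor
    · intro _; right; omega
    · intro _; omega
  · have h1 : (i + j) / 2 = i / 2 + j / 2 + 1 := by omega
    have h2 : (i + j) % 2 = 0 := by omega
    simp only [h1, h2, hi, hj, add_mul, one_mul, and_self, not_true, or_false]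
    generalize i / 2 * n = x
    generalize j / 2 * n = y
    constructor <;> intro _ <;> omega

/-- The algebra `A_U`, `U = nℤ ∪ (nℤ + 1)`, regraded so that its component of degree `j` is
`A_{δ(j)}`. The product of two homogeneous elements of `A_U` is their product in `A` if its
degree in `A` belongs to `U`, and zero otherwise. -/
def GrAlg.regrade {K : Type u} [Field K] (A : GrAlg.{u, w} K) (n : ℕ) : GrAlg.{u, w} K where
  obj j := A.obj (delta n j)
  mul {i j k} _ := if hδ : delta n i + delta n j = delta n k then A.mul hδ else 0
  one := (show 0 = delta n 0 by simp [delta]) ▸ A.one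
  one_mul {i} a := by
    have h0 : delta n 0 + delta n i = delta n i := by simp [delta]
    have key : ∀ (z : ℕ) (hz : 0 = z) (h : z + delta n i = delta n i),
        A.mul h (hz ▸ A.one) a = a := by
      rintro _ rfl h; exact A.one_mul a
    rw [dif_pos h0]
    exact key (delta n 0) (by simp [delta]) h0
  mul_one {i} a := by
    have h0 : delta n i + delta n 0 = delta n i := by simp [delta]
    have key : ∀ (z : ℕ) (hz : 0 = z) (h : delta n i + z = delta n i),
        A.mul h a (hz ▸ A.one) = a := by
      rintro _ rfl h; exact A.mul_one a
    rw [dif_pos h0]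
    exact key (delta n 0) (by simp [delta]) h0
  mul_assoc {i j k ij jk l} hij hjk h h' a b c := by
    by_cases h1 : delta n i + delta n j = delta n ij ∧ delta n ij + delta n k = delta n l
    · obtain ⟨h1, h2⟩ := h1
      have h3 : delta n j + delta n k = delta n jk := by
        rw [delta_add_iff n hjk]; rw [delta_add_iff n hij] at h1; rw [delta_add_iff n h] at h2
        omega
      have h4 : delta n i + delta n jk = delta n l := by omega
      simp only [dif_pos h1, dif_pos h2, dif_pos h3, dif_pos h4]
      exact A.mul_assoc _ _ _ _ _ _ _
    · have h2 : ¬ (delta n j + delta n k = delta n jk ∧ delta n i + delta n jk = delta n l) := by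
        rw [delta_add_iff n hij, delta_add_iff n h] at h1
        rw [delta_add_iff n hjk, delta_add_iff n h']
        omega
      rw [not_and_or] at h1 h2
      trans (0 : A.obj (delta n l))
      · rcases h1 with h1 | h1 <;> simp [dif_neg h1]
      · rcases h2 with h2 | h2 <;> simp [dif_neg h2]

/-! ## Path algebras and their homogeneous quotients -/

section Paths

variable {V : Type v} [Quiver.{w + 1} V]

variable (V) in
/-- Paths of length `k` in a quiver: `k` consecutive arrows, with the `k + 1` vertices they
pass through. -/
@[ext]
structure QPath (k : ℕ) where
  vertex : Fin (k + 1) → V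
  arrow : Fin k → Quiver.Total V
  left_eq : ∀ s, (arrow s).left = vertex s.castSucc
  right_eq : ∀ s, (arrow s).right = vertex s.succ

/-- The subpath formed by the first `i` arrows. -/
def QPath.take {i j k : ℕ} (h : i + j = k) (p : QPath V k) : QPath V i where
  vertex s := p.vertex ⟨s, by omega⟩
  arrow s := p.arrow ⟨s, by omega⟩
  left_eq s := p.left_eq ⟨s, by omega⟩
  right_eq s := p.right_eq ⟨s, by omega⟩

/-- The subpath formed by the last `j` arrows. -/
def QPath.drop {i j k : ℕ} (h : i + j = k) (p : QPath V k) : QPath V j where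
  vertex s := p.vertex ⟨i + s, by omega⟩
  arrow s := p.arrow ⟨i + s, by omega⟩
  left_eq s := p.left_eq ⟨i + s, by omega⟩
  right_eq s := p.right_eq ⟨i + s, by omega⟩

instance [Finite V] [∀ a b : V, Finite (a ⟶ b)] : Finite (Quiver.Total V) :=
  Finite.of_injective
    (fun t => (⟨t.left, t.right, t.hom⟩ : Σ a b : V, (a ⟶ b))) (by
      rintro ⟨a, b, f⟩ ⟨a', b', f'⟩ h
      simp only [Sigma.mk.injEq] at h
      obtain ⟨rfl, h⟩ := h
      simp only [heq_eq_eq, Sigma.mk.injEq] at h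
      obtain ⟨rfl, h⟩ := h
      simp only [heq_eq_eq] at h
      rw [h])

instance [Finite V] [∀ a b : V, Finite (a ⟶ b)] (k : ℕ) : Finite (QPath V k) :=
  Finite.of_injective (fun p => (p.vertex, p.arrow)) (by
    intro p q h
    simp only [Prod.mk.injEq] at h
    exact QPath.ext h.1 h.2)

instance [Finite V] [∀ a b : V, Finite (a ⟶ b)] (k : ℕ) : Fintype (QPath V k) :=
  Fintype.ofFinite _

variable (V) (K : Type u) [Field K]

/-- The component `KQ_k` of the path algebra of a finite quiver: linear combinations of paths
of length `k`, written as functions `p ↦ (coefficient of p)`. -/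
abbrev PathSpace (k : ℕ) : Type _ := QPath V k → K

variable {V K}

/-- The multiplication `KQ_i × KQ_j → KQ_k` of the path algebra, `i + j = k`. The product of
two paths is their concatenation (first path first), or zero if they cannot be concatenated;
hence the coefficient of `f g` at `p` is `f (first i arrows of p) * g (last j arrows of p)`. -/
def conv {i j k : ℕ} (h : i + j = k) :
    PathSpace V K i →ₗ[K] PathSpace V K j →ₗ[K] PathSpace V K k :=
  LinearMap.mk₂ K (fun f g p => f (p.take h) * g (p.drop h))
    (fun _ _ _ => by ext; simp [add_mul]) (fun _ _ _ => by ext; simp [mul_assoc])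
    (fun _ _ _ => by ext; simp [mul_add]) (fun _ _ _ => by ext; simp [mul_left_comm])

theorem conv_assoc {i j k ij jk l : ℕ} (hij : i + j = ij) (hjk : j + k = jk) (h : ij + k = l)
    (h' : i + jk = l) (a : PathSpace V K i) (b : PathSpace V K j) (c : PathSpace V K k) :
    conv h (conv hij a b) c = conv h' a (conv hjk b c) := by
  subst hij
  funext p
  have h1 : (p.take h).take rfl = p.take h' := rfl
  have h2 : (p.take h).drop rfl = (p.drop h').take hjk := rfl
  have h3 : p.drop h = (p.drop h').drop hjk := by
    refine QPath.ext (funext fun s => ?_) (funext fun s => ?_)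
    · exact congrArg p.vertex (Fin.ext (Nat.add_assoc i j s))
    · exact congrArg p.arrow (Fin.ext (Nat.add_assoc i j s))
  change a ((p.take h).take rfl) * b ((p.take h).drop rfl) * c (p.drop h) =
    a (p.take h') * (b ((p.drop h').take hjk) * c ((p.drop h').drop hjk))
  rw [h1, h2, h3, mul_assoc]

/-- The component of degree `k` of the two-sided ideal of `KQ` (equivalently, of `KQ^op`)
generated by a subspace `R` of `KQ_n`. -/
def idealGen {n : ℕ} (R : Submodule K (PathSpace V K n)) (k : ℕ) :
    Submodule K (PathSpace V K k) :=
  Submodule.span K { g | ∃ (i l j : ℕ) (h : i + n = l) (h' : l + j = k)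
    (a : PathSpace V K i) (f : PathSpace V K n) (b : PathSpace V K j),
    f ∈ R ∧ g = conv h' (conv h a f) b }

theorem conv_idealGen_left {n : ℕ} (R : Submodule K (PathSpace V K n)) {i j k : ℕ}
    (h : i + j = k) (a : PathSpace V K i) {g : PathSpace V K j} (hg : g ∈ idealGen R j) :
    conv h a g ∈ idealGen R k := by
  refine Submodule.span_induction (p := fun g _ => conv h a g ∈ idealGen R k)
    ?_ (by simp) (fun x y _ _ hx hy => by rw [map_add]; exact add_mem hx hy)
    (fun c x _ hx => by rw [map_smul]; exact Submodule.smul_mem _ c hx) hg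
  rintro _ ⟨i', l', j', h1, h2, b, f, c, hf, rfl⟩
  refine Submodule.subset_span
    ⟨i + i', i + l', j', by omega, by omega, conv rfl a b, f, c, hf, ?_⟩
  rw [← conv_assoc (rfl : i + l' = i + l') h2 (by omega) h, conv_assoc rfl h1 _ rfl]

theorem conv_idealGen_right {n : ℕ} (R : Submodule K (PathSpace V K n)) {i j k : ℕ}
    (h : i + j = k) (a : PathSpace V K j) {g : PathSpace V K i} (hg : g ∈ idealGen R i) :
    conv h g a ∈ idealGen R k := by
  refine Submodule.span_induction (p := fun g _ => conv h g a ∈ idealGen R k)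
    ?_ (by simp)
    (fun x y _ _ hx hy => by rw [map_add, LinearMap.add_apply]; exact add_mem hx hy)
    (fun c x _ hx => by
      rw [map_smul, LinearMap.smul_apply]; exact Submodule.smul_mem _ c hx) hg
  rintro _ ⟨i', l', j', h1, h2, b, f, c, hf, rfl⟩
  refine Submodule.subset_span
    ⟨i', l', j' + j, h1, by omega, b, f, conv rfl c a, hf, ?_⟩
  rw [conv_assoc h2 rfl h]

/-- The multiplication of `KQ^op / ⟨R⟩`: the product of `a` and `b` in `KQ^op` is the product
`b a` in `KQ`. -/
def opQuotientMul {n : ℕ} (R : Submodule K (PathSpace V K n)) {i j k : ℕ} (h : i + j = k) :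
    (PathSpace V K i ⧸ idealGen R i) →ₗ[K] (PathSpace V K j ⧸ idealGen R j) →ₗ[K]
      (PathSpace V K k ⧸ idealGen R k) :=
  (Submodule.liftQ (idealGen R j)
    (Submodule.liftQ (idealGen R i)
      (((conv (show j + i = k by omega)).flip).compr₂ (idealGen R k).mkQ)
      (fun _ hg => LinearMap.ext fun a =>
        (Submodule.Quotient.mk_eq_zero _).2 (conv_idealGen_left R _ a hg))).flip
    (fun g hg => LinearMap.ext fun x => by
      obtain ⟨a, rfl⟩ := Submodule.mkQ_surjective _ x
      exact (Submodule.Quotient.mk_eq_zero _).2 (conv_idealGen_right R _ a hg))).flip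

theorem opQuotientMul_mk {n : ℕ} (R : Submodule K (PathSpace V K n)) {i j k : ℕ}
    (h : i + j = k) (a : PathSpace V K i) (b : PathSpace V K j) :
    opQuotientMul R h ((idealGen R i).mkQ a) ((idealGen R j).mkQ b) =
      (idealGen R k).mkQ (conv (show j + i = k by omega) b a) := rfl

/-- The graded algebra `KQ^op / ⟨R⟩`, for a subspace `R` of `KQ_n^op`. -/
def opQuotient {n : ℕ} (R : Submodule K (PathSpace V K n)) : GrAlg K where
  obj k := PathSpace V K k ⧸ idealGen R k
  mul h := opQuotientMul R h
  one := (idealGen R 0).mkQ fun _ => 1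
  one_mul {i} x := by
    obtain ⟨a, rfl⟩ := Submodule.mkQ_surjective _ x
    rw [opQuotientMul_mk]
    congr 1
    funext p
    exact mul_one _
  mul_one {i} x := by
    obtain ⟨a, rfl⟩ := Submodule.mkQ_surjective _ x
    rw [opQuotientMul_mk]
    congr 1
    funext p
    refine (one_mul _).trans (congrArg a ?_)
    refine QPath.ext (funext fun s => ?_) (funext fun s => ?_)
    · exact congrArg p.vertex (Fin.ext (Nat.zero_add s))
    · exact congrArg p.arrow (Fin.ext (Nat.zero_add s))
  mul_assoc {i j k ij jk l} hij hjk h h' x y z := by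
    obtain ⟨a, rfl⟩ := Submodule.mkQ_surjective _ x
    obtain ⟨b, rfl⟩ := Submodule.mkQ_surjective _ y
    obtain ⟨c, rfl⟩ := Submodule.mkQ_surjective _ z
    rw [opQuotientMul_mk, opQuotientMul_mk, opQuotientMul_mk, opQuotientMul_mk, conv_assoc]

end Paths

/-! ## Positively graded algebras, quivers, `n`-homogeneous duals, Yoneda algebras -/

section Algebra

variable {K : Type u} [Field K] {Λ : Type u} [Ring Λ] [Algebra K Λ]
  (𝒜 : ℕ → Submodule K Λ) [GradedAlgebra 𝒜]

/-- The homogeneous components of a graded algebra `Λ = ⨁ Λ_i`. -/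
def GrAlg.ofGraded : GrAlg.{u, u} K where
  obj i := 𝒜 i
  mul h := LinearMap.mk₂ K (fun a b => ⟨(a : Λ) * b, h ▸ SetLike.mul_mem_graded a.2 b.2⟩)
    (fun _ _ _ => by ext; simp [add_mul]) (fun _ _ _ => by ext; simp)
    (fun _ _ _ => by ext; simp [mul_add]) (fun _ _ _ => by ext; simp)
  one := ⟨1, SetLike.one_mem_graded 𝒜⟩
  one_mul a := by ext; simp
  mul_one a := by ext; simp
  mul_assoc hij hjk h h' a b c := by ext; simp [_root_.mul_assoc]

/-- `Λ_0` as a right `Λ`-module (`Λ_0 = Λ / ⨁_{i > 0} Λ_i`), that is, as a module over the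
opposite ring of `Λ`. -/
def degZeroModule : ModuleCat.{u} Λᵐᵒᵖ :=
  letI : Module Λᵐᵒᵖ (𝒜 0) :=
    Module.compHom (𝒜 0) (RingHom.op (GradedRing.projZeroRingHom' 𝒜))
  ModuleCat.of Λᵐᵒᵖ (𝒜 0)

/-- The Yoneda algebra `E = ⨁_j Ext^j_Λ(Λ_0, Λ_0)` of `Λ`, where `Ext` is taken for right
`Λ`-modules. The product `a b` is the composition `a ∘ b` (first `b`, then `a`). -/
def yonedaAlgebra : GrAlg.{u, u} K where
  obj j := Abelian.Ext (degZeroModule 𝒜) (degZeroModule 𝒜) j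
  mul {i j k} h := (Abelian.Ext.bilinearCompOfLinear K (degZeroModule 𝒜) (degZeroModule 𝒜)
    (degZeroModule 𝒜) j i k (by omega)).flip
  one := Abelian.Ext.mk₀ (𝟙 _)
  one_mul a := by simp
  mul_one a := by simp
  mul_assoc {i j k ij jk l} hij hjk h h' a b c := by
    simp only [LinearMap.flip_apply, Abelian.Ext.bilinearCompOfLinear_apply_apply]
    exact (Abelian.Ext.comp_assoc c b a (by omega) (by omega) (by omega)).symm

variable (V : Type v) [Quiver.{w + 1} V]

/-- An identification of a quiver `Q` (with vertex set `V`) as the quiver of the positively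
graded algebra `Λ`: isomorphisms `KQ_0 ≅ Λ_0` of algebras and `KQ_1 ≅ Λ_1` of
`KQ_0`-`KQ_0`-bimodules. They are given by the images of the basis of vertices and of the basis
of arrows; an arrow `α` from `a` to `b` satisfies `α = e_a α e_b`. -/
structure QuiverOf where
  e : Module.Basis V K (𝒜 0)
  x : Module.Basis (Quiver.Total V) K (𝒜 1)
  idem : ∀ a, (e a : Λ) * e a = e a
  orth : ∀ a b, a ≠ b → (e a : Λ) * e b = 0
  left_mul : ∀ α : Quiver.Total V, (e α.left : Λ) * x α = x α
  mul_right : ∀ α : Quiver.Total V, (x α : Λ) * e α.right = x α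

namespace QuiverOf

variable {𝒜 V} [Finite V] [∀ a b : V, Finite (a ⟶ b)] (Φ : QuiverOf 𝒜 V)

/-- The image in `Λ` of a path, under the structural homomorphism `π : KQ → Λ`. -/
def pathProd {k : ℕ} (p : QPath V k) : Λ :=
  (Φ.e (p.vertex 0) : Λ) * (List.ofFn fun s => (Φ.x (p.arrow s) : Λ)).prod

/-- The component `I_k` of the kernel `I` of `π : KQ → Λ`. -/
def relations (k : ℕ) : Submodule K (PathSpace V K k) :=
  LinearMap.ker (Fintype.linearCombination K (Φ.pathProd (k := k)))

/-- `Λ` is a graded factor of a path algebra (i.e. `π` is surjective), and it is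
`n`-homogeneous: `I` is generated by `I_n`. -/
def IsNHomogeneous (n : ℕ) : Prop :=
  Algebra.adjoin K ((𝒜 0 : Set Λ) ∪ 𝒜 1) = ⊤ ∧
    ∀ k, Φ.relations k = idealGen (Φ.relations n) k

/-- `Λ` is `n`-Koszul: it is `n`-homogeneous and the graded right module `Λ_0` has a resolution
`⋯ → P_1 → P_0 → Λ_0 → 0` in `Gr_Λ`, with `P_j` projective and generated in degree `δ(j)`. -/
def IsNKoszul (n : ℕ) : Prop :=
  Φ.IsNHomogeneous n ∧
  ∃ (P : ℕ → GrMod (GrAlg.ofGraded 𝒜)) (d : ∀ j, P (j + 1) ⟶ P j)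
    (ε : P 0 ⟶ GrMod.degZero (GrAlg.ofGraded 𝒜)),
    (∀ j, Projective (P j) ∧ (P j).GeneratedIn {(delta n j : ℤ)}) ∧
    ∀ i, Function.Surjective (ε.app i) ∧
      LinearMap.ker (ε.app i) = LinearMap.range ((d 0).app i) ∧
      ∀ j, LinearMap.ker ((d j).app i) = LinearMap.range ((d (j + 1)).app i)

/-- The orthogonal `I_n^⊥ ⊆ KQ_n^op` of `I_n`, for the pairing in which the opposites of the
paths of length `n` form the basis dual to the paths of length `n`. -/
def orthogonal (n : ℕ) : Submodule K (PathSpace V K n) where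
  carrier := { f | ∀ g ∈ Φ.relations n, ∑ p, f p * g p = 0 }
  add_mem' ha hb g hg := by simp [add_mul, Finset.sum_add_distrib, ha g hg, hb g hg]
  zero_mem' g hg := by simp
  smul_mem' c f hf g hg := by simp [mul_assoc, ← Finset.mul_sum, hf g hg]

/-- The `n`-homogeneous dual algebra `Λ^! = KQ^op / ⟨I_n^⊥⟩`. -/
def dualAlg (n : ℕ) : GrAlg K := opQuotient (Φ.orthogonal n)

/-- The algebra `Λ^!_U`, `U = nℤ ∪ (nℤ + 1)`, with `Λ^!_{δ(j)}` in degree `j`. -/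
def dualAlgU (n : ℕ) : GrAlg K := (Φ.dualAlg n).regrade n

/-- The objects of the full subcategory `L_E` of `Gr_E`, where `E` is the Yoneda algebra of `Λ`,
identified with `Λ^!_U` by means of `φ`: all the objects if `n = 2`; if `n > 2`, those `M` which
are generated in even degrees and satisfy
`Ker (M_{2k} ⊗ E_1 → M_{2k+1}) Λ^!_{n-1} ⊆ Ker (M_{2k} ⊗ E_2 → M_{2k+2})` for all `k`.
Here the tensor products are written over `K` instead of `Λ_0`. As they surject onto those over
`Λ_0`, compatibly with the multiplication maps and with the right multiplications by elements
of `Λ^!_{n-1}`, this does not change the condition. -/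
def IsLE (n : ℕ) (φ : (yonedaAlgebra 𝒜).Iso (Φ.dualAlgU n)) :
    ObjectProperty (GrMod (yonedaAlgebra 𝒜)) := fun M =>
  2 < n → M.GeneratedIn {i | Even i} ∧
    ∀ (k : ℤ) (h : delta n 1 + (n - 1) = delta n 2) (b : (Φ.dualAlg n).obj (n - 1)),
      (LinearMap.ker (TensorProduct.lift
          (M.act (show 2 * k + (1 : ℕ) = 2 * k + 1 by simp)))).map
        (TensorProduct.map LinearMap.id
          ((φ.equiv 2).symm.toLinearMap ∘ₗ ((Φ.dualAlg n).mul h).flip b ∘ₗ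
            (φ.equiv 1).toLinearMap))
      ≤ LinearMap.ker (TensorProduct.lift
          (M.act (show 2 * k + (2 : ℕ) = 2 * k + 2 by simp)))

end QuiverOf

end Algebra

/-! ## `n`-complexes, their contractions, and the category `Y(S, U)` -/

section Complexes

variable {K : Type u} [Field K] {A : GrAlg.{u, u} K}

/-- The composition `X^i → X^{i+1} → ⋯ → X^j` of `r` consecutive maps, `j = i + r`. -/
def iter (X : ℤ → GrMod A) (d : ∀ i, X i ⟶ X (i + 1)) :
    ∀ (r : ℕ) (i j : ℤ), i + r = j → (X i ⟶ X j)
  | 0, _, _, h => eqToHom (congrArg X (by simpa using h))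
  | r + 1, i, j, h => d i ≫ iter X d r (i + 1) j (by push_cast at h; omega)

theorem iter_comp (X : ℤ → GrMod A) (d : ∀ i, X i ⟶ X (i + 1)) (r : ℕ) :
    ∀ (s t : ℕ) (i j l : ℤ) (h : i + r = j) (h' : j + s = l) (h'' : i + t = l),
      iter X d r i j h ≫ iter X d s j l h' = iter X d t i l h'' := by
  induction r with
  | zero =>
    intro s t i j l h h' h''
    obtain rfl : i = j := by simpa using h
    obtain rfl : s = t := by omega
    simp [iter]
  | succ r ih =>
    intro s t i j l h h' h''
    obtain ⟨t, rfl⟩ : ∃ t', t = t' + 1 := ⟨t - 1, by push_cast at h; omega⟩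
    simp only [iter, Category.assoc]
    rw [ih]

/-- `n`-complexes of graded `A`-modules: the composition of any `n` consecutive maps is zero. -/
structure NComplex (n : ℕ) (A : GrAlg.{u, u} K) where
  X : ℤ → GrMod A
  d : ∀ i, X i ⟶ X (i + 1)
  iter_eq_zero : ∀ (i j : ℤ) (h : i + n = j), iter X d n i j h = 0

/-- Linear `n`-complexes of almost injective graded modules: the term in position `k` is almost
injective and cogenerated in degree `-k`. -/
def NComplex.IsLinear {n : ℕ} (I : NComplex n A) : Prop :=
  ∀ k, (I.X k).IsAlmostInjective ∧ (I.X k).CogeneratedIn {-k}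

/-- `δ_m(j + 1) - δ_m(j)`. -/
def jump (n : ℕ) (j : ℤ) : ℕ := if j % 2 = 0 then 1 else n - 1

theorem deltaZ_add_jump {n : ℕ} (hn : 2 ≤ n) (m j : ℤ) :
    deltaZ n m j + jump n j = deltaZ n m (j + 1) := by
  unfold deltaZ jump
  split_ifs with h
  · have h1 : (j + 1) / 2 = j / 2 := by omega
    rw [h1]; push_cast; omega
  · have h1 : (j + 1) / 2 = j / 2 + 1 := by omega
    rw [h1, add_mul, Nat.cast_sub (by omega)]; push_cast; omega

theorem jump_add_jump {n : ℕ} (hn : 2 ≤ n) (j : ℤ) : jump n j + jump n (j + 1) = n := by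
  unfold jump
  split_ifs <;> omega

/-- The contraction `H_m(I)` of an `n`-complex `I`: the cochain complex with `I^{δ_m(j)}` in
position `j`, whose differentials are compositions of consecutive maps of `I`. -/
def NComplex.contraction {n : ℕ} (I : NComplex n A) (hn : 2 ≤ n) (m : ℤ) :
    CochainComplex (GrMod A) ℤ :=
  CochainComplex.of (fun j => I.X (deltaZ n m j))
    (fun j => iter I.X I.d (jump n j) _ _ (deltaZ_add_jump hn m j))
    (fun j => by
      have h : deltaZ n m j + n = deltaZ n m (j + 1 + 1) := by
        rw [← deltaZ_add_jump hn m (j + 1), ← deltaZ_add_jump hn m j, add_assoc]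
        congr 1
        exact_mod_cast (jump_add_jump hn j).symm
      rw [iter_comp (t := n) (h'' := h), I.iter_eq_zero])

/-- The complexes isomorphic to `H_m(I)`, for a linear `n`-complex `I` of almost injective
graded modules. -/
def IsHLiftable {n : ℕ} (hn : 2 ≤ n) (m : ℤ) (C : CochainComplex (GrMod A) ℤ) : Prop :=
  ∃ I : NComplex n A, I.IsLinear ∧ Nonempty (C ≅ I.contraction hn m)

variable (A) in
/-- The objects of the full subcategory `Y(S, U)` of the category of cochain complexes of graded
`A`-modules, `U = nℤ ∪ (nℤ + 1)` and `S = m + U`. -/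
def IsY {n : ℕ} (hn : 2 ≤ n) (m : ℤ) : ObjectProperty (CochainComplex (GrMod A) ℤ) := fun C =>
  IsHLiftable hn m C ∧
  (∀ j, (C.X j).IsAlmostInjective ∧ (C.X j).CogeneratedIn {-(deltaZ n m j)}) ∧
  (2 < n → ∀ j i : ℤ,
    (C.X (2 * j + 1)).socle i ≤ LinearMap.range ((C.d (2 * j) (2 * j + 1)).app i))

end Complexes

end NKoszul

end

open NKoszul

/-!
The Yoneda algebra is computed by the Koszul complex, and the equivalence is a Koszul-type
correspondence between linear `n`-complexes of almost injective `Λ`-modules and graded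
`Λ^!`-modules, cut down to the degrees `m + n ℤ` and `m + n ℤ + 1`.

*The Yoneda algebra.* Let `J_k` be the intersection of the spaces `KQ_i I_n KQ_j`, `i + n + j = k`,
inside `KQ_k`; its orthogonal is the component of degree `k` of the ideal defining `Λ^!`. The
Koszul complex has the terms `J_{δ(j)} ⊗ Λ` (`QuiverOf.KG` in the graded and `QuiverOf.KM` in the
ungraded setting), modelled by functions on paths with values in `Λ`. It consists of projective
modules generated in degree `δ(j)`, and is compared step by step with the resolution that exists by
`n`-Koszulness: two projective modules generated in one and the same degree are isomorphic over
their common image as soon as they agree in that degree (`GrMod.exists_iso_of_generatedIn`). The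
agreement of the degree `δ(j)` parts means that certain intersections of spaces of relations are
equal to `J_{δ(j)}`. In the first steps this is automatic, and exactness at `J_n ⊗ Λ` gives the
extra condition on `I_n` (`QuiverOf.extraCondition_of_exact`) that makes it true in all further
steps. So the Koszul complex is exact (`QuiverOf.exact_KG`), and it is minimal, so that
`Ext^j(Λ_0, Λ_0)` is the space of maps from the `j`-th syzygy `Z_j` to `Λ_0`
(`SyzygyTower.extOf_bijective`), which is `Λ^!_{δ(j)}` (`QuiverOf.funcZ_eq_zero_iff`,
`QuiverOf.funcZ_surjective`). A functional on `KQ_{δ(j)}` lifts to the whole Koszul complex: it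
contracts the first `δ(j)` arrows, after the superfluous last arrows have been multiplied into `Λ`
(`QuiverOf.shift`). Hence Yoneda products are products in `Λ^!_U`, which vanish if there are
superfluous arrows, as these have positive degree (`QuiverOf.yonedaIso`).

*The equivalence.* An algebra `A = Λ` and its dual `B = Λ^!` form a `DualPair`. A module is almost
injective and cogenerated in degree `s` if and only if it is coinduced by its component of degree
`s` (`GrMod.IsAlmostInjective.isCofree`, `DualPair.isAlmostInjective`). Therefore a linear
`n`-complex `X` is the same as a graded `B`-module `W` with `W_k = (X^k)_{-k}`, the differential
being `z ↦ ∑ (z x_α) y_α` over the arrows `α` (`DualPair.Link`, `DualPair.exists_link`,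
`DualPair.exists_link_of_isLinear`). The compositions of `c` differentials are given by the
canonical element `∑ x_q ⊗ y_q` of `A_c ⊗ B_c`, which is zero for `c = n`. Under this correspondence the contraction of `X` corresponds to the
restriction of `W` to the degrees `δ_m(j)`, a graded `E`-module (`restr`), and the socle condition
says that `W_{m+kn+1} = W_{m+kn} B_1` (`DualPair.Link.oddGen_iff`). A map between contractions and a
map between restrictions determine each other (`DualPair.Link.Compat`), so the category of linked
pairs has fully faithful functors to both sides (`LinkedPair`, `nonempty_equivalence`).

It remains to identify the restrictions of the modules `W` with `W_{m+kn+1} = W_{m+kn} B_1`. They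
satisfy the conditions that define `L_E` (`evenGenKer_restr`). Conversely, an object `M` of `L_E` is
the restriction of a submodule of a coinduced `B`-module, generated by the maps `z ↦ x z` for
elements `x` of `M` of even degree, or of any degree if `n = 2` (`dualSub`, `exists_restr_iso`); the
kernel condition is what makes the evaluation at the unit injective in odd degrees.

*Modules presented in even degrees.* The evaluation `dualEval` maps a restricted module onto any
module generated in even degrees. If the latter is projective, it is a direct summand of that
restricted module and inherits the kernel condition (`evenGenKer_of_projective`); a diagram chase
extends this to cokernels (`evenGenKer_of_presentedIn`).
-/


set_option autoImplicit false
set_option linter.unusedSectionVars false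

noncomputable section

namespace NKoszul

section

/-! ### Graded submodules, factors and coproducts -/

namespace GrMod

variable {K : Type u} [Field K] {A : GrAlg.{u, u} K}

theorem comp_app_apply {M N L : GrMod A} (f : M ⟶ N) (g : N ⟶ L) (i : ℤ) (x : M.obj i) :
    (f ≫ g).app i x = g.app i (f.app i x) := rfl

/-- A graded submodule of `M`, given by its homogeneous components. -/
structure Submod (M : GrMod A) where
  carrier : ∀ i, Submodule K (M.obj i)
  act_mem : ∀ {i : ℤ} {j : ℕ} {l : ℤ} (h : i + j = l) {x : M.obj i}, x ∈ carrier i →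
    ∀ a : A.obj j, M.act h x a ∈ carrier l

namespace Submod

variable {M : GrMod A} (X : Submod M)

/-- A graded submodule, as a graded module. -/
def toMod : GrMod A where
  obj i := X.carrier i
  act h := LinearMap.mk₂ K (fun x a => ⟨M.act h x.1 a, X.act_mem h x.2 a⟩)
    (fun _ _ _ => by ext; simp) (fun _ _ _ => by ext; simp)
    (fun _ _ _ => by ext; simp) (fun _ _ _ => by ext; simp)
  act_one x := Subtype.ext (M.act_one x.1)
  act_act hij h hjk h' x a b := Subtype.ext (M.act_act hij h hjk h' x.1 a b)

/-- The inclusion of a graded submodule. -/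
def incl : X.toMod ⟶ M where
  app i := (X.carrier i).subtype
  comm _ _ _ := rfl

/-- The factor of a graded module by a graded submodule. -/
def quot : GrMod A where
  obj i := M.obj i ⧸ X.carrier i
  act {i j l} h := (X.carrier i).liftQ ((M.act h).compr₂ (X.carrier l).mkQ) (fun _ hx =>
    LinearMap.ext fun a => (Submodule.Quotient.mk_eq_zero _).2 (X.act_mem h hx a))
  act_one x := by
    obtain ⟨x, rfl⟩ := Submodule.mkQ_surjective _ x
    exact congrArg _ (M.act_one x)
  act_act hij h hjk h' x a b := by
    obtain ⟨x, rfl⟩ := Submodule.mkQ_surjective _ x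
    exact congrArg _ (M.act_act hij h hjk h' x a b)

/-- The projection onto a factor module. -/
def proj : M ⟶ X.quot where
  app i := (X.carrier i).mkQ
  comm _ _ _ := rfl

end Submod

/-- The image of a morphism of graded modules. -/
def range {M N : GrMod A} (f : M ⟶ N) : Submod N where
  carrier i := LinearMap.range (f.app i)
  act_mem := by
    rintro i j l h _ ⟨x, rfl⟩ a
    exact ⟨M.act h x a, f.comm h x a⟩

/-- The kernel of a morphism of graded modules. -/
def ker {M N : GrMod A} (f : M ⟶ N) : Submod M where
  carrier i := LinearMap.ker (f.app i)
  act_mem := by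
    intro i j l h x hx a
    rw [LinearMap.mem_ker] at hx ⊢
    rw [f.comm, hx, map_zero, LinearMap.zero_apply]

theorem GeneratedIn.eq_top {S : Set ℤ} {M : GrMod A} (hM : GeneratedIn S M) (X : Submod M)
    (hX : ∀ i ∈ S, X.carrier i = ⊤) (i : ℤ) : X.carrier i = ⊤ := by
  by_contra hi
  obtain ⟨s, hs, hs'⟩ := hM X.quot X.proj (fun i => Submodule.mkQ_surjective _)
    ⟨i, Submodule.Quotient.nontrivial_iff.2 hi⟩
  exact Submodule.Quotient.nontrivial_iff.1 hs' (hX s hs)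

theorem CogeneratedIn.eq_bot {S : Set ℤ} {M : GrMod A} (hM : CogeneratedIn S M) (X : Submod M)
    (hX : ∀ i ∈ S, X.carrier i = ⊥) (i : ℤ) : X.carrier i = ⊥ := by
  by_contra hi
  obtain ⟨s, hs, hs'⟩ := hM X.toMod X.incl (fun i => Subtype.val_injective)
    ⟨i, (Submodule.nontrivial_iff_ne_bot (p := X.carrier i)).2 hi⟩
  exact (Submodule.nontrivial_iff_ne_bot (p := X.carrier s)).1 hs' (hX s hs)

theorem GeneratedIn.of_surjective {S : Set ℤ} {M N : GrMod A} (hM : GeneratedIn S M) (f : M ⟶ N)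
    (hf : ∀ i, Function.Surjective (f.app i)) : GeneratedIn S N := fun L g hg h =>
  hM L (f ≫ g) (fun i => (hg i).comp (hf i)) h

theorem surjective_of_epi {M N : GrMod A} (f : M ⟶ N) [Epi f] (i : ℤ) :
    Function.Surjective (f.app i) := by
  have h : f ≫ (range f).proj = f ≫ 0 := hom_ext fun i => LinearMap.ext fun x =>
    (Submodule.Quotient.mk_eq_zero _).2 ⟨x, rfl⟩
  have h1 := (cancel_epi f).1 h
  intro y
  have h2 : (range f).proj.app i y = 0 := by rw [h1]; rfl
  exact (Submodule.Quotient.mk_eq_zero _).1 h2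

theorem epi_of_surjective {M N : GrMod A} (f : M ⟶ N)
    (hf : ∀ i, Function.Surjective (f.app i)) : Epi f :=
  ⟨fun g h hgh => hom_ext fun i => LinearMap.ext fun y => by
    obtain ⟨x, rfl⟩ := hf i y
    exact LinearMap.congr_fun (congrArg (fun k => Hom.app k i) hgh) x⟩

/-- A morphism of graded modules that is bijective in each degree is an isomorphism. -/
def isoOfBijective {M N : GrMod A} (f : M ⟶ N) (hf : ∀ i, Function.Bijective (f.app i)) :
    M ≅ N where
  hom := f
  inv :=
    { app := fun i => (LinearEquiv.ofBijective (f.app i) (hf i)).symm.toLinearMap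
      comm := fun {i j l} h y a => by
        obtain ⟨x, rfl⟩ := (hf i).2 y
        apply (hf l).1
        have e1 : ∀ i (x : M.obj i),
            (LinearEquiv.ofBijective (f.app i) (hf i)).symm (f.app i x) = x := fun i x =>
          (LinearEquiv.ofBijective (f.app i) (hf i)).symm_apply_apply x
        simp only [LinearEquiv.coe_coe]
        rw [← f.comm, e1, e1] }
  hom_inv_id := hom_ext fun i => LinearMap.ext fun x =>
    (LinearEquiv.ofBijective (f.app i) (hf i)).symm_apply_apply x
  inv_hom_id := hom_ext fun i => LinearMap.ext fun x =>
    (LinearEquiv.ofBijective (f.app i) (hf i)).apply_symm_apply x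

theorem bijective_of_iso {M N : GrMod A} (e : M ≅ N) (i : ℤ) :
    Function.Bijective (e.hom.app i) := by
  have h1 : ∀ x, e.inv.app i (e.hom.app i x) = x := fun x => by
    rw [← comp_app_apply, e.hom_inv_id]; rfl
  have h2 : ∀ x, e.hom.app i (e.inv.app i x) = x := fun x => by
    rw [← comp_app_apply, e.inv_hom_id]; rfl
  exact ⟨Function.LeftInverse.injective h1, Function.RightInverse.surjective h2⟩

section Coproduct

open scoped Classical

variable {ι : Type u} (N : ι → GrMod A)

/-- The coproduct of a family of graded modules. -/
def dsum : GrMod A where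
  obj i := Π₀ x, (N x).obj i
  act {i j l} h := LinearMap.mk₂ K
    (fun t a => DFinsupp.mapRange (fun x y => (N x).act h y a) (fun x => by simp) t)
    (fun _ _ _ => by ext; simp) (fun _ _ _ => by ext; simp)
    (fun _ _ _ => by ext; simp) (fun _ _ _ => by ext; simp)
  act_one {i} t := DFinsupp.ext fun x => (N x).act_one (t x)
  act_act hij h hjk h' t a b := DFinsupp.ext fun x => (N x).act_act hij h hjk h' (t x) a b

/-- The projection of a coproduct onto a term. -/
def dsumProj (x : ι) : dsum N ⟶ N x where
  app i := DFinsupp.lapply (R := K) (M := fun x => (N x).obj i) x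
  comm _ _ _ := rfl

theorem dsum_ext {i : ℤ} {s t : (dsum N).obj i}
    (h : ∀ x, (dsumProj N x).app i s = (dsumProj N x).app i t) : s = t :=
  DFinsupp.ext h

/-- The inclusion of a term into a coproduct. -/
def dsumIncl (x : ι) : N x ⟶ dsum N where
  app i := DFinsupp.lsingle (R := K) (M := fun x => (N x).obj i) x
  comm {i j l} h t a := by
    refine DFinsupp.ext fun y => ?_
    change DFinsupp.single (β := fun x => (N x).obj l) x ((N x).act h t a) y =
      (N y).act h (DFinsupp.single (β := fun x => (N x).obj i) x t y) a
    by_cases hxy : y = x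
    · subst hxy
      rw [DFinsupp.single_eq_same, DFinsupp.single_eq_same]
    · rw [DFinsupp.single_eq_of_ne hxy, DFinsupp.single_eq_of_ne hxy, map_zero,
        LinearMap.zero_apply]

theorem dsumProj_incl_self {i : ℤ} (x : ι) (t : (N x).obj i) :
    (dsumProj N x).app i ((dsumIncl N x).app i t) = t :=
  DFinsupp.single_eq_same (β := fun x => (N x).obj i)

theorem dsumProj_incl_ne {i : ℤ} {x y : ι} (h : y ≠ x) (t : (N x).obj i) :
    (dsumProj N y).app i ((dsumIncl N x).app i t) = 0 :=
  DFinsupp.single_eq_of_ne (β := fun x => (N x).obj i) h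

theorem dsum_induction {i : ℤ} {p : (dsum N).obj i → Prop} (t : (dsum N).obj i) (h0 : p 0)
    (h1 : ∀ x t, p ((dsumIncl N x).app i t)) (h2 : ∀ s t, p s → p t → p (s + t)) : p t :=
  DFinsupp.induction (p := p) t h0 fun x b _ _ _ hf => h2 _ _ (h1 x b) hf

variable {N} in
/-- A linear map out of a component of a coproduct. -/
def dsumLift {i : ℤ} {W : Type u} [AddCommGroup W] [Module K W]
    (g : ∀ x, (N x).obj i →ₗ[K] W) : (dsum N).obj i →ₗ[K] W :=
  DFinsupp.lsum K (M := fun x => (N x).obj i) g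

theorem dsumLift_incl {i : ℤ} {W : Type u} [AddCommGroup W] [Module K W]
    (g : ∀ x, (N x).obj i →ₗ[K] W) (x : ι) (t : (N x).obj i) :
    dsumLift g ((dsumIncl N x).app i t) = g x t :=
  DFinsupp.lsum_single K (M := fun x => (N x).obj i) g x t

variable {N} in
/-- The morphism out of a coproduct given by morphisms out of the terms. -/
def dsumDesc {M : GrMod A} (f : ∀ x, N x ⟶ M) : dsum N ⟶ M where
  app i := dsumLift fun x => (f x).app i
  comm {i j l} h t a := by
    induction t using dsum_induction with
    | h0 => simp only [map_zero, LinearMap.zero_apply]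
    | h1 x t => rw [← (dsumIncl N x).comm, dsumLift_incl, dsumLift_incl, (f x).comm]
    | h2 s t hs ht => simp only [map_add, LinearMap.add_apply] at hs ht ⊢; rw [hs, ht]

theorem dsumIncl_desc {M : GrMod A} (f : ∀ x, N x ⟶ M) (x : ι) :
    dsumIncl N x ≫ dsumDesc f = f x :=
  hom_ext fun i => LinearMap.ext fun t => dsumLift_incl N (fun x => (f x).app i) x t

/-- The direct sum is a coproduct in the category of graded modules. -/
def dsumIsColimit : Limits.IsColimit (Limits.Cofan.mk (dsum N) (dsumIncl N)) :=
  Limits.Cofan.IsColimit.mk _ (fun s => dsumDesc s.inj) (fun s x => dsumIncl_desc N s.inj x)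
    (fun s m hm => hom_ext fun i => LinearMap.ext fun t => by
      induction t using dsum_induction with
      | h0 => rw [map_zero, map_zero]
      | h1 x t =>
        change (dsumIncl N x ≫ m).app i t = (dsumIncl N x ≫ dsumDesc s.inj).app i t
        rw [dsumIncl_desc]
        exact LinearMap.congr_fun (congrArg (fun k => Hom.app k i) (hm x)) t
      | h2 s t hs ht => rw [map_add, map_add, hs, ht])

end Coproduct

end GrMod

end

section

/-! ### Concatenation of paths and slices of functions on paths -/

section Slices

variable {V : Type v} [Quiver.{w + 1} V]

namespace QPath

/-- The first vertex of a path. -/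
def src {k : ℕ} (p : QPath V k) : V := p.vertex 0

/-- The last vertex of a path. -/
def tgt {k : ℕ} (p : QPath V k) : V := p.vertex (Fin.last k)

theorem take_drop_ext {i j k : ℕ} (h : i + j = k) {r r' : QPath V k}
    (h1 : r.take h = r'.take h) (h2 : r.drop h = r'.drop h) : r = r' := by
  subst h
  refine QPath.ext (funext fun s => ?_) (funext fun s => ?_)
  · by_cases hs : (s : ℕ) < i + 1
    · exact congrFun (congrArg QPath.vertex h1) ⟨s, hs⟩
    · have := congrFun (congrArg QPath.vertex h2) ⟨s - i, by omega⟩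
      simp only [QPath.drop] at this
      convert this using 2 <;> exact Fin.ext (by simp; omega)
  · by_cases hs : (s : ℕ) < i
    · exact congrFun (congrArg QPath.arrow h1) ⟨s, hs⟩
    · have := congrFun (congrArg QPath.arrow h2) ⟨s - i, by omega⟩
      simp only [QPath.drop] at this
      convert this using 2 <;> exact Fin.ext (by simp; omega)

/-- The concatenation of two composable paths. -/
def join {i j k : ℕ} (h : i + j = k) (p : QPath V i) (q : QPath V j) (hpq : p.tgt = q.src) :
    QPath V k where
  vertex s := if hs : (s : ℕ) < i + 1 then p.vertex ⟨s, hs⟩ else q.vertex ⟨s - i, by omega⟩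
  arrow s := if hs : (s : ℕ) < i then p.arrow ⟨s, hs⟩ else q.arrow ⟨s - i, by omega⟩
  left_eq s := by
    simp only [Fin.val_castSucc]
    by_cases hs : (s : ℕ) < i
    · rw [dif_pos hs, dif_pos (by omega)]
      exact p.left_eq ⟨s, hs⟩
    · rw [dif_neg hs]
      by_cases hs' : (s : ℕ) < i + 1
      · rw [dif_pos hs', q.left_eq]
        have hsi : (s : ℕ) = i := by omega
        have e1 : (⟨s, hs'⟩ : Fin (i + 1)) = Fin.last i := Fin.ext hsi
        have e2 : (⟨s - i, by omega⟩ : Fin j).castSucc = ⟨0, by omega⟩ :=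
          Fin.ext (Nat.sub_eq_zero_of_le (by omega))
        rw [e1, e2]
        exact hpq.symm
      · rw [dif_neg hs', q.left_eq]
        rfl
  right_eq s := by
    simp only [Fin.val_succ]
    by_cases hs : (s : ℕ) < i
    · rw [dif_pos hs, dif_pos (by omega)]
      exact p.right_eq ⟨s, hs⟩
    · rw [dif_neg hs, dif_neg (by omega), q.right_eq]
      congr 1
      exact Fin.ext (by simp; omega)

theorem take_join {i j k : ℕ} (h : i + j = k) (p : QPath V i) (q : QPath V j)
    (hpq : p.tgt = q.src) : (join h p q hpq).take h = p := by
  refine QPath.ext (funext fun s => ?_) (funext fun s => ?_)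
  · exact dif_pos s.2
  · exact dif_pos s.2

theorem drop_join {i j k : ℕ} (h : i + j = k) (p : QPath V i) (q : QPath V j)
    (hpq : p.tgt = q.src) : (join h p q hpq).drop h = q := by
  refine QPath.ext (funext fun s => ?_) (funext fun s => ?_)
  · simp only [QPath.drop, QPath.join]
    split_ifs with hs
    · have hs0 : (s : ℕ) = 0 := by omega
      have e1 : (⟨i + s, hs⟩ : Fin (i + 1)) = Fin.last i := Fin.ext (show i + (s : ℕ) = i by omega)
      have e2 : s = 0 := Fin.ext hs0
      rw [e1, e2]
      exact hpq
    · congr 1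
      exact Fin.ext (by simp)
  · simp only [QPath.drop, QPath.join]
    rw [dif_neg (by omega)]
    congr 1
    exact Fin.ext (by simp)

theorem tgt_take {i j k : ℕ} (h : i + j = k) (r : QPath V k) :
    (r.take h).tgt = (r.drop h).src := rfl

theorem src_take {i j k : ℕ} (h : i + j = k) (r : QPath V k) : (r.take h).src = r.src := rfl

theorem tgt_drop {i j k : ℕ} (h : i + j = k) (r : QPath V k) : (r.drop h).tgt = r.tgt := by
  subst h; rfl

theorem join_take_drop {i j k : ℕ} (h : i + j = k) (r : QPath V k) :
    join h (r.take h) (r.drop h) (tgt_take h r) = r :=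
  take_drop_ext h (take_join h _ _ _) (drop_join h _ _ _)

theorem src_join {i j k : ℕ} (h : i + j = k) (p : QPath V i) (q : QPath V j)
    (hpq : p.tgt = q.src) : (join h p q hpq).src = p.src := by
  rw [← src_take h, take_join]

theorem tgt_join {i j k : ℕ} (h : i + j = k) (p : QPath V i) (q : QPath V j)
    (hpq : p.tgt = q.src) : (join h p q hpq).tgt = q.tgt := by
  rw [← tgt_drop h, drop_join]

theorem join_assoc {i j k ij jk l : ℕ} (hij : i + j = ij) (hjk : j + k = jk) (h : ij + k = l)
    (h' : i + jk = l) (p : QPath V i) (q : QPath V j) (r : QPath V k) (hpq : p.tgt = q.src)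
    (hqr : q.tgt = r.src) :
    join h (join hij p q hpq) r ((tgt_join _ _ _ _).trans hqr) =
      join h' p (join hjk q r hqr) (hpq.trans (src_join _ _ _ _).symm) := by
  have e1 : ∀ t : QPath V l, (t.take h).take hij = t.take h' := fun t => rfl
  have e2 : ∀ t : QPath V l, (t.take h).drop hij = (t.drop h').take hjk := fun t => rfl
  have e3 : ∀ t : QPath V l, t.drop h = (t.drop h').drop hjk := fun t => by
    subst hij
    refine QPath.ext (funext fun s => ?_) (funext fun s => ?_)
    · exact congrArg t.vertex (Fin.ext (Nat.add_assoc i j s))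
    · exact congrArg t.arrow (Fin.ext (Nat.add_assoc i j s))
  apply take_drop_ext h
  · apply take_drop_ext hij
    · rw [take_join, take_join, e1, take_join]
    · rw [take_join, drop_join, e2, drop_join, take_join]
  · rw [drop_join, e3, drop_join, drop_join]

end QPath

section Fns

variable {M : Type*} [Zero M]

open Classical in
/-- The value of a function on paths at the concatenation of `p` and `q`, and zero if they cannot
be concatenated. -/
def atJoin {i j k : ℕ} (h : i + j = k) (y : QPath V k → M) (p : QPath V i) (q : QPath V j) : M :=
  if hpq : p.tgt = q.src then y (p.join h q hpq) else 0

theorem atJoin_of_ne {i j k : ℕ} (h : i + j = k) (y : QPath V k → M) {p : QPath V i}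
    {q : QPath V j} (hpq : p.tgt ≠ q.src) : atJoin h y p q = 0 := dif_neg hpq

theorem atJoin_take_drop {i j k : ℕ} (h : i + j = k) (y : QPath V k → M) (r : QPath V k) :
    atJoin h y (r.take h) (r.drop h) = y r := by
  rw [atJoin, dif_pos (QPath.tgt_take h r), QPath.join_take_drop]

theorem atJoin_ext {i j k : ℕ} (h : i + j = k) {y z : QPath V k → M}
    (hyz : ∀ p q, atJoin h y p q = atJoin h z p q) : y = z := by
  funext r
  rw [← atJoin_take_drop h y, ← atJoin_take_drop h z, hyz]

theorem atJoin_join {i j k : ℕ} (h : i + j = k) (y : QPath V k → M) (p : QPath V i)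
    (q : QPath V j) (hpq : p.tgt = q.src) : atJoin h y p q = y (p.join h q hpq) := dif_pos hpq

theorem atJoin_assoc {i j k ij jk l : ℕ} (hij : i + j = ij) (hjk : j + k = jk) (h : ij + k = l)
    (h' : i + jk = l) (y : QPath V l → M) (p : QPath V i) (q : QPath V j) (r : QPath V k) :
    atJoin hij (fun s => atJoin h y s r) p q = atJoin hjk (fun s => atJoin h' y p s) q r := by
  by_cases hpq : p.tgt = q.src
  · rw [atJoin_join hij _ p q hpq]
    by_cases hqr : q.tgt = r.src
    · rw [atJoin_join hjk _ q r hqr, atJoin_join h _ _ _ ((QPath.tgt_join _ _ _ _).trans hqr),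
        atJoin_join h' _ _ _ (hpq.trans (QPath.src_join _ _ _ _).symm),
        QPath.join_assoc hij hjk h h']
    · rw [atJoin_of_ne hjk _ hqr, atJoin_of_ne h _ (by rwa [QPath.tgt_join])]
  · rw [atJoin_of_ne hij _ hpq]
    by_cases hqr : q.tgt = r.src
    · rw [atJoin_join hjk _ q r hqr, atJoin_of_ne h' _ (by rwa [QPath.src_join])]
    · rw [atJoin_of_ne hjk _ hqr]

end Fns

variable {K : Type u} [Field K]

theorem atJoin_map {M N : Type*} [Zero M] [Zero N] (φ : M → N) (hφ : φ 0 = 0) {i j k : ℕ}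
    (h : i + j = k) (y : QPath V k → M) (p : QPath V i) (q : QPath V j) :
    atJoin h (fun r => φ (y r)) p q = φ (atJoin h y p q) := by
  by_cases hpq : p.tgt = q.src
  · rw [atJoin_join h _ p q hpq, atJoin_join h _ p q hpq]
  · rw [atJoin_of_ne h _ hpq, atJoin_of_ne h _ hpq, hφ]

theorem atJoin_add {M : Type*} [AddZeroClass M] {i j k : ℕ} (h : i + j = k) (y z : QPath V k → M)
    (p : QPath V i) (q : QPath V j) :
    atJoin h (y + z) p q = atJoin h y p q + atJoin h z p q := by
  by_cases hpq : p.tgt = q.src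
  · simp only [atJoin_join h _ p q hpq, Pi.add_apply]
  · simp only [atJoin_of_ne h _ hpq, add_zero]

theorem atJoin_smul {S M : Type*} [Zero M] [SMulZeroClass S M] {i j k : ℕ} (h : i + j = k) (c : S)
    (y : QPath V k → M) (p : QPath V i) (q : QPath V j) :
    atJoin h (c • y) p q = c • atJoin h y p q :=
  atJoin_map (c • ·) (smul_zero c) h y p q

/-- The left slice `y ↦ (q ↦ y (p q))`. -/
def lslice {i j k : ℕ} (h : i + j = k) (p : QPath V i) :
    PathSpace V K k →ₗ[K] PathSpace V K j where
  toFun y q := atJoin h y p q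
  map_add' y z := funext fun q => atJoin_add h y z p q
  map_smul' c y := funext fun q => atJoin_smul h c y p q

/-- The right slice `y ↦ (p ↦ y (p q))`. -/
def rslice {i j k : ℕ} (h : i + j = k) (q : QPath V j) :
    PathSpace V K k →ₗ[K] PathSpace V K i where
  toFun y p := atJoin h y p q
  map_add' y z := funext fun p => atJoin_add h y z p q
  map_smul' c y := funext fun p => atJoin_smul h c y p q

theorem lslice_ext {i j k : ℕ} (h : i + j = k) {y z : PathSpace V K k}
    (H : ∀ p, lslice h p y = lslice h p z) : y = z :=
  atJoin_ext h fun p q => congrFun (H p) q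

theorem rslice_lslice {i j k ij jk l : ℕ} (hij : i + j = ij) (hjk : j + k = jk) (h : ij + k = l)
    (h' : i + jk = l) (p : QPath V i) (r : QPath V k) (y : PathSpace V K l) :
    lslice hij p (rslice h r y) = rslice hjk r (lslice h' p y) :=
  funext fun q => atJoin_assoc hij hjk h h' y p q r

/-- Slicing twice on the left is slicing along the concatenation. -/
theorem lslice_lslice {i j k ij jk l : ℕ} (hij : i + j = ij) (hjk : j + k = jk) (h : ij + k = l)
    (h' : i + jk = l) (s : QPath V ij) (y : PathSpace V K l) :
    lslice hjk (s.drop hij) (lslice h' (s.take hij) y) = lslice h s y :=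
  funext fun r => by
    refine (atJoin_assoc hij hjk h h' y (s.take hij) (s.drop hij) r).symm.trans ?_
    exact atJoin_take_drop hij (fun s => atJoin h y s r) s

theorem rslice_rslice {i j k ij jk l : ℕ} (hij : i + j = ij) (hjk : j + k = jk) (h : ij + k = l)
    (h' : i + jk = l) (s : QPath V jk) (y : PathSpace V K l) :
    rslice hij (s.take hjk) (rslice h (s.drop hjk) y) = rslice h' s y :=
  funext fun p => by
    refine (atJoin_assoc hij hjk h h' y p (s.take hjk) (s.drop hjk)).trans ?_
    exact atJoin_take_drop hjk (fun s => atJoin h' y p s) s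

/-- A double slice vanishes unless the two paths can be concatenated. -/
theorem lslice_lslice' {i j k ij jk l : ℕ} (hij : i + j = ij) (hjk : j + k = jk) (h : ij + k = l)
    (h' : i + jk = l) (p : QPath V i) (q : QPath V j) (y : PathSpace V K l) :
    lslice hjk q (lslice h' p y) = 0 ∨ ∃ s : QPath V ij, s.take hij = p ∧ s.drop hij = q := by
  by_cases hpq : p.tgt = q.src
  · exact Or.inr ⟨p.join hij q hpq, QPath.take_join _ _ _ _, QPath.drop_join _ _ _ _⟩
  · refine Or.inl (funext fun r => ?_)
    refine (atJoin_assoc hij hjk h h' y p q r).symm.trans ?_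
    exact atJoin_of_ne hij _ hpq

variable [Finite V] [∀ a b : V, Finite (a ⟶ b)]

/-- A sum over paths is a sum over pairs of composable paths. -/
theorem sum_take_drop {M : Type*} [AddCommMonoid M] {i j k : ℕ} (h : i + j = k)
    (F : QPath V i → QPath V j → M) (hF : ∀ p q, p.tgt ≠ q.src → F p q = 0) :
    ∑ r : QPath V k, F (r.take h) (r.drop h) = ∑ p, ∑ q, F p q := by
  rw [← Fintype.sum_prod_type']
  refine Fintype.sum_of_injective (fun r : QPath V k => (r.take h, r.drop h)) ?_ _ _ ?_ ?_
  · intro r r' hr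
    exact QPath.take_drop_ext h (congrArg Prod.fst hr) (congrArg Prod.snd hr)
  · rintro ⟨p, q⟩ hpq
    apply hF
    intro h1
    exact hpq ⟨p.join h q h1, Prod.ext (QPath.take_join _ _ _ _) (QPath.drop_join _ _ _ _)⟩
  · intro r; rfl

/-- A sum over paths of length `k = i + j`, written with the help of `atJoin` as a sum over all
pairs of paths of lengths `i` and `j`. -/
theorem sum_atJoin {R M : Type*} [Zero R] [AddCommMonoid M] {i j k : ℕ} (h : i + j = k)
    (y : QPath V k → R) (F : R → QPath V i → QPath V j → M) (hF : ∀ p q, F 0 p q = 0) :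
    ∑ r : QPath V k, F (y r) (r.take h) (r.drop h) = ∑ p, ∑ q, F (atJoin h y p q) p q := by
  rw [← sum_take_drop h]
  · exact Finset.sum_congr rfl fun r _ => by rw [atJoin_take_drop]
  · intro p q hpq
    rw [atJoin_of_ne h y hpq, hF]

open Classical in
/-- The function on paths that is `1` at `p` and zero elsewhere. -/
abbrev pathδ {k : ℕ} (p : QPath V k) : PathSpace V K k := Pi.single p 1

theorem sum_smul_pathδ {k : ℕ} (f : PathSpace V K k) : ∑ p, f p • pathδ (K := K) p = f := by
  classical
  funext q
  rw [Finset.sum_apply, Finset.sum_eq_single q]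
  · simp
  · intro p _ hp
    simp [Ne.symm hp]
  · simp

/-- A function on paths that is orthogonal to the orthogonal of `X` belongs to `X`. -/
theorem mem_of_orthogonal {k : ℕ} (X : Submodule K (PathSpace V K k)) (f : PathSpace V K k)
    (H : ∀ g : PathSpace V K k, (∀ x ∈ X, ∑ p, g p * x p = 0) → ∑ p, g p * f p = 0) : f ∈ X := by
  classical
  by_contra hf
  obtain ⟨φ, hφ, hφX⟩ := Submodule.exists_le_ker_of_notMem hf
  have key : ∀ x, φ x = ∑ p, φ (pathδ p) * x p := fun x => by
    conv_lhs => rw [← sum_smul_pathδ x]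
    rw [map_sum]
    exact Finset.sum_congr rfl fun p _ => by rw [map_smul, smul_eq_mul, mul_comm]
  refine hφ ?_
  rw [key]
  refine H _ fun x hx => ?_
  rw [← key]
  exact hφX hx

end Slices

end

section

/-! ### The structural homomorphism from the path algebra -/

namespace QuiverOf

variable {K : Type u} [Field K] {Λ : Type u} [Ring Λ] [Algebra K Λ]
  {𝒜 : ℕ → Submodule K Λ} [GradedAlgebra 𝒜] {V : Type v} [Quiver.{w + 1} V]
  (Φ : QuiverOf 𝒜 V)

/-- The path of length `0` at a vertex. -/
def _root_.NKoszul.QPath.nil (a : V) : QPath V 0 where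
  vertex := fun _ => a
  arrow s := s.elim0
  left_eq s := s.elim0
  right_eq s := s.elim0

/-- The path of length `1` formed by an arrow. -/
def _root_.NKoszul.QPath.single (α : Quiver.Total V) : QPath V 1 where
  vertex := ![α.left, α.right]
  arrow _ := α
  left_eq s := by
    obtain rfl : s = 0 := Subsingleton.elim _ _
    rfl
  right_eq s := by
    obtain rfl : s = 0 := Subsingleton.elim _ _
    rfl

theorem _root_.NKoszul.QPath.eq_nil (p : QPath V 0) : p = QPath.nil p.src := by
  refine QPath.ext (funext fun s => ?_) (funext fun s => s.elim0)
  exact congrArg p.vertex (Fin.ext (by omega))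

theorem _root_.NKoszul.QPath.eq_single (p : QPath V 1) : p = QPath.single (p.arrow 0) := by
  refine QPath.ext (funext fun s => ?_) (funext fun s => ?_)
  · fin_cases s
    · exact (p.left_eq 0).symm
    · exact (p.right_eq 0).symm
  · obtain rfl : s = 0 := Subsingleton.elim _ _
    rfl

/-- Paths of length `0` are vertices. -/
def _root_.NKoszul.QPath.zeroEquiv : QPath V 0 ≃ V where
  toFun p := p.src
  invFun := QPath.nil
  left_inv p := (QPath.eq_nil p).symm
  right_inv _ := rfl

theorem pathProd_nil [Finite V] (a : V) : Φ.pathProd (QPath.nil a) = Φ.e a := by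
  simp [pathProd, QPath.nil]

theorem pathProd_single [Finite V] (α : Quiver.Total V) :
    Φ.pathProd (QPath.single α) = Φ.x α := by
  simp only [pathProd, List.ofFn_succ, List.ofFn_zero, List.prod_cons, List.prod_nil, mul_one]
  exact Φ.left_mul α

variable [Finite V]

theorem sum_e [Fintype V] : ∑ a, (Φ.e a : Λ) = 1 := by
  classical
  obtain ⟨c, hc⟩ : ∃ c : V → K, ∑ a, c a • (Φ.e a : Λ) = 1 := by
    refine ⟨Φ.e.repr ⟨1, SetLike.one_mem_graded 𝒜⟩, ?_⟩
    have := congrArg Subtype.val (Φ.e.sum_repr ⟨1, SetLike.one_mem_graded 𝒜⟩)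
    rw [Submodule.coe_sum] at this
    exact this
  have key : ∀ a, c a = 1 := by
    intro a
    have h1 : (∑ b, c b • (Φ.e b : Λ)) * Φ.e a = c a • (Φ.e a : Λ) := by
      rw [Finset.sum_mul, Finset.sum_eq_single a]
      · rw [smul_mul_assoc, Φ.idem]
      · intro b _ hb
        rw [smul_mul_assoc, Φ.orth b a hb, smul_zero]
      · simp
    rw [hc, one_mul] at h1
    have h2 : Φ.e a = c a • Φ.e a := Subtype.ext h1
    have h3 := congrArg (fun z => Φ.e.repr z a) h2
    simpa using h3.symm
  rw [← hc]
  exact Finset.sum_congr rfl fun a _ => by rw [key, one_smul]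

theorem e_mul_pathProd {k : ℕ} (p : QPath V k) : (Φ.e p.src : Λ) * Φ.pathProd p = Φ.pathProd p := by
  rw [pathProd, ← mul_assoc]
  congr 1
  exact Φ.idem _

theorem e_mul_pathProd_of_ne {k : ℕ} (p : QPath V k) {a : V} (h : a ≠ p.src) :
    (Φ.e a : Λ) * Φ.pathProd p = 0 := by
  rw [← e_mul_pathProd, ← mul_assoc, Φ.orth a _ h, zero_mul]

theorem pathProd_take_mul {i j k : ℕ} (h : i + j = k) (r : QPath V k) :
    Φ.pathProd (r.take h) * (List.ofFn fun s => (Φ.x ((r.drop h).arrow s) : Λ)).prod =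
      Φ.pathProd r := by
  subst h
  rw [pathProd, pathProd, List.ofFn_add, List.prod_append, mul_assoc]
  rfl

theorem pathProd_mul_e {k : ℕ} (p : QPath V k) : Φ.pathProd p * (Φ.e p.tgt : Λ) = Φ.pathProd p := by
  cases k with
  | zero =>
    rw [QPath.eq_nil p, pathProd_nil]
    exact Φ.idem _
  | succ k =>
    rw [← Φ.pathProd_take_mul (i := k) (j := 1) rfl, mul_assoc]
    congr 1
    simp only [List.ofFn_succ, List.ofFn_zero, List.prod_cons, List.prod_nil, mul_one]
    have : p.tgt = ((p.drop (i := k) (j := 1) rfl).arrow 0).right :=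
      (p.right_eq (Fin.last k)).symm
    rw [this]
    exact Φ.mul_right _

theorem pathProd_mul_e_of_ne {k : ℕ} (p : QPath V k) {a : V} (h : p.tgt ≠ a) :
    Φ.pathProd p * (Φ.e a : Λ) = 0 := by
  rw [← pathProd_mul_e, mul_assoc, Φ.orth _ a h, mul_zero]

theorem pathProd_mul {i j k : ℕ} (h : i + j = k) (r : QPath V k) :
    Φ.pathProd (r.take h) * Φ.pathProd (r.drop h) = Φ.pathProd r := by
  rw [← Φ.pathProd_take_mul h r, pathProd.eq_1 Φ (r.drop h), ← mul_assoc]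
  congr 1
  exact Φ.pathProd_mul_e _

theorem pathProd_mul_of_ne {i j : ℕ} (p : QPath V i) (q : QPath V j) (h : p.tgt ≠ q.src) :
    Φ.pathProd p * Φ.pathProd q = 0 := by
  rw [← e_mul_pathProd Φ q, ← mul_assoc, Φ.pathProd_mul_e_of_ne p h, zero_mul]

theorem pathProd_mem {k : ℕ} (p : QPath V k) : Φ.pathProd p ∈ 𝒜 k := by
  induction k with
  | zero =>
    rw [QPath.eq_nil p, pathProd_nil]
    exact (Φ.e _).2
  | succ k ih =>
    rw [← Φ.pathProd_mul (i := k) (j := 1) rfl]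
    refine SetLike.mul_mem_graded (ih _) ?_
    rw [QPath.eq_single (p.drop _), pathProd_single]
    exact (Φ.x _).2

variable [∀ a b : V, Finite (a ⟶ b)]

/-- The component `KQ_k → Λ` of the structural homomorphism of the path algebra. -/
def π (k : ℕ) : PathSpace V K k →ₗ[K] Λ :=
  Fintype.linearCombination K (Φ.pathProd (k := k))

theorem π_apply {k : ℕ} (f : PathSpace V K k) : Φ.π k f = ∑ p, f p • Φ.pathProd p := rfl

theorem mem_relations {k : ℕ} {f : PathSpace V K k} : f ∈ Φ.relations k ↔ Φ.π k f = 0 := Iff.rfl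

theorem π_pathδ {k : ℕ} (p : QPath V k) : Φ.π k (pathδ p) = Φ.pathProd p := by
  classical
  rw [π, Fintype.linearCombination_apply_single, one_smul]

theorem π_mem {k : ℕ} (f : PathSpace V K k) : Φ.π k f ∈ 𝒜 k := by
  rw [π_apply]
  exact Submodule.sum_mem _ fun p _ => Submodule.smul_mem _ _ (Φ.pathProd_mem p)

theorem π_conv {i j k : ℕ} (h : i + j = k) (f : PathSpace V K i) (g : PathSpace V K j) :
    Φ.π k (conv h f g) = Φ.π i f * Φ.π j g := by
  have := sum_take_drop h (fun p q => (f p * g q) • (Φ.pathProd p * Φ.pathProd q))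
    (fun p q hpq => by rw [Φ.pathProd_mul_of_ne p q hpq, smul_zero])
  simp only [pathProd_mul] at this
  rw [π_apply, π_apply, π_apply, Finset.sum_mul_sum]
  refine this.trans ?_
  exact Finset.sum_congr rfl fun p _ => Finset.sum_congr rfl fun q _ => by
    rw [smul_mul_smul_comm]

/-- A product over paths, sorted by the first factors. -/
theorem π_eq_sum_lslice {i j k : ℕ} (h : i + j = k) (f : PathSpace V K k) :
    Φ.π k f = ∑ p : QPath V i, Φ.pathProd p * Φ.π j (lslice h p f) := by
  have := sum_atJoin h f (fun c p q => c • (Φ.pathProd p * Φ.pathProd q)) (by simp)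
  simp only [pathProd_mul] at this
  rw [π_apply, this]
  refine Finset.sum_congr rfl fun p _ => ?_
  rw [π_apply, Finset.mul_sum]
  exact Finset.sum_congr rfl fun q _ => by rw [mul_smul_comm]; rfl

/-- An algebra generated in degrees `0` and `1` is spanned in degree `k` by the products over the
paths of length `k`. -/
theorem π_surjective (h : Algebra.adjoin K ((𝒜 0 : Set Λ) ∪ 𝒜 1) = ⊤) {k : ℕ} {a : Λ}
    (ha : a ∈ 𝒜 k) : ∃ f, Φ.π k f = a := by
  classical
  have := Fintype.ofFinite V
  have := Fintype.ofFinite (Quiver.Total V)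
  -- The sum of the images of all components of `π` contains the generators and is closed under
  -- products, hence is everything; it remains to extract the component of degree `k`.
  let S : Submodule K Λ := ⨆ k, LinearMap.range (Φ.π k)
  have hle : ∀ k, LinearMap.range (Φ.π k) ≤ S := le_iSup fun k => LinearMap.range (Φ.π k)
  have hnil : ∀ b : V, (Φ.e b : Λ) ∈ S := fun b =>
    hle 0 ⟨pathδ (QPath.nil b), by rw [π_pathδ, pathProd_nil]⟩
  have hS : ∀ a : Λ, a ∈ S := by
    intro a
    have ha : a ∈ Algebra.adjoin K ((𝒜 0 : Set Λ) ∪ 𝒜 1) := h ▸ Algebra.mem_top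
    induction ha using Algebra.adjoin_induction with
    | mem x hx =>
      rcases hx with hx | hx
      · have := congrArg Subtype.val (Φ.e.sum_repr ⟨x, hx⟩)
        simp only [Submodule.coe_sum, Submodule.coe_smul] at this
        rw [← this]
        exact Submodule.sum_mem _ fun b _ => Submodule.smul_mem _ _ (hnil b)
      · have := congrArg Subtype.val (Φ.x.sum_repr ⟨x, hx⟩)
        simp only [Submodule.coe_sum, Submodule.coe_smul] at this
        rw [← this]
        exact Submodule.sum_mem _ fun α _ => Submodule.smul_mem _ _
          (hle 1 ⟨pathδ (QPath.single α), by rw [π_pathδ, pathProd_single]⟩)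
    | algebraMap c =>
      rw [Algebra.algebraMap_eq_smul_one, ← Φ.sum_e]
      exact Submodule.smul_mem _ _ (Submodule.sum_mem _ fun b _ => hnil b)
    | add x y _ _ hx hy => exact Submodule.add_mem _ hx hy
    | mul x y hx' hy' hx hy =>
      clear hx' hy'
      induction hx using Submodule.iSup_induction' with
      | mem i x hx =>
        obtain ⟨f, rfl⟩ := hx
        induction hy using Submodule.iSup_induction' with
        | mem j y hy =>
          obtain ⟨g, rfl⟩ := hy
          exact hle (i + j) ⟨conv rfl f g, Φ.π_conv rfl f g⟩
        | zero => rw [mul_zero]; exact zero_mem _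
        | add y z _ _ hy hz => rw [mul_add]; exact add_mem hy hz
      | zero => rw [zero_mul]; exact zero_mem _
      | add y z _ _ hy hz => rw [add_mul]; exact add_mem hy hz
  have key : ∀ a ∈ S, ((DirectSum.decompose 𝒜 a k : 𝒜 k) : Λ) ∈ LinearMap.range (Φ.π k) := by
    intro a ha
    induction ha using Submodule.iSup_induction' with
    | mem j y hy =>
      obtain ⟨f, rfl⟩ := hy
      by_cases hjk : j = k
      · subst hjk
        rw [DirectSum.decompose_of_mem_same 𝒜 (Φ.π_mem f)]
        exact ⟨f, rfl⟩
      · rw [DirectSum.decompose_of_mem_ne 𝒜 (Φ.π_mem f) hjk]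
        exact zero_mem _
    | zero => rw [DirectSum.decompose_zero]; exact zero_mem _
    | add y z _ _ hy hz =>
      rw [DirectSum.decompose_add, DirectSum.add_apply, Submodule.coe_add]
      exact add_mem hy hz
  have := key a (hS a)
  rwa [DirectSum.decompose_of_mem_same 𝒜 ha] at this

end QuiverOf

end

section

/-! ### The dual spaces of the components of the homogeneous dual -/

section Pairing

variable {V : Type v} [Quiver.{w + 1} V] [Finite V] [∀ a b : V, Finite (a ⟶ b)]
  {K : Type u} [Field K]

theorem sum_conv_mul {i j k : ℕ} (h : i + j = k) (a : PathSpace V K i) (b : PathSpace V K j)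
    (f : PathSpace V K k) :
    ∑ r, conv h a b r * f r = ∑ p, a p * ∑ q, b q * lslice h p f q := by
  have := sum_atJoin h f (fun c p q => a p * (b q * c)) (by simp)
  simp only [Finset.mul_sum]
  refine Eq.trans ?_ this
  exact Finset.sum_congr rfl fun r _ => mul_assoc _ _ _

theorem sum_conv_mul' {i j k : ℕ} (h : i + j = k) (a : PathSpace V K i) (b : PathSpace V K j)
    (f : PathSpace V K k) :
    ∑ r, conv h a b r * f r = ∑ q, b q * ∑ p, a p * rslice h q f p := by
  rw [sum_conv_mul]
  simp only [Finset.mul_sum]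
  rw [Finset.sum_comm]
  exact Finset.sum_congr rfl fun q _ => Finset.sum_congr rfl fun p _ => mul_left_comm _ _ _

theorem sum_pathδ_mul {k : ℕ} {M : Type*} [NonAssocSemiring M] [Module K M] (p : QPath V k)
    (F : QPath V k → M) : ∑ q, pathδ (K := K) p q • F q = F p := by
  classical
  rw [Finset.sum_eq_single p]
  · simp
  · intro q _ hq
    simp [hq]
  · simp

end Pairing

namespace QuiverOf

variable {K : Type u} [Field K] {Λ : Type u} [Ring Λ] [Algebra K Λ]
  {𝒜 : ℕ → Submodule K Λ} [GradedAlgebra 𝒜] {V : Type v} [Quiver.{w + 1} V]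
  (Φ : QuiverOf 𝒜 V) [Finite V] [∀ a b : V, Finite (a ⟶ b)] (n : ℕ)

/-- The space `J_k = ⋂_{i + n + j = k} KQ_i I_n KQ_j`, written as the orthogonal of the component
of degree `k` of the ideal generated by the orthogonal of `I_n`. -/
def J (k : ℕ) : Submodule K (PathSpace V K k) where
  carrier := { f | ∀ g ∈ idealGen (Φ.orthogonal n) k, ∑ p, g p * f p = 0 }
  add_mem' ha hb g hg := by simp [mul_add, Finset.sum_add_distrib, ha g hg, hb g hg]
  zero_mem' g hg := by simp
  smul_mem' c f hf g hg := by simp [mul_left_comm _ c, ← Finset.mul_sum, hf g hg]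

variable {n}

theorem mem_relations_iff {f : PathSpace V K n} :
    f ∈ Φ.relations n ↔ ∀ g ∈ Φ.orthogonal n, ∑ p, g p * f p = 0 :=
  ⟨fun hf _ hg => hg f hf, fun h => mem_of_orthogonal _ f fun g hg => h g hg⟩

theorem mem_idealGen_orthogonal_iff {k : ℕ} {g : PathSpace V K k} :
    g ∈ idealGen (Φ.orthogonal n) k ↔ ∀ f ∈ Φ.J n k, ∑ p, g p * f p = 0 := by
  refine ⟨fun hg f hf => hf g hg, fun h => mem_of_orthogonal _ g fun f hf => ?_⟩
  have := h f fun g hg => by simpa [mul_comm] using hf g hg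
  simpa [mul_comm] using this

/-- Membership in `J_k` means that each slice of length `n` is a relation. -/
theorem mem_J_iff {k : ℕ} {f : PathSpace V K k} :
    f ∈ Φ.J n k ↔ ∀ (i l j : ℕ) (h : i + n = l) (h' : l + j = k) (p : QPath V i) (q : QPath V j),
      lslice h p (rslice h' q f) ∈ Φ.relations n := by
  constructor
  · intro hf i l j h h' p q
    rw [mem_relations_iff]
    intro g hg
    have := hf (conv h' (conv h (pathδ p) g) (pathδ q))
      (Submodule.subset_span ⟨i, l, j, h, h', pathδ p, g, pathδ q, hg, rfl⟩)
    rw [sum_conv_mul'] at this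
    simp only [sum_conv_mul] at this
    have e1 := sum_pathδ_mul (K := K) q fun q =>
      ∑ p', pathδ (K := K) p p' * ∑ m, g m * lslice h p' (rslice h' q f) m
    have e2 := sum_pathδ_mul (K := K) p fun p' => ∑ m, g m * lslice h p' (rslice h' q f) m
    simp only [smul_eq_mul] at e1 e2
    rw [e1, e2] at this
    exact this
  · intro H g hg
    induction hg using Submodule.span_induction with
    | mem g hg =>
      obtain ⟨i, l, j, h, h', a, g, b, hg, rfl⟩ := hg
      rw [sum_conv_mul']
      refine Finset.sum_eq_zero fun q _ => ?_
      rw [sum_conv_mul]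
      rw [Finset.sum_eq_zero, mul_zero]
      intro p _
      rw [Φ.mem_relations_iff.1 (H i l j h h' p q) g hg, mul_zero]
    | zero => simp
    | add x y _ _ hx hy => simp [add_mul, Finset.sum_add_distrib, hx, hy]
    | smul c x _ hx => simp [mul_assoc, ← Finset.mul_sum, hx]

theorem mem_J_of_lt {k : ℕ} (hk : k < n) (f : PathSpace V K k) : f ∈ Φ.J n k := by
  rw [mem_J_iff]
  intro i l j h h'
  omega

theorem lslice_nil_src {k : ℕ} (h : 0 + k = k) (f : PathSpace V K k) (p : QPath V k) :
    lslice h (QPath.nil p.src) f p = f p := by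
  have h1 : p.take h = QPath.nil p.src := QPath.eq_nil _
  have h2 : p.drop h = p := by
    refine QPath.ext (funext fun s => ?_) (funext fun s => ?_)
    · exact congrArg p.vertex (Fin.ext (Nat.zero_add s))
    · exact congrArg p.arrow (Fin.ext (Nat.zero_add s))
  have := atJoin_take_drop h f p
  rw [h1, h2] at this
  exact this

theorem lslice_nil {k : ℕ} (h : 0 + k = k) (f : PathSpace V K k) (a : V) (p : QPath V k) :
    (p.src = a ∧ lslice h (QPath.nil a) f p = f p) ∨
      (p.src ≠ a ∧ lslice h (QPath.nil a) f p = 0) := by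
  by_cases hp : p.src = a
  · subst hp
    exact Or.inl ⟨rfl, lslice_nil_src h f p⟩
  · exact Or.inr ⟨hp, atJoin_of_ne h f (fun h' => hp h'.symm)⟩

theorem rslice_nil_tgt {k : ℕ} (h : k + 0 = k) (f : PathSpace V K k) (p : QPath V k) :
    rslice h (QPath.nil p.tgt) f p = f p := by
  have h1 : p.drop h = QPath.nil p.tgt := QPath.eq_nil _
  have h2 : p.take h = p := rfl
  have := atJoin_take_drop h f p
  rw [h1, h2] at this
  exact this

theorem rslice_nil {k : ℕ} (h : k + 0 = k) (f : PathSpace V K k) (a : V) (p : QPath V k) :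
    (p.tgt = a ∧ rslice h (QPath.nil a) f p = f p) ∨
      (p.tgt ≠ a ∧ rslice h (QPath.nil a) f p = 0) := by
  by_cases hp : p.tgt = a
  · subst hp
    exact Or.inl ⟨rfl, rslice_nil_tgt h f p⟩
  · exact Or.inr ⟨hp, atJoin_of_ne h f hp⟩

/-- The space of relations of degree `k` is stable under the idempotents on both sides. -/
theorem lslice_nil_mem_relations {k : ℕ} (h : 0 + k = k) {f : PathSpace V K k}
    (hf : f ∈ Φ.relations k) (a : V) : lslice h (QPath.nil a) f ∈ Φ.relations k := by
  classical
  rw [mem_relations] at hf ⊢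
  have : Φ.π k (lslice h (QPath.nil a) f) = (Φ.e a : Λ) * Φ.π k f := by
    rw [π_apply, π_apply, Finset.mul_sum]
    refine Finset.sum_congr rfl fun p _ => ?_
    rw [mul_smul_comm]
    rcases lslice_nil h f a p with ⟨h1, h2⟩ | ⟨h1, h2⟩
    · rw [h2, ← h1, Φ.e_mul_pathProd]
    · rw [h2, Φ.e_mul_pathProd_of_ne p (Ne.symm h1), zero_smul, smul_zero]
  rw [this, hf, mul_zero]

theorem rslice_nil_mem_relations {k : ℕ} (h : k + 0 = k) {f : PathSpace V K k}
    (hf : f ∈ Φ.relations k) (a : V) : rslice h (QPath.nil a) f ∈ Φ.relations k := by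
  classical
  rw [mem_relations] at hf ⊢
  have : Φ.π k (rslice h (QPath.nil a) f) = Φ.π k f * (Φ.e a : Λ) := by
    rw [π_apply, π_apply, Finset.sum_mul]
    refine Finset.sum_congr rfl fun p _ => ?_
    rw [smul_mul_assoc]
    rcases rslice_nil h f a p with ⟨h1, h2⟩ | ⟨h1, h2⟩
    · rw [h2, ← h1, Φ.pathProd_mul_e]
    · rw [h2, Φ.pathProd_mul_e_of_ne p h1, zero_smul, smul_zero]
  rw [this, hf, zero_mul]

theorem lslice_mem_relations_of_src {k : ℕ} {f : PathSpace V K k} (h : 0 + k = k)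
    (H : ∀ a, lslice h (QPath.nil a) f ∈ Φ.relations k) : f ∈ Φ.relations k := by
  rw [mem_relations, Φ.π_eq_sum_lslice h]
  refine Finset.sum_eq_zero fun p _ => ?_
  rw [QPath.eq_nil p, Φ.mem_relations.1 (H _), mul_zero]

theorem J_self : Φ.J n n = Φ.relations n := by
  ext f
  constructor
  · intro hf
    refine Φ.lslice_mem_relations_of_src (Nat.zero_add n) fun a => ?_
    rw [mem_relations_iff]
    intro g hg
    have := hf (conv (Nat.zero_add n) (pathδ (QPath.nil a)) g) (Submodule.subset_span
      ⟨0, n, 0, Nat.zero_add n, rfl, pathδ (QPath.nil a), g, fun _ => 1, hg, by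
        funext p
        exact (mul_one _).symm⟩)
    rw [sum_conv_mul] at this
    have e2 := sum_pathδ_mul (K := K) (QPath.nil a) fun p' =>
      ∑ m, g m * lslice (Nat.zero_add n) p' f m
    simp only [smul_eq_mul] at e2
    rwa [e2] at this
  · intro hf
    rw [mem_J_iff]
    intro i l j h h' p q
    obtain rfl : i = 0 := by omega
    obtain rfl : j = 0 := by omega
    obtain rfl : n = l := by omega
    rw [QPath.eq_nil p, QPath.eq_nil q]
    exact Φ.lslice_nil_mem_relations _ (Φ.rslice_nil_mem_relations _ hf _) _

theorem lslice_mem_J {i j k : ℕ} (h : i + j = k) (p : QPath V i) {f : PathSpace V K k}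
    (hf : f ∈ Φ.J n k) : lslice h p f ∈ Φ.J n j := by
  rw [mem_J_iff] at hf ⊢
  intro i' l j' h1 h2 p' q
  rw [← rslice_lslice (i := i) (j := l) (k := j') rfl h2 (by omega) h]
  rcases lslice_lslice' (i := i) (j := i') (k := n) rfl h1 (by omega) rfl p p'
    (rslice (i := i + l) (j := j') (k := k) (by omega) q f) with h0 | ⟨s, rfl, rfl⟩
  · rw [h0]; exact zero_mem _
  · rw [lslice_lslice rfl h1 (by omega) rfl]
    exact hf _ _ _ _ _ _ _

theorem rslice_rslice' {i j k ij jk l : ℕ} (hij : i + j = ij) (hjk : j + k = jk) (h : ij + k = l)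
    (h' : i + jk = l) (q : QPath V j) (r : QPath V k) (y : PathSpace V K l) :
    rslice hij q (rslice h r y) = 0 ∨ ∃ s : QPath V jk, s.take hjk = q ∧ s.drop hjk = r := by
  by_cases hqr : q.tgt = r.src
  · exact Or.inr ⟨q.join hjk r hqr, QPath.take_join _ _ _ _, QPath.drop_join _ _ _ _⟩
  · refine Or.inl (funext fun p => ?_)
    refine (atJoin_assoc hij hjk h h' y p q r).trans ?_
    exact atJoin_of_ne hjk _ hqr

theorem rslice_mem_J {i j k : ℕ} (h : i + j = k) (q : QPath V j) {f : PathSpace V K k}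
    (hf : f ∈ Φ.J n k) : rslice h q f ∈ Φ.J n i := by
  rw [mem_J_iff] at hf ⊢
  intro i' l j' h1 h2 p' q'
  rcases rslice_rslice' (i := l) (j := j') (k := j) h2 rfl h (by omega) q' q f with
    h0 | ⟨s, rfl, rfl⟩
  · rw [h0, map_zero]; exact zero_mem _
  · rw [rslice_rslice h2 rfl h (by omega)]
    exact hf _ _ _ _ _ _ _

end QuiverOf

end

section

/-! ### Algebra-valued functions on paths -/

theorem atJoin_sum {V : Type v} [Quiver.{w + 1} V] {M ι : Type*} [AddCommMonoid M] [Fintype ι]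
    {i j k : ℕ} (h : i + j = k) (G : ι → QPath V k → M) (p : QPath V i) (q : QPath V j) :
    atJoin h (fun r => ∑ x, G x r) p q = ∑ x, atJoin h (G x) p q := by
  by_cases hpq : p.tgt = q.src
  · simp only [atJoin_join h _ p q hpq]
  · simp only [atJoin_of_ne h _ hpq, Finset.sum_const_zero]

section Fn

variable (Λ : Type u) (V : Type v) [Quiver.{w + 1} V] [Finite V] [∀ a b : V, Finite (a ⟶ b)]

/-- The paths of length `k`, as a type in a prescribed universe. -/
def PIdx (k : ℕ) : Type u := Shrink.{u} (QPath V k)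

/-- The index of a path. -/
def shEquiv (k : ℕ) : QPath V k ≃ PIdx.{u} V k := equivShrink.{u} (QPath V k)

instance (k : ℕ) : Finite (PIdx.{u} V k) := Finite.of_equiv _ (shEquiv V k)

/-- The functions from paths of length `k` to `Λ`, which model the right `Λ`-module `KQ_k ⊗_K Λ`.
The paths are indexed by a type in the universe of `Λ`. -/
abbrev Fn (k : ℕ) : Type u := PIdx.{u} V k → Λ

variable {V} in
/-- The index of a path. -/
abbrev sh {k : ℕ} (p : QPath V k) : PIdx.{u} V k := shEquiv V k p

variable {Λ V} in
/-- The element of `Fn Λ V k` given by a function on paths. -/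
def mkFn {k : ℕ} (φ : QPath V k → Λ) : Fn Λ V k := fun s => φ ((shEquiv V k).symm s)

variable {Λ V}

@[simp]
theorem mkFn_sh {k : ℕ} (φ : QPath V k → Λ) (p : QPath V k) : mkFn φ (sh p) = φ p := by
  simp [mkFn]

theorem fn_ext {k : ℕ} {F G : Fn Λ V k} (h : ∀ p, F (sh p) = G (sh p)) : F = G := by
  funext s
  obtain ⟨p, rfl⟩ := (shEquiv V k).surjective s
  exact h p

end Fn

open MulOpposite

namespace QuiverOf

variable {K : Type u} [Field K] {Λ : Type u} [Ring Λ] [Algebra K Λ]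
  {𝒜 : ℕ → Submodule K Λ} [GradedAlgebra 𝒜] {V : Type v} [Quiver.{w + 1} V]
  (Φ : QuiverOf 𝒜 V) [Finite V] [∀ a b : V, Finite (a ⟶ b)]

/-- The image of `KQ_{k + l} = KQ_k ⊗ KQ_l` in `KQ_k ⊗ Λ_l`. -/
def kap {k l t : ℕ} (h : k + l = t) : PathSpace V K t →ₗ[K] Fn Λ V k where
  toFun y := mkFn fun p => Φ.π l (lslice h p y)
  map_add' y z := fn_ext fun p => by simp
  map_smul' c y := fn_ext fun p => by simp

@[simp]
theorem kap_apply {k l t : ℕ} (h : k + l = t) (y : PathSpace V K t) (p : QPath V k) :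
    Φ.kap h y (sh p) = Φ.π l (lslice h p y) :=
  mkFn_sh (fun p => Φ.π l (lslice h p y)) p

/-- The embedding of `KQ_k` in `KQ_k ⊗ Λ`. -/
abbrev iota (k : ℕ) : PathSpace V K k →ₗ[K] Fn Λ V k := Φ.kap (Nat.add_zero k)

theorem iota_apply {k : ℕ} (y : PathSpace V K k) (p : QPath V k) :
    Φ.iota k y (sh p) = y p • (Φ.e p.tgt : Λ) := by
  classical
  rw [kap_apply, π_apply, Finset.sum_eq_single (QPath.nil p.tgt)]
  · rw [Φ.pathProd_nil]
    congr 1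
    exact rslice_nil_tgt (Nat.add_zero k) y p
  · intro q _ hq
    have : lslice (Nat.add_zero k) p y q = 0 := atJoin_of_ne _ _ fun h => hq (by
      rw [QPath.eq_nil q, h])
    rw [this, zero_smul]
  · simp

/-- The map `KQ_{k + c} ⊗ Λ → KQ_k ⊗ Λ` which multiplies the last `c` arrows of the paths into
`Λ`. -/
def dmap {k c t : ℕ} (h : k + c = t) : Fn Λ V t →ₗ[Λᵐᵒᵖ] Fn Λ V k where
  toFun F := mkFn fun p => ∑ q, Φ.pathProd q * atJoin h (fun r => F (sh r)) p q
  map_add' F G := fn_ext fun p => by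
    simp only [mkFn_sh, Pi.add_apply, ← Finset.sum_add_distrib, ← mul_add]
    exact Finset.sum_congr rfl fun q _ => congrArg _ (atJoin_add h _ _ p q)
  map_smul' a F := fn_ext fun p => by
    simp only [mkFn_sh, Pi.smul_apply, RingHom.id_apply, Finset.smul_sum]
    refine Finset.sum_congr rfl fun q _ => ?_
    rw [← mul_smul_comm]
    exact congrArg _ (atJoin_smul h a _ p q)

theorem dmap_apply {k c t : ℕ} (h : k + c = t) (F : Fn Λ V t) (p : QPath V k) :
    Φ.dmap h F (sh p) = ∑ q, Φ.pathProd q * atJoin h (fun r => F (sh r)) p q :=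
  mkFn_sh (fun p => ∑ q, Φ.pathProd q * atJoin h (fun r => F (sh r)) p q) p

/-- The contraction `KQ_{i + k} ⊗ Λ → KQ_k ⊗ Λ` of the first `i` arrows of the paths with a
functional on `KQ_i`. -/
def ctr {i k t : ℕ} (h : i + k = t) (g : PathSpace V K i) : Fn Λ V t →ₗ[Λᵐᵒᵖ] Fn Λ V k where
  toFun F := mkFn fun q => ∑ p, g p • atJoin h (fun r => F (sh r)) p q
  map_add' F G := fn_ext fun p => by
    simp only [mkFn_sh, Pi.add_apply, ← Finset.sum_add_distrib, ← smul_add]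
    exact Finset.sum_congr rfl fun q _ => congrArg _ (atJoin_add h _ _ _ _)
  map_smul' a F := fn_ext fun p => by
    simp only [mkFn_sh, Pi.smul_apply, RingHom.id_apply, Finset.smul_sum]
    refine Finset.sum_congr rfl fun q _ => ?_
    rw [smul_comm]
    exact congrArg _ (atJoin_smul h a _ _ _)

theorem ctr_apply {i k t : ℕ} (h : i + k = t) (g : PathSpace V K i) (F : Fn Λ V t)
    (q : QPath V k) : ctr h g F (sh q) = ∑ p, g p • atJoin h (fun r => F (sh r)) p q :=
  mkFn_sh (fun q => ∑ p, g p • atJoin h (fun r => F (sh r)) p q) q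

theorem dmap_dmap {k c k' c' t cc : ℕ} (h : k + c = k') (h' : k' + c' = t) (hc : c + c' = cc)
    (hh : k + cc = t) (F : Fn Λ V t) : Φ.dmap h (Φ.dmap h' F) = Φ.dmap hh F := by
  refine fn_ext fun p => ?_
  have := sum_atJoin hc (fun s => atJoin hh (fun r => F (sh r)) p s)
    (fun x q q' => Φ.pathProd q * Φ.pathProd q' * x) (by simp)
  simp only [pathProd_mul] at this
  rw [dmap_apply, dmap_apply, this]
  refine Finset.sum_congr rfl fun q _ => ?_
  simp only [dmap_apply, atJoin_sum, Finset.mul_sum]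
  refine Finset.sum_congr rfl fun q' _ => ?_
  rw [atJoin_map (Φ.pathProd q' * ·) (mul_zero _), mul_assoc, atJoin_assoc h hc h' hh]

theorem atJoin_π_lslice {i j ij k jk t : ℕ} (hij : i + j = ij) (hjk : j + k = jk) (h : ij + k = t)
    (h' : i + jk = t) (y : PathSpace V K t) (p : QPath V i) (q : QPath V j) :
    atJoin hij (fun r => Φ.π k (lslice h r y)) p q = Φ.π k (lslice hjk q (lslice h' p y)) := by
  by_cases hpq : p.tgt = q.src
  · rw [atJoin_join hij _ p q hpq, ← lslice_lslice hij hjk h h', QPath.take_join, QPath.drop_join]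
  · rw [atJoin_of_ne hij _ hpq]
    rcases lslice_lslice' hij hjk h h' p q y with h0 | ⟨s, rfl, rfl⟩
    · rw [h0, map_zero]
    · exact absurd (QPath.tgt_take hij s) hpq

theorem dmap_kap {k c k' l t cl : ℕ} (h : k + c = k') (h' : k' + l = t) (hc : c + l = cl)
    (hh : k + cl = t) (y : PathSpace V K t) : Φ.dmap h (Φ.kap h' y) = Φ.kap hh y := by
  refine fn_ext fun p => ?_
  rw [dmap_apply, kap_apply, Φ.π_eq_sum_lslice hc]
  refine Finset.sum_congr rfl fun q _ => ?_
  simp only [kap_apply]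
  rw [Φ.atJoin_π_lslice h hc h' hh]

theorem ctr_dmap {i k t' c t k' : ℕ} (h : i + k = t') (h' : t' + c = t) (hk : k + c = k')
    (hh : i + k' = t) (g : PathSpace V K i) (F : Fn Λ V t) :
    ctr h g (Φ.dmap h' F) = Φ.dmap hk (ctr hh g F) := by
  refine fn_ext fun q => ?_
  rw [dmap_apply, ctr_apply]
  simp only [dmap_apply, ctr_apply, atJoin_sum, Finset.mul_sum, Finset.smul_sum]
  rw [Finset.sum_comm]
  refine Finset.sum_congr rfl fun s _ => Finset.sum_congr rfl fun p _ => ?_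
  rw [atJoin_map (Φ.pathProd s * ·) (mul_zero _), atJoin_map (g p • ·) (smul_zero _),
    atJoin_assoc h hk h' hh, mul_smul_comm]

/-- The contraction of the first `i` arrows of the paths with a functional on `KQ_i`. -/
def ctrP {i k t : ℕ} (h : i + k = t) (g : PathSpace V K i) (y : PathSpace V K t) :
    PathSpace V K k := ∑ p, g p • lslice h p y

theorem ctr_iota {i k t : ℕ} (h : i + k = t) (g : PathSpace V K i) (y : PathSpace V K t) :
    ctr h g (Φ.iota t y) = Φ.iota k (ctrP h g y) := by
  refine fn_ext fun q => ?_
  rw [ctr_apply, kap_apply, ctrP, map_sum, map_sum]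
  refine Finset.sum_congr rfl fun p _ => ?_
  rw [map_smul, map_smul]
  simp only [kap_apply]
  rw [Φ.atJoin_π_lslice h (Nat.add_zero k) (Nat.add_zero t) h]

theorem lslice_conv {i j k ij jk l : ℕ} (hij : i + j = ij) (hjk : j + k = jk) (h : ij + k = l)
    (h' : i + jk = l) (p : QPath V i) (y : PathSpace V K ij) (f : PathSpace V K k) :
    lslice h' p (conv h y f) = conv hjk (lslice hij p y) f := by
  funext q
  change atJoin h' (conv h y f) p q = atJoin hij y p (q.take hjk) * f (q.drop hjk)
  by_cases hpq : p.tgt = q.src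
  · have hpq' : p.tgt = (q.take hjk).src := hpq
    have e : p.join h' q hpq = (p.join hij (q.take hjk) hpq').join h (q.drop hjk)
        ((QPath.tgt_join _ _ _ _).trans (QPath.tgt_take hjk q)) := by
      rw [QPath.join_assoc hij hjk h h' _ _ _ hpq' (QPath.tgt_take hjk q)]
      congr 1
      exact (QPath.join_take_drop hjk q).symm
    rw [atJoin_join h' _ p q hpq, atJoin_join hij _ p _ hpq', e]
    change y (QPath.take h _) * f (QPath.drop h _) = _
    rw [QPath.take_join, QPath.drop_join]
  · rw [atJoin_of_ne h' _ hpq, atJoin_of_ne hij _ (by exact hpq), zero_mul]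

theorem smul_kap {k l l' t t' ll : ℕ} (h : k + l = t) (h' : t + l' = t') (hl : l + l' = ll)
    (hh : k + ll = t') (y : PathSpace V K t) (f : PathSpace V K l') :
    op (Φ.π l' f) • Φ.kap h y = Φ.kap hh (conv h' y f) := by
  refine fn_ext fun p => ?_
  rw [Pi.smul_apply, kap_apply, kap_apply, lslice_conv h hl h' hh, Φ.π_conv hl]
  rfl

theorem kap_eq_sum {k l t : ℕ} (h : k + l = t) (y : PathSpace V K t) :
    Φ.kap h y = ∑ q : QPath V l, op (Φ.pathProd q) • Φ.iota k (rslice h q y) := by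
  refine fn_ext fun p => ?_
  rw [kap_apply, π_apply, Finset.sum_apply]
  refine Finset.sum_congr rfl fun q _ => ?_
  rw [Pi.smul_apply, iota_apply, op_smul_eq_mul, smul_mul_assoc]
  change atJoin h y p q • _ = atJoin h y p q • _
  by_cases hpq : p.tgt = q.src
  · rw [hpq, Φ.e_mul_pathProd]
  · rw [atJoin_of_ne h y hpq, zero_smul, zero_smul]

theorem op_e_smul_iota {k : ℕ} (a : V) (y : PathSpace V K k) :
    op (Φ.e a : Λ) • Φ.iota k y = Φ.iota k (rslice (Nat.add_zero k) (QPath.nil a) y) := by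
  refine fn_ext fun p => ?_
  rw [Pi.smul_apply, iota_apply, iota_apply, op_smul_eq_mul, smul_mul_assoc]
  rcases rslice_nil (Nat.add_zero k) y a p with ⟨h1, h2⟩ | ⟨h1, h2⟩
  · rw [h2, h1, Φ.idem]
  · rw [h2, Φ.orth _ _ h1, smul_zero, zero_smul]

theorem rslice_conv {k l t : ℕ} (h : k + l = t) (x : PathSpace V K k) (f : PathSpace V K l)
    (q : QPath V l) :
    rslice h q (conv h x f) = f q • rslice (Nat.add_zero k) (QPath.nil q.src) x := by
  funext p
  change atJoin h (conv h x f) p q = f q * rslice (Nat.add_zero k) (QPath.nil q.src) x p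
  by_cases hpq : p.tgt = q.src
  · rw [atJoin_join h _ p q hpq, ← hpq, rslice_nil_tgt]
    change x (QPath.take h _) * f (QPath.drop h _) = _
    rw [QPath.take_join, QPath.drop_join, mul_comm]
  · rw [atJoin_of_ne h _ hpq]
    rcases rslice_nil (Nat.add_zero k) x q.src p with ⟨h1, h2⟩ | ⟨h1, h2⟩
    · exact absurd h1 hpq
    · rw [h2, mul_zero]

/-! ### The terms of the Koszul complex -/

variable (n : ℕ)

/-- The term `J_k ⊗ Λ` of the Koszul complex, as a submodule of `KQ_k ⊗ Λ`. -/
def Kmod (k : ℕ) : Submodule Λᵐᵒᵖ (Fn Λ V k) :=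
  Submodule.span Λᵐᵒᵖ (Φ.iota k '' (Φ.J n k : Set (PathSpace V K k)))

variable {n}

theorem iota_mem_Kmod {k : ℕ} {y : PathSpace V K k} (hy : y ∈ Φ.J n k) :
    Φ.iota k y ∈ Φ.Kmod n k := Submodule.subset_span ⟨y, hy, rfl⟩

theorem kap_mem_Kmod {k l t : ℕ} (h : k + l = t) {y : PathSpace V K t}
    (hy : ∀ q, rslice h q y ∈ Φ.J n k) : Φ.kap h y ∈ Φ.Kmod n k := by
  rw [kap_eq_sum]
  exact Submodule.sum_mem _ fun q _ => Submodule.smul_mem _ _ (Φ.iota_mem_Kmod (hy q))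

theorem dmap_mem_Kmod {k c t : ℕ} (h : k + c = t) {F : Fn Λ V t} (hF : F ∈ Φ.Kmod n t) :
    Φ.dmap h F ∈ Φ.Kmod n k := by
  induction hF using Submodule.span_induction with
  | mem F hF =>
    obtain ⟨y, hy, rfl⟩ := hF
    rw [Φ.dmap_kap h (Nat.add_zero t) (Nat.add_zero c) h]
    exact Φ.kap_mem_Kmod h fun q => Φ.rslice_mem_J h q hy
  | zero => rw [map_zero]; exact zero_mem _
  | add x y _ _ hx hy => rw [map_add]; exact add_mem hx hy
  | smul a x _ hx => rw [map_smul]; exact Submodule.smul_mem _ _ hx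

theorem ctr_mem_Kmod {i k t : ℕ} (h : i + k = t) (g : PathSpace V K i) {F : Fn Λ V t}
    (hF : F ∈ Φ.Kmod n t) : ctr h g F ∈ Φ.Kmod n k := by
  induction hF using Submodule.span_induction with
  | mem F hF =>
    obtain ⟨y, hy, rfl⟩ := hF
    rw [ctr_iota]
    refine Φ.iota_mem_Kmod (Submodule.sum_mem _ fun p _ => Submodule.smul_mem _ _ ?_)
    exact Φ.lslice_mem_J h p hy
  | zero => rw [map_zero]; exact zero_mem _
  | add x y _ _ hx hy => rw [map_add]; exact add_mem hx hy
  | smul a x _ hx => rw [map_smul]; exact Submodule.smul_mem _ _ hx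

theorem dmap_zero_of_mem_Kmod {k : ℕ} {F : Fn Λ V k} (hF : F ∈ Φ.Kmod n k) :
    Φ.dmap (Nat.add_zero k) F = F := by
  induction hF using Submodule.span_induction with
  | mem F hF =>
    obtain ⟨y, hy, rfl⟩ := hF
    exact Φ.dmap_kap _ _ rfl _ y
  | zero => simp
  | add x y _ _ hx hy => rw [map_add, hx, hy]
  | smul a x _ hx => rw [map_smul, hx]

theorem decompose_zero_mul {a b : Λ} (ha : a ∈ 𝒜 0) (l : ℕ) :
    ((DirectSum.decompose 𝒜 (a * b) l : 𝒜 l) : Λ) = a * (DirectSum.decompose 𝒜 b l : 𝒜 l) := by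
  have := DirectSum.coe_decompose_mul_add_of_left_mem 𝒜 (i := 0) (j := l) (b := b) ha
  rwa [zero_add] at this

/-- The homogeneous components of the elements of `J_k ⊗ Λ` come from `J_k ⊗ KQ_l`. -/
theorem exists_kap_of_mem_Kmod (hgen : Algebra.adjoin K ((𝒜 0 : Set Λ) ∪ 𝒜 1) = ⊤) {k l t : ℕ}
    (h : k + l = t) {F : Fn Λ V k} (hF : F ∈ Φ.Kmod n k) :
    ∃ y, (∀ q, rslice h q y ∈ Φ.J n k) ∧
      ∀ p, ((DirectSum.decompose 𝒜 (F (sh p)) l : 𝒜 l) : Λ) = Φ.kap h y (sh p) := by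
  -- The statement for all `F b` is what is stable under the action of `Λ` on the elements `F`.
  suffices H : ∀ b : Λ, ∃ y, (∀ q, rslice h q y ∈ Φ.J n k) ∧
      ∀ p, ((DirectSum.decompose 𝒜 (F (sh p) * b) l : 𝒜 l) : Λ) = Φ.kap h y (sh p) by
    simpa using H 1
  induction hF using Submodule.span_induction with
  | mem F hF =>
    obtain ⟨x, hx, rfl⟩ := hF
    intro b
    obtain ⟨f, hf⟩ := Φ.π_surjective hgen (SetLike.coe_mem (DirectSum.decompose 𝒜 b l))
    refine ⟨conv h x f, fun q => ?_, fun p => ?_⟩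
    · rw [rslice_conv]
      exact Submodule.smul_mem _ _ (Φ.rslice_mem_J _ _ hx)
    · rw [← Φ.smul_kap (Nat.add_zero k) h (Nat.zero_add l) h x f, hf, iota_apply,
        decompose_zero_mul (Submodule.smul_mem _ _ (Φ.e _).2), Pi.smul_apply, iota_apply]
      rfl
  | zero =>
    intro b
    exact ⟨0, fun q => by rw [map_zero]; exact zero_mem _, fun p => by simp⟩
  | add x y _ _ hx hy =>
    intro b
    obtain ⟨y1, h1, h1'⟩ := hx b
    obtain ⟨y2, h2, h2'⟩ := hy b
    refine ⟨y1 + y2, fun q => by rw [map_add]; exact add_mem (h1 q) (h2 q), fun p => ?_⟩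
    rw [Pi.add_apply, add_mul, DirectSum.decompose_add, DirectSum.add_apply, Submodule.coe_add,
      h1', h2', map_add, Pi.add_apply]
  | smul a x _ hx =>
    intro b
    obtain ⟨y1, h1, h1'⟩ := hx (a.unop * b)
    refine ⟨y1, h1, fun p => ?_⟩
    rw [← h1', ← mul_assoc]
    rfl

theorem eq_kap_of_mem_Kmod (hgen : Algebra.adjoin K ((𝒜 0 : Set Λ) ∪ 𝒜 1) = ⊤) {k l t : ℕ}
    (h : k + l = t) {F : Fn Λ V k} (hF : F ∈ Φ.Kmod n k) (hl : ∀ p, F (sh p) ∈ 𝒜 l) :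
    ∃ y, (∀ q, rslice h q y ∈ Φ.J n k) ∧ F = Φ.kap h y := by
  obtain ⟨y, hy, hy'⟩ := Φ.exists_kap_of_mem_Kmod hgen h hF
  refine ⟨y, hy, fn_ext fun p => ?_⟩
  rw [← hy', DirectSum.decompose_of_mem_same 𝒜 (hl p)]

theorem kap_mem {k l t : ℕ} (h : k + l = t) (y : PathSpace V K t) (p : QPath V k) :
    Φ.kap h y (sh p) ∈ 𝒜 l := by
  rw [kap_apply]; exact Φ.π_mem _

theorem kap_eq_zero_iff {k l t : ℕ} (h : k + l = t) (y : PathSpace V K t) :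
    Φ.kap h y = 0 ↔ ∀ p, lslice h p y ∈ Φ.relations l := by
  constructor
  · intro hy p
    rw [mem_relations, ← kap_apply, hy]
    rfl
  · intro hy
    refine fn_ext fun p => ?_
    rw [kap_apply, Φ.mem_relations.1 (hy p)]
    rfl

end QuiverOf

end

section

open MulOpposite
namespace QuiverOf

variable {K : Type u} [Field K] {Λ : Type u} [Ring Λ] [Algebra K Λ]
  {𝒜 : ℕ → Submodule K Λ} [GradedAlgebra 𝒜] {V : Type v} [Quiver.{w + 1} V]
  (Φ : QuiverOf 𝒜 V) [Finite V] [∀ a b : V, Finite (a ⟶ b)] {n : ℕ}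

/-! ### Projectivity of the terms of the Koszul complex -/

theorem rslice_nil_nil {k : ℕ} (h : k + 0 = k) (a : V) (y : PathSpace V K k) :
    rslice h (QPath.nil a) (rslice h (QPath.nil a) y) = rslice h (QPath.nil a) y := by
  funext p
  rcases rslice_nil h (rslice h (QPath.nil a) y) a p with ⟨_, h2⟩ | ⟨h1, h2⟩
  · rw [h2]
  · rcases rslice_nil h y a p with ⟨h3, _⟩ | ⟨_, h4⟩
    · exact absurd h3 h1
    · rw [h2, h4]

theorem rslice_nil_nil_ne {k : ℕ} (h : k + 0 = k) {a b : V} (hab : a ≠ b) (y : PathSpace V K k) :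
    rslice h (QPath.nil a) (rslice h (QPath.nil b) y) = 0 := by
  funext p
  rcases rslice_nil h (rslice h (QPath.nil b) y) a p with ⟨h1, h2⟩ | ⟨h1, h2⟩
  · rcases rslice_nil h y b p with ⟨h3, _⟩ | ⟨_, h4⟩
    · exact absurd (h1.symm.trans h3) hab
    · rw [h2, h4]; rfl
  · rw [h2]; rfl

theorem sum_rslice_nil [Fintype V] {k : ℕ} (h : k + 0 = k) (y : PathSpace V K k) :
    ∑ a, rslice h (QPath.nil a) y = y := by
  funext p
  rw [Finset.sum_apply, Finset.sum_eq_single p.tgt]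
  · exact rslice_nil_tgt h y p
  · intro b _ hb
    rcases rslice_nil h y b p with ⟨h1, _⟩ | ⟨_, h2⟩
    · exact absurd h1 (Ne.symm hb)
    · exact h2
  · simp

theorem rslice_nil_pathδ {k : ℕ} (h : k + 0 = k) (p : QPath V k) :
    rslice h (QPath.nil p.tgt) (pathδ (K := K) p) = pathδ p := by
  classical
  funext q
  rcases rslice_nil h (pathδ (K := K) p) p.tgt q with ⟨_, h2⟩ | ⟨h1, h2⟩
  · exact h2
  · rw [h2]
    have : q ≠ p := fun h => h1 (h ▸ rfl)
    simp [this]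

variable (n) in
/-- There is a projection of `KQ_k` onto `J_k` that is linear over the vertex idempotents on the
right. -/
theorem exists_projection (k : ℕ) : ∃ ρ : PathSpace V K k →ₗ[K] PathSpace V K k,
    (∀ y, ρ y ∈ Φ.J n k) ∧ (∀ y ∈ Φ.J n k, ρ y = y) ∧
    ∀ (a : V) y, rslice (Nat.add_zero k) (QPath.nil a) (ρ y) =
      ρ (rslice (Nat.add_zero k) (QPath.nil a) y) := by
  classical
  have := Fintype.ofFinite V
  obtain ⟨g, hg⟩ := LinearMap.exists_leftInverse_of_injective (Φ.J n k).subtype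
    (LinearMap.ker_eq_bot.2 Subtype.val_injective)
  -- An arbitrary linear projection onto `J_k`, averaged over the vertex idempotents.
  let R : V → (PathSpace V K k →ₗ[K] PathSpace V K k) :=
    fun a => rslice (Nat.add_zero k) (QPath.nil a)
  let ρ : PathSpace V K k →ₗ[K] PathSpace V K k :=
    ∑ a, (R a) ∘ₗ (Φ.J n k).subtype ∘ₗ g ∘ₗ (R a)
  have hρ : ∀ y, ρ y = ∑ a, R a (g (R a y)) := fun y => by
    simp [ρ, LinearMap.sum_apply]
  have hJ : ∀ a, ∀ y ∈ Φ.J n k, R a y ∈ Φ.J n k := fun a y hy => Φ.rslice_mem_J _ _ hy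
  refine ⟨ρ, fun y => ?_, fun y hy => ?_, fun a y => ?_⟩
  · rw [hρ]
    exact Submodule.sum_mem _ fun a _ => hJ a _ (g (R a y)).2
  · rw [hρ]
    conv_rhs => rw [← sum_rslice_nil (Nat.add_zero k) y]
    refine Finset.sum_congr rfl fun a _ => ?_
    have := congrArg Subtype.val (LinearMap.congr_fun hg ⟨R a y, hJ a y hy⟩)
    simp only [LinearMap.comp_apply, Submodule.subtype_apply, LinearMap.id_apply] at this
    rw [this]
    exact rslice_nil_nil _ a y
  · change R a (ρ y) = ρ (R a y)
    rw [hρ, hρ, map_sum, Finset.sum_eq_single a, Finset.sum_eq_single a]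
    · change R a (R a _) = R a (g (R a (R a y)))
      rw [show R a (R a y) = R a y from rslice_nil_nil _ a y]
      exact rslice_nil_nil _ a _
    · intro b _ hb
      rw [show R b (R a y) = 0 from rslice_nil_nil_ne _ hb y, map_zero]
      exact map_zero _
    · simp
    · intro b _ hb
      exact rslice_nil_nil_ne _ (Ne.symm hb) _
    · simp

/-- The images of the paths under a projection `ρ` of `KQ_k` onto `J_k` form, together with the
values at the paths, a dual basis of `J_k ⊗ Λ`. -/
theorem sum_op_smul_iota_projection {k : ℕ} {ρ : PathSpace V K k →ₗ[K] PathSpace V K k}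
    (h2 : ∀ y ∈ Φ.J n k, ρ y = y)
    (h3 : ∀ (a : V) y, rslice (Nat.add_zero k) (QPath.nil a) (ρ y) =
      ρ (rslice (Nat.add_zero k) (QPath.nil a) y)) {F : Fn Λ V k} (hF : F ∈ Φ.Kmod n k) :
    ∑ p, op (F (sh p)) • Φ.iota k (ρ (pathδ p)) = F := by
  induction hF using Submodule.span_induction with
  | mem F hF =>
    obtain ⟨x, hx, rfl⟩ := hF
    have : ∀ p, op (Φ.iota k x (sh p)) • Φ.iota k (ρ (pathδ p)) =
        x p • Φ.iota k (ρ (pathδ p)) := fun p => by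
      rw [iota_apply, op_smul, smul_assoc, op_e_smul_iota, h3, rslice_nil_pathδ]
    simp only [this]
    simp only [← map_smul, ← map_sum]
    rw [sum_smul_pathδ, h2 x hx]
  | zero => simp
  | add x y _ _ hx hy =>
    have : ∀ p, op ((x + y) (sh p)) • Φ.iota k (ρ (pathδ p)) =
        op (x (sh p)) • Φ.iota k (ρ (pathδ p)) + op (y (sh p)) • Φ.iota k (ρ (pathδ p)) :=
      fun p => add_smul (op (x (sh p))) (op (y (sh p))) _
    simp only [this, Finset.sum_add_distrib]
    rw [hx, hy]
  | smul a x _ hx =>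
    conv_rhs => rw [← hx]
    rw [Finset.smul_sum]
    refine Finset.sum_congr rfl fun p _ => ?_
    rw [← mul_smul]
    rfl

instance projective_Kmod (k : ℕ) : Module.Projective Λᵐᵒᵖ (Φ.Kmod n k) := by
  obtain ⟨ρ, h1, h2, h3⟩ := Φ.exists_projection n k
  refine Module.Projective.of_lifting_property'' fun f hf => ?_
  choose m hm using fun p : QPath V k => hf ⟨Φ.iota k (ρ (pathδ p)), Φ.iota_mem_Kmod (h1 _)⟩
  refine ⟨{ toFun := fun F => ∑ p, op (F.1 (sh p)) • m p
            map_add' := fun F G => ?_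
            map_smul' := fun a F => ?_ }, ?_⟩
  · rw [← Finset.sum_add_distrib]
    exact Finset.sum_congr rfl fun p _ => add_smul (op (F.1 (sh p))) (op (G.1 (sh p))) _
  · rw [Finset.smul_sum]
    exact Finset.sum_congr rfl fun p _ => mul_smul a (op (F.1 (sh p))) _
  · refine LinearMap.ext fun F => Subtype.ext ?_
    have := Φ.sum_op_smul_iota_projection h2 h3 F.2
    change (f (∑ p, op (F.1 (sh p)) • m p)).1 = F.1
    rw [map_sum, Submodule.coe_sum]
    refine Eq.trans ?_ this
    exact Finset.sum_congr rfl fun p _ => by rw [map_smul, hm]; rfl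

/-! ### The graded version of the Koszul complex -/

variable (n) in
/-- The graded module `J_k ⊗ Λ`, generated in degree `k`. -/
def KG (k : ℕ) : GrMod (GrAlg.ofGraded 𝒜) where
  obj i := ({ carrier := { F | F ∈ Φ.Kmod n k ∧ (i < k → F = 0) ∧
                ∀ l : ℕ, (k : ℤ) + l = i → ∀ p, F (sh p) ∈ 𝒜 l }
              add_mem' := fun hF hG => ⟨add_mem hF.1 hG.1,
                fun h => by rw [hF.2.1 h, hG.2.1 h, add_zero],
                fun l hl p => add_mem (hF.2.2 l hl p) (hG.2.2 l hl p)⟩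
              zero_mem' := ⟨zero_mem _, fun _ => rfl, fun l _ p => zero_mem _⟩
              smul_mem' := fun c F hF => ⟨by
                have : c • F = op (algebraMap K Λ c) • F := funext fun s => by
                  rw [Pi.smul_apply, Pi.smul_apply, op_smul_eq_mul, Algebra.smul_def,
                    Algebra.commutes]
                rw [this]
                exact Submodule.smul_mem _ _ hF.1,
                fun h => by rw [hF.2.1 h, smul_zero],
                fun l hl p => Submodule.smul_mem _ _ (hF.2.2 l hl p)⟩ } : Submodule K (Fn Λ V k))
  act {i j l} h := LinearMap.mk₂ K
    (fun F a => ⟨op a.1 • F.1, Submodule.smul_mem _ _ F.2.1, fun hl => by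
        rw [F.2.2.1 (by omega), smul_zero], fun l' hl' p => by
        by_cases hi : i < k
        · rw [F.2.2.1 hi, smul_zero]
          exact zero_mem _
        · obtain ⟨i', hi'⟩ := Int.le.dest (not_lt.1 hi)
          obtain rfl : l' = i' + j := by omega
          exact SetLike.mul_mem_graded (F.2.2.2 i' hi' p) a.2⟩)
    (fun F G a => Subtype.ext (smul_add _ _ _))
    (fun c F a => Subtype.ext (smul_comm _ _ _))
    (fun F a b => Subtype.ext (add_smul (op a.1) (op b.1) _))
    (fun c F a => Subtype.ext (smul_assoc c (op a.1) F.1))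
  act_one x := Subtype.ext (one_smul _ x.1)
  act_act hij h hjk h' x a b := Subtype.ext (by
    change op b.1 • (op a.1 • x.1) = op (a.1 * b.1) • x.1
    rw [op_mul, mul_smul])

variable (n) in
/-- The underlying function on paths of a homogeneous element of `J_k ⊗ Λ`. -/
def KGval (k : ℕ) (i : ℤ) : (Φ.KG n k).obj i →ₗ[K] Fn Λ V k := Submodule.subtype _

theorem KG_ext {k : ℕ} {i : ℤ} {F G : (Φ.KG n k).obj i}
    (h : Φ.KGval n k i F = Φ.KGval n k i G) : F = G := Subtype.ext h

theorem KGval_mem {k : ℕ} {i : ℤ} (F : (Φ.KG n k).obj i) : Φ.KGval n k i F ∈ Φ.Kmod n k := F.2.1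

/-- The value of a homogeneous element of `J_k ⊗ Λ` at a path. -/
def KGcoef {k l : ℕ} {i : ℤ} (h : (k : ℤ) + l = i) (p : QPath V k) :
    (Φ.KG n k).obj i →ₗ[K] (GrAlg.ofGraded 𝒜).obj l where
  toFun F := ⟨Φ.KGval n k i F (sh p), F.2.2.2 l h p⟩
  map_add' _ _ := rfl
  map_smul' _ _ := rfl

theorem KGcoef_act {k l j lj : ℕ} {i i' : ℤ} (h : (k : ℤ) + l = i) (h' : i + j = i')
    (h'' : (k : ℤ) + lj = i') (hlj : l + j = lj) (p : QPath V k) (F : (Φ.KG n k).obj i)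
    (a : (GrAlg.ofGraded 𝒜).obj j) :
    Φ.KGcoef h'' p ((Φ.KG n k).act h' F a) = (GrAlg.ofGraded 𝒜).mul hlj (Φ.KGcoef h p F) a := rfl

/-- The element of degree `k` of `J_k ⊗ Λ` given by an element of `J_k`. -/
def KGι {k : ℕ} {y : PathSpace V K k} (hy : y ∈ Φ.J n k) : (Φ.KG n k).obj k :=
  ⟨Φ.iota k y, Φ.iota_mem_Kmod hy, fun h => absurd h (lt_irrefl _), fun l hl p => by
    obtain rfl : l = 0 := by omega
    exact Φ.kap_mem _ _ _⟩

/-- The element of degree `t = k + l` of `J_k ⊗ Λ` given by an element of `J_k ⊗ KQ_l`. -/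
def KGκ {k l t : ℕ} (h : k + l = t) {y : PathSpace V K t}
    (hy : ∀ q, rslice h q y ∈ Φ.J n k) : (Φ.KG n k).obj t :=
  ⟨Φ.kap h y, Φ.kap_mem_Kmod h hy, fun h' => absurd h' (by omega), fun l' hl' p => by
    obtain rfl : l' = l := by omega
    exact Φ.kap_mem _ _ _⟩

theorem exists_KGκ (hgen : Algebra.adjoin K ((𝒜 0 : Set Λ) ∪ 𝒜 1) = ⊤) {k l t : ℕ}
    (h : k + l = t) (F : (Φ.KG n k).obj t) :
    ∃ (y : _) (hy : ∀ q, rslice h q y ∈ Φ.J n k), F = Φ.KGκ h hy := by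
  obtain ⟨y, hy, hy'⟩ := Φ.eq_kap_of_mem_Kmod hgen h F.2.1 (F.2.2.2 l (by omega))
  exact ⟨y, hy, Subtype.ext hy'⟩

theorem KG_eq_zero {k : ℕ} {i : ℤ} (hi : i < k) (F : (Φ.KG n k).obj i) : F = 0 :=
  Subtype.ext (F.2.2.1 hi)

theorem KG_eq_top (hgen : Algebra.adjoin K ((𝒜 0 : Set Λ) ∪ 𝒜 1) = ⊤) {k : ℕ}
    (X : GrMod.Submod (Φ.KG n k)) (hX : X.carrier k = ⊤) (i : ℤ) : X.carrier i = ⊤ := by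
  refine eq_top_iff.2 fun F _ => ?_
  by_cases hi : i < k
  · rw [Φ.KG_eq_zero hi F]
    exact zero_mem _
  · obtain ⟨l, hl⟩ := Int.le.dest (not_lt.1 hi)
    obtain rfl : ((k + l : ℕ) : ℤ) = i := by omega
    obtain ⟨y, hy, rfl⟩ := Φ.exists_KGκ hgen rfl F
    have : Φ.KGκ rfl hy = ∑ q : QPath V l, (Φ.KG n k).act (by push_cast; rfl) (Φ.KGι (hy q))
        ⟨Φ.pathProd q, Φ.pathProd_mem q⟩ := Φ.KG_ext (by
      rw [map_sum]
      exact Φ.kap_eq_sum rfl y)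
    rw [this]
    exact Submodule.sum_mem _ fun q _ => X.act_mem _ (hX ▸ Submodule.mem_top) _

instance projective_KG (k : ℕ) : Projective (Φ.KG n k) where
  factors {N' N} f g hg := by
    obtain ⟨ρ, h1, h2, h3⟩ := Φ.exists_projection n k
    choose m hm using fun p : QPath V k =>
      GrMod.surjective_of_epi g k (f.app k (Φ.KGι (h1 (pathδ p))))
    -- A lift of `f` is determined by lifts `m p` of the values of `f` at the elements `ρ p ∈ J_k`.
    let lift : ∀ i, (Φ.KG n k).obj i →ₗ[K] N'.obj i := fun i =>
      if hi : (k : ℤ) ≤ i then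
        ∑ p, (N'.act (show (k : ℤ) + (i - k).toNat = i by omega) (m p)) ∘ₗ
          Φ.KGcoef (by omega) p
      else 0
    have hlift : ∀ (l : ℕ) (i : ℤ) (hi : (k : ℤ) + l = i) (F : (Φ.KG n k).obj i),
        lift i F = ∑ p, N'.act hi (m p) (Φ.KGcoef hi p F) := by
      intro l i hi F
      obtain rfl : l = (i - k).toNat := by omega
      have hi' : (k : ℤ) ≤ i := by omega
      simp only [lift, dif_pos hi', LinearMap.sum_apply]
      rfl
    refine ⟨{ app := lift, comm := ?_ }, ?_⟩
    · intro i j l h F a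
      by_cases hi : i < k
      · rw [Φ.KG_eq_zero hi F]
        simp
      · obtain ⟨i', hi'⟩ := Int.le.dest (not_lt.1 hi)
        rw [hlift (i' + j) l (by push_cast; omega), hlift i' i hi', map_sum, LinearMap.sum_apply]
        refine Finset.sum_congr rfl fun p _ => ?_
        rw [N'.act_act hi' h rfl (by push_cast; omega), Φ.KGcoef_act hi' h _ rfl]
    · refine GrMod.hom_ext fun i => LinearMap.ext fun F => ?_
      rw [GrMod.comp_app_apply]
      change g.app i (lift i F) = _
      by_cases hi : i < k
      · rw [Φ.KG_eq_zero hi F]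
        simp
      · obtain ⟨l, hl⟩ := Int.le.dest (not_lt.1 hi)
        rw [hlift l i hl, map_sum]
        have : F = ∑ p, (Φ.KG n k).act hl (Φ.KGι (h1 (pathδ p)))
            (Φ.KGcoef hl p F) := Φ.KG_ext (by
          rw [map_sum]
          exact (Φ.sum_op_smul_iota_projection h2 h3 F.2.1).symm)
        conv_rhs => rw [this, map_sum]
        refine Finset.sum_congr rfl fun p _ => ?_
        rw [g.comm, f.comm, hm]

variable (n) in
/-- The differentials of the graded Koszul complex. -/
def dKG {k c t : ℕ} (h : k + c = t) : Φ.KG n t ⟶ Φ.KG n k where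
  app i :=
    { toFun := fun F => ⟨Φ.dmap h F.1, Φ.dmap_mem_Kmod h F.2.1, fun hi => by
          rw [F.2.2.1 (by omega), map_zero], fun l hl p => by
          by_cases hi : i < t
          · rw [F.2.2.1 hi, map_zero]
            exact zero_mem _
          · obtain ⟨i', hi'⟩ := Int.le.dest (not_lt.1 hi)
            obtain rfl : l = c + i' := by omega
            rw [dmap_apply]
            refine Submodule.sum_mem _ fun q _ =>
              SetLike.mul_mem_graded (Φ.pathProd_mem q) ?_
            by_cases hpq : p.tgt = q.src
            · rw [atJoin_join h _ p q hpq]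
              exact F.2.2.2 i' hi' _
            · rw [atJoin_of_ne h _ hpq]
              exact zero_mem _⟩
      map_add' := fun F G => Subtype.ext (map_add _ _ _)
      map_smul' := fun c F => Subtype.ext ((Φ.dmap h).map_smul_of_tower c F.1) }
  comm h' F a := Subtype.ext ((Φ.dmap h).map_smul (op a.1) F.1)

theorem dKG_app_val {k c t : ℕ} (h : k + c = t) {i : ℤ} (F : (Φ.KG n t).obj i) :
    Φ.KGval n k i ((Φ.dKG n h).app i F) = Φ.dmap h (Φ.KGval n t i F) := rfl

end QuiverOf

end

section

namespace GrMod

variable {K : Type u} [Field K] {A : GrAlg.{u, u} K}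

/-! ### Comparison of projective resolutions, one step at a time -/

/-- A graded module generated in degree `s` vanishes in smaller degrees. -/
theorem GeneratedIn.eq_zero_of_lt {s : ℤ} {M : GrMod A} (hM : GeneratedIn {s} M) {i : ℤ}
    (hi : i < s) (x : M.obj i) : x = 0 := by
  classical
  let X : Submod M :=
    { carrier := fun i => if s ≤ i then ⊤ else ⊥
      act_mem := fun {i j l} h {x} hx a => by
        by_cases hi : s ≤ i
        · rw [if_pos (by omega)]; trivial
        · rw [if_neg hi, Submodule.mem_bot] at hx
          rw [hx, map_zero, LinearMap.zero_apply]
          exact zero_mem _ }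
  have h1 : X.carrier i = ⊤ := hM.eq_top X (by rintro _ rfl; exact if_pos le_rfl) i
  have h2 : X.carrier i = ⊥ := if_neg (not_le.2 hi)
  have : x ∈ X.carrier i := h1 ▸ Submodule.mem_top
  rwa [h2, Submodule.mem_bot] at this

/-- Let `P₃ → P₂ → P₁` be exact with `P₂` projective, and `P₂` and `P₃` generated in the degrees
`s < s'`. A map `d : K₂ → K₁ ≅ P₁` with `K₂` projective and generated in degree `s`, whose image is
contained in that of `P₂ → P₁`, has the same image and extends to an isomorphism of maps, as soon as
in degree `s` it is injective and has the right image. -/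
theorem exists_iso_of_generatedIn {K₁ K₂ P₁ P₂ P₃ : GrMod A} (d : K₂ ⟶ K₁) (p : P₂ ⟶ P₁)
    (q : P₃ ⟶ P₂) (θ : K₁ ≅ P₁) [Projective K₂] [Projective P₂] {s s' : ℤ} (hs : s < s')
    (hP₂ : GeneratedIn {s} P₂) (hP₃ : GeneratedIn {s'} P₃)
    (hpq : ∀ i, LinearMap.ker (p.app i) = LinearMap.range (q.app i))
    (hK₂ : ∀ X : Submod K₂, X.carrier s = ⊤ → ∀ i, X.carrier i = ⊤)
    (hd : ∀ i x, θ.hom.app i (d.app i x) ∈ LinearMap.range (p.app i))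
    (hinj : ∀ x, d.app s x = 0 → x = 0)
    (hsurj : ∀ x, θ.hom.app s x ∈ LinearMap.range (p.app s) → x ∈ LinearMap.range (d.app s)) :
    (∀ i x, θ.hom.app i x ∈ LinearMap.range (p.app i) → x ∈ LinearMap.range (d.app i)) ∧
    ∃ θ₂ : K₂ ≅ P₂, ∀ i x, p.app i (θ₂.hom.app i x) = θ.hom.app i (d.app i x) := by
  -- In degree `s` the map `p` is injective, as `P₃` vanishes there.
  have hp : ∀ y : P₂.obj s, p.app s y = 0 → y = 0 := fun y hy => by
    have : y ∈ LinearMap.ker (p.app s) := hy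
    rw [hpq] at this
    obtain ⟨z, rfl⟩ := this
    rw [hP₃.eq_zero_of_lt hs z, map_zero]
  -- Since `K₂` is projective, `θ ∘ d` lifts along `P₂ → Im p` to a map `t : K₂ ⟶ P₂`.
  let p' : P₂ ⟶ (range p).toMod :=
    { app := fun i => LinearMap.rangeRestrict (p.app i)
      comm := fun h x a => Subtype.ext (p.comm h x a) }
  let d' : K₂ ⟶ (range p).toMod :=
    { app := fun i => LinearMap.codRestrict _ (θ.hom.app i ∘ₗ d.app i) (hd i)
      comm := fun h x a => Subtype.ext (by
        change θ.hom.app _ (d.app _ _) = _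
        rw [d.comm, θ.hom.comm]; rfl) }
  have : Epi p' := epi_of_surjective p' fun i => LinearMap.surjective_rangeRestrict _
  let t : K₂ ⟶ P₂ := Projective.factorThru d' p'
  have ht : ∀ i x, p.app i (t.app i x) = θ.hom.app i (d.app i x) := fun i x => by
    have h1 : t ≫ p' = d' := Projective.factorThru_comp d' p'
    exact congrArg Subtype.val (LinearMap.congr_fun (congrArg (fun f => Hom.app f i) h1) x)
  have hθ : ∀ i, Function.Injective (θ.hom.app i) := fun i => (bijective_of_iso θ i).1
  have ht_inj : ∀ x : K₂.obj s, t.app s x = 0 → x = 0 := fun x hx => by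
    refine hinj x (hθ s ?_)
    rw [← ht, hx, map_zero, map_zero]
  -- `t` is bijective in degree `s`, hence surjective, as `P₂` is generated in degree `s`.
  have ht_surj : ∀ i, Function.Surjective (t.app i) := by
    have := hP₂.eq_top (range t) (by
      rintro _ rfl
      refine eq_top_iff.2 fun y _ => ?_
      obtain ⟨x, hx⟩ := (bijective_of_iso θ _).2 (p.app _ y)
      obtain ⟨z, rfl⟩ := hsurj x ⟨y, hx.symm⟩
      refine ⟨z, ?_⟩
      rw [← sub_eq_zero]
      refine hp _ ?_
      rw [map_sub, ht, hx, sub_self])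
    exact fun i => LinearMap.range_eq_top.1 (this i)
  have : Epi t := epi_of_surjective t ht_surj
  -- A section of `t` is surjective as well, as `K₂` is generated in degree `s`; so `t` is
  -- bijective.
  let σ : P₂ ⟶ K₂ := Projective.factorThru (𝟙 P₂) t
  have hσ : ∀ i y, t.app i (σ.app i y) = y := fun i y => by
    have h1 : σ ≫ t = 𝟙 P₂ := Projective.factorThru_comp _ _
    exact LinearMap.congr_fun (congrArg (fun f => Hom.app f i) h1) y
  have hσ_surj : ∀ i, LinearMap.range (σ.app i) = ⊤ := hK₂ (range σ) (by
    refine eq_top_iff.2 fun x _ => ⟨t.app s x, ?_⟩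
    rw [← sub_eq_zero]
    exact ht_inj _ (by rw [map_sub, hσ, sub_self]))
  have ht_bij : ∀ i, Function.Bijective (t.app i) := fun i => by
    refine ⟨(injective_iff_map_eq_zero _).2 fun x hx => ?_, ht_surj i⟩
    obtain ⟨y, rfl⟩ := LinearMap.range_eq_top.1 (hσ_surj i) x
    rw [hσ] at hx
    rw [hx, map_zero]
  refine ⟨fun i x ⟨y, hy⟩ => ?_, isoOfBijective t ht_bij, ht⟩
  obtain ⟨z, rfl⟩ := ht_surj i y
  exact ⟨z, hθ i (by rw [← ht, hy])⟩

theorem degZero_act_zero {i l : ℤ} (h : i + (0 : ℕ) = l) (x : (degZero A).obj i) (a : A.obj 0) :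
    ((degZero A).act h x a).1 = A.mul (Nat.add_zero 0) x.1 a := rfl

theorem degZero_act_pos {i l : ℤ} {j : ℕ} (h : i + j = l) (hj : 0 < j) (x : (degZero A).obj i)
    (a : A.obj j) : ((degZero A).act h x a).1 = 0 := by
  have h1 : (degZero A).act h x a = 0 := dif_neg (by omega)
  rw [h1]
  rfl

end GrMod

/-! ### Exactness of the graded Koszul complex -/

theorem delta_zero (n : ℕ) : delta n 0 = 0 := by simp [delta]
theorem delta_one (n : ℕ) : delta n 1 = 1 := by simp [delta]
theorem delta_two (n : ℕ) : delta n 2 = n := by simp [delta]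

/-- `δ(j + 1) - δ(j)`. -/
def stp (n j : ℕ) : ℕ := if j % 2 = 0 then 1 else n - 1

theorem delta_add_stp {n : ℕ} (hn : 2 ≤ n) (j : ℕ) : delta n j + stp n j = delta n (j + 1) := by
  unfold delta stp
  split_ifs with h
  · have h1 : (j + 1) / 2 = j / 2 := by omega
    rw [h1]; omega
  · have h1 : (j + 1) / 2 = j / 2 + 1 := by omega
    rw [h1, add_mul]; omega

theorem delta_add_two (n j : ℕ) : delta n j + n = delta n (j + 1 + 1) := by
  unfold delta
  have h1 : (j + 1 + 1) / 2 = j / 2 + 1 := by omega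
  have h2 : (j + 1 + 1) % 2 = j % 2 := by omega
  rw [h1, h2, add_mul]; omega

theorem stp_lt {n : ℕ} (hn : 2 ≤ n) (j : ℕ) : stp n j < n := by
  unfold stp; split_ifs <;> omega

theorem stp_pos {n : ℕ} (hn : 2 ≤ n) (j : ℕ) : 0 < stp n j := by
  unfold stp; split_ifs <;> omega

theorem stp_add_stp {n : ℕ} (hn : 2 ≤ n) (j : ℕ) : stp n j + stp n (j + 1) = n := by
  unfold stp; split_ifs <;> omega

namespace QuiverOf

variable {K : Type u} [Field K] {Λ : Type u} [Ring Λ] [Algebra K Λ]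
  {𝒜 : ℕ → Submodule K Λ} [GradedAlgebra 𝒜] {V : Type v} [Quiver.{w + 1} V]
  (Φ : QuiverOf 𝒜 V) [Finite V] [∀ a b : V, Finite (a ⟶ b)] {n : ℕ}

theorem relations_eq_bot_of_lt (hΛ : Φ.IsNHomogeneous n) {k : ℕ} (hk : k < n) :
    Φ.relations k = ⊥ := by
  rw [hΛ.2, idealGen, Submodule.span_eq_bot]
  rintro _ ⟨i, l, j, h, h', _⟩
  omega

/-- There are no relations in degrees `l < n`, so `KQ_{k + l}` embeds in `KQ_k ⊗ Λ_l`. -/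
theorem kap_injective (hΛ : Φ.IsNHomogeneous n) {k l t : ℕ} (h : k + l = t) (hl : l < n)
    {y z : PathSpace V K t} (hy : Φ.kap h y = Φ.kap h z) : y = z := by
  rw [← sub_eq_zero, ← map_sub, kap_eq_zero_iff, Φ.relations_eq_bot_of_lt hΛ hl] at hy
  exact lslice_ext h fun p => by
    rw [← sub_eq_zero, ← map_sub]; exact hy p

/-- The components of the augmentation `Λ → Λ_0` of the Koszul complex. -/
def augLin {k : ℕ} (hk : k = 0) (i : ℤ) : (Φ.KG n k).obj i →ₗ[K] (GrAlg.ofGraded 𝒜).obj 0 :=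
  if h : i = 0 then ∑ p : QPath V k, Φ.KGcoef (by simp [h, hk]) p else 0

section Augmentation

variable {k : ℕ} (hk : k = 0)

theorem augLin_of_eq {i : ℤ} (h : (k : ℤ) + (0 : ℕ) = i) (F : (Φ.KG n k).obj i) :
    Φ.augLin hk i F = ∑ p : QPath V k, Φ.KGcoef h p F := by
  have hi : i = 0 := by simpa [hk] using h.symm
  rw [augLin, dif_pos hi, LinearMap.sum_apply]

theorem augLin_of_ne {i : ℤ} (h : i ≠ 0) (F : (Φ.KG n k).obj i) : Φ.augLin hk i F = 0 := by
  rw [augLin, dif_neg h, LinearMap.zero_apply]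

/-- The augmentation `Λ → Λ_0` of the Koszul complex. -/
def augKG : Φ.KG n k ⟶ GrMod.degZero (GrAlg.ofGraded 𝒜) where
  app i := LinearMap.codRestrict _ (Φ.augLin hk i) fun F h => Φ.augLin_of_ne hk h F
  comm {i j l} h F a := Subtype.ext (by
    rcases Nat.eq_zero_or_pos j with hj | hj
    · subst hj
      obtain rfl : i = l := by simpa using h
      refine Eq.trans ?_ (GrMod.degZero_act_zero _ _ _).symm
      change Φ.augLin hk i _ = (GrAlg.ofGraded 𝒜).mul _ (Φ.augLin hk i F) a
      by_cases hi : i = 0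
      · have hi' : (k : ℤ) + (0 : ℕ) = i := by simp [hi, hk]
        rw [augLin_of_eq _ _ hi', augLin_of_eq _ _ hi', map_sum, LinearMap.sum_apply]
        exact Finset.sum_congr rfl fun p _ => Φ.KGcoef_act _ h _ rfl p F a
      · rw [augLin_of_ne _ _ hi, augLin_of_ne _ _ hi, map_zero, LinearMap.zero_apply]
    · refine Eq.trans ?_ (GrMod.degZero_act_pos _ hj _ _).symm
      change Φ.augLin hk l _ = 0
      by_cases hl : l = 0
      · rw [Φ.KG_eq_zero (show i < k by omega) F, map_zero, LinearMap.zero_apply, map_zero]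
      · rw [augLin_of_ne _ _ hl])

theorem augKG_app_eq_zero_iff {i : ℤ} (F : (Φ.KG n k).obj i) :
    (Φ.augKG hk).app i F = 0 ↔ Φ.augLin hk i F = 0 := Subtype.ext_iff

theorem augLin_KGι {y : PathSpace V K k} (hy : y ∈ Φ.J n k) :
    Φ.augLin hk k (Φ.KGι hy) = ∑ p : QPath V k, y p • Φ.e p.tgt := by
  refine (Φ.augLin_of_eq hk (by simp) _).trans ?_
  exact Finset.sum_congr rfl fun p _ => Subtype.ext (Φ.iota_apply y p)

theorem augLin_KGι_injective {y : PathSpace V K k} (hy : y ∈ Φ.J n k)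
    (h : Φ.augLin hk k (Φ.KGι hy) = 0) : y = 0 := by
  have := Fintype.ofFinite V
  rw [augLin_KGι] at h
  subst hk
  rw [← Equiv.sum_comp (QPath.zeroEquiv (V := V)).symm] at h
  have h' := Fintype.linearIndependent_iff.1 Φ.e.linearIndependent
    (fun a => y (QPath.zeroEquiv.symm a)) h
  funext p
  rw [← QPath.zeroEquiv.symm_apply_apply p]
  exact h' _

theorem augLin_surjective (hn : 0 < n) (a : (GrAlg.ofGraded 𝒜).obj 0) :
    ∃ F, Φ.augLin (n := n) hk k F = a := by
  have := Fintype.ofFinite V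
  subst hk
  refine ⟨Φ.KGι (Φ.mem_J_of_lt hn fun p => Φ.e.repr a p.tgt), ?_⟩
  rw [augLin_KGι, ← Equiv.sum_comp (QPath.zeroEquiv (V := V)).symm]
  exact Φ.e.sum_repr a

end Augmentation

/-- The differential from the term `j + 1` to the term `j` of the Koszul complex. -/
abbrev dK (hn : 2 ≤ n) (j : ℕ) : Φ.KG n (delta n (j + 1)) ⟶ Φ.KG n (delta n j) :=
  Φ.dKG n (delta_add_stp hn j)

theorem dKG_KGκ {k c k' l t cl : ℕ} (h : k + c = k') (h' : k' + l = t) (hc : c + l = cl)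
    (hh : k + cl = t) {y : PathSpace V K t} (hy : ∀ q, rslice h' q y ∈ Φ.J n k') :
    Φ.KGval n k t ((Φ.dKG n h).app t (Φ.KGκ h' hy)) = Φ.kap hh y := Φ.dmap_kap h h' hc hh y

theorem dKG_KGι {k c k' : ℕ} (h : k + c = k') {y : PathSpace V K k'} (hy : y ∈ Φ.J n k') :
    Φ.KGval n k k' ((Φ.dKG n h).app k' (Φ.KGι hy)) = Φ.kap h y :=
  Φ.dmap_kap h (Nat.add_zero _) (Nat.add_zero _) h y

theorem exists_KGι (hgen : Algebra.adjoin K ((𝒜 0 : Set Λ) ∪ 𝒜 1) = ⊤) {k : ℕ}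
    (F : (Φ.KG n k).obj k) : ∃ (y : _) (hy : y ∈ Φ.J n k), F = Φ.KGι hy := by
  have := Fintype.ofFinite V
  obtain ⟨y, hy, rfl⟩ := Φ.exists_KGκ hgen (Nat.add_zero k) F
  refine ⟨y, ?_, rfl⟩
  rw [← sum_rslice_nil (Nat.add_zero k) y]
  exact Submodule.sum_mem _ fun a _ => hy _

theorem augKG_dK (hn : 2 ≤ n) (i : ℤ) (F : (Φ.KG n (delta n 1)).obj i) :
    (Φ.augKG (delta_zero n)).app i ((Φ.dK hn 0).app i F) = 0 := by
  rw [augKG_app_eq_zero_iff]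
  by_cases hi : i = 0
  · rw [Φ.KG_eq_zero (by rw [hi, delta_one]; simp) F, map_zero, map_zero]
  · exact Φ.augLin_of_ne _ hi _

/-- Two consecutive differentials of the Koszul complex compose to zero, as together they multiply
the last `n` arrows of elements of `J_{δ(j + 2)}`, which form relations, into `Λ`. -/
theorem dmap_dmap_of_mem_Kmod (hn : 2 ≤ n) (j : ℕ) {F : Fn Λ V (delta n (j + 1 + 1))}
    (hF : F ∈ Φ.Kmod n (delta n (j + 1 + 1))) :
    Φ.dmap (delta_add_stp hn j) (Φ.dmap (delta_add_stp hn (j + 1)) F) = 0 := by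
  rw [Φ.dmap_dmap (hc := stp_add_stp hn j) (hh := delta_add_two n j)]
  induction hF using Submodule.span_induction with
  | mem F hF =>
    obtain ⟨y, hy, rfl⟩ := hF
    rw [Φ.dmap_kap _ _ (Nat.add_zero n) (delta_add_two n j), kap_eq_zero_iff]
    intro p
    rw [← Φ.J_self]
    exact Φ.lslice_mem_J _ _ hy
  | zero => exact map_zero _
  | add x y _ _ hx hy => rw [map_add, hx, hy, add_zero]
  | smul a x _ hx => rw [map_smul, hx, smul_zero]

theorem dK_comp (hn : 2 ≤ n) (j : ℕ) (i : ℤ) (F : (Φ.KG n (delta n (j + 1 + 1))).obj i) :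
    (Φ.dK hn j).app i ((Φ.dK hn (j + 1)).app i F) = 0 :=
  Φ.KG_ext (Φ.dmap_dmap_of_mem_Kmod hn j (Φ.KGval_mem F))

section Koszul

variable (hn : 2 ≤ n) (hΛ : Φ.IsNHomogeneous n)
include hn hΛ

/-- The differentials of the Koszul complex are injective in the smallest degree of their source. -/
theorem dK_injective (j : ℕ) (F : (Φ.KG n (delta n (j + 1))).obj (delta n (j + 1) : ℕ))
    (hF : (Φ.dK hn j).app _ F = 0) : F = 0 := by
  obtain ⟨y, hy, rfl⟩ := Φ.exists_KGι hΛ.1 F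
  have h1 := Φ.dKG_KGι (delta_add_stp hn j) hy
  rw [hF, map_zero] at h1
  have h2 : y = 0 := Φ.kap_injective hΛ _ (stp_lt hn j) (h1.symm.trans (map_zero _).symm)
  subst h2
  exact Φ.KG_ext (map_zero (Φ.iota _))

/-- An element of `J_{δ(j)} ⊗ Λ` of degree `δ(j + 1)` that comes from `J_{δ(j + 1)}` is a boundary.
-/
theorem mem_range_dK_of_mem_J (j : ℕ) {y : PathSpace V K (delta n (j + 1))}
    (hy' : ∀ q, rslice (delta_add_stp hn j) q y ∈ Φ.J n (delta n j))
    (hy : y ∈ Φ.J n (delta n (j + 1))) :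
    Φ.KGκ (delta_add_stp hn j) hy' ∈
      LinearMap.range ((Φ.dK hn j).app (delta n (j + 1) : ℕ)) :=
  ⟨Φ.KGι hy, Φ.KG_ext (Φ.dKG_KGι _ hy)⟩

end Koszul

end QuiverOf

end

section

namespace QuiverOf

variable {K : Type u} [Field K] {Λ : Type u} [Ring Λ] [Algebra K Λ]
  {𝒜 : ℕ → Submodule K Λ} [GradedAlgebra 𝒜] {V : Type v} [Quiver.{w + 1} V]
  (Φ : QuiverOf 𝒜 V) [Finite V] [∀ a b : V, Finite (a ⟶ b)] {n : ℕ}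

/-- The cycles of the graded Koszul complex augmented by `Λ_0`. -/
def cyc (hn : 2 ≤ n) : ∀ j, GrMod.Submod (Φ.KG n (delta n j))
  | 0 => GrMod.ker (Φ.augKG (delta_zero n))
  | j + 1 => GrMod.ker (Φ.dK hn j)

variable (n) in
/-- The relations of degree `n` satisfy the extra condition: an element of `KQ_{n + r}`, `r < n`,
belongs to `J_{n + r}` as soon as it belongs to `I_n KQ_r` and to `KQ_r I_n`. -/
def ExtraCondition : Prop :=
  ∀ (r t : ℕ) (h : n + r = t) (h' : r + n = t) (z : PathSpace V K t), r < n →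
    (∀ q, rslice h q z ∈ Φ.relations n) → (∀ p, lslice h' p z ∈ Φ.relations n) → z ∈ Φ.J n t

/-- Exactness of the Koszul complex at its term `J_n ⊗ Λ` gives the extra condition. -/
theorem extraCondition_of_exact (hn : 2 ≤ n) (hΛ : Φ.IsNHomogeneous n) {k k' k'' c c' : ℕ}
    (h : k + c = k') (h' : k' + c' = k'') (hk : k = 1) (hk' : k' = n) (hc' : c' = 1)
    (hex : ∀ i x, (Φ.dKG n h).app i x = 0 → x ∈ LinearMap.range ((Φ.dKG n h').app i)) :
    Φ.ExtraCondition n := by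
  have := Fintype.ofFinite V
  subst hk hk' hc'
  intro r
  induction r with
  | zero =>
    intro t ht ht' z _ hz _
    obtain rfl : k' = t := by omega
    rw [J_self, ← sum_rslice_nil ht z]
    exact Submodule.sum_mem _ fun a _ => hz _
  | succ r ih =>
    intro t ht ht' z hr hz1 hz2
    have hzJ : ∀ q, rslice ht q z ∈ Φ.J k' k' := fun q => by rw [J_self]; exact hz1 q
    -- `z` defines an element of `J_n ⊗ Λ_{r + 1}`, which is a cycle as the last `n` arrows of `z`
    -- form relations.
    have h1 : (Φ.dKG k' h).app t (Φ.KGκ ht hzJ) = 0 := by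
      refine Φ.KG_ext ?_
      rw [Φ.dKG_KGκ h ht rfl (by omega) hzJ, map_zero,
        ← Φ.dmap_kap (Nat.add_comm 1 r) ht' (by omega) (by omega) z,
        (Φ.kap_eq_zero_iff ht' z).2 hz2,
        map_zero]
    -- By exactness it is the image of some `z'`, and there are no relations in degree `r + 1 < n`,
    -- so `z = z'` belongs to `J_{n + 1} KQ_r`.
    obtain ⟨G, hG⟩ := hex _ _ h1
    obtain ⟨z', hz', rfl⟩ := Φ.exists_KGκ hΛ.1 (show k'' + r = t by omega) G
    have h2 := congrArg (Φ.KGval k' k' t) hG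
    rw [Φ.dKG_KGκ h' _ (Nat.add_comm 1 r) ht hz'] at h2
    obtain rfl : z' = z := Φ.kap_injective hΛ ht hr h2
    rw [mem_J_iff]
    intro i l j hi hl p q
    rcases Nat.eq_zero_or_pos i with rfl | hi'
    · obtain rfl : k' = l := by omega
      obtain rfl : j = r + 1 := by omega
      rw [QPath.eq_nil p]
      exact Φ.lslice_nil_mem_relations _ (hz1 q) _
    -- A slice of length `n` that does not start at the beginning is a slice of `z` without its
    -- first arrow, to which the induction hypothesis applies.
    · obtain ⟨i, rfl⟩ : ∃ i', i = 1 + i' := ⟨i - 1, by omega⟩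
      have h3 : lslice (show 1 + (k' + r) = t by omega) (p.take rfl) z' ∈ Φ.J k' (k' + r) := by
        refine ih _ rfl (Nat.add_comm _ _) _ (by omega) (fun s => ?_) fun s => ?_
        · rw [← rslice_lslice (show 1 + k' = k'' by omega) rfl (by omega) (by omega),
            ← J_self]
          exact Φ.lslice_mem_J _ _ (hz' s)
        · rcases lslice_lslice' (Nat.add_comm 1 r) (Nat.add_comm r k') ht' (by omega)
            (p.take rfl) s z' with h0 | ⟨s', h4, h5⟩
          · rw [h0]; exact zero_mem _
          · rw [← h4, ← h5, lslice_lslice (Nat.add_comm 1 r) (Nat.add_comm r k') ht' (by omega)]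
            exact hz2 s'
      rw [mem_J_iff] at h3
      have h6 := h3 i (i + k') j rfl (by omega) (p.drop rfl) q
      rw [← rslice_lslice (ij := l) (by omega) (by omega) hl (by omega), lslice_lslice] at h6
      exact h6

/-- The description of the cycles of degree `δ(j + 2)` in the term `J_{δ(j + 1)} ⊗ Λ` of the Koszul
complex. The extra condition is needed only for even `j > 0`. -/
theorem mem_J_of_cycle (hn : 2 ≤ n) (j : ℕ) (hj : j % 2 = 1 ∨ j = 0 ∨ Φ.ExtraCondition n)
    {y : PathSpace V K (delta n (j + 1 + 1))}
    (hy : ∀ q, rslice (delta_add_stp hn (j + 1)) q y ∈ Φ.J n (delta n (j + 1)))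
    (hy' : ∀ p, lslice (delta_add_two n j) p y ∈ Φ.relations n) :
    y ∈ Φ.J n (delta n (j + 1 + 1)) := by
  have e1 := delta_add_stp hn (j + 1)
  have e2 := delta_add_two n j
  have e3 := delta_add_stp hn j
  have e4 := stp_add_stp hn j
  rw [mem_J_iff]
  intro i l b hi hl p q
  -- A slice of length `n` at the very end of `y`.
  rcases Nat.eq_zero_or_pos b with rfl | hb
  · obtain rfl : i = delta n j := by omega
    rw [rslice_lslice (jk := n) hi (Nat.add_zero n) hl e2, QPath.eq_nil q]
    exact Φ.rslice_nil_mem_relations _ (hy' p) _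
  -- A slice of length `n` within the first `δ(j + 1)` arrows.
  by_cases hb' : stp n (j + 1) ≤ b
  · obtain ⟨b', rfl⟩ : ∃ b', b = b' + stp n (j + 1) := ⟨b - stp n (j + 1), by omega⟩
    rw [← rslice_rslice (i := l) (ij := delta n (j + 1)) (by omega) rfl e1 hl]
    exact Φ.mem_J_iff.1 (hy _) _ _ _ _ _ _ _
  -- In the remaining case `δ(j + 2) - δ(j + 1) = n - 1`, and the extra condition applies to the
  -- last `2 n - 1` arrows.
  · have hs : stp n (j + 1) = n - 1 := by
      unfold stp at hb' ⊢
      split_ifs at hb' ⊢ <;> omega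
    have hj2 : ¬ (j % 2 = 1) := by
      intro h
      have : stp n (j + 1) = 1 := by unfold stp; rw [if_pos (by omega)]
      omega
    have hδ : n ≤ delta n j ∨ j = 0 := by
      rcases Nat.lt_or_ge j 2 with h | h
      · right; omega
      · left
        unfold delta
        have : 1 * n ≤ j / 2 * n := Nat.mul_le_mul_right n (by omega)
        omega
    rcases hδ with hδ | rfl
    swap
    · have := delta_zero n
      omega
    rcases hj with hj | rfl | hj
    · exact absurd hj hj2
    · have := delta_zero n
      omega
    obtain ⟨i', hi'⟩ : ∃ i', (delta n j - (n - 1)) + i' = i := ⟨i - (delta n j - (n - 1)), by omega⟩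
    have h3 : lslice (show delta n j - (n - 1) + (n + (n - 1)) = delta n (j + 1 + 1) by omega)
        (p.take hi') y ∈ Φ.J n (n + (n - 1)) := by
      refine hj (n - 1) _ rfl (Nat.add_comm _ _) _ (by omega) (fun s => ?_) fun s => ?_
      · have e5 : delta n (j + 1) + (n - 1) = delta n (j + 1 + 1) := by omega
        rw [← rslice_lslice (ij := delta n (j + 1)) (by omega) rfl e5 (by omega), ← J_self]
        refine Φ.lslice_mem_J _ _ ?_
        have : ∀ (c : ℕ) (h : delta n (j + 1) + c = delta n (j + 1 + 1)) (s : QPath V c),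
            rslice h s y ∈ Φ.J n (delta n (j + 1)) := by
          intro c h s
          obtain rfl : c = stp n (j + 1) := by omega
          exact hy s
        exact this _ _ s
      · rcases lslice_lslice' (ij := delta n j) (by omega) (Nat.add_comm (n - 1) n) e2 (by omega)
            (p.take hi') s y with h0 | ⟨s', h4, h5⟩
        · rw [h0]; exact zero_mem _
        · rw [← h4, ← h5, lslice_lslice _ _ e2]
          exact hy' s'
    rw [mem_J_iff] at h3
    have h6 := h3 i' (i' + n) b rfl (by omega) (p.drop hi') q
    rw [← rslice_lslice (ij := l) (by omega) (by omega) hl (by omega), lslice_lslice] at h6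
    exact h6

/-- A cycle of degree `δ(j + 1)` in the term `j` of the Koszul complex is a boundary. -/
theorem mem_range_dK_of_mem_cyc (hn : 2 ≤ n) (hΛ : Φ.IsNHomogeneous n) (j : ℕ)
    (hj : j % 2 = 0 ∨ j = 1 ∨ Φ.ExtraCondition n)
    (x : (Φ.KG n (delta n j)).obj (delta n (j + 1) : ℕ))
    (hx : x ∈ (Φ.cyc hn j).carrier _) :
    x ∈ LinearMap.range ((Φ.dK hn j).app (delta n (j + 1) : ℕ)) := by
  obtain ⟨y, hy, rfl⟩ := Φ.exists_KGκ hΛ.1 (delta_add_stp hn j) x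
  refine Φ.mem_range_dK_of_mem_J hn hΛ j hy ?_
  cases j with
  | zero => exact Φ.mem_J_of_lt (by rw [delta_one]; omega) _
  | succ j =>
    refine Φ.mem_J_of_cycle hn j (by rcases hj with hj | hj | hj; · omega
                                     · omega
                                     · exact Or.inr (Or.inr hj)) hy ?_
    have h1 := congrArg (Φ.KGval n _ _) (show (Φ.dK hn j).app _ _ = 0 from hx)
    rw [Φ.dKG_KGκ _ _ (stp_add_stp hn j) (delta_add_two n j), map_zero, kap_eq_zero_iff] at h1
    exact h1

theorem dK_mem_cyc (hn : 2 ≤ n) (j : ℕ) (i : ℤ)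
    (x : (Φ.KG n (delta n (j + 1))).obj i) : (Φ.dK hn j).app i x ∈ (Φ.cyc hn j).carrier i := by
  cases j with
  | zero => exact Φ.augKG_dK hn i x
  | succ j => exact Φ.dK_comp hn j i x

section Resolution

variable (hn : 2 ≤ n) (hΛ : Φ.IsNHomogeneous n) {P : ℕ → GrMod (GrAlg.ofGraded 𝒜)}
  {d : ∀ j, P (j + 1) ⟶ P j} {ε : P 0 ⟶ GrMod.degZero (GrAlg.ofGraded 𝒜)}
  (hP : ∀ j, Projective (P j) ∧ (P j).GeneratedIn {(delta n j : ℤ)})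
  (hex : ∀ i, Function.Surjective (ε.app i) ∧
      LinearMap.ker (ε.app i) = LinearMap.range ((d 0).app i) ∧
      ∀ j, LinearMap.ker ((d j).app i) = LinearMap.range ((d (j + 1)).app i))
include hn hΛ hP hex

/-- The augmentation of the Koszul complex is isomorphic to that of the given resolution. -/
theorem exists_iso_zero : ∃ θ : Φ.KG n (delta n 0) ≅ P 0, ∀ i x,
    θ.hom.app i x ∈ LinearMap.range ((d 0).app i) ↔ x ∈ (Φ.cyc hn 0).carrier i := by
  have := (hP 0).1
  have h0 := delta_zero n
  have hs : (delta n 0 : ℤ) < delta n 1 := by rw [delta_zero, delta_one]; simp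
  obtain ⟨-, θ, hθ⟩ := GrMod.exists_iso_of_generatedIn (Φ.augKG (n := n) h0) ε (d 0) (Iso.refl _) hs
    (hP 0).2 (hP 1).2 (fun i => (hex i).2.1) (fun X hX i => Φ.KG_eq_top hΛ.1 X hX i)
    (fun i x => (hex i).1 _) (fun x hx => by
      obtain ⟨y, hy, rfl⟩ := Φ.exists_KGι hΛ.1 x
      have := Φ.augLin_KGι_injective h0 hy ((Φ.augKG_app_eq_zero_iff h0 _).1 hx)
      subst this
      exact Φ.KG_ext (map_zero (Φ.iota _)))
    (fun x _ => by
      obtain ⟨F, hF⟩ := Φ.augLin_surjective h0 (show 0 < n by omega) x.1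
      exact ⟨F, Subtype.ext hF⟩)
  refine ⟨θ, fun i x => ?_⟩
  rw [← (hex i).2.1, LinearMap.mem_ker, hθ]
  rfl

/-- One step of the comparison of the Koszul complex with the given resolution: an isomorphism
between the terms `j` which matches cycles with cycles gives exactness at the term `j` and such an
isomorphism between the terms `j + 1`. -/
theorem exists_iso_succ (j : ℕ) (hj : j % 2 = 0 ∨ j = 1 ∨ Φ.ExtraCondition n)
    (h : ∃ θ : Φ.KG n (delta n j) ≅ P j, ∀ i x,
      θ.hom.app i x ∈ LinearMap.range ((d j).app i) ↔ x ∈ (Φ.cyc hn j).carrier i) :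
    (∀ i, ∀ x ∈ (Φ.cyc hn j).carrier i, x ∈ LinearMap.range ((Φ.dK hn j).app i)) ∧
    ∃ θ : Φ.KG n (delta n (j + 1)) ≅ P (j + 1), ∀ i x,
      θ.hom.app i x ∈ LinearMap.range ((d (j + 1)).app i) ↔
        x ∈ (Φ.cyc hn (j + 1)).carrier i := by
  obtain ⟨θ₁, hθ₁⟩ := h
  have := (hP (j + 1)).1
  have hs : (delta n (j + 1) : ℤ) < delta n (j + 1 + 1) := by
    rw [← delta_add_stp hn (j + 1)]
    have := stp_pos hn (j + 1)
    push_cast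
    omega
  obtain ⟨h1, θ, hθ⟩ := GrMod.exists_iso_of_generatedIn (Φ.dK hn j) (d j) (d (j + 1)) θ₁ hs
    (hP (j + 1)).2 (hP (j + 1 + 1)).2 (fun i => (hex i).2.2 j)
    (fun X hX i => Φ.KG_eq_top hΛ.1 X hX i)
    (fun i x => (hθ₁ i _).2 (Φ.dK_mem_cyc hn j i x))
    (Φ.dK_injective hn hΛ j)
    (fun x hx => Φ.mem_range_dK_of_mem_cyc hn hΛ j hj x ((hθ₁ _ _).1 hx))
  refine ⟨fun i x hx => h1 i x ((hθ₁ i x).2 hx), θ, fun i x => ?_⟩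
  rw [← (hex i).2.2 j, LinearMap.mem_ker, hθ]
  constructor
  · intro h
    exact (GrMod.bijective_of_iso θ₁ i).1 (h.trans (map_zero _).symm)
  · intro h
    rw [show (Φ.dK hn j).app i x = 0 from h, map_zero]

end Resolution

/-- The Koszul complex of an `n`-Koszul algebra is exact. -/
theorem exact_KG (hn : 2 ≤ n) (hΛ : Φ.IsNKoszul n) (j : ℕ) (i : ℤ)
    (x : (Φ.KG n (delta n j)).obj i) (hx : x ∈ (Φ.cyc hn j).carrier i) :
    x ∈ LinearMap.range ((Φ.dK hn j).app i) := by
  obtain ⟨hH, P, d, ε, hP, hex⟩ := hΛ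
  have h0 := Φ.exists_iso_zero hn hH hP hex
  have h1 := Φ.exists_iso_succ hn hH hP hex 0 (by simp) h0
  have h2 := Φ.exists_iso_succ hn hH hP hex 1 (by simp) h1.2
  have h3 := Φ.exists_iso_succ hn hH hP hex 2 (by simp) h2.2
  -- The first steps do not involve the extra condition, and exactness at `J_n ⊗ Λ` yields it.
  have hE : Φ.ExtraCondition n := by
    refine Φ.extraCondition_of_exact hn hH (delta_add_stp hn 1) (delta_add_stp hn 2)
      (delta_one n) (delta_two n) (by simp [stp]) fun i x hx => h3.1 i x hx
  have h : ∀ j, ∃ θ : Φ.KG n (delta n j) ≅ P j, ∀ i x,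
      θ.hom.app i x ∈ LinearMap.range ((d j).app i) ↔ x ∈ (Φ.cyc hn j).carrier i := by
    intro j
    induction j with
    | zero => exact h0
    | succ j ih => exact (Φ.exists_iso_succ hn hH hP hex j (Or.inr (Or.inr hE)) ih).2
  exact (Φ.exists_iso_succ hn hH hP hex j (Or.inr (Or.inr hE)) (h j)).1 i x hx

end QuiverOf

end

section

/-! ### Extensions computed by a minimal resolution -/

open Abelian Limits

/-- A projective resolution of `Z_0`, cut into short exact sequences `0 → Z_{j+1} → P_j → Z_j → 0`.
-/
structure SyzygyTower (C : Type*) [Category* C] [Abelian C] where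
  Z : ℕ → C
  P : ℕ → C
  i : ∀ j, Z (j + 1) ⟶ P j
  p : ∀ j, P j ⟶ Z j
  zero : ∀ j, i j ≫ p j = 0
  exact : ∀ j, (ShortComplex.mk (i j) (p j) (zero j)).ShortExact
  proj : ∀ j, Projective (P j)

namespace SyzygyTower

variable {C : Type*} [Category* C] [Abelian C] [HasExt.{u} C] (T : SyzygyTower C) {S : C}

/-- The class of the extension `0 → Z_{j+1} → P_j → Z_j → 0`. -/
def cls (j : ℕ) : Ext (T.Z j) (T.Z (j + 1)) 1 := (T.exact j).extClass

/-- The Yoneda product of the classes of the extensions `0 → Z_{i+1} → P_i → Z_i → 0`, `i < j`. -/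
def Ω : ∀ j, Ext (T.Z 0) (T.Z j) j
  | 0 => Ext.mk₀ (𝟙 _)
  | j + 1 => (Ω j).comp (T.cls j) rfl

/-- Every map from `P_j` to `S` vanishes on `Z_{j+1}`. -/
def IsMinimal (S : C) : Prop := ∀ j (f : T.P j ⟶ S), T.i j ≫ f = 0

/-- Dimension shifting: the connecting map `Ext^a(Z_{j+1}, S) → Ext^{a+1}(Z_j, S)` is bijective,
also for `a = 0`, where injectivity is the minimality of the resolution. -/
theorem cls_comp_bijective (hS : T.IsMinimal S) (j : ℕ) {a b : ℕ} (h : 1 + a = b) :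
    Function.Bijective fun x : Ext (T.Z (j + 1)) S a => (T.cls j).comp x h := by
  have := T.proj j
  subst h
  constructor
  · refine (injective_iff_map_eq_zero ((T.cls j).precomp S rfl)).2 fun x hx => ?_
    obtain ⟨y, rfl⟩ := Ext.contravariant_sequence_exact₁ (T.exact j) S x rfl hx
    cases a with
    | zero =>
      obtain ⟨f, rfl⟩ := (Ext.mk₀_bijective _ _).2 y
      rw [Ext.mk₀_comp_mk₀]
      exact (congrArg Ext.mk₀ (hS j f)).trans (Ext.mk₀_zero _ _)
    | succ a => rw [Ext.eq_zero_of_projective y, Ext.comp_zero]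
  · intro y
    have h : 1 + a = a + 1 := by omega
    have H : ∀ c (hc : 1 + a = c) (y : Ext (T.Z j) S c), ∃ x, (T.cls j).comp x hc = y := by
      rintro _ hc y
      obtain rfl : _ = a + 1 := hc.symm.trans h
      exact Ext.contravariant_sequence_exact₃ (T.exact j) S y (Ext.eq_zero_of_projective _) hc
    exact H _ rfl y

theorem Ω_comp_bijective (hS : T.IsMinimal S) (j : ℕ) : ∀ {a b : ℕ} (h : j + a = b),
    Function.Bijective fun x : Ext (T.Z j) S a => (T.Ω j).comp x h := by
  induction j with
  | zero =>
    intro a b h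
    obtain rfl : a = b := by omega
    simp only [Ω, Ext.mk₀_id_comp]
    exact Function.bijective_id
  | succ j ih =>
    intro a b h
    have h2 := (ih (show j + (1 + a) = b by omega)).comp (T.cls_comp_bijective hS j rfl)
    convert h2 using 1
    funext x
    exact Ext.comp_assoc _ _ _ _ _ (by omega)

/-- A map of degree `-j` from a resolution to itself. -/
structure Shift (j : ℕ) where
  z : ∀ t, T.Z (j + t) ⟶ T.Z t
  c : ∀ t, T.P (j + t) ⟶ T.P t
  p_z : ∀ t, T.p (j + t) ≫ z t = c t ≫ T.p t
  i_c : ∀ t, T.i (j + t) ≫ c t = z (t + 1) ≫ T.i t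

variable {T}

theorem Shift.cls_comp {j : ℕ} (s : T.Shift j) (t : ℕ) :
    (T.cls (j + t)).comp (Ext.mk₀ (s.z (t + 1))) (add_zero 1) =
      (Ext.mk₀ (s.z t)).comp (T.cls t) (zero_add 1) :=
  ShortComplex.ShortExact.extClass_naturality (T.exact (j + t)) (T.exact t)
    { τ₁ := s.z (t + 1)
      τ₂ := s.c t
      τ₃ := s.z t
      comm₁₂ := (s.i_c t).symm
      comm₂₃ := (s.p_z t).symm }

/-- The iterated extensions `Ω` are natural with respect to shifts of the resolution. -/
theorem Shift.Ω_comp {j : ℕ} (s : T.Shift j) (t : ℕ) :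
    (T.Ω (j + t)).comp (Ext.mk₀ (s.z t)) (add_zero (j + t)) =
      (T.Ω j).comp ((Ext.mk₀ (s.z 0)).comp (T.Ω t) (zero_add t)) rfl := by
  induction t with
  | zero =>
    change (T.Ω j).comp _ _ = (T.Ω j).comp ((Ext.mk₀ (s.z 0)).comp (Ext.mk₀ (𝟙 _)) _) _
    rw [Ext.comp_mk₀_id]
  | succ t ih =>
    change ((T.Ω (j + t)).comp (T.cls (j + t)) rfl).comp (Ext.mk₀ (s.z (t + 1))) _ =
      (T.Ω j).comp ((Ext.mk₀ (s.z 0)).comp ((T.Ω t).comp (T.cls t) rfl) _) _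
    rw [Ext.comp_assoc _ _ _ _ (add_zero 1) (by omega), s.cls_comp,
      ← Ext.comp_assoc _ _ _ (add_zero (j + t)) _ (by omega), ih,
      Ext.comp_assoc _ _ _ _ (show t + 1 = t + 1 from rfl) (by omega),
      Ext.comp_assoc _ _ _ _ _ (by omega)]

variable (T) (e : S ≅ T.Z 0)

/-- The element of `Ext^j(S, S)` given by a map from the `j`-th syzygy of `S ≅ Z_0` to `S`. -/
def extOf (j : ℕ) (f : T.Z j ⟶ S) : Ext S S j :=
  (Ext.mk₀ e.hom).comp ((T.Ω j).comp (Ext.mk₀ f) (add_zero j)) (zero_add j)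

theorem extOf_add (j : ℕ) (f g : T.Z j ⟶ S) :
    T.extOf e j (f + g) = T.extOf e j f + T.extOf e j g := by
  simp [extOf, Ext.mk₀_add]

theorem extOf_smul {R : Type*} [Ring R] [Linear R C] (j : ℕ) (r : R) (f : T.Z j ⟶ S) :
    T.extOf e j (r • f) = r • T.extOf e j f := by
  simp [extOf, Ext.mk₀_smul]

theorem extOf_zero_right (j : ℕ) : T.extOf e j 0 = 0 := by
  simp [extOf, Ext.mk₀_zero]

theorem extOf_bijective (hS : T.IsMinimal S) (j : ℕ) : Function.Bijective (T.extOf e j) := by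
  have h1 : Function.Bijective fun x : Ext (T.Z 0) S j => (Ext.mk₀ e.hom).comp x (zero_add j) := by
    refine Function.bijective_iff_has_inverse.2
      ⟨fun y => (Ext.mk₀ e.inv).comp y (zero_add j), fun x => ?_, fun x => ?_⟩
    · simp
    · simp
  exact h1.comp ((T.Ω_comp_bijective hS j (add_zero j)).comp (Ext.mk₀_bijective _ _))

theorem extOf_zero : T.extOf e 0 e.inv = Ext.mk₀ (𝟙 S) := by
  simp [extOf, Ω]

/-- The Yoneda product of the classes of `g : Z_j ⟶ S` and `f : Z_i ⟶ S` is the class of `f`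
composed with a lift of `g` to the resolution. -/
theorem extOf_comp {i j k : ℕ} (h : j + i = k) (s : T.Shift j) (f : T.Z i ⟶ S) (g : T.Z j ⟶ S)
    (hg : s.z 0 = g ≫ e.hom) (f' : T.Z k ⟶ S) (hf' : f' = eqToHom (by rw [h]) ≫ s.z i ≫ f) :
    (T.extOf e j g).comp (T.extOf e i f) h = T.extOf e k f' := by
  subst h
  rw [eqToHom_refl, Category.id_comp] at hf'
  subst hf'
  have h1 := s.Ω_comp i
  rw [hg, ← Ext.mk₀_comp_mk₀] at h1
  unfold extOf
  rw [← Ext.mk₀_comp_mk₀,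
    ← Ext.comp_assoc (T.Ω (j + i)) _ _ (add_zero (j + i)) (add_zero 0) (by omega), h1]
  simp only [Ext.comp_assoc_of_second_deg_zero, Ext.comp_assoc_of_third_deg_zero]
  rw [Ext.comp_assoc _ _ _ (zero_add j) rfl (by omega), Ext.comp_assoc_of_second_deg_zero]

end SyzygyTower

end

section

open MulOpposite

/-! ### The Koszul complex as a resolution of `Λ_0` by right `Λ`-modules -/

namespace QuiverOf

variable {K : Type u} [Field K] {Λ : Type u} [Ring Λ] [Algebra K Λ]
  {𝒜 : ℕ → Submodule K Λ} [GradedAlgebra 𝒜] {V : Type v} [Quiver.{w + 1} V]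
  (Φ : QuiverOf 𝒜 V) [Finite V] [∀ a b : V, Finite (a ⟶ b)] {n : ℕ}

/-- The homogeneous component of a function with values in `Λ`. -/
def hcomp (𝒜 : ℕ → Submodule K Λ) [GradedAlgebra 𝒜] {k : ℕ} (l : ℕ) (F : Fn Λ V k) : Fn Λ V k :=
  fun s => (DirectSum.decompose 𝒜 (F s) l : 𝒜 l)

theorem exists_sum_hcomp {k : ℕ} (F : Fn Λ V k) :
    ∃ T : Finset ℕ, F = ∑ l ∈ T, hcomp 𝒜 l F := by
  classical
  have := Fintype.ofFinite (PIdx.{u} V k)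
  refine ⟨Finset.univ.biUnion fun s => (DirectSum.decompose 𝒜 (F s)).support, ?_⟩
  funext s
  rw [Finset.sum_apply]
  conv_lhs => rw [← DirectSum.sum_support_decompose 𝒜 (F s)]
  refine Finset.sum_subset (Finset.subset_biUnion_of_mem
    (fun s => (DirectSum.decompose 𝒜 (F s)).support) (Finset.mem_univ s)) fun l _ hl => ?_
  rw [DFinsupp.notMem_support_iff.1 hl]
  rfl

theorem exists_KG_hcomp (hgen : Algebra.adjoin K ((𝒜 0 : Set Λ) ∪ 𝒜 1) = ⊤) {k l t : ℕ}
    (h : k + l = t) {F : Fn Λ V k} (hF : F ∈ Φ.Kmod n k) :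
    ∃ G : (Φ.KG n k).obj t, Φ.KGval n k t G = hcomp 𝒜 l F := by
  obtain ⟨y, hy, hy'⟩ := Φ.exists_kap_of_mem_Kmod hgen h hF
  exact ⟨Φ.KGκ h hy, fn_ext fun p => (hy' p).symm⟩

theorem dmap_hcomp {k c t l : ℕ} (h : k + c = t) (F : Fn Λ V t) :
    Φ.dmap h (hcomp 𝒜 l F) = hcomp 𝒜 (c + l) (Φ.dmap h F) := by
  refine fn_ext fun p => ?_
  change _ = ((DirectSum.decompose 𝒜 _ (c + l) : 𝒜 (c + l)) : Λ)
  rw [dmap_apply, dmap_apply, DirectSum.decompose_sum, DFinsupp.finsetSum_apply,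
    Submodule.coe_sum]
  refine Finset.sum_congr rfl fun q _ => ?_
  rw [DirectSum.coe_decompose_mul_add_of_left_mem 𝒜 (Φ.pathProd_mem q)]
  congr 1
  exact atJoin_map (fun x => ((DirectSum.decompose 𝒜 x l : 𝒜 l) : Λ)) (by simp) h
    (fun r => F (sh r)) p q

/-- An element of a term of the ungraded Koszul complex whose homogeneous components are cycles is a
boundary. -/
theorem exists_of_hcomp {j : ℕ} (hn : 2 ≤ n) (hΛ : Φ.IsNKoszul n) {F : Fn Λ V (delta n j)}
    (hF : F ∈ Φ.Kmod n (delta n j))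
    (hcyc : ∀ l t (_ : delta n j + l = t) (G : (Φ.KG n (delta n j)).obj t),
      Φ.KGval n _ t G = hcomp 𝒜 l F → G ∈ (Φ.cyc hn j).carrier t) :
    ∃ G ∈ Φ.Kmod n (delta n (j + 1)), Φ.dmap (delta_add_stp hn j) G = F := by
  obtain ⟨T, hT⟩ := exists_sum_hcomp (𝒜 := 𝒜) F
  have : ∀ l, ∃ G ∈ Φ.Kmod n (delta n (j + 1)), Φ.dmap (delta_add_stp hn j) G = hcomp 𝒜 l F := by
    intro l
    obtain ⟨G, hG⟩ := Φ.exists_KG_hcomp hΛ.1.1 rfl hF (l := l)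
    obtain ⟨H, hH⟩ := Φ.exact_KG hn hΛ j _ G (hcyc l _ rfl G hG)
    refine ⟨_, Φ.KGval_mem H, ?_⟩
    rw [← hG, ← hH, dKG_app_val]
  choose G hG hG' using this
  refine ⟨∑ l ∈ T, G l, Submodule.sum_mem _ fun l _ => hG l, ?_⟩
  rw [map_sum]
  conv_rhs => rw [hT]
  exact Finset.sum_congr rfl fun l _ => hG' l

theorem exists_of_dmap_eq_zero {j : ℕ} (hn : 2 ≤ n) (hΛ : Φ.IsNKoszul n)
    {F : Fn Λ V (delta n (j + 1))} (hF : F ∈ Φ.Kmod n (delta n (j + 1)))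
    (hF' : Φ.dmap (delta_add_stp hn j) F = 0) :
    ∃ G ∈ Φ.Kmod n (delta n (j + 1 + 1)), Φ.dmap (delta_add_stp hn (j + 1)) G = F := by
  refine Φ.exists_of_hcomp hn hΛ hF fun l t h G hG => ?_
  refine Φ.KG_ext ?_
  rw [dKG_app_val, hG, dmap_hcomp, hF', map_zero]
  funext s
  simp [hcomp]

theorem exists_of_sum_eq_zero (hn : 2 ≤ n) (hΛ : Φ.IsNKoszul n)
    {F : Fn Λ V (delta n 0)} (hF : F ∈ Φ.Kmod n (delta n 0))
    (hF' : ∑ p, GradedRing.projZeroRingHom' 𝒜 (F (sh p)) = 0) :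
    ∃ G ∈ Φ.Kmod n (delta n 1), Φ.dmap (delta_add_stp hn 0) G = F := by
  refine Φ.exists_of_hcomp hn hΛ hF fun l t h G hG => ?_
  refine (Φ.augKG_app_eq_zero_iff _ _).2 ?_
  by_cases ht : (t : ℤ) = 0
  · have hl : l = 0 := by omega
    subst hl
    have ht' : ((delta n 0 : ℕ) : ℤ) + (0 : ℕ) = t := by push_cast; omega
    refine (Φ.augLin_of_eq _ ht' G).trans (Eq.trans ?_ hF')
    refine Finset.sum_congr rfl fun p _ => Subtype.ext ?_
    exact congrFun hG (sh p)
  · exact Φ.augLin_of_ne _ ht G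

variable (n) in
/-- The term `J_{δ(j)} ⊗ Λ` of the Koszul complex. -/
abbrev KM (j : ℕ) : Type u := Φ.Kmod n (delta n j)

/-- The differential of the Koszul complex. -/
def dM (hn : 2 ≤ n) (j : ℕ) : Φ.KM n (j + 1) →ₗ[Λᵐᵒᵖ] Φ.KM n j :=
  (Φ.dmap (delta_add_stp hn j)).restrict fun _ hF => Φ.dmap_mem_Kmod _ hF

theorem dM_dM (hn : 2 ≤ n) (j : ℕ) (F : Φ.KM n (j + 1 + 1)) :
    Φ.dM hn j (Φ.dM hn (j + 1) F) = 0 := Subtype.ext (Φ.dmap_dmap_of_mem_Kmod hn j F.2)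

/-- The homogeneous element of degree `0` of `Λ_0` attached to an element of the module `Λ_0`. -/
def dzVal : degZeroModule 𝒜 →+ 𝒜 0 := AddMonoidHom.id _

theorem dzVal_injective : Function.Injective (dzVal (𝒜 := 𝒜)) := fun _ _ h => h

theorem dzVal_smul (a : Λᵐᵒᵖ) (x : degZeroModule 𝒜) :
    dzVal (a • x) = dzVal x * GradedRing.projZeroRingHom' 𝒜 a.unop := rfl

theorem smul_mul_degZero (c : K) (a b : 𝒜 0) : (c • a) * b = c • (a * b) :=
  Subtype.ext (smul_mul_assoc c (a : Λ) (b : Λ))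

/-- The linear map from `J_{δ(j)} ⊗ Λ` to `Λ_0` given by a functional `γ` on `KQ_{δ(j)}`: it maps
the function `F` on paths to `∑ γ(p) F(p)_0`. -/
def funcM (j : ℕ) (γ : PathSpace V K (delta n j)) : Φ.KM n j →ₗ[Λᵐᵒᵖ] degZeroModule 𝒜 where
  toFun F := (∑ p, γ p • GradedRing.projZeroRingHom' 𝒜 (F.1 (sh p)) : 𝒜 0)
  map_add' F G := by
    refine dzVal_injective ?_
    change (∑ p, γ p • GradedRing.projZeroRingHom' 𝒜 (F.1 (sh p) + G.1 (sh p)) : 𝒜 0) =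
      (∑ p, γ p • GradedRing.projZeroRingHom' 𝒜 (F.1 (sh p)) : 𝒜 0) +
      (∑ p, γ p • GradedRing.projZeroRingHom' 𝒜 (G.1 (sh p)) : 𝒜 0)
    simp only [map_add, smul_add, Finset.sum_add_distrib]
  map_smul' a F := by
    change (∑ p, γ p • GradedRing.projZeroRingHom' 𝒜 (F.1 (sh p) * a.unop) : 𝒜 0) =
      (∑ p, γ p • GradedRing.projZeroRingHom' 𝒜 (F.1 (sh p)) : 𝒜 0) *
        GradedRing.projZeroRingHom' 𝒜 a.unop
    simp only [map_mul, Finset.sum_mul]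
    exact Finset.sum_congr rfl fun p _ => (smul_mul_degZero _ _ _).symm

theorem dzVal_funcM (j : ℕ) (γ : PathSpace V K (delta n j)) (F : Φ.KM n j) :
    dzVal (Φ.funcM j γ F) = ∑ p, γ p • GradedRing.projZeroRingHom' 𝒜 (F.1 (sh p)) := rfl

/-- Linear maps from `J_{δ(j)} ⊗ Λ` are determined by their values on `J_{δ(j)}`. -/
theorem KM_hom_ext {j : ℕ} {M : Type*} [AddCommGroup M] [Module Λᵐᵒᵖ M]
    {f g : Φ.KM n j →ₗ[Λᵐᵒᵖ] M}
    (h : ∀ y (hy : y ∈ Φ.J n (delta n j)), f ⟨Φ.iota _ y, Φ.iota_mem_Kmod hy⟩ =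
      g ⟨Φ.iota _ y, Φ.iota_mem_Kmod hy⟩) : f = g := by
  refine LinearMap.ext fun ⟨F, hF⟩ => ?_
  induction hF using Submodule.span_induction with
  | mem F hF =>
    obtain ⟨y, hy, rfl⟩ := hF
    exact h y hy
  | zero => exact (map_zero f).trans (map_zero g).symm
  | add x y hx' hy' hx hy =>
    have e : (⟨x + y, add_mem hx' hy'⟩ : Φ.KM n j) = ⟨x, hx'⟩ + ⟨y, hy'⟩ := rfl
    rw [e, map_add, map_add, hx, hy]
  | smul a x hx' hx =>
    have e : (⟨a • x, Submodule.smul_mem _ a hx'⟩ : Φ.KM n j) = a • ⟨x, hx'⟩ := rfl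
    rw [e, map_smul, map_smul, hx]

theorem projZero_of_mem_of_pos {l : ℕ} (hl : 0 < l) {a : Λ} (ha : a ∈ 𝒜 l) :
    GradedRing.projZeroRingHom' 𝒜 a = 0 :=
  Subtype.ext (DirectSum.decompose_of_mem_ne 𝒜 ha (by omega))

theorem projZero_of_mem {a : Λ} (ha : a ∈ 𝒜 0) :
    (GradedRing.projZeroRingHom' 𝒜 a : Λ) = a :=
  DirectSum.decompose_of_mem_same 𝒜 ha

/-- The Koszul complex is minimal: all maps to `Λ_0` vanish on boundaries. -/
theorem hom_dM (hn : 2 ≤ n) (j : ℕ) (f : Φ.KM n j →ₗ[Λᵐᵒᵖ] degZeroModule 𝒜) :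
    f ∘ₗ Φ.dM hn j = 0 := by
  refine Φ.KM_hom_ext fun y hy => ?_
  have h1 : Φ.dM hn j ⟨Φ.iota _ y, Φ.iota_mem_Kmod hy⟩ =
      ∑ q, op (Φ.pathProd q) • (⟨Φ.iota _ (rslice (delta_add_stp hn j) q y),
        Φ.iota_mem_Kmod (Φ.rslice_mem_J _ q hy)⟩ : Φ.KM n j) := by
    refine Subtype.ext ?_
    rw [Submodule.coe_sum]
    refine Eq.trans ?_ (Φ.kap_eq_sum (delta_add_stp hn j) y)
    exact Φ.dmap_kap _ _ (Nat.add_zero _) _ y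
  rw [LinearMap.comp_apply, h1, map_sum, LinearMap.zero_apply]
  refine Finset.sum_eq_zero fun q _ => dzVal_injective ?_
  rw [map_smul, dzVal_smul, unop_op, projZero_of_mem_of_pos (stp_pos hn j) (Φ.pathProd_mem q),
    mul_zero, map_zero]

theorem exists_dM_eq (hn : 2 ≤ n) (hΛ : Φ.IsNKoszul n) (j : ℕ) (F : Φ.KM n (j + 1))
    (hF : Φ.dM hn j F = 0) : ∃ G, Φ.dM hn (j + 1) G = F := by
  obtain ⟨G, hG, hG'⟩ := Φ.exists_of_dmap_eq_zero hn hΛ F.2 (congrArg Subtype.val hF)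
  exact ⟨⟨G, hG⟩, Subtype.ext hG'⟩

/-- The augmentation of the Koszul complex. -/
abbrev augM : Φ.KM n 0 →ₗ[Λᵐᵒᵖ] degZeroModule 𝒜 := Φ.funcM 0 fun _ => 1

theorem exists_dM_eq_of_augM (hn : 2 ≤ n) (hΛ : Φ.IsNKoszul n) (F : Φ.KM n 0)
    (hF : Φ.augM F = 0) : ∃ G, Φ.dM hn 0 G = F := by
  have h := congrArg dzVal hF
  rw [dzVal_funcM, map_zero] at h
  simp only [one_smul] at h
  obtain ⟨G, hG, hG'⟩ := Φ.exists_of_sum_eq_zero hn hΛ F.2 h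
  exact ⟨⟨G, hG⟩, Subtype.ext hG'⟩

theorem augM_surjective (hn : 2 ≤ n) : Function.Surjective (Φ.augM (n := n)) := by
  intro x
  obtain ⟨F, hF⟩ := Φ.augLin_surjective (n := n) (delta_zero n) (by omega) (dzVal x)
  refine ⟨⟨Φ.KGval _ _ _ F, Φ.KGval_mem F⟩, dzVal_injective ?_⟩
  rw [dzVal_funcM]
  simp only [one_smul]
  rw [Φ.augLin_of_eq _ (by simp)] at hF
  refine Eq.trans ?_ hF
  refine Finset.sum_congr rfl fun p _ => Subtype.ext ?_
  exact projZero_of_mem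
    (Φ.KGcoef (show ((delta n 0 : ℕ) : ℤ) + (0 : ℕ) = (delta n 0 : ℕ) by simp) p F).2

end QuiverOf

end

section

open MulOpposite

/-! ### The Yoneda algebra of an `n`-Koszul algebra -/

namespace QuiverOf

variable {K : Type u} [Field K] {Λ : Type u} [Ring Λ] [Algebra K Λ]
  {𝒜 : ℕ → Submodule K Λ} [GradedAlgebra 𝒜] {V : Type v} [Quiver.{w + 1} V]
  (Φ : QuiverOf 𝒜 V) [Finite V] [∀ a b : V, Finite (a ⟶ b)] {n : ℕ}

/-- The syzygies of `Λ_0` given by the Koszul complex, as cokernels of its differentials. -/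
abbrev ZM (hn : 2 ≤ n) (j : ℕ) : Type u := Φ.KM n j ⧸ LinearMap.range (Φ.dM hn j)

/-- The resolution of `Λ_0` given by the Koszul complex. -/
def tower (hn : 2 ≤ n) (hΛ : Φ.IsNKoszul n) : SyzygyTower (ModuleCat.{u} Λᵐᵒᵖ) where
  Z j := ModuleCat.of _ (Φ.ZM hn j)
  P j := ModuleCat.of _ (Φ.KM n j)
  i j := ModuleCat.ofHom ((LinearMap.range (Φ.dM hn (j + 1))).liftQ (Φ.dM hn j) (by
    rintro _ ⟨F, rfl⟩
    exact Φ.dM_dM hn j F))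
  p j := ModuleCat.ofHom (LinearMap.range (Φ.dM hn j)).mkQ
  zero j := by
    ext F
    exact (Submodule.Quotient.mk_eq_zero _).2 ⟨F, rfl⟩
  exact j :=
    { exact := by
        rw [ShortComplex.moduleCat_exact_iff]
        intro F hF
        obtain ⟨G, rfl⟩ := (Submodule.Quotient.mk_eq_zero _).1 hF
        exact ⟨Submodule.Quotient.mk G, rfl⟩
      mono_f := by
        refine (ModuleCat.mono_iff_injective _).2 ?_
        refine (injective_iff_map_eq_zero _).2 fun x hx => ?_
        obtain ⟨F, rfl⟩ := Submodule.mkQ_surjective _ x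
        exact (Submodule.Quotient.mk_eq_zero _).2 (Φ.exists_dM_eq hn hΛ j F hx)
      epi_g := (ModuleCat.epi_iff_surjective _).2 (Submodule.mkQ_surjective _) }
  proj j := (IsProjective.iff_projective _).1 (Φ.projective_Kmod (delta n j))

/-- The cokernel of the first differential of the Koszul complex is `Λ_0`. -/
def augIso (hn : 2 ≤ n) (hΛ : Φ.IsNKoszul n) : degZeroModule 𝒜 ≅ (Φ.tower hn hΛ).Z 0 :=
  (LinearEquiv.toModuleIso (LinearEquiv.ofBijective
    ((LinearMap.range (Φ.dM hn 0)).liftQ Φ.augM (by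
      rintro _ ⟨F, rfl⟩
      exact LinearMap.congr_fun (Φ.hom_dM hn 0 Φ.augM) F))
    ⟨(injective_iff_map_eq_zero _).2 fun x hx => by
      obtain ⟨F, rfl⟩ := Submodule.mkQ_surjective _ x
      exact (Submodule.Quotient.mk_eq_zero _).2 (Φ.exists_dM_eq_of_augM hn hΛ F hx),
    fun x => by
      obtain ⟨F, rfl⟩ := Φ.augM_surjective hn x
      exact ⟨Submodule.Quotient.mk F, rfl⟩⟩)).symm

theorem isMinimal_tower (hn : 2 ≤ n) (hΛ : Φ.IsNKoszul n) :
    (Φ.tower hn hΛ).IsMinimal (degZeroModule 𝒜) := fun j f => by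
  ext x
  obtain ⟨F, rfl⟩ := Submodule.mkQ_surjective _ x
  exact LinearMap.congr_fun (Φ.hom_dM hn j f.hom) F

/-- The projection of a term of the Koszul complex onto a syzygy. -/
def zmk (hn : 2 ≤ n) (hΛ : Φ.IsNKoszul n) (j : ℕ) : Φ.KM n j →ₗ[Λᵐᵒᵖ] (Φ.tower hn hΛ).Z j :=
  (LinearMap.range (Φ.dM hn j)).mkQ

theorem hom_Z_ext {hn : 2 ≤ n} {hΛ : Φ.IsNKoszul n} {j : ℕ} {M : ModuleCat.{u} Λᵐᵒᵖ}
    {f g : (Φ.tower hn hΛ).Z j ⟶ M}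
    (h : ∀ F : Φ.KM n j, f.hom (Φ.zmk hn hΛ j F) = g.hom (Φ.zmk hn hΛ j F)) :
    f = g := by
  ext x
  obtain ⟨F, rfl⟩ := Submodule.mkQ_surjective _ x
  exact h F

/-- The map from a syzygy to `Λ_0` given by a functional on `KQ_{δ(j)}`. -/
def funcZ (hn : 2 ≤ n) (hΛ : Φ.IsNKoszul n) (j : ℕ) (γ : PathSpace V K (delta n j)) :
    (Φ.tower hn hΛ).Z j ⟶ degZeroModule 𝒜 :=
  show ModuleCat.of Λᵐᵒᵖ (Φ.ZM hn j) ⟶ ModuleCat.of Λᵐᵒᵖ (degZeroModule 𝒜) from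
  ModuleCat.ofHom ((LinearMap.range (Φ.dM hn j)).liftQ (Φ.funcM j γ) (by
    rintro _ ⟨F, rfl⟩
    exact LinearMap.congr_fun (Φ.hom_dM hn j (Φ.funcM j γ)) F))

theorem funcZ_mk (hn : 2 ≤ n) (hΛ : Φ.IsNKoszul n) (j : ℕ) (γ : PathSpace V K (delta n j))
    (F : Φ.KM n j) : (Φ.funcZ hn hΛ j γ).hom (Φ.zmk hn hΛ j F) = Φ.funcM j γ F := rfl

theorem funcZ_add (hn : 2 ≤ n) (hΛ : Φ.IsNKoszul n) (j : ℕ) (γ γ' : PathSpace V K (delta n j)) :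
    Φ.funcZ hn hΛ j (γ + γ') = Φ.funcZ hn hΛ j γ + Φ.funcZ hn hΛ j γ' :=
  Φ.hom_Z_ext fun F => dzVal_injective (by
    rw [ModuleCat.hom_add, LinearMap.add_apply, map_add]
    simp only [funcZ_mk, dzVal_funcM, Pi.add_apply, add_smul, Finset.sum_add_distrib])

theorem dzVal_algebraMap_smul (c : K) (x : degZeroModule 𝒜) :
    dzVal (algebraMap K Λᵐᵒᵖ c • x) = c • dzVal x := by
  rw [dzVal_smul]
  refine Subtype.ext ?_
  rw [SetLike.GradeZero.coe_mul, projZero_of_mem (by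
    rw [MulOpposite.algebraMap_apply, unop_op]; exact SetLike.algebraMap_mem_graded 𝒜 c),
    MulOpposite.algebraMap_apply, unop_op, ← Algebra.commutes, ← Algebra.smul_def]
  rfl

theorem funcZ_smul (hn : 2 ≤ n) (hΛ : Φ.IsNKoszul n) (j : ℕ) (c : K)
    (γ : PathSpace V K (delta n j)) :
    Φ.funcZ hn hΛ j (c • γ) = c • Φ.funcZ hn hΛ j γ :=
  Φ.hom_Z_ext fun F => dzVal_injective (by
    refine Eq.trans ?_ (dzVal_algebraMap_smul c _).symm
    simp only [funcZ_mk, dzVal_funcM, Pi.smul_apply, smul_eq_mul, mul_smul, Finset.smul_sum])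

theorem projZero_iota {k : ℕ} (y : PathSpace V K k) (p : QPath V k) :
    GradedRing.projZeroRingHom' 𝒜 (Φ.iota k y (sh p)) = y p • Φ.e p.tgt := by
  refine Subtype.ext ?_
  rw [iota_apply]
  exact projZero_of_mem (Submodule.smul_mem _ _ (Φ.e _).2)

theorem dzVal_funcM_iota (j : ℕ) (γ : PathSpace V K (delta n j))
    {y : PathSpace V K (delta n j)} (hy : y ∈ Φ.J n (delta n j)) :
    dzVal (Φ.funcM j γ ⟨Φ.iota _ y, Φ.iota_mem_Kmod hy⟩) = ∑ p, (γ p * y p) • Φ.e p.tgt := by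
  rw [dzVal_funcM]
  simp only [projZero_iota, mul_smul]

/-- The coordinate of an element of `Λ_0` at a vertex is the sum of all the coordinates of its
product with the corresponding idempotent. -/
theorem repr_eq_sum_repr_mul [Fintype V] (x : 𝒜 0) (a : V) :
    Φ.e.repr x a = ∑ b, Φ.e.repr (x * Φ.e a) b := by
  classical
  have hx := Φ.e.sum_repr x
  have : x * Φ.e a = Φ.e.repr x a • Φ.e a := by
    conv_lhs => rw [← hx, Finset.sum_mul]
    rw [Finset.sum_eq_single a]
    · rw [smul_mul_degZero]
      congr 1
      exact Subtype.ext (Φ.idem a)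
    · intro b _ hb
      rw [smul_mul_degZero, show Φ.e b * Φ.e a = 0 from Subtype.ext (Φ.orth b a hb), smul_zero]
    · simp
  rw [this, map_smul, Module.Basis.repr_self]
  simp [Finsupp.single_apply]

theorem sum_repr_sum [Fintype V] {k : ℕ} (c : QPath V k → K) :
    ∑ b, Φ.e.repr (∑ p, c p • Φ.e p.tgt) b = ∑ p, c p := by
  classical
  simp only [map_sum, map_smul, Module.Basis.repr_self, Finsupp.coe_finsetSum, Finset.sum_apply,
    Finsupp.smul_apply, Finsupp.single_apply, smul_eq_mul]
  rw [Finset.sum_comm]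
  exact Finset.sum_congr rfl fun p _ => by simp

/-- A functional on `KQ_{δ(j)}` gives the zero map `Z_j → Λ_0` if and only if it vanishes on
`J_{δ(j)}`, whose orthogonal is the component of degree `δ(j)` of the ideal defining `Λ^!`. -/
theorem funcZ_eq_zero_iff (hn : 2 ≤ n) (hΛ : Φ.IsNKoszul n) (j : ℕ)
    (γ : PathSpace V K (delta n j)) :
    Φ.funcZ hn hΛ j γ = 0 ↔ γ ∈ idealGen (Φ.orthogonal n) (delta n j) := by
  have := Fintype.ofFinite V
  rw [mem_idealGen_orthogonal_iff]
  constructor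
  · intro h y hy
    have h1 : Φ.funcM j γ ⟨Φ.iota _ y, Φ.iota_mem_Kmod hy⟩ = 0 := by
      rw [← Φ.funcZ_mk hn hΛ, h]; rfl
    have h2 := congrArg dzVal h1
    rw [Φ.dzVal_funcM_iota j γ hy, map_zero] at h2
    rw [← Φ.sum_repr_sum, h2]
    simp
  · intro h
    have h1 : Φ.funcM j γ = 0 := Φ.KM_hom_ext fun y hy => dzVal_injective (by
      rw [Φ.dzVal_funcM_iota j γ hy, LinearMap.zero_apply, map_zero]
      refine Φ.e.repr.injective (Finsupp.ext fun a => ?_)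
      rw [repr_eq_sum_repr_mul, map_zero, Finsupp.zero_apply,
        ← h _ (Φ.rslice_mem_J (Nat.add_zero _) (QPath.nil a) hy), ← Φ.sum_repr_sum]
      have e : (∑ p, (γ p * y p) • Φ.e p.tgt) * Φ.e a = ∑ p, (γ p *
          rslice (Nat.add_zero _) (QPath.nil a) y p) • Φ.e p.tgt := by
        rw [Finset.sum_mul]
        refine Finset.sum_congr rfl fun p _ => ?_
        rw [smul_mul_degZero]
        rcases rslice_nil (Nat.add_zero _) y a p with ⟨h1, h2⟩ | ⟨h1, h2⟩
        · rw [h2, h1, show Φ.e a * Φ.e a = Φ.e a from Subtype.ext (Φ.idem a)]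
        · rw [h2, show Φ.e p.tgt * Φ.e a = 0 from Subtype.ext (Φ.orth _ _ h1), mul_zero,
            smul_zero, zero_smul]
      rw [e])
    exact Φ.hom_Z_ext fun F => by rw [funcZ_mk, h1]; rfl

/-- Every map from a syzygy to `Λ_0` comes from a functional on `KQ_{δ(j)}`. -/
theorem funcZ_surjective (hn : 2 ≤ n) (hΛ : Φ.IsNKoszul n) (j : ℕ) :
    Function.Surjective (Φ.funcZ hn hΛ j) := by
  have := Fintype.ofFinite V
  intro f
  let f' : Φ.KM n j →ₗ[Λᵐᵒᵖ] degZeroModule 𝒜 := f.hom ∘ₗ (LinearMap.range (Φ.dM hn j)).mkQ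
  have hf' : ∀ (c : K) (F : Φ.KM n j), dzVal (f' (algebraMap K Λᵐᵒᵖ c • F)) = c • dzVal (f' F) :=
    fun c F => by rw [map_smul, dzVal_algebraMap_smul]
  have hι : ∀ (c : K) (y : Φ.J n (delta n j)),
      (⟨Φ.iota _ (c • y.1), Φ.iota_mem_Kmod (Submodule.smul_mem _ c y.2)⟩ : Φ.KM n j) =
        algebraMap K Λᵐᵒᵖ c • ⟨Φ.iota _ y.1, Φ.iota_mem_Kmod y.2⟩ := fun c y =>
    Subtype.ext (funext fun s => by
      change Φ.iota _ (c • y.1) s = Φ.iota _ y.1 s * algebraMap K Λ c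
      rw [map_smul, Pi.smul_apply, Algebra.smul_def, Algebra.commutes])
  -- The functional adds up the coordinates of the values in `Λ_0`. It determines the map, because
  -- the coordinate at a vertex is recovered by slicing with the idempotent of this vertex.
  let ℓ : Φ.J n (delta n j) →ₗ[K] K :=
    { toFun := fun y => ∑ b, Φ.e.repr (dzVal (f' ⟨Φ.iota _ y.1, Φ.iota_mem_Kmod y.2⟩)) b
      map_add' := fun y z => by
        rw [← Finset.sum_add_distrib]
        refine Finset.sum_congr rfl fun b _ => ?_
        rw [← Finsupp.add_apply, ← map_add, ← map_add, ← map_add]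
        congr 4
        exact Subtype.ext (map_add (Φ.iota _) y.1 z.1)
      map_smul' := fun c y => by
        rw [RingHom.id_apply, Finset.smul_sum]
        refine Finset.sum_congr rfl fun b _ => ?_
        rw [← Finsupp.smul_apply, ← map_smul, ← hf', ← hι]
        rfl }
  obtain ⟨ℓ', hℓ'⟩ := LinearMap.exists_extend ℓ
  refine ⟨fun p => ℓ' (pathδ p), ?_⟩
  have h1 : ∀ y : PathSpace V K (delta n j), ∑ p, ℓ' (pathδ p) * y p = ℓ' y := fun y => by
    conv_rhs => rw [← sum_smul_pathδ y]
    rw [map_sum]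
    exact Finset.sum_congr rfl fun p _ => by rw [map_smul, smul_eq_mul, mul_comm]
  have h2 : ∀ y (hy : y ∈ Φ.J n (delta n j)), ℓ' y = ℓ ⟨y, hy⟩ := fun y hy =>
    LinearMap.congr_fun hℓ' ⟨y, hy⟩
  have h3 : Φ.funcM j (fun p => ℓ' (pathδ p)) = f' := Φ.KM_hom_ext fun y hy => dzVal_injective (by
    refine Φ.e.repr.injective (Finsupp.ext fun a => ?_)
    have key : ∀ g : Φ.KM n j →ₗ[Λᵐᵒᵖ] degZeroModule 𝒜,
        Φ.e.repr (dzVal (g ⟨Φ.iota _ y, Φ.iota_mem_Kmod hy⟩)) a =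
        ∑ b, Φ.e.repr (dzVal (g ⟨Φ.iota _ (rslice (Nat.add_zero _) (QPath.nil a) y),
          Φ.iota_mem_Kmod (Φ.rslice_mem_J (Nat.add_zero _) (QPath.nil a) hy)⟩)) b := by
      intro g
      rw [repr_eq_sum_repr_mul]
      have e : (⟨Φ.iota _ (rslice (Nat.add_zero _) (QPath.nil a) y),
          Φ.iota_mem_Kmod (Φ.rslice_mem_J (Nat.add_zero _) (QPath.nil a) hy)⟩ : Φ.KM n j) =
          op (Φ.e a : Λ) • ⟨Φ.iota _ y, Φ.iota_mem_Kmod hy⟩ :=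
        Subtype.ext (Φ.op_e_smul_iota a y).symm
      rw [e, map_smul, dzVal_smul, unop_op, GradedRing.projZeroRingHom'_apply_coe]
    rw [key, key, Φ.dzVal_funcM_iota j _ (Φ.rslice_mem_J _ _ hy), sum_repr_sum, h1,
      h2 _ (Φ.rslice_mem_J _ _ hy)]
    rfl)
  exact Φ.hom_Z_ext fun F => by rw [funcZ_mk, h3]; rfl

end QuiverOf

end

section

open MulOpposite

/-! ### The Yoneda product -/

theorem delta_add_le {n : ℕ} (hn : 2 ≤ n) (i j : ℕ) : delta n i + delta n j ≤ delta n (i + j) := by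
  unfold delta
  rcases Nat.mod_two_eq_zero_or_one i with hi | hi <;>
  rcases Nat.mod_two_eq_zero_or_one j with hj | hj
  · have h1 : (i + j) / 2 = i / 2 + j / 2 := by omega
    rw [h1, add_mul]; omega
  · have h1 : (i + j) / 2 = i / 2 + j / 2 := by omega
    rw [h1, add_mul]; omega
  · have h1 : (i + j) / 2 = i / 2 + j / 2 := by omega
    rw [h1, add_mul]; omega
  · have h1 : (i + j) / 2 = i / 2 + j / 2 + 1 := by omega
    rw [h1, add_mul, add_mul]; omega

namespace GrAlg

variable {K : Type u} [Field K] (A : GrAlg.{u, w} K) {n : ℕ}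

theorem regrade_mul_of_eq {i j k : ℕ} (h : i + j = k) (hδ : delta n i + delta n j = delta n k) :
    (A.regrade n).mul h = A.mul hδ := dif_pos hδ

theorem regrade_mul_of_ne {i j k : ℕ} (h : i + j = k) (hδ : delta n i + delta n j ≠ delta n k) :
    (A.regrade n).mul h = 0 := dif_neg hδ

end GrAlg

namespace QuiverOf

variable {K : Type u} [Field K] {Λ : Type u} [Ring Λ] [Algebra K Λ]
  {𝒜 : ℕ → Submodule K Λ} [GradedAlgebra 𝒜] {V : Type v} [Quiver.{w + 1} V]
  (Φ : QuiverOf 𝒜 V) [Finite V] [∀ a b : V, Finite (a ⟶ b)] {n : ℕ}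

theorem sum_smul_sum_atJoin {M : Type*} [AddCommGroup M] [Module K M] {a b t : ℕ} (h : a + b = t)
    (γ : PathSpace V K a) (γ' : PathSpace V K b) (φ : QPath V t → M) :
    ∑ q, γ' q • ∑ p, γ p • atJoin h φ p q = ∑ r, conv h γ γ' r • φ r := by
  have := sum_atJoin h φ (fun x p q => (γ p * γ' q) • x) (by simp)
  refine Eq.trans ?_ this.symm
  rw [Finset.sum_comm]
  simp only [Finset.smul_sum, smul_smul, mul_comm]

/-- The composition of a contraction of the Koszul complex with a functional. When the contraction
turns arrows into elements of `Λ`, the result vanishes as these have positive degree. -/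
theorem sum_projZero_ctr_dmap {a b s x t : ℕ} (h : a + b = s) (hx : s + x = t)
    (γ : PathSpace V K a) (γ' : PathSpace V K b) {F : Fn Λ V t} (hF : F ∈ Φ.Kmod n t) :
    ∑ q, γ' q • GradedRing.projZeroRingHom' 𝒜 (ctr h γ (Φ.dmap hx F) (sh q)) =
      ∑ r, (if hs : a + b = t then conv hs γ γ' else 0) r •
        GradedRing.projZeroRingHom' 𝒜 (F (sh r)) := by
  have h0 : ∀ (c : K) (x : Λ), GradedRing.projZeroRingHom' 𝒜 (c • x) =
      c • GradedRing.projZeroRingHom' 𝒜 x := fun c x => Subtype.ext (by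
    change ((DirectSum.decompose 𝒜 (c • x) 0 : 𝒜 0) : Λ) = _
    rw [DirectSum.decompose_smul]; rfl)
  have h1 : ∀ G : Fn Λ V s, ∑ q, γ' q • GradedRing.projZeroRingHom' 𝒜 (ctr h γ G (sh q)) =
      ∑ r, conv h γ γ' r • GradedRing.projZeroRingHom' 𝒜 (G (sh r)) := fun G => by
    refine Eq.trans ?_ (sum_smul_sum_atJoin h γ γ'
      fun r => GradedRing.projZeroRingHom' 𝒜 (G (sh r)))
    refine Finset.sum_congr rfl fun q _ => ?_
    rw [ctr_apply, map_sum]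
    congr 1
    refine Finset.sum_congr rfl fun p _ => ?_
    rw [h0]
    congr 1
    exact (atJoin_map (GradedRing.projZeroRingHom' 𝒜) (map_zero _) h (fun r => G (sh r)) p q).symm
  rw [h1]
  rcases Nat.eq_zero_or_pos x with rfl | hx'
  · obtain rfl : s = t := hx
    rw [dif_pos h, Φ.dmap_zero_of_mem_Kmod hF]
  · rw [dif_neg (by omega)]
    simp only [Pi.zero_apply, zero_smul, Finset.sum_const_zero]
    refine Finset.sum_eq_zero fun r _ => ?_
    rw [dmap_apply, map_sum, Finset.sum_eq_zero, smul_zero]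
    intro q _
    rw [map_mul, projZero_of_mem_of_pos hx' (Φ.pathProd_mem q), zero_mul]

/-- The lift to the Koszul complex of the map `Z_j → Λ_0` given by a functional on `KQ_{δ(j)}`. From
`J_{δ(j+t)} ⊗ Λ` to `J_{δ(t)} ⊗ Λ` it multiplies the last `δ(j+t) - δ(j) - δ(t)` arrows of the paths
into `Λ` and contracts the first `δ(j)` arrows with the functional. -/
def shiftM (hn : 2 ≤ n) (j : ℕ) (γ : PathSpace V K (delta n j)) (t : ℕ) :
    Φ.KM n (j + t) →ₗ[Λᵐᵒᵖ] Φ.KM n t :=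
  (ctr rfl γ ∘ₗ Φ.dmap (Nat.add_sub_of_le (delta_add_le hn j t))).restrict fun _ hF =>
    Φ.ctr_mem_Kmod rfl γ (Φ.dmap_mem_Kmod _ hF)

theorem shiftM_dM (hn : 2 ≤ n) (j : ℕ) (γ : PathSpace V K (delta n j)) (t : ℕ)
    (F : Φ.KM n (j + t + 1)) :
    Φ.shiftM hn j γ t (Φ.dM hn (j + t) F) = Φ.dM hn t (Φ.shiftM hn j γ (t + 1) F) := by
  refine Subtype.ext ?_
  change ctr _ γ (Φ.dmap _ (Φ.dmap _ F.1)) = Φ.dmap (delta_add_stp hn t) (ctr _ γ (Φ.dmap _ F.1))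
  have e1 := delta_add_le hn j t
  have e2 := delta_add_le hn j (t + 1)
  have e3 := delta_add_stp hn t
  have e4 := delta_add_stp hn (j + t)
  rw [← add_assoc] at e2
  rw [← ctr_dmap (𝒜 := 𝒜) (Φ := Φ) (i := delta n j) (k := delta n t)
      (t' := delta n j + delta n t) rfl
    (by omega) e3 rfl,
    Φ.dmap_dmap (cc := delta n (j + t + 1) - (delta n j + delta n t)) _ _ (by omega) (by omega),
    Φ.dmap_dmap (cc := delta n (j + t + 1) - (delta n j + delta n t)) _ _ ?_ (by omega)]
  change stp n t + (delta n (j + t + 1) - _) = _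
  omega

/-- The composition of a functional with the lift of another one is their convolution if
`δ(j) + δ(i) = δ(j + i)`, and zero otherwise. This is the multiplication of `Λ^!_U`. -/
theorem funcM_shiftM (hn : 2 ≤ n) (j : ℕ) (γ : PathSpace V K (delta n j)) (i : ℕ)
    (γ' : PathSpace V K (delta n i)) (F : Φ.KM n (j + i)) :
    Φ.funcM i γ' (Φ.shiftM hn j γ i F) = Φ.funcM (j + i)
      (if hs : delta n j + delta n i = delta n (j + i) then conv hs γ γ' else 0) F := by
  refine dzVal_injective ?_
  rw [dzVal_funcM, dzVal_funcM]
  exact Φ.sum_projZero_ctr_dmap rfl _ γ γ' F.2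

/-- The maps `shiftM` and the maps which they induce on the syzygies. -/
def shift (hn : 2 ≤ n) (hΛ : Φ.IsNKoszul n) (j : ℕ) (γ : PathSpace V K (delta n j)) :
    (Φ.tower hn hΛ).Shift j where
  z t := ModuleCat.ofHom (Submodule.mapQ (LinearMap.range (Φ.dM hn (j + t)))
    (LinearMap.range (Φ.dM hn t)) (Φ.shiftM hn j γ t) (by
      rintro _ ⟨F, rfl⟩
      exact ⟨Φ.shiftM hn j γ (t + 1) F, (Φ.shiftM_dM hn j γ t F).symm⟩))
  c t := ModuleCat.ofHom (Φ.shiftM hn j γ t)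
  p_z t := rfl
  i_c t := Φ.hom_Z_ext fun F => Φ.shiftM_dM hn j γ t F

theorem conv_one {a b : ℕ} (h : a + b = a) (γ : PathSpace V K a) :
    conv h γ (fun _ => 1) = γ := by
  obtain rfl : b = 0 := by omega
  exact funext fun p => mul_one _

theorem shift_zero (hn : 2 ≤ n) (hΛ : Φ.IsNKoszul n) (j : ℕ) (γ : PathSpace V K (delta n j)) :
    (Φ.shift hn hΛ j γ).z 0 = Φ.funcZ hn hΛ j γ ≫ (Φ.augIso hn hΛ).hom := by
  rw [← Iso.comp_inv_eq]
  refine Φ.hom_Z_ext fun F => ?_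
  refine (Φ.funcM_shiftM hn j γ 0 (fun _ => 1) F).trans ?_
  have h : delta n j + delta n 0 = delta n j := by rw [delta_zero]; rfl
  have h' : delta n j + delta n 0 = delta n (j + 0) := h
  rw [dif_pos h']
  refine Eq.trans ?_ (Φ.funcZ_mk hn hΛ j γ F).symm
  exact congrArg (fun γ => Φ.funcM j γ F) (conv_one h γ)

/-- The element of `Ext^j(Λ_0, Λ_0)` given by an element of degree `δ(j)` of `Λ^!`. -/
def extEquiv (hn : 2 ≤ n) (hΛ : Φ.IsNKoszul n) (j : ℕ) :
    (PathSpace V K (delta n j) ⧸ idealGen (Φ.orthogonal n) (delta n j)) ≃ₗ[K]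
      (yonedaAlgebra 𝒜).obj j :=
  LinearEquiv.ofBijective
    ((idealGen (Φ.orthogonal n) (delta n j)).liftQ
      ({ toFun := fun γ => (Φ.tower hn hΛ).extOf (Φ.augIso hn hΛ) j (Φ.funcZ hn hΛ j γ)
         map_add' := fun γ γ' => by rw [funcZ_add, SyzygyTower.extOf_add]; rfl
         map_smul' := fun c γ => by rw [funcZ_smul, SyzygyTower.extOf_smul]; rfl } :
        PathSpace V K (delta n j) →ₗ[K] (yonedaAlgebra 𝒜).obj j) (fun γ hγ => by
          change (Φ.tower hn hΛ).extOf (Φ.augIso hn hΛ) j (Φ.funcZ hn hΛ j γ) = 0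
          rw [(Φ.funcZ_eq_zero_iff hn hΛ j γ).2 hγ]
          exact (Φ.tower hn hΛ).extOf_zero_right (Φ.augIso hn hΛ) j))
    (by
      have hb := (Φ.tower hn hΛ).extOf_bijective (Φ.augIso hn hΛ) (Φ.isMinimal_tower hn hΛ) j
      have h0 := (Φ.tower hn hΛ).extOf_zero_right (S := degZeroModule 𝒜) (Φ.augIso hn hΛ) j
      constructor
      · refine (injective_iff_map_eq_zero _).2 fun x hx => ?_
        obtain ⟨γ, rfl⟩ := Submodule.mkQ_surjective _ x
        refine (Submodule.Quotient.mk_eq_zero _).2 ((Φ.funcZ_eq_zero_iff hn hΛ j γ).1 ?_)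
        exact hb.1 (Eq.trans hx h0.symm)
      · intro x
        obtain ⟨f, rfl⟩ := hb.2 x
        obtain ⟨γ, rfl⟩ := Φ.funcZ_surjective hn hΛ j f
        exact ⟨Submodule.Quotient.mk γ, rfl⟩)

theorem extEquiv_mk (hn : 2 ≤ n) (hΛ : Φ.IsNKoszul n) (j : ℕ) (γ : PathSpace V K (delta n j)) :
    Φ.extEquiv hn hΛ j ((idealGen (Φ.orthogonal n) (delta n j)).mkQ γ) =
      (Φ.tower hn hΛ).extOf (Φ.augIso hn hΛ) j (Φ.funcZ hn hΛ j γ) := rfl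

theorem extEquiv_one (hn : 2 ≤ n) (hΛ : Φ.IsNKoszul n) :
    Φ.extEquiv hn hΛ 0 (Φ.dualAlgU n).one = (yonedaAlgebra 𝒜).one := by
  have key : ∀ (z : ℕ) (hz : 0 = z), (hz ▸ (Φ.dualAlg n).one : (Φ.dualAlg n).obj z) =
      (idealGen (Φ.orthogonal n) z).mkQ fun _ => 1 := by
    rintro _ rfl; rfl
  refine (congrArg (Φ.extEquiv hn hΛ 0) (key _ _)).trans ?_
  rw [extEquiv_mk]
  exact (Φ.tower hn hΛ).extOf_zero (Φ.augIso hn hΛ)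

/-- The first factor `a` of the product `a b` is applied last, both in `Ext` and, as `Λ^!` is a
factor of `KQ^op`, in the concatenation of paths. -/
theorem extEquiv_mul (hn : 2 ≤ n) (hΛ : Φ.IsNKoszul n) {i j k : ℕ} (h : i + j = k)
    (a : (Φ.dualAlgU n).obj i) (b : (Φ.dualAlgU n).obj j) :
    Φ.extEquiv hn hΛ k ((Φ.dualAlgU n).mul h a b) =
      (yonedaAlgebra 𝒜).mul h (Φ.extEquiv hn hΛ i a) (Φ.extEquiv hn hΛ j b) := by
  obtain ⟨γ', rfl⟩ := Submodule.mkQ_surjective _ a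
  obtain ⟨γ, rfl⟩ := Submodule.mkQ_surjective _ b
  obtain rfl : j + i = k := by omega
  rw [extEquiv_mk, extEquiv_mk]
  refine Eq.trans ?_ ((Φ.tower hn hΛ).extOf_comp (Φ.augIso hn hΛ) rfl (Φ.shift hn hΛ j γ)
    (Φ.funcZ hn hΛ i γ') (Φ.funcZ hn hΛ j γ) (Φ.shift_zero hn hΛ j γ) (Φ.funcZ hn hΛ (j + i)
      (if hs : delta n j + delta n i = delta n (j + i) then conv hs γ γ' else 0)) ?_).symm
  · rw [← extEquiv_mk]
    congr 1
    by_cases hs : delta n j + delta n i = delta n (j + i)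
    · rw [dif_pos hs]
      exact congrFun (congrArg DFunLike.coe (congrFun (congrArg DFunLike.coe
        ((Φ.dualAlg n).regrade_mul_of_eq h (show delta n i + delta n j = delta n (j + i) by omega)))
        _)) _
    · rw [dif_neg hs, map_zero]
      exact congrFun (congrArg DFunLike.coe (congrFun (congrArg DFunLike.coe
        ((Φ.dualAlg n).regrade_mul_of_ne h (show delta n i + delta n j ≠ delta n (j + i) by omega)))
        _)) _
  · rw [eqToHom_refl, Category.id_comp]
    exact Φ.hom_Z_ext fun F => (Φ.funcM_shiftM hn j γ i γ' F).symm

/-- The Yoneda algebra of an `n`-Koszul algebra is isomorphic to `Λ^!_U`. -/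
def yonedaIso (hn : 2 ≤ n) (hΛ : Φ.IsNKoszul n) : (yonedaAlgebra 𝒜).Iso (Φ.dualAlgU n) where
  equiv j := (Φ.extEquiv hn hΛ j).symm
  map_one := (LinearEquiv.symm_apply_eq _).2 (Φ.extEquiv_one hn hΛ).symm
  map_mul h a b := (LinearEquiv.symm_apply_eq _).2 (by
    refine Eq.trans ?_ (Φ.extEquiv_mul hn hΛ h _ _).symm
    exact congrArg₂ (fun a b => (yonedaAlgebra 𝒜).mul h a b)
      (LinearEquiv.apply_symm_apply _ a).symm (LinearEquiv.apply_symm_apply _ b).symm)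

end QuiverOf

end

section

/-! ### The pair formed by an algebra and its `n`-homogeneous dual -/

namespace GrAlg

variable {K : Type u} [Field K]

/-- A graded algebra with small components, moved to the universe of `K`. -/
def shrink (A : GrAlg.{u, w} K) [∀ i, Small.{u} (A.obj i)] : GrAlg.{u, u} K where
  obj i := Shrink.{u} (A.obj i)
  mul {i j k} h := ((A.mul h).compl₁₂ (Shrink.linearEquiv K (A.obj i)).toLinearMap
    (Shrink.linearEquiv K (A.obj j)).toLinearMap).compr₂
      (Shrink.linearEquiv K (A.obj k)).symm.toLinearMap
  one := (Shrink.linearEquiv K (A.obj 0)).symm A.one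
  one_mul a := by simp [A.one_mul]
  mul_one a := by simp [A.mul_one]
  mul_assoc hij hjk h h' a b c := by simp [A.mul_assoc hij hjk h h']

/-- The identification of a component of a graded algebra with its copy in the universe of `K`. -/
def shrinkEquiv (A : GrAlg.{u, w} K) [∀ i, Small.{u} (A.obj i)] (i : ℕ) :
    A.obj i ≃ₗ[K] A.shrink.obj i :=
  (Shrink.linearEquiv K (A.obj i)).symm

theorem shrinkEquiv_mul (A : GrAlg.{u, w} K) [∀ i, Small.{u} (A.obj i)] {i j k : ℕ} (h : i + j = k)
    (a : A.obj i) (b : A.obj j) :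
    A.shrinkEquiv k (A.mul h a b) = A.shrink.mul h (A.shrinkEquiv i a) (A.shrinkEquiv j b) := by
  change _ = (Shrink.linearEquiv K (A.obj k)).symm (A.mul h
    (Shrink.linearEquiv K (A.obj i) ((Shrink.linearEquiv K (A.obj i)).symm a))
    (Shrink.linearEquiv K (A.obj j) ((Shrink.linearEquiv K (A.obj j)).symm b)))
  rw [LinearEquiv.apply_symm_apply, LinearEquiv.apply_symm_apply]
  rfl

/-- The composition of isomorphisms of graded algebras. -/
def Iso.trans {A : GrAlg.{u, u} K} {B : GrAlg.{u, v} K} {C : GrAlg.{u, w} K} (f : A.Iso B)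
    (g : B.Iso C) : A.Iso C where
  equiv i := (f.equiv i).trans (g.equiv i)
  map_one := (congrArg (g.equiv 0) f.map_one).trans g.map_one
  map_mul h a b := (congrArg (g.equiv _) (f.map_mul h a b)).trans (g.map_mul h _ _)

/-- An algebra regraded by means of `δ` and its copy in the universe of `K`. -/
def regradeShrink (A : GrAlg.{u, w} K) [∀ i, Small.{u} (A.obj i)] (n : ℕ) :
    (A.regrade n).Iso (A.shrink.regrade n) where
  equiv i := A.shrinkEquiv (delta n i)
  map_one := by
    have key : ∀ (z : ℕ) (hz : 0 = z), A.shrinkEquiv z (hz ▸ A.one) = hz ▸ A.shrink.one := by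
      rintro _ rfl; rfl
    exact key _ _
  map_mul {i j k} h a b := by
    by_cases hδ : delta n i + delta n j = delta n k
    · rw [regrade_mul_of_eq _ h hδ, regrade_mul_of_eq _ h hδ]
      exact A.shrinkEquiv_mul hδ a b
    · rw [regrade_mul_of_ne _ h hδ, regrade_mul_of_ne _ h hδ]
      exact map_zero (A.shrinkEquiv (delta n k))

end GrAlg

/-- Two graded algebras `A = KQ / I` and `B = KQ^op / ⟨R⟩` with `R = I_n^⊥` and `I_c = 0` for
`c < n`. The images in `A` and `B` of the paths of `Q` are denoted by `x` and `y`. That `R` is the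
orthogonal of `I_n` is expressed by `exists_extend` and `sum_eq_zero`: the elements of `R` define
functionals on `A_n`, and the canonical element `∑ x_q ⊗ y_q` of `A_n ⊗ B_n` is zero. -/
structure DualPair {K : Type u} [Field K] (A B : GrAlg.{u, u} K) (V : Type v) [Quiver.{w + 1} V]
    [Finite V] [∀ a b : V, Finite (a ⟶ b)] (n : ℕ) where
  x : ∀ {c : ℕ}, QPath V c → A.obj c
  y : ∀ {c : ℕ}, QPath V c → B.obj c
  R : Submodule K (PathSpace V K n)
  x_mul : ∀ {a b t : ℕ} (h : a + b = t) (p : QPath V a) (q : QPath V b),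
    A.mul h (x p) (x q) = atJoin h x p q
  y_mul : ∀ {a b t : ℕ} (h : a + b = t) (h' : b + a = t) (p : QPath V a) (q : QPath V b),
    B.mul h' (y q) (y p) = atJoin h y p q
  x_one : ∑ p : QPath V 0, x p = A.one
  y_one : ∑ p : QPath V 0, y p = B.one
  x_span : ∀ c, ⊤ ≤ Submodule.span K (Set.range (x (c := c)))
  x_linearIndependent : ∀ {c : ℕ}, c < n → LinearIndependent K (x (c := c))
  exists_extend : ∀ f ∈ R, ∃ l : A.obj n →ₗ[K] K, ∀ q, l (x q) = f q
  y_surjective : ∀ {c : ℕ} (b : B.obj c), ∃ f : PathSpace V K c, ∑ q, f q • y q = b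
  y_ker : ∀ {c : ℕ} (f : PathSpace V K c), ∑ q, f q • y q = 0 ↔ f ∈ idealGen R c
  sum_eq_zero : ∀ {M : Type u} [AddCommGroup M] [Module K M]
    (β : A.obj n →ₗ[K] B.obj n →ₗ[K] M), ∑ q, β (x q) (y q) = 0

namespace QuiverOf

variable {K : Type u} [Field K] {Λ : Type u} [Ring Λ] [Algebra K Λ]
  {𝒜 : ℕ → Submodule K Λ} [GradedAlgebra 𝒜] {V : Type v} [Quiver.{w + 1} V]
  (Φ : QuiverOf 𝒜 V) [Finite V] [∀ a b : V, Finite (a ⟶ b)] {n : ℕ}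

instance (i : ℕ) : Small.{u} ((Φ.dualAlg n).obj i) :=
  have e := Module.Free.chooseBasis K (PathSpace V K i ⧸ idealGen (Φ.orthogonal n) i)
  have : Small.{u} (Module.Free.ChooseBasisIndex K
    (PathSpace V K i ⧸ idealGen (Φ.orthogonal n) i)) := inferInstance
  small_map (e.equivFun.toEquiv : (PathSpace V K i ⧸ idealGen (Φ.orthogonal n) i) ≃ _)

/-- The image of a path in `Λ^!`. -/
def dualPath {c : ℕ} (q : QPath V c) : (Φ.dualAlg n).shrink.obj c :=
  (Φ.dualAlg n).shrinkEquiv c ((idealGen (Φ.orthogonal n) c).mkQ (pathδ q))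

theorem sum_smul_dualPath {c : ℕ} (f : PathSpace V K c) :
    ∑ q, f q • Φ.dualPath (n := n) q =
      (Φ.dualAlg n).shrinkEquiv c ((idealGen (Φ.orthogonal n) c).mkQ f) := by
  have h : f = ∑ q, f q • pathδ (K := K) q := (sum_smul_pathδ f).symm
  have h1 : (idealGen (Φ.orthogonal n) c).mkQ f =
      ∑ q, f q • (idealGen (Φ.orthogonal n) c).mkQ (pathδ q) := by
    conv_lhs => rw [h]
    rw [map_sum]
    simp only [map_smul]
  refine Eq.symm ((congrArg ((Φ.dualAlg n).shrinkEquiv c) h1).trans ?_)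
  exact (map_sum ((Φ.dualAlg n).shrinkEquiv c) _ _).trans
    (Finset.sum_congr rfl fun q _ => map_smul ((Φ.dualAlg n).shrinkEquiv c) _ _)

theorem sum_smul_dualPath_eq_zero {c : ℕ} (f : PathSpace V K c) :
    ∑ q, f q • Φ.dualPath (n := n) q = 0 ↔ f ∈ idealGen (Φ.orthogonal n) c := by
  rw [sum_smul_dualPath]
  exact (LinearEquiv.map_eq_zero_iff ((Φ.dualAlg n).shrinkEquiv c)).trans
    (Submodule.Quotient.mk_eq_zero _)

theorem conv_pathδ {a b t : ℕ} (h : a + b = t) (p : QPath V a) (q : QPath V b) :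
    conv h (pathδ (K := K) p) (pathδ q) = atJoin h (pathδ (K := K)) p q := by
  classical
  by_cases hpq : p.tgt = q.src
  · rw [atJoin_join h _ p q hpq]
    funext r
    change pathδ (K := K) p (r.take h) * pathδ q (r.drop h) = pathδ (p.join h q hpq) r
    by_cases hr : r = p.join h q hpq
    · subst hr
      rw [QPath.take_join, QPath.drop_join]
      simp [pathδ]
    · have : r.take h ≠ p ∨ r.drop h ≠ q := by
        by_contra! hc
        refine hr (QPath.take_drop_ext h ?_ ?_)
        · rw [hc.1, QPath.take_join]
        · rw [hc.2, QPath.drop_join]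
      rw [pathδ, pathδ, pathδ, Pi.single_eq_of_ne hr]
      rcases this with h1 | h1
      · rw [Pi.single_eq_of_ne h1, zero_mul]
      · rw [Pi.single_eq_of_ne h1, mul_zero]
  · rw [atJoin_of_ne h _ hpq]
    funext r
    change pathδ (K := K) p (r.take h) * pathδ q (r.drop h) = 0
    by_cases h1 : r.take h = p
    · have h2 : r.drop h ≠ q := fun h2 => hpq (by rw [← h1, ← h2, QPath.tgt_take])
      rw [pathδ, pathδ, Pi.single_eq_of_ne h2, mul_zero]
    · rw [pathδ, Pi.single_eq_of_ne h1, zero_mul]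

/-- The canonical element `∑ x_q ⊗ y_q` of `Λ_n ⊗ Λ^!_n` is zero: it corresponds to the map
`I_n → KQ_n → KQ_n / I_n`. -/
theorem sum_pathProd_dualPath {M : Type*} [AddCommGroup M] [Module K M]
    (β : 𝒜 n →ₗ[K] (Φ.dualAlg n).shrink.obj n →ₗ[K] M) :
    ∑ q, β ⟨Φ.pathProd q, Φ.pathProd_mem q⟩ (Φ.dualPath q) = 0 := by
  -- `D` is a projection of `KQ_n` with kernel `I_n`; replacing `q` by `D q` does not change `x_q`.
  obtain ⟨P, hP⟩ := LinearMap.exists_leftInverse_of_injective (Φ.relations n).subtype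
    (Submodule.ker_subtype _)
  let D : PathSpace V K n →ₗ[K] PathSpace V K n := LinearMap.id - (Φ.relations n).subtype ∘ₗ P
  have hx : ∀ q : QPath V n, (⟨Φ.pathProd q, Φ.pathProd_mem q⟩ : 𝒜 n) =
      ∑ s, D (pathδ q) s • (⟨Φ.pathProd s, Φ.pathProd_mem s⟩ : 𝒜 n) := fun q => by
    refine Subtype.ext ?_
    have h1 : Φ.π n (D (pathδ q)) = Φ.pathProd q := by
      change Φ.π n (pathδ q - (P (pathδ q) : PathSpace V K n)) = _
      rw [map_sub, Φ.mem_relations.1 (P (pathδ q)).2, sub_zero, π_pathδ]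
    rw [AddSubmonoidClass.coe_finsetSum]
    exact h1.symm.trans (Φ.π_apply (D (pathδ q)))
  have h1 : ∀ q : QPath V n, β ⟨Φ.pathProd q, Φ.pathProd_mem q⟩ (Φ.dualPath q) =
      ∑ s, β ⟨Φ.pathProd s, Φ.pathProd_mem s⟩ (D (pathδ q) s • Φ.dualPath q) := fun q => by
    conv_lhs => rw [hx q]
    rw [map_sum, LinearMap.sum_apply]
    refine Finset.sum_congr rfl fun s _ => ?_
    rw [map_smul, LinearMap.smul_apply, map_smul]
  rw [Finset.sum_congr rfl fun q _ => h1 q, Finset.sum_comm]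
  refine Finset.sum_eq_zero fun s _ => ?_
  rw [← map_sum]
  refine (congrArg _ ?_).trans (map_zero _)
  -- Each coordinate of `D` vanishes on `I_n`, hence is zero in `Λ^!_n`.
  refine (Φ.sum_smul_dualPath_eq_zero fun q => D (pathδ q) s).2 ?_
  rw [mem_idealGen_orthogonal_iff, J_self]
  intro g hg
  have h2 : P g = ⟨g, hg⟩ := LinearMap.congr_fun hP ⟨g, hg⟩
  have h3 : D g = 0 := by
    change g - (P g : PathSpace V K n) = 0
    rw [h2, sub_self]
  rw [← sum_smul_pathδ g, map_sum] at h3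
  have h4 := congrFun h3 s
  simpa [mul_comm] using h4

/-- An `n`-homogeneous algebra and its `n`-homogeneous dual. -/
def dualPair (hΛ : Φ.IsNHomogeneous n) :
    DualPair (GrAlg.ofGraded 𝒜) (Φ.dualAlg n).shrink V n where
  x q := ⟨Φ.pathProd q, Φ.pathProd_mem q⟩
  y q := Φ.dualPath q
  R := Φ.orthogonal n
  x_mul h p q := by
    by_cases hpq : p.tgt = q.src
    · refine Eq.trans ?_ (atJoin_join h _ p q hpq).symm
      refine Subtype.ext ?_
      have := Φ.pathProd_mul h (p.join h q hpq)
      rw [QPath.take_join, QPath.drop_join] at this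
      exact this
    · refine Eq.trans ?_ (atJoin_of_ne h _ hpq).symm
      exact Subtype.ext (Φ.pathProd_mul_of_ne p q hpq)
  y_mul {a b t} h h' p q := by
    refine ((Φ.dualAlg n).shrinkEquiv_mul h' _ _).symm.trans ?_
    have e1 : (Φ.dualAlg n).mul h' ((idealGen (Φ.orthogonal n) b).mkQ (pathδ q))
        ((idealGen (Φ.orthogonal n) a).mkQ (pathδ p)) =
        (idealGen (Φ.orthogonal n) t).mkQ (atJoin h pathδ p q) := by
      rw [← conv_pathδ]
      rfl
    refine (congrArg _ e1).trans ?_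
    exact (atJoin_map (fun f => (Φ.dualAlg n).shrinkEquiv t
      ((idealGen (Φ.orthogonal n) t).mkQ f))
      ((congrArg _ (map_zero _)).trans (map_zero ((Φ.dualAlg n).shrinkEquiv t))) h pathδ p q).symm
  x_one := by
    have := Fintype.ofFinite V
    refine Subtype.ext ((AddSubmonoidClass.coe_finsetSum (S := 𝒜 0)
      (fun p : QPath V 0 => (⟨Φ.pathProd p, Φ.pathProd_mem p⟩ : 𝒜 0)) _).trans ?_)
    refine Eq.trans ?_ Φ.sum_e
    refine Fintype.sum_equiv QPath.zeroEquiv _ _ fun p => ?_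
    conv_lhs => rw [QPath.eq_nil p]
    exact Φ.pathProd_nil _
  y_one := by
    have := Φ.sum_smul_dualPath (n := n) (c := 0) fun _ => 1
    simp only [one_smul] at this
    exact this
  x_span c := by
    rintro ⟨a, ha⟩ -
    obtain ⟨f, rfl⟩ := Φ.π_surjective hΛ.1 ha
    have : (⟨Φ.π c f, ha⟩ : 𝒜 c) = ∑ q, f q • (⟨Φ.pathProd q, Φ.pathProd_mem q⟩ : 𝒜 c) :=
      Subtype.ext (by rw [AddSubmonoidClass.coe_finsetSum]; exact Φ.π_apply f)
    rw [this]
    exact Submodule.sum_mem _ fun q _ => Submodule.smul_mem _ _ (Submodule.subset_span ⟨q, rfl⟩)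
  x_linearIndependent {c} hc := by
    refine (Fintype.linearIndependent_iff (R := K)
      (v := fun q : QPath V c => (⟨Φ.pathProd q, Φ.pathProd_mem q⟩ : 𝒜 c))).2 ?_
    intro g hg q
    have h1 : g ∈ Φ.relations c := by
      rw [mem_relations, π_apply]
      have := congrArg Subtype.val hg
      rw [AddSubmonoidClass.coe_finsetSum] at this
      exact this
    rw [Φ.relations_eq_bot_of_lt hΛ hc] at h1
    exact congrFun h1 q
  exists_extend f hf := by
    let p : PathSpace V K n →ₗ[K] 𝒜 n := (Φ.π n).codRestrict (𝒜 n) Φ.π_mem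
    have hp : Function.Surjective p := fun a => by
      obtain ⟨g, hg⟩ := Φ.π_surjective hΛ.1 a.2
      exact ⟨g, Subtype.ext hg⟩
    let F : PathSpace V K n →ₗ[K] K := Fintype.linearCombination K f
    have hF : LinearMap.ker p ≤ LinearMap.ker F := fun g hg => by
      have h1 : g ∈ Φ.relations n := Φ.mem_relations.2 (congrArg Subtype.val hg)
      have h2 := hf g h1
      simp only [mul_comm (f _)] at h2
      exact h2
    refine ⟨(LinearMap.ker p).liftQ F hF ∘ₗ (p.quotKerEquivOfSurjective hp).symm.toLinearMap,
      fun q => ?_⟩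
    have h1 : (p.quotKerEquivOfSurjective hp).symm ⟨Φ.pathProd q, Φ.pathProd_mem q⟩ =
        (LinearMap.ker p).mkQ (pathδ q) := by
      rw [LinearEquiv.symm_apply_eq]
      exact Subtype.ext (Φ.π_pathδ q).symm
    refine (congrArg ((LinearMap.ker p).liftQ F hF) h1).trans ?_
    classical
    exact (Fintype.linearCombination_apply_single K f q (1 : K)).trans (one_smul K _)
  y_surjective {c} b := by
    obtain ⟨b, rfl⟩ := ((Φ.dualAlg n).shrinkEquiv c).surjective b
    obtain ⟨f, rfl⟩ := (idealGen (Φ.orthogonal n) c).mkQ_surjective b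
    exact ⟨f, Φ.sum_smul_dualPath f⟩
  y_ker f := Φ.sum_smul_dualPath_eq_zero f
  sum_eq_zero β := Φ.sum_pathProd_dualPath β

end QuiverOf

end

section

/-! ### Cofree and almost injective modules -/

namespace GrMod

variable {K : Type u} [Field K] {A : GrAlg.{u, u} K}

/-- `M` is the graded module coinduced by the `A_0`-module `M_s`: for every `p` the map
`M_{s-p} → Hom_{A_0}(A_p, M_s)` given by the action is bijective, and `M_i = 0` for `i > s`. -/
structure IsCofree (s : ℤ) (M : GrMod A) : Prop where
  eq_zero : ∀ {i : ℤ} (x : M.obj i),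
    (∀ (p : ℕ) (h : i + p = s) (a : A.obj p), M.act h x a = 0) → x = 0
  exists_act : ∀ {i : ℤ} {p : ℕ} (h : i + p = s) (f : A.obj p →ₗ[K] M.obj s),
    (∀ (a : A.obj p) (e : A.obj 0), f (A.mul (add_zero p) a e) = M.act (by simp) (f a) e) →
      ∃ x : M.obj i, ∀ a, M.act h x a = f a

namespace IsCofree

variable {s : ℤ} {M N : GrMod A}

theorem eq_of_act (hN : N.IsCofree s) {i : ℤ} {x y : N.obj i}
    (H : ∀ (p : ℕ) (h : i + p = s) (a : A.obj p), N.act h x a = N.act h y a) : x = y := by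
  rw [← sub_eq_zero]
  refine hN.eq_zero _ fun p h a => ?_
  rw [map_sub, LinearMap.sub_apply, H, sub_self]

theorem hom_ext (hN : N.IsCofree s) {f g : M ⟶ N} (H : ∀ x, f.app s x = g.app s x) : f = g :=
  GrMod.hom_ext fun i => LinearMap.ext fun x => hN.eq_of_act fun p h a => by
    rw [← f.comm, ← g.comm, H]

/-- Every `A_0`-linear map `M_s → N_s` extends to a morphism `M ⟶ N` if `N` is cofree. -/
theorem exists_hom (hN : N.IsCofree s) (g : M.obj s →ₗ[K] N.obj s)
    (hg : ∀ (x : M.obj s) (e : A.obj 0),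
      g (M.act (by simp) x e) = N.act (by simp) (g x) e) :
    ∃ F : M ⟶ N, ∀ x, F.app s x = g x := by
  have ex : ∀ (i : ℤ) (x : M.obj i), ∃ z : N.obj i,
      ∀ (p : ℕ) (h : i + p = s) (a : A.obj p), N.act h z a = g (M.act h x a) := by
    intro i x
    by_cases H : ∃ p : ℕ, i + p = s
    · obtain ⟨p, h⟩ := H
      obtain ⟨z, hz⟩ := hN.exists_act h (g ∘ₗ M.act h x) fun a e => by
        have := M.act_act h (show s + (0 : ℕ) = s by simp) (add_zero p) h x a e
        rw [LinearMap.comp_apply, LinearMap.comp_apply, ← this, hg]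
      refine ⟨z, fun p' h' a => ?_⟩
      obtain rfl : p' = p := by omega
      exact hz a
    · exact ⟨0, fun p h => (H ⟨p, h⟩).elim⟩
  choose F hF using ex
  refine ⟨{ app := fun i =>
              { toFun := F i
                map_add' := fun x y => hN.eq_of_act fun p h a => by
                  simp only [hF, map_add, LinearMap.add_apply]
                map_smul' := fun c x => hN.eq_of_act fun p h a => by
                  simp only [hF, map_smul, LinearMap.smul_apply, RingHom.id_apply] }
            comm := fun {i j l} h x b => hN.eq_of_act fun p h' a => ?_ }, fun x => ?_⟩
  · have h1 := N.act_act h h' (rfl : j + p = j + p) (by push_cast; omega) (F i x) b a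
    have h2 := M.act_act h h' (rfl : j + p = j + p) (by push_cast; omega) x b a
    exact (hF l _ p h' a).trans ((congrArg g h2).trans ((hF i x _ _ _).symm.trans h1.symm))
  · have h1 := hF s x 0 (by simp) A.one
    rw [M.act_one, N.act_one] at h1
    exact h1

theorem cogeneratedIn (hN : N.IsCofree s) : N.CogeneratedIn {s} := by
  rintro M f hf ⟨i, hi⟩
  obtain ⟨x, hx⟩ := exists_ne (0 : M.obj i)
  have h1 : f.app i x ≠ 0 := fun h => hx (hf i (h.trans (map_zero _).symm))
  by_contra hs
  refine h1 (hN.eq_zero _ fun p h a => ?_)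
  have : Subsingleton (M.obj s) := not_nontrivial_iff_subsingleton.1 fun h => hs ⟨s, rfl, h⟩
  rw [← f.comm h, Subsingleton.elim (M.act h x a) 0, map_zero]

end IsCofree

theorem CogeneratedIn.eq_zero_of_act {s : ℤ} {M : GrMod A} (hM : M.CogeneratedIn {s}) {i : ℤ}
    (x : M.obj i) (hx : ∀ (p : ℕ) (h : i + p = s) (a : A.obj p), M.act h x a = 0) : x = 0 := by
  let X : Submod M :=
    { carrier := fun j =>
        { carrier := { y | ∀ (p : ℕ) (h : j + p = s) (a : A.obj p), M.act h y a = 0 }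
          add_mem' := fun hy hz p h a => by
            rw [map_add, LinearMap.add_apply, hy p h a, hz p h a, add_zero]
          zero_mem' := fun p h a => by rw [map_zero, LinearMap.zero_apply]
          smul_mem' := fun c y hy p h a => by
            rw [map_smul, LinearMap.smul_apply, hy p h a, smul_zero] }
      act_mem := fun {j k l} h y hy b p h' a => by
        rw [M.act_act h h' rfl (by push_cast; omega)]
        exact hy _ _ _ }
  have h1 := hM.eq_bot X (fun j hj => by
    obtain rfl : j = s := hj
    rw [eq_bot_iff]
    intro y hy
    have := hy 0 (by simp) A.one
    rwa [M.act_one] at this) i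
  have h2 : x ∈ X.carrier i := hx
  rw [h1] at h2
  exact h2

section Dual

/-- `D(A)[-s]` is cofree: the functional on `A_p` that represents `f` is `a ↦ f(a)(1)`. -/
theorem exists_act_dual {κ s i : ℤ} (hκ : κ = -s) {p : ℕ} (h : i + p = s)
    (f : A.obj p →ₗ[K] ((dual A).shift κ).obj s)
    (hf : ∀ (a : A.obj p) (e : A.obj 0),
      f (A.mul (add_zero p) a e) = ((dual A).shift κ).act (by simp) (f a) e) :
    ∃ x : ((dual A).shift κ).obj i, ∀ a, ((dual A).shift κ).act h x a = f a := by
  let ev : ((dual A).shift κ).obj s →ₗ[K] K :=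
    { toFun := fun t => t.1 0 A.one
      map_add' := fun _ _ => rfl
      map_smul' := fun _ _ => rfl }
  let z : ∀ q : ℕ, A.obj q →ₗ[K] K := fun q =>
    if hq : q + 0 = p then ev ∘ₗ f ∘ₗ (A.mul hq).flip A.one else 0
  have hz : ∀ (hq : p + 0 = p) (a : A.obj p) (b : A.obj 0), z (p + 0) (A.mul hq a b) =
      (f a).1 0 b := by
    intro hq a b
    have h1 : z (p + 0) = ev ∘ₗ f ∘ₗ (A.mul (show p + 0 + 0 = p by omega)).flip A.one :=
      dif_pos (show p + 0 + 0 = p by omega)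
    rw [h1]
    change (f (A.mul (add_zero p) (A.mul (add_zero p) a b) A.one)).1 0 A.one = _
    rw [A.mul_one, hf]
    exact congrArg ((f a).1 0) (A.mul_one b)
  refine ⟨⟨z, fun q hq => dif_neg (by omega)⟩, fun a => Subtype.ext (funext fun q => ?_)⟩
  refine LinearMap.ext fun b => ?_
  change z (p + q) (A.mul rfl a b) = (f a).1 q b
  rcases Nat.eq_zero_or_pos q with rfl | hq
  · exact hz rfl a b
  · have h1 : z (p + q) = 0 := dif_neg (by omega)
    have h2 : (f a).1 q = 0 := (f a).2 q (by omega)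
    rw [h1, h2]
    rfl

theorem eq_zero_of_act_dual {κ s i : ℤ} (hκ : κ = -s) (x : ((dual A).shift κ).obj i)
    (H : ∀ (p : ℕ) (h : i + p = s) (a : A.obj p), ((dual A).shift κ).act h x a = 0) : x = 0 := by
  refine Subtype.ext (funext fun q => ?_)
  by_cases hq : (q : ℤ) = -(i + κ)
  · refine LinearMap.ext fun a => ?_
    have h1 := H q (by omega) a
    have h2 : x.1 (q + 0) (A.mul rfl a A.one) = 0 :=
      LinearMap.congr_fun (congrFun (congrArg Subtype.val h1) 0) A.one
    have h3 : A.mul (show q + 0 = q + 0 from rfl) a A.one = a := A.mul_one a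
    rw [h3] at h2
    exact h2
  · exact x.2 q hq

variable {ι : Type u} (κ : ι → ℤ)

theorem exists_support {N : ι → GrMod A} {i : ℤ} (t : (dsum N).obj i) :
    ∃ S : Finset ι, ∀ x ∉ S, (dsumProj N x).app i t = 0 := by
  classical
  induction t using dsum_induction with
  | h0 => exact ⟨∅, fun x _ => map_zero _⟩
  | h1 x t =>
    refine ⟨{x}, fun y hy => dsumProj_incl_ne N (fun h => hy (by simp [h])) t⟩
  | h2 s t hs ht =>
    obtain ⟨S, hS⟩ := hs
    obtain ⟨T, hT⟩ := ht
    refine ⟨S ∪ T, fun x hx => ?_⟩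
    rw [Finset.mem_union, not_or] at hx
    rw [map_add, hS x hx.1, hT x hx.2, add_zero]

/-- A linear map from a finite-dimensional space to a direct sum has values in a finite partial
sum. -/
theorem exists_support_of_finite {N : ι → GrMod A} {i : ℤ} {W : Type u} [AddCommGroup W]
    [Module K W] [Module.Finite K W] (f : W →ₗ[K] (dsum N).obj i) :
    ∃ S : Finset ι, ∀ x ∉ S, ∀ a, (dsumProj N x).app i (f a) = 0 := by
  classical
  obtain ⟨G, hG⟩ := (inferInstance : Module.Finite K W).fg_top
  choose S hS using fun t : (dsum N).obj i => exists_support t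
  refine ⟨G.biUnion fun a => S (f a), fun x hx a => ?_⟩
  have ha : a ∈ Submodule.span K (G : Set W) := by rw [hG]; trivial
  induction ha using Submodule.span_induction with
  | mem a ha =>
    refine hS _ x fun h => hx (Finset.mem_biUnion.2 ⟨a, ha, h⟩)
  | zero => rw [map_zero, map_zero]
  | add a b _ _ ha hb => rw [map_add, map_add, ha, hb, add_zero]
  | smul c a _ ha => rw [map_smul, map_smul, ha, smul_zero]

/-- Extension of maps to a direct sum of shifts of `D(A)`, whose values lie in the part of the
sum that is cogenerated in degree `s`. -/
theorem exists_act_dsum [∀ p, Module.Finite K (A.obj p)] {s i : ℤ} {p : ℕ} (h : i + p = s)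
    (f : A.obj p →ₗ[K] (dsum fun x => (dual A).shift (κ x)).obj s)
    (hf : ∀ (a : A.obj p) (e : A.obj 0), f (A.mul (add_zero p) a e) =
      (dsum fun x => (dual A).shift (κ x)).act (by simp) (f a) e)
    (hf' : ∀ x, κ x ≠ -s → ∀ a, (dsumProj (fun x => (dual A).shift (κ x)) x).app s (f a) = 0) :
    ∃ z : (dsum fun x => (dual A).shift (κ x)).obj i,
      ∀ a, (dsum fun x => (dual A).shift (κ x)).act h z a = f a := by
  classical
  let N : ι → GrMod A := fun x => (dual A).shift (κ x)
  obtain ⟨S, hS⟩ := exists_support_of_finite f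
  have hx : ∀ x, ∃ z : (N x).obj i, ∀ a, (N x).act h z a = (dsumProj N x).app s (f a) := by
    intro x
    by_cases hκ : κ x = -s
    · refine exists_act_dual hκ h ((dsumProj N x).app s ∘ₗ f) fun a e => ?_
      rw [LinearMap.comp_apply, hf, (dsumProj N x).comm]
      rfl
    · exact ⟨0, fun a => (LinearMap.congr_fun (map_zero _) a).trans (hf' x hκ a).symm⟩
  choose z hz using hx
  refine ⟨∑ x ∈ S, (dsumIncl N x).app i (z x), fun a => dsum_ext N fun x => ?_⟩
  rw [(dsumProj N x).comm, map_sum]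
  by_cases hxS : x ∈ S
  · rw [Finset.sum_eq_single x (fun y _ hy => dsumProj_incl_ne N (Ne.symm hy) _)
      (fun h => (h hxS).elim), dsumProj_incl_self, hz]
  · rw [Finset.sum_eq_zero fun y hy => dsumProj_incl_ne N (fun h => hxS (by rw [h]; exact hy)) _,
      map_zero, LinearMap.zero_apply, hS x hxS]

theorem isCofree_dsum_dual [∀ p, Module.Finite K (A.obj p)] {s : ℤ} (hκ : ∀ x, κ x = -s) :
    (dsum fun x => (dual A).shift (κ x)).IsCofree s where
  eq_zero t H := dsum_ext _ fun x => by
    rw [map_zero]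
    refine eq_zero_of_act_dual (hκ x) _ fun p h a => ?_
    have := congrArg ((dsumProj (fun x => (dual A).shift (κ x)) x).app s) (H p h a)
    rw [(dsumProj (fun x => (dual A).shift (κ x)) x).comm, map_zero] at this
    exact this
  exists_act h f hf := exists_act_dsum κ h f hf fun x hx => (hx (hκ x)).elim

end Dual

/-- An almost injective module that is cogenerated in one degree is cofree. -/
theorem IsAlmostInjective.isCofree [∀ p, Module.Finite K (A.obj p)] {s : ℤ} {M : GrMod A}
    (hM : M.IsAlmostInjective) (hM' : M.CogeneratedIn {s}) : M.IsCofree s := by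
  refine ⟨hM'.eq_zero_of_act, fun {i p} h f hf => ?_⟩
  obtain ⟨ι, κ, T, ⟨hT⟩, ⟨R⟩⟩ := hM
  let N : ι → GrMod A := fun x => (dual A).shift (κ x)
  let θ : T.pt ≅ dsum N := hT.coconePointUniqueUpToIso (dsumIsColimit N)
  let j : M ⟶ dsum N := R.i ≫ θ.hom
  let r : dsum N ⟶ M := θ.inv ≫ R.r
  have hjr : ∀ i (x : M.obj i), r.app i (j.app i x) = x := fun i x => by
    have : j ≫ r = 𝟙 M := by simp [j, r]
    exact LinearMap.congr_fun (congrArg (fun f => Hom.app f i) this) x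
  obtain ⟨z, hz⟩ := exists_act_dsum κ h (j.app s ∘ₗ f)
    (fun a e => by rw [LinearMap.comp_apply, hf, j.comm]; rfl) (fun x hx a => by
      -- In a term not cogenerated in degree `s`, a functional on `A_q` with `q ≠ 0` is determined
      -- by its translates of degree `s + q`, where `M` vanishes.
      refine Subtype.ext (funext fun q => ?_)
      by_cases hq : (q : ℤ) = -(s + κ x)
      · refine LinearMap.ext fun b => ?_
        have h0 : M.act (show s + (q : ℤ) = s + q from rfl) (f a) b = 0 :=
          hM'.eq_zero_of_act _ fun p' h' => by omega
        have h1 : ((dsumProj N x).app (s + q) (j.app (s + q)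
            (M.act (show s + (q : ℤ) = s + q from rfl) (f a) b))).1 0 A.one = 0 := by
          rw [h0, map_zero, map_zero]; rfl
        rw [j.comm, (dsumProj N x).comm] at h1
        have h2 : ((dsumProj N x).app s (j.app s (f a))).1 (q + 0) (A.mul rfl b A.one) = 0 := h1
        have h3 : A.mul (show q + 0 = q + 0 from rfl) b A.one = b := A.mul_one b
        rw [h3] at h2
        exact h2
      · exact ((dsumProj N x).app s (j.app s (f a))).2 q hq)
  refine ⟨r.app i z, fun a => ?_⟩
  rw [← r.comm, hz]
  exact hjr s (f a)

end GrMod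

namespace DualPair

variable {K : Type u} [Field K] {A B : GrAlg.{u, u} K} {V : Type v} [Quiver.{w + 1} V]
  [Finite V] [∀ a b : V, Finite (a ⟶ b)] {n : ℕ} (D : DualPair A B V n)

theorem hom_ext {c : ℕ} {W : Type*} [AddCommGroup W] [Module K W] {f g : A.obj c →ₗ[K] W}
    (H : ∀ q : QPath V c, f (D.x q) = g (D.x q)) : f = g :=
  LinearMap.ext_on_range (top_le_iff.1 (D.x_span c)) H

include D in
theorem finite (p : ℕ) : Module.Finite K (A.obj p) :=
  ⟨by
    classical
    refine ⟨Finset.univ.image (D.x (c := p)), ?_⟩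
    rw [Finset.coe_image, Finset.coe_univ, Set.image_univ]
    exact top_le_iff.1 (D.x_span p)⟩

/-- For `c < n`, the images of the paths form a basis of `A_c`. -/
def basis {c : ℕ} (hc : c < n) : Module.Basis (QPath V c) K (A.obj c) :=
  Module.Basis.mk (D.x_linearIndependent hc) (D.x_span c)

theorem basis_apply {c : ℕ} (hc : c < n) (q : QPath V c) : D.basis hc q = D.x q :=
  Module.Basis.mk_apply _ _ q

theorem _root_.NKoszul.atJoin_nil_nil {M : Type*} [Zero M] [DecidableEq (QPath V 0)]
    (h : 0 + 0 = 0) (F : QPath V 0 → M) (p q : QPath V 0) :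
    atJoin h F p q = if p = q then F p else 0 := by
  rw [QPath.eq_nil p, QPath.eq_nil q]
  by_cases hpq : p.src = q.src
  · rw [hpq, if_pos rfl, atJoin_join h _ _ _ rfl]
    congr 1
    exact QPath.eq_nil _
  · have hne : QPath.nil p.src ≠ QPath.nil q.src := fun h => by
      have h' := congrArg (fun r : QPath V 0 => r.src) h
      exact hpq h'
    rw [if_neg hne]
    exact atJoin_of_ne h F hpq

theorem x_mul_zero [DecidableEq (QPath V 0)] (h : 0 + 0 = 0) (u v : QPath V 0) :
    A.mul h (D.x u) (D.x v) = if u = v then D.x u else 0 := by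
  rw [D.x_mul, atJoin_nil_nil]

theorem y_mul_zero [DecidableEq (QPath V 0)] (h : 0 + 0 = 0) (u v : QPath V 0) :
    B.mul h (D.y u) (D.y v) = if u = v then D.y u else 0 := by
  rw [D.y_mul h, atJoin_nil_nil]
  by_cases huv : u = v
  · rw [huv]
  · rw [if_neg huv, if_neg (Ne.symm huv)]

open Classical in
include D in
/-- A cofree module is almost injective. As `A_0` is separable, every linear map of `A_0`-modules
can be averaged to an `A_0`-linear one. -/
theorem isAlmostInjective (hn : 0 < n) {s : ℤ} {M : GrMod A} (hM : M.IsCofree s) :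
    M.IsAlmostInjective := by
  have := D.finite
  have hs : s + (0 : ℕ) = s := by simp
  let b := Module.Basis.ofVectorSpace K (M.obj s)
  let N : Module.Basis.ofVectorSpaceIndex K (M.obj s) → GrMod A :=
    fun _ => (GrMod.dual A).shift (-s)
  have hN : (GrMod.dsum N).IsCofree s := GrMod.isCofree_dsum_dual _ fun _ => rfl
  -- `E v` is the functional on `A_0` dual to the vertex `v`, as an element of degree `s` of
  -- `D(A)[-s]`.
  let E₀ : QPath V 0 → ∀ q, A.obj q →ₗ[K] K := fun v q =>
    if hq : q + 0 = 0 then (D.basis hn).coord v ∘ₗ (A.mul hq).flip A.one else 0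
  let E : QPath V 0 → ((GrMod.dual A).shift (-s)).obj s := fun v =>
    ⟨E₀ v, fun q hq => dif_neg (by omega)⟩
  have hE : ∀ v u, (E v).1 0 (D.x u) = if u = v then 1 else 0 := fun v u => by
    have h1 : E₀ v 0 = (D.basis hn).coord v ∘ₗ (A.mul (add_zero 0)).flip A.one :=
      dif_pos (show 0 + 0 = 0 from rfl)
    change E₀ v 0 (D.x u) = _
    rw [h1]
    change (D.basis hn).coord v (A.mul (add_zero 0) (D.x u) A.one) = _
    rw [A.mul_one, ← D.basis_apply hn, Module.Basis.coord_apply, Module.Basis.repr_self,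
      Finsupp.single_apply]
  have hE' : ∀ v u, ((GrMod.dual A).shift (-s)).act hs (E v) (D.x u) =
      if v = u then E v else 0 := fun v u => by
    refine Subtype.ext (funext fun q => ?_)
    rcases Nat.eq_zero_or_pos q with rfl | hq
    · refine D.hom_ext fun t => ?_
      change (E v).1 0 (A.mul (add_zero 0) (D.x u) (D.x t)) = (if v = u then E v else 0).1 0 (D.x t)
      rw [D.x_mul_zero]
      by_cases huv : v = u
      · rw [if_pos huv, hE]
        by_cases hut : u = t
        · rw [if_pos hut, hE, ← hut]
        · rw [if_neg hut, map_zero, if_neg fun h => hut (by rw [h, huv])]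
      · rw [if_neg huv]
        by_cases hut : u = t
        · rw [if_pos hut, hE, if_neg (Ne.symm huv)]; rfl
        · rw [if_neg hut, map_zero]; rfl
    · exact ((((GrMod.dual A).shift (-s)).act hs (E v) (D.x u)).2 q (by omega)).trans
        ((if v = u then E v else 0).2 q (by omega)).symm
  let lift : QPath V 0 → (_ →₀ K) →ₗ[K] (GrMod.dsum N).obj s := fun v =>
    Finsupp.linearCombination K fun x => (GrMod.dsumIncl N x).app s (E v)
  have hlift : ∀ v u t, (GrMod.dsum N).act hs (lift v t) (D.x u) =
      if v = u then lift v t else 0 := fun v u t => by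
    have h1 : ((GrMod.dsum N).act hs).flip (D.x u) ∘ₗ lift v = if v = u then lift v else 0 := by
      refine Finsupp.lhom_ext' fun x => LinearMap.ext_ring ?_
      have h2 : lift v (Finsupp.single x 1) = (GrMod.dsumIncl N x).app s (E v) := by
        simp [lift]
      change (GrMod.dsum N).act hs (lift v (Finsupp.single x 1)) (D.x u) =
        (if v = u then lift v else 0) (Finsupp.single x 1)
      rw [h2, ← (GrMod.dsumIncl N x).comm]
      refine (congrArg _ (hE' v u)).trans ?_
      split_ifs
      · exact h2.symm
      · exact map_zero _
    have h2 := LinearMap.congr_fun h1 t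
    refine h2.trans ?_
    split_ifs <;> rfl
  -- The maps `g` and `r` between `M_s` and the direct sum are averaged over the vertices; they are
  -- `A_0`-linear, and `r ∘ g = id`.
  let g : M.obj s →ₗ[K] (GrMod.dsum N).obj s :=
    ∑ v, lift v ∘ₗ b.repr.toLinearMap ∘ₗ (M.act hs).flip (D.x v)
  have hg : ∀ w, g w = ∑ v, lift v (b.repr (M.act hs w (D.x v))) := fun w => by
    rw [LinearMap.sum_apply]; rfl
  let r : (GrMod.dsum N).obj s →ₗ[K] M.obj s := GrMod.dsumLift fun x =>
    ∑ v, (LinearMap.toSpanSingleton K _ (M.act hs (b x) (D.x v))) ∘ₗ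
      (LinearMap.applyₗ (D.x v) ∘ₗ LinearMap.proj 0 ∘ₗ
        Submodule.subtype _ : ((GrMod.dual A).shift (-s)).obj s →ₗ[K] K)
  have hr : ∀ x t, r ((GrMod.dsumIncl N x).app s t) = ∑ v, t.1 0 (D.x v) • M.act hs (b x) (D.x v) :=
    fun x t => by
      refine (GrMod.dsumLift_incl N _ x t).trans ?_
      rw [LinearMap.sum_apply]; rfl
  have hact : ∀ (w : M.obj s) u v, M.act hs (M.act hs w (D.x u)) (D.x v) =
      if u = v then M.act hs w (D.x u) else 0 := fun w u v => by
    rw [M.act_act hs hs (add_zero 0) hs, D.x_mul_zero]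
    split_ifs
    · rfl
    · rw [map_zero]
  have hrg : ∀ w, r (g w) = w := fun w => by
    have h1 : ∀ v, r ∘ₗ lift v = (M.act hs).flip (D.x v) ∘ₗ b.repr.symm.toLinearMap := fun v => by
      refine Finsupp.lhom_ext' fun x => LinearMap.ext_ring ?_
      have h2 : lift v (Finsupp.single x 1) = (GrMod.dsumIncl N x).app s (E v) := by
        simp [lift]
      change r (lift v (Finsupp.single x 1)) = M.act hs (b.repr.symm (Finsupp.single x 1)) (D.x v)
      rw [h2, hr, b.repr_symm_single_one, Finset.sum_eq_single v]
      · rw [hE, if_pos rfl, one_smul]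
      · intro u _ hu
        rw [hE, if_neg hu, zero_smul]
      · simp
    rw [hg, map_sum]
    have h2 : ∀ v, r (lift v (b.repr (M.act hs w (D.x v)))) = M.act hs w (D.x v) := fun v => by
      refine (LinearMap.congr_fun (h1 v) _).trans ?_
      change M.act hs (b.repr.symm (b.repr (M.act hs w (D.x v)))) (D.x v) = _
      rw [LinearEquiv.symm_apply_apply, hact, if_pos rfl]
    rw [Finset.sum_congr rfl fun v _ => h2 v, ← map_sum, D.x_one, M.act_one]
  have hgA : ∀ w e, g (M.act hs w e) = (GrMod.dsum N).act hs (g w) e := fun w e => by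
    refine LinearMap.congr_fun (f := g ∘ₗ M.act hs w) (g := (GrMod.dsum N).act hs (g w))
      (D.hom_ext fun u => ?_) e
    change g (M.act hs w (D.x u)) = _
    rw [hg, hg, map_sum, LinearMap.sum_apply]
    refine Finset.sum_congr rfl fun v _ => ?_
    rw [hlift, hact]
    by_cases huv : u = v
    · rw [if_pos huv, if_pos huv.symm, huv]
    · rw [if_neg huv, if_neg (Ne.symm huv), map_zero, map_zero]
  have hrA : ∀ t e, r ((GrMod.dsum N).act hs t e) = M.act hs (r t) e := fun t e => by
    refine LinearMap.congr_fun (f := r ∘ₗ (GrMod.dsum N).act hs t) (g := M.act hs (r t))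
      (D.hom_ext fun u => ?_) e
    change r ((GrMod.dsum N).act hs t (D.x u)) = _
    induction t using GrMod.dsum_induction with
    | h0 => simp only [map_zero, LinearMap.zero_apply]
    | h1 x t =>
      rw [← (GrMod.dsumIncl N x).comm, hr, hr, map_sum, LinearMap.sum_apply]
      refine Finset.sum_congr rfl fun v _ => ?_
      rw [map_smul, LinearMap.smul_apply, hact]
      change t.1 0 (A.mul (add_zero 0) (D.x u) (D.x v)) • _ = _
      rw [D.x_mul_zero]
      by_cases huv : u = v
      · rw [if_pos huv, if_pos huv.symm, huv]
      · rw [if_neg huv, if_neg (Ne.symm huv), map_zero, zero_smul, smul_zero]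
    | h2 s t hs ht => simp only [map_add, LinearMap.add_apply] at hs ht ⊢; rw [hs, ht]
  obtain ⟨F, hF⟩ := hN.exists_hom g hgA
  obtain ⟨G, hG⟩ := hM.exists_hom r hrA
  refine ⟨_, _, Limits.Cofan.mk (GrMod.dsum N) (GrMod.dsumIncl N), ⟨GrMod.dsumIsColimit N⟩,
    ⟨⟨F, G, hM.hom_ext fun w => ?_⟩⟩⟩
  rw [GrMod.comp_app_apply, hF, hG, hrg]
  rfl

section Coinduced

variable {W : Type u} [AddCommGroup W] [Module K W] (ρ : QPath V 0 → W →ₗ[K] W) (s : ℤ)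

/-- The graded module coinduced by an `A_0`-module `W`, on which the vertices act by `ρ`. Its
component of degree `i` is `Hom_{A_0}(A_p, W)` if `i + p = s`; the action is `(f a)(b) = f (a b)`.
-/
def coind : GrMod A where
  obj i := ({ carrier := { f | ∀ (p : {p : ℕ // i + (p : ℤ) = s}) (v : QPath V 0) (a : A.obj p),
                f p (A.mul (add_zero (p : ℕ)) a (D.x v)) = ρ v (f p a) }
              add_mem' := fun hf hg p v a => by simp [hf p v a, hg p v a]
              zero_mem' := fun p v a => by simp
              smul_mem' := fun c f hf p v a => by simp [hf p v a] } :
      Submodule K (∀ p : {p : ℕ // i + (p : ℤ) = s}, A.obj p →ₗ[K] W))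
  act {i j l} h := LinearMap.mk₂ K
    (fun f a => ⟨fun p => f.1 ⟨j + p, by push_cast; omega⟩ ∘ₗ A.mul rfl a, fun p v b => by
      have := f.2 ⟨j + p, by push_cast; omega⟩ v (A.mul rfl a b)
      have h2 := A.mul_assoc (rfl : j + (p : ℕ) = j + p) (add_zero (p : ℕ)) (add_zero _) rfl a b
        (D.x v)
      rw [h2] at this
      exact this⟩)
    (fun _ _ _ => rfl) (fun _ _ _ => rfl)
    (fun f a b => by ext p x; simp) (fun c f a => by ext p x; simp)
  act_one {i} f := by
    ext p x
    have key : ∀ (q : ℕ) (h : 0 + (p : ℕ) = q) (hq : i + (q : ℤ) = s),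
        f.1 ⟨q, hq⟩ (A.mul h A.one x) = f.1 p x := by
      intro q h hq
      obtain ⟨p, hp⟩ := p
      obtain rfl : p = q := by simpa using h
      rw [A.one_mul]
    exact key _ rfl _
  act_act {i j k jk l l'} hij h hjk h' f a b := by
    ext p x
    have key : ∀ (q : ℕ) (hq : jk + (p : ℕ) = q) (hq' : j + (k + (p : ℕ)) = q)
        (h1 : i + ((j + (k + (p : ℕ)) : ℕ) : ℤ) = s) (h2 : i + (q : ℤ) = s),
        f.1 ⟨j + (k + p), h1⟩ (A.mul rfl a (A.mul rfl b x)) =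
          f.1 ⟨q, h2⟩ (A.mul hq (A.mul hjk a b) x) := by
      intro q hq hq' h1 h2
      subst hq'
      rw [A.mul_assoc hjk rfl hq rfl]
    exact key _ rfl (by omega) _ _

/-- The evaluation at `1` of the elements of degree `s` of a coinduced module. -/
def coindEval : (D.coind ρ s).obj s →ₗ[K] W where
  toFun f := f.1 ⟨0, by simp⟩ A.one
  map_add' _ _ := rfl
  map_smul' _ _ := rfl

theorem coindEval_act {i : ℤ} {p : ℕ} (h : i + p = s) (f : (D.coind ρ s).obj i) (a : A.obj p) :
    D.coindEval ρ s ((D.coind ρ s).act h f a) = f.1 ⟨p, h⟩ a :=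
  congrArg (f.1 ⟨p, h⟩) (A.mul_one a)

theorem coindEval_act_x (f : (D.coind ρ s).obj s) (v : QPath V 0) :
    D.coindEval ρ s ((D.coind ρ s).act (by simp) f (D.x v)) = ρ v (D.coindEval ρ s f) := by
  rw [coindEval_act]
  refine Eq.trans ?_ (f.2 ⟨0, by simp⟩ v A.one)
  exact congrArg (f.1 ⟨0, by simp⟩) (A.one_mul (D.x v)).symm

theorem coindEval_injective : Function.Injective (D.coindEval ρ s) := by
  refine (injective_iff_map_eq_zero _).2 fun f hf => Subtype.ext (funext fun p => ?_)
  obtain ⟨p, hp⟩ := p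
  obtain rfl : p = 0 := by omega
  refine D.hom_ext fun v => ?_
  have h1 := D.coindEval_act_x ρ s f v
  rw [hf, map_zero, coindEval_act] at h1
  exact h1

open Classical in
theorem coindEval_surjective (hn : 0 < n) (h1 : ∀ w, ∑ v, ρ v w = w)
    (h2 : ∀ u v w, ρ v (ρ u w) = if u = v then ρ u w else 0) :
    Function.Surjective (D.coindEval ρ s) := by
  intro w
  let F : A.obj 0 →ₗ[K] W := (D.basis hn).constr K fun v => ρ v w
  have hF : ∀ v, F (D.x v) = ρ v w := fun v => by
    rw [← D.basis_apply hn]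
    exact (D.basis hn).constr_basis K _ v
  refine ⟨⟨fun p => F ∘ₗ (A.mul (show (p : ℕ) + 0 = 0 by have := p.2; omega)).flip A.one, ?_⟩, ?_⟩
  · rintro ⟨p, hp⟩ v a
    obtain rfl : p = 0 := by omega
    change F (A.mul (add_zero 0) (A.mul (add_zero 0) a (D.x v)) A.one) =
      ρ v (F (A.mul (add_zero 0) a A.one))
    rw [A.mul_one, A.mul_one]
    refine LinearMap.congr_fun (f := F ∘ₗ (A.mul (add_zero 0)).flip (D.x v)) (g := ρ v ∘ₗ F)
      (D.hom_ext fun u => ?_) a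
    change F (A.mul (add_zero 0) (D.x u) (D.x v)) = ρ v (F (D.x u))
    rw [D.x_mul_zero, hF, h2]
    split_ifs
    · exact hF u
    · exact map_zero F
  · change F (A.mul (add_zero 0) A.one A.one) = w
    rw [A.mul_one, ← D.x_one, map_sum]
    simp only [hF, h1]

theorem isCofree_coind : (D.coind ρ s).IsCofree s where
  eq_zero {i} f H := Subtype.ext (funext fun ⟨p, hp⟩ => LinearMap.ext fun a => by
    rw [← D.coindEval_act ρ s hp f a, H, map_zero]; rfl)
  exists_act {i p} h F hF := by
    refine ⟨⟨fun q => D.coindEval ρ s ∘ₗ F ∘ₗ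
      (A.mul (show (q : ℕ) + 0 = p by have := q.2; omega)).flip A.one, ?_⟩, fun a => ?_⟩
    · rintro ⟨q, hq⟩ v a
      obtain rfl : q = p := by omega
      change D.coindEval ρ s (F (A.mul (add_zero q) (A.mul (add_zero q) a (D.x v)) A.one)) =
        ρ v (D.coindEval ρ s (F (A.mul (add_zero q) a A.one)))
      rw [A.mul_one, A.mul_one, hF, coindEval_act_x]
    · refine D.coindEval_injective ρ s ?_
      refine (D.coindEval_act ρ s h _ a).trans ?_
      change D.coindEval ρ s (F (A.mul (add_zero p) a A.one)) = _
      rw [A.mul_one]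

end Coinduced

end DualPair

end

section

/-! ### Linear complexes of cofree modules and modules over the dual algebra -/

section Paths

variable {V : Type v} [Quiver.{w + 1} V] {M : Type*} [Zero M]

open Classical in
theorem atJoin_nil_left {c : ℕ} (h : 0 + c = c) (F : QPath V c → M) (v : QPath V 0)
    (q : QPath V c) : atJoin h F v q = if v.src = q.src then F q else 0 := by
  have h2 : q.drop h = q := by
    refine QPath.ext (funext fun s => ?_) (funext fun s => ?_)
    · exact congrArg q.vertex (Fin.ext (Nat.zero_add s))
    · exact congrArg q.arrow (Fin.ext (Nat.zero_add s))
  split_ifs with hv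
  · have h1 : q.take h = v := by
      rw [QPath.eq_nil v, hv]
      exact QPath.eq_nil _
    have := atJoin_take_drop h F q
    rwa [h1, h2] at this
  · exact atJoin_of_ne h F hv

open Classical in
theorem atJoin_nil_right {c : ℕ} (h : c + 0 = c) (F : QPath V c → M) (q : QPath V c)
    (v : QPath V 0) : atJoin h F q v = if q.tgt = v.src then F q else 0 := by
  split_ifs with hv
  · have h1 : q.drop h = v := by
      rw [QPath.eq_nil v, ← hv]
      exact QPath.eq_nil _
    have h2 : q.take h = q := rfl
    have := atJoin_take_drop h F q
    rwa [h1, h2] at this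
  · exact atJoin_of_ne h F hv

end Paths

namespace DualPair

variable {K : Type u} [Field K] {A B : GrAlg.{u, u} K} {V : Type v} [Quiver.{w + 1} V]
  [Finite V] [∀ a b : V, Finite (a ⟶ b)] {n : ℕ} (D : DualPair A B V n)

/-- The canonical elements `∑ x_q ⊗ y_q` are multiplicative. -/
theorem sum_mul {a b t : ℕ} (h : a + b = t) (h' : b + a = t) {M : Type*} [AddCommGroup M]
    [Module K M] (β : A.obj t →ₗ[K] B.obj t →ₗ[K] M) :
    ∑ r, β (D.x r) (D.y r) =
      ∑ p : QPath V a, ∑ q : QPath V b,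
        β (A.mul h (D.x p) (D.x q)) (B.mul h' (D.y q) (D.y p)) := by
  rw [← sum_take_drop h]
  · refine Finset.sum_congr rfl fun r _ => ?_
    rw [D.x_mul, D.y_mul h, atJoin_take_drop, atJoin_take_drop]
  · intro p q hpq
    rw [D.x_mul, atJoin_of_ne h _ hpq, map_zero, LinearMap.zero_apply]

/-- The canonical element `∑ x_q ⊗ y_q` is balanced over the vertices. -/
theorem sum_balanced {c : ℕ} {M : Type*} [AddCommGroup M] [Module K M]
    (β : A.obj c →ₗ[K] B.obj c →ₗ[K] M) (v : QPath V 0) :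
    ∑ q, β (A.mul (Nat.zero_add c) (D.x v) (D.x q)) (D.y q) =
      ∑ q, β (D.x q) (B.mul (add_zero c) (D.y q) (D.y v)) := by
  classical
  refine Finset.sum_congr rfl fun q _ => ?_
  rw [D.x_mul, D.y_mul (Nat.zero_add c), atJoin_nil_left, atJoin_nil_left]
  split_ifs
  · rfl
  · rw [map_zero, map_zero, LinearMap.zero_apply]

/-- The data relating a sequence of cofree `A`-modules `X^k`, cogenerated in degree `-k`, and a
graded `B`-module `W`: identifications `(X^k)_{-k} ≅ W_k`, under which the maps `X^k → X^{k+1}` are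
given in degree `-(k+1)` by `z ↦ ∑ (z x_α) y_α`, the sum being over the arrows `α`. -/
structure Link (X : ℤ → GrMod A) (d : ∀ k, X k ⟶ X (k + 1)) (W : GrMod B) where
  isCofree : ∀ k, (X k).IsCofree (-k)
  lam : ∀ k, (X k).obj (-k) ≃ₗ[K] W.obj k
  lam_act : ∀ (k : ℤ) (z : (X k).obj (-k)) (v : QPath V 0),
    lam k ((X k).act (by simp) z (D.x v)) = W.act (by simp) (lam k z) (D.y v)
  lam_d : ∀ (k : ℤ) (z : (X k).obj (-(k + 1))),
    lam (k + 1) ((d k).app _ z) = ∑ α : QPath V 1,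
      W.act (by simp) (lam k ((X k).act (by push_cast; omega) z (D.x α))) (D.y α)

namespace Link

variable {D} {X : ℤ → GrMod A} {d : ∀ k, X k ⟶ X (k + 1)} {W : GrMod B} (L : D.Link X d W)

/-- The bilinear map `(a, b) ↦ (z a) b`. -/
def pairing {c : ℕ} {k l : ℤ} (h : k + c = l) (h' : -l + c = -k) (z : (X k).obj (-l)) :
    A.obj c →ₗ[K] B.obj c →ₗ[K] W.obj l :=
  W.act h ∘ₗ (L.lam k).toLinearMap ∘ₗ (X k).act h' z

/-- The composition of `c` consecutive maps `X^k → X^{k+c}` is given by the canonical element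
`∑ x_q ⊗ y_q` of `A_c ⊗ B_c`. -/
theorem lam_iter (c : ℕ) : ∀ (k l : ℤ) (h : k + c = l) (h' : -l + c = -k) (z : (X k).obj (-l)),
    L.lam l ((iter X d c k l h).app _ z) = ∑ q : QPath V c, L.pairing h h' z (D.x q) (D.y q) := by
  induction c with
  | zero =>
    intro k l h h' z
    obtain rfl : k = l := by simpa using h
    have h1 : ∀ q : QPath V 0, L.pairing h h' z (D.x q) (D.y q) =
        W.act h (L.lam k z) (D.y q) := fun q => by
      classical
      change W.act h (L.lam k ((X k).act h' z (D.x q))) (D.y q) = _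
      rw [L.lam_act, W.act_act _ _ (add_zero 0) (by simp), D.y_mul_zero, if_pos rfl]
    rw [Finset.sum_congr rfl fun q _ => h1 q, ← map_sum, D.y_one, W.act_one]
    rfl
  | succ c ih =>
    intro k l h h' z
    rw [iter, GrMod.comp_app_apply, ih _ _ _ (by push_cast at h; omega),
      D.sum_mul (a := c) (b := 1) rfl (by omega)]
    refine Finset.sum_congr rfl fun q _ => ?_
    have h2 : -l + (c : ℤ) = -(k + 1) := by push_cast at h; omega
    change W.act _ (L.lam (k + 1) ((X (k + 1)).act h2 ((d k).app _ z) (D.x q))) (D.y q) = _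
    rw [← (d k).comm, L.lam_d, map_sum, LinearMap.sum_apply]
    refine Finset.sum_congr rfl fun α _ => ?_
    rw [(X k).act_act _ _ rfl h', W.act_act _ _ (by omega) h]
    rfl

include L in
/-- As the canonical element of `A_n ⊗ B_n` is zero, the sequence of maps is an `n`-complex. -/
theorem iter_eq_zero (k l : ℤ) (h : k + n = l) : iter X d n k l h = 0 :=
  (L.isCofree l).hom_ext fun z => by
    refine (L.lam l).injective ?_
    rw [L.lam_iter n k l h (by omega) z, D.sum_eq_zero]
    exact (map_zero (L.lam l)).symm

/-- The `n`-complex of a link. -/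
def nComplex : NComplex n A := ⟨X, d, L.iter_eq_zero⟩

end Link

/-- Every graded `B`-module is linked to a sequence of cofree modules. -/
theorem exists_link (hn : 0 < n) (W : GrMod B) :
    ∃ (X : ℤ → GrMod A) (d : ∀ k, X k ⟶ X (k + 1)), Nonempty (D.Link X d W) := by
  classical
  -- `X^k` is coinduced by `W_k`, on which the vertices act as elements of `B_0`.
  let ρ : ∀ k, QPath V 0 → W.obj k →ₗ[K] W.obj k := fun k v =>
    (W.act (show k + (0 : ℕ) = k by simp)).flip (D.y v)
  let X : ℤ → GrMod A := fun k => D.coind (ρ k) (-k)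
  have hX : ∀ k, (X k).IsCofree (-k) := fun k => D.isCofree_coind (ρ k) (-k)
  have hsurj : ∀ k, Function.Surjective (D.coindEval (ρ k) (-k)) := fun k =>
    D.coindEval_surjective (ρ k) (-k) hn
      (fun w => by
        change ∑ v, W.act (show k + (0 : ℕ) = k by simp) w (D.y v) = w
        rw [← map_sum, D.y_one, W.act_one])
      (fun u v w => by
        change W.act (show k + (0 : ℕ) = k by simp)
          (W.act (show k + (0 : ℕ) = k by simp) w (D.y u)) (D.y v) =
          if u = v then W.act (show k + (0 : ℕ) = k by simp) w (D.y u) else 0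
        rw [W.act_act _ _ (add_zero 0) (by simp), D.y_mul_zero]
        split_ifs
        · rfl
        · exact map_zero _)
  let lam : ∀ k, (X k).obj (-k) ≃ₗ[K] W.obj k := fun k =>
    LinearEquiv.ofBijective (D.coindEval (ρ k) (-k)) ⟨D.coindEval_injective (ρ k) (-k), hsurj k⟩
  have lam_act : ∀ (k : ℤ) (z : (X k).obj (-k)) (v : QPath V 0),
      lam k ((X k).act (by simp) z (D.x v)) = W.act (by simp) (lam k z) (D.y v) :=
    fun k z v => D.coindEval_act_x (ρ k) (-k) z v
  have h1 : ∀ k : ℤ, -(k + 1) + (1 : ℕ) = -k := fun k => by push_cast; omega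
  have h2 : ∀ k : ℤ, k + (1 : ℕ) = k + 1 := fun k => by simp
  let g : ∀ k, (X k).obj (-(k + 1)) →ₗ[K] (X (k + 1)).obj (-(k + 1)) := fun k =>
    (lam (k + 1)).symm.toLinearMap ∘ₗ ∑ α : QPath V 1,
      (W.act (h2 k)).flip (D.y α) ∘ₗ (lam k).toLinearMap ∘ₗ ((X k).act (h1 k)).flip (D.x α)
  have hg : ∀ k z, lam (k + 1) (g k z) =
      ∑ α : QPath V 1, W.act (h2 k) (lam k ((X k).act (h1 k) z (D.x α))) (D.y α) := fun k z => by
    change lam (k + 1) ((lam (k + 1)).symm _) = _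
    rw [LinearEquiv.apply_symm_apply, LinearMap.sum_apply]
    rfl
  -- The prescribed maps in degree `-(k + 1)` are `A_0`-linear, hence extend to `X^k ⟶ X^{k+1}`.
  have hgA : ∀ k (z : (X k).obj (-(k + 1))) (e : A.obj 0),
      g k ((X k).act (by simp) z e) = (X (k + 1)).act (by simp) (g k z) e := fun k z e => by
    refine LinearMap.congr_fun (f := g k ∘ₗ (X k).act (by simp) z)
      (g := (X (k + 1)).act (by simp) (g k z)) (D.hom_ext fun v => (lam (k + 1)).injective ?_) e
    rw [lam_act, hg, map_sum, LinearMap.sum_apply]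
    refine (hg k _).trans ?_
    have h3 := D.sum_balanced (W.act (h2 k) ∘ₗ (lam k).toLinearMap ∘ₗ (X k).act (h1 k) z) v
    refine Eq.trans (Finset.sum_congr rfl fun α _ => ?_) (h3.trans
      (Finset.sum_congr rfl fun α _ => ?_))
    · rw [(X k).act_act _ _ (Nat.zero_add 1) (h1 k)]
      rfl
    · rw [W.act_act _ _ (add_zero 1) (h2 k)]
      rfl
  choose d hd using fun k => (hX (k + 1)).exists_hom (g k) (hgA k)
  exact ⟨X, d, ⟨⟨hX, lam, lam_act, fun k z => by rw [hd, hg]⟩⟩⟩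

end DualPair

end

section

/-! ### Modules over the dual algebra, given by the action of the arrows -/

theorem sum_smul_atJoin_comm {K : Type u} [Field K] {V : Type v} [Quiver.{w + 1} V]
    [Finite V] [∀ a b : V, Finite (a ⟶ b)] {M : Type*} [AddCommGroup M] [Module K M] {a b t : ℕ}
    (h : a + b = t) (γ : PathSpace V K a) (γ' : PathSpace V K b) (φ : QPath V t → M) :
    ∑ p, γ p • ∑ q, γ' q • atJoin h φ p q = ∑ r, conv h γ γ' r • φ r := by
  rw [← QuiverOf.sum_smul_sum_atJoin]
  simp only [Finset.smul_sum]
  rw [Finset.sum_comm]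
  exact Finset.sum_congr rfl fun q _ => Finset.sum_congr rfl fun p _ => smul_comm _ _ _

/-- A graded right representation of the opposite quiver: vector spaces `W_k` on which the vertices
act as orthogonal idempotents, and maps `W_k → W_{k+1}` given by the arrows. -/
structure Rep (K : Type u) [Field K] (V : Type v) [Quiver.{w + 1} V]
    [Finite V] [∀ a b : V, Finite (a ⟶ b)] [DecidableEq V] (W : ℤ → Type u)
    [∀ k, AddCommGroup (W k)] [∀ k, Module K (W k)] where
  ρ : ∀ k, QPath V 0 → W k →ₗ[K] W k
  Y : ∀ k, QPath V 1 → W k →ₗ[K] W (k + 1)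
  sum_ρ : ∀ k w, ∑ v, ρ k v w = w
  ρ_ρ : ∀ k u v w, ρ k v (ρ k u w) = if v.src = u.src then ρ k u w else 0
  Y_ρ : ∀ k α v w, Y k α (ρ k v w) = if α.tgt = v.src then Y k α w else 0

namespace Rep

variable {K : Type u} [Field K] {V : Type v} [Quiver.{w + 1} V]
  [Finite V] [∀ a b : V, Finite (a ⟶ b)] [DecidableEq V] {W : ℤ → Type u}
  [∀ k, AddCommGroup (W k)] [∀ k, Module K (W k)] (T : Rep K V W)

/-- The identification of components with equal indices. -/
def castEquiv {k l : ℤ} (h : k = l) : W k ≃ₗ[K] W l := h ▸ LinearEquiv.refl K (W k)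

/-- The action of the paths: the last arrow of a path acts first. -/
def pathOp : ∀ (c : ℕ) (k l : ℤ), k + c = l → QPath V c → W k →ₗ[K] W l
  | 0, k, _, h, q => (castEquiv (by simpa using h)).toLinearMap ∘ₗ T.ρ k q
  | c + 1, k, l, h, q =>
    pathOp c (k + 1) l (by push_cast at h; omega) (q.take (j := 1) rfl) ∘ₗ
      T.Y k (q.drop (i := c) rfl)

theorem pathOp_zero (k : ℤ) (h : k + (0 : ℕ) = k) (q : QPath V 0) : T.pathOp 0 k k h q = T.ρ k q :=
  rfl

theorem pathOp_ρ {c : ℕ} {k l : ℤ} (h : k + c = l) (q : QPath V c) (v : QPath V 0) (w : W k) :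
    T.pathOp c k l h q (T.ρ k v w) = if q.tgt = v.src then T.pathOp c k l h q w else 0 := by
  cases c with
  | zero =>
    obtain rfl : k = l := by simpa using h
    rw [pathOp_zero, T.ρ_ρ]
    have h1 : q.tgt = q.src := congrArg q.vertex (Fin.ext rfl)
    rw [h1]
    split_ifs with hq
    · rw [QPath.eq_nil q, QPath.eq_nil v, hq]
    · rfl
  | succ c =>
    change T.pathOp c _ _ _ _ (T.Y k _ (T.ρ k v w)) = _
    rw [T.Y_ρ, QPath.tgt_drop]
    split_ifs
    · rfl
    · exact map_zero _

theorem pathOp_pathOp {a b t : ℕ} (h : a + b = t) {k k' l : ℤ} (h1 : k + b = k') (h2 : k' + a = l)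
    (h3 : k + t = l) (q : QPath V a) (r : QPath V b) (w : W k) :
    T.pathOp a k' l h2 q (T.pathOp b k k' h1 r w) =
      atJoin h (fun s => T.pathOp t k l h3 s w) q r := by
  induction b generalizing k k' t with
  | zero =>
    obtain rfl : k = k' := by simpa using h1
    obtain rfl : a = t := h
    classical
    rw [pathOp_zero, pathOp_ρ, atJoin_nil_right]
    split_ifs <;> rfl
  | succ b ih =>
    obtain rfl : t = a + b + 1 := by omega
    change T.pathOp a k' l h2 q (T.pathOp b (k + 1) k' _ (r.take rfl) (T.Y k (r.drop rfl) w)) = _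
    rw [ih (rfl : a + b = a + b) (by push_cast at h1; omega) (by push_cast at h3 ⊢; omega)]
    by_cases hqr : q.tgt = r.src
    · rw [atJoin_join h _ q r hqr, atJoin_join rfl _ q (r.take rfl) hqr]
      change _ = T.pathOp (a + b) (k + 1) l _ ((q.join h r hqr).take rfl)
        (T.Y k ((q.join h r hqr).drop rfl) w)
      have e := QPath.join_assoc (rfl : a + b = a + b) (rfl : b + 1 = b + 1)
        (rfl : a + b + 1 = a + b + 1) h q (r.take rfl) (r.drop rfl) hqr (QPath.tgt_take rfl r)
      have e' : QPath.join (rfl : b + 1 = b + 1) (r.take rfl) (r.drop rfl) (QPath.tgt_take rfl r)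
        = r := QPath.join_take_drop rfl r
      have e2 : q.join h r hqr = (q.join rfl (r.take rfl) hqr).join (rfl : a + b + 1 = a + b + 1)
          (r.drop rfl) ((QPath.tgt_join _ _ _ _).trans (QPath.tgt_take rfl r)) := by
        rw [e]
        congr 1
        exact e'.symm
      rw [e2, QPath.take_join, QPath.drop_join]
    · rw [atJoin_of_ne h _ hqr]
      exact atJoin_of_ne _ _ (q := r.take rfl) hqr

/-- The action of the linear combinations of paths. -/
def op {c : ℕ} {k l : ℤ} (h : k + c = l) : PathSpace V K c →ₗ[K] W k →ₗ[K] W l :=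
  Fintype.linearCombination K (T.pathOp c k l h)

theorem op_apply {c : ℕ} {k l : ℤ} (h : k + c = l) (f : PathSpace V K c) (w : W k) :
    T.op h f w = ∑ q, f q • T.pathOp c k l h q w := by
  rw [op, Fintype.linearCombination_apply, LinearMap.sum_apply]
  rfl

theorem op_op {a b t : ℕ} (h : a + b = t) {k k' l : ℤ} (h1 : k + b = k') (h2 : k' + a = l)
    (h3 : k + t = l) (f : PathSpace V K a) (g : PathSpace V K b) (w : W k) :
    T.op h2 f (T.op h1 g w) = T.op h3 (conv h f g) w := by
  rw [op_apply, op_apply, op_apply, ← sum_smul_atJoin_comm]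
  refine Finset.sum_congr rfl fun p _ => ?_
  rw [map_sum]
  congr 1
  refine Finset.sum_congr rfl fun q _ => ?_
  rw [map_smul, T.pathOp_pathOp h h1 h2 h3]

theorem op_eq_zero {n : ℕ} {R : Submodule K (PathSpace V K n)}
    (hR : ∀ f ∈ R, ∀ (k l : ℤ) (h : k + n = l) (w : W k), T.op h f w = 0) {c : ℕ} {k l : ℤ}
    (h : k + c = l) (w : W k) {f : PathSpace V K c} (hf : f ∈ idealGen R c) : T.op h f w = 0 := by
  induction hf using Submodule.span_induction with
  | mem f hf =>
    obtain ⟨i, t, j, h1, h2, a, g, b, hg, rfl⟩ := hf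
    rw [← T.op_op h2 (rfl : k + j = k + j) (by push_cast [← h, ← h2]; ring),
      ← T.op_op h1 (rfl : k + j + n = k + j + n) (by push_cast [← h, ← h2, ← h1]; ring),
      hR g hg, map_zero]
  | zero => rw [map_zero, LinearMap.zero_apply]
  | add f g _ _ hf hg => rw [map_add, LinearMap.add_apply, hf, hg, add_zero]
  | smul c f _ hf => rw [map_smul, LinearMap.smul_apply, hf, smul_zero]

section

variable {A B : GrAlg.{u, u} K} {n : ℕ} (D : DualPair A B V n)
  (hR : ∀ f ∈ D.R, ∀ (k l : ℤ) (h : k + n = l) (w : W k), T.op h f w = 0)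

include hR in
/-- The action of a linear combination of paths depends only on its image in `B`. -/
theorem op_congr {c : ℕ} {k l : ℤ} (h : k + c = l) {f g : PathSpace V K c}
    (hfg : ∑ q, f q • D.y q = ∑ q, g q • D.y q) : T.op h f = T.op h g := by
  rw [← sub_eq_zero, ← map_sub]
  refine LinearMap.ext fun w => T.op_eq_zero hR h w ((D.y_ker (f - g)).1 ?_)
  simp only [Pi.sub_apply, sub_smul, Finset.sum_sub_distrib, hfg, sub_self]

/-- A linear combination of paths representing an element of `B`. -/
def repr {c : ℕ} (b : B.obj c) : PathSpace V K c := (D.y_surjective b).choose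

theorem sum_repr {c : ℕ} (b : B.obj c) : ∑ q, repr D b q • D.y q = b :=
  (D.y_surjective b).choose_spec

/-- A representation of the opposite quiver that satisfies the relations of `B`, as a graded
`B`-module. -/
def toMod : GrMod B where
  obj := W
  act {i j l} h := LinearMap.mk₂ K (fun w b => T.op h (repr D b) w)
    (fun w w' b => map_add _ _ _) (fun c w b => map_smul _ _ _)
    (fun w b b' => by
      rw [← LinearMap.add_apply, ← map_add]
      refine LinearMap.congr_fun (T.op_congr D hR h ?_) w
      simp only [Pi.add_apply, add_smul, Finset.sum_add_distrib, sum_repr])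
    (fun c w b => by
      rw [← LinearMap.smul_apply, ← map_smul]
      refine LinearMap.congr_fun (T.op_congr D hR h ?_) w
      simp only [Pi.smul_apply, smul_assoc, ← Finset.smul_sum, sum_repr])
  act_one {i} w := by
    have h1 : T.op (show i + (0 : ℕ) = i by simp) (repr D B.one) =
        T.op (show i + (0 : ℕ) = i by simp) fun _ => 1 := T.op_congr D hR _ (by
      simp only [sum_repr, one_smul, D.y_one])
    refine (LinearMap.congr_fun h1 w).trans ?_
    rw [op_apply]
    simp only [one_smul]
    exact T.sum_ρ i w
  act_act {i j k jk l l'} hij h hjk h' w a b := by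
    change T.op h (repr D b) (T.op hij (repr D a) w) = T.op h' (repr D (B.mul hjk a b)) w
    rw [T.op_op (show k + j = jk by omega) hij h h']
    refine LinearMap.congr_fun (T.op_congr D hR h' ?_) w
    rw [sum_repr, ← sum_smul_atJoin_comm]
    conv_rhs => rw [← sum_repr D a, ← sum_repr D b]
    simp only [map_sum, LinearMap.sum_apply, map_smul, LinearMap.smul_apply,
      D.y_mul (show k + j = jk by omega) hjk]

theorem toMod_act_y {c : ℕ} {k l : ℤ} (h : k + c = l) (w : W k) (q : QPath V c) :
    (T.toMod D hR).act h w (D.y q) = T.pathOp c k l h q w := by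
  have h1 : T.op h (repr D (D.y q)) = T.op h (pathδ q) := T.op_congr D hR h (by
    classical
    rw [sum_repr, Finset.sum_eq_single q]
    all_goals unfold pathδ
    · rw [Pi.single_eq_same, one_smul]
    · intro p _ hp
      rw [Pi.single_eq_of_ne hp, zero_smul]
    · simp)
  refine (LinearMap.congr_fun h1 w).trans ?_
  classical
  rw [op, Fintype.linearCombination_apply_single, one_smul]

end

end Rep

namespace DualPair

variable {K : Type u} [Field K] {A B : GrAlg.{u, u} K} {V : Type v} [Quiver.{w + 1} V]
  [Finite V] [∀ a b : V, Finite (a ⟶ b)] {n : ℕ} (D : DualPair A B V n)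

open Classical in
/-- In a cofree module, the condition of linearity over `A_0` can be checked on paths. -/
theorem exists_act_of_basis {s : ℤ} {M : GrMod A} (hM : M.IsCofree s) {i : ℤ} {c : ℕ}
    (h : i + c = s) (f : A.obj c →ₗ[K] M.obj s)
    (hf : ∀ (q : QPath V c) (v : QPath V 0), M.act (by simp) (f (D.x q)) (D.x v) =
      if q.tgt = v.src then f (D.x q) else 0) :
    ∃ z : M.obj i, ∀ a, M.act h z a = f a :=
  hM.exists_act h f fun a e => by
    refine LinearMap.congr_fun₂ (f := (A.mul (add_zero c)).compr₂ f)
      (g := (M.act (by simp) : M.obj s →ₗ[K] A.obj 0 →ₗ[K] M.obj s) ∘ₗ f)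
      (D.hom_ext fun q => D.hom_ext fun v => ?_) a e
    change f (A.mul (add_zero c) (D.x q) (D.x v)) = M.act _ (f (D.x q)) (D.x v)
    rw [hf, D.x_mul, atJoin_nil_right]
    split_ifs
    · rfl
    · exact map_zero f

theorem act_x_x [DecidableEq V] {M : GrMod A} {i s : ℤ} {c : ℕ} (h : i + c = s)
    (h' : s + (0 : ℕ) = s) (z : M.obj i) (q : QPath V c) (v : QPath V 0) :
    M.act h' (M.act h z (D.x q)) (D.x v) = if q.tgt = v.src then M.act h z (D.x q) else 0 := by
  rw [M.act_act h h' (add_zero c) h, D.x_mul, atJoin_nil_right]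
  split_ifs
  · rfl
  · exact map_zero _

open Classical in
/-- Every linear `n`-complex is linked to a graded `B`-module. -/
theorem exists_link_of_isLinear (hn : 2 ≤ n) (I : NComplex n A) (hI : I.IsLinear) :
    ∃ W : GrMod B, Nonempty (D.Link I.X I.d W) := by
  have := D.finite
  have hX : ∀ k, (I.X k).IsCofree (-k) := fun k => (hI k).1.isCofree (hI k).2
  have h0 : ∀ k : ℤ, -k + (0 : ℕ) = -k := fun k => by simp
  have h1 : ∀ k : ℤ, -(k + 1) + (1 : ℕ) = -k := fun k => by push_cast; omega
  -- the element `z` with `z x_α = w e`, `e` the last vertex of `α`, and `z x_β = 0` for `β ≠ α`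
  have ex : ∀ (k : ℤ) (α : QPath V 1) (w : (I.X k).obj (-k)), ∃ z : (I.X k).obj (-(k + 1)),
      ∀ β, (I.X k).act (h1 k) z (D.x β) =
        if β = α then (I.X k).act (h0 k) w (D.x (QPath.nil α.tgt)) else 0 := fun k α w => by
    let f : A.obj 1 →ₗ[K] (I.X k).obj (-k) := (D.basis (show 1 < n by omega)).constr K fun β =>
      if β = α then (I.X k).act (h0 k) w (D.x (QPath.nil α.tgt)) else 0
    have hf : ∀ β, f (D.x β) =
        if β = α then (I.X k).act (h0 k) w (D.x (QPath.nil α.tgt)) else 0 := fun β => by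
      rw [← D.basis_apply (show 1 < n by omega)]
      exact (D.basis _).constr_basis K _ β
    obtain ⟨z, hz⟩ := D.exists_act_of_basis (hX k) (h1 k) f fun β v => by
      rw [hf]
      by_cases hβ : β = α
      · rw [if_pos hβ, D.act_x_x (h0 k), hβ]
        rfl
      · rw [if_neg hβ, map_zero, LinearMap.zero_apply, ite_self]
    exact ⟨z, fun β => (hz _).trans (hf β)⟩
  choose F hF using ex
  have heq : ∀ (k : ℤ) (z z' : (I.X k).obj (-(k + 1))),
      (∀ β, (I.X k).act (h1 k) z (D.x β) = (I.X k).act (h1 k) z' (D.x β)) → z = z' :=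
    fun k z z' H => (hX k).eq_of_act fun p h a => by
      obtain rfl : p = 1 := by omega
      exact LinearMap.congr_fun (D.hom_ext H) a
  -- The arrow `α` maps `w` to `d z`, for the `z` attached above to `α` and `w`.
  let T : Rep K V fun k => (I.X k).obj (-k) :=
    { ρ := fun k v => ((I.X k).act (h0 k)).flip (D.x v)
      Y := fun k α => (I.d k).app (-(k + 1)) ∘ₗ
        { toFun := F k α
          map_add' := fun w w' => heq k _ _ fun β => by
            rw [map_add, LinearMap.add_apply, hF, hF, hF]
            split_ifs
            · rw [map_add, LinearMap.add_apply]
            · rw [add_zero]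
          map_smul' := fun c w => heq k _ _ fun β => by
            rw [map_smul, LinearMap.smul_apply, hF, hF, RingHom.id_apply]
            split_ifs
            · rw [map_smul, LinearMap.smul_apply]
            · rw [smul_zero] }
      sum_ρ := fun k w => by
        change ∑ v, (I.X k).act (h0 k) w (D.x v) = w
        rw [← map_sum, D.x_one, (I.X k).act_one]
      ρ_ρ := fun k u v w => by
        change (I.X k).act (h0 k) ((I.X k).act (h0 k) w (D.x u)) (D.x v) =
          if v.src = u.src then (I.X k).act (h0 k) w (D.x u) else 0
        rw [D.act_x_x (h0 k)]
        have hu : u.tgt = u.src := congrArg u.vertex (Fin.ext rfl)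
        rw [hu]
        simp only [eq_comm]
      Y_ρ := fun k α v w => by
        change (I.d k).app _ (F k α ((I.X k).act (h0 k) w (D.x v))) =
          if α.tgt = v.src then (I.d k).app _ (F k α w) else 0
        have h2 : F k α ((I.X k).act (h0 k) w (D.x v)) = if α.tgt = v.src then F k α w else 0 := by
          refine heq k _ _ fun β => ?_
          have h3 : (I.X k).act (h1 k) (if α.tgt = v.src then F k α w else 0) (D.x β) =
              if α.tgt = v.src then (I.X k).act (h1 k) (F k α w) (D.x β) else 0 := by
            split_ifs
            · rfl
            · rw [map_zero, LinearMap.zero_apply]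
          rw [h3, hF, hF, D.act_x_x (h0 k)]
          have hv : v.tgt = v.src := congrArg v.vertex (Fin.ext rfl)
          have hn : (QPath.nil α.tgt).src = α.tgt := rfl
          rw [hv, hn]
          by_cases hβ : β = α
          · rw [if_pos hβ, if_pos hβ]
            by_cases hα : α.tgt = v.src
            · rw [if_pos hα, if_pos hα.symm, hα, ← QPath.eq_nil]
            · rw [if_neg hα, if_neg (Ne.symm hα)]
          · rw [if_neg hβ, if_neg hβ, ite_self]
        rw [h2]
        split_ifs
        · rfl
        · exact map_zero _ }
  -- Conversely, `d` is given by the action of the arrows, and its iterates by that of the paths.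
  have hY : ∀ (k : ℤ) (z : (I.X k).obj (-(k + 1))),
      (I.d k).app _ z = ∑ α, T.Y k α ((I.X k).act (h1 k) z (D.x α)) := fun k z => by
    change _ = ∑ α, (I.d k).app _ (F k α ((I.X k).act (h1 k) z (D.x α)))
    rw [← map_sum]
    congr 1
    refine heq k _ _ fun β => ?_
    rw [map_sum, LinearMap.sum_apply, Finset.sum_congr rfl fun α _ => hF k α _ β,
      Finset.sum_ite_eq, if_pos (Finset.mem_univ β), D.act_x_x (h1 k) (h0 k)]
    exact (if_pos rfl).symm
  have hiter : ∀ (c : ℕ) (k l : ℤ) (h : k + c = l) (h' : -l + c = -k) (z : (I.X k).obj (-l)),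
      (iter I.X I.d c k l h).app _ z =
        ∑ q, T.pathOp c k l h q ((I.X k).act h' z (D.x q)) := by
    intro c
    induction c with
    | zero =>
      intro k l h h' z
      obtain rfl : k = l := by simpa using h
      have h2 : ∀ q, T.pathOp 0 k k h q ((I.X k).act h' z (D.x q)) =
          (I.X k).act h' z (D.x q) := fun q => by
        change (I.X k).act (h0 k) ((I.X k).act h' z (D.x q)) (D.x q) = _
        rw [D.act_x_x h' (h0 k)]
        exact if_pos (congrArg q.vertex (Fin.ext rfl))
      rw [Finset.sum_congr rfl fun q _ => h2 q, ← map_sum, D.x_one, (I.X k).act_one]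
      rfl
    | succ c ih =>
      intro k l h h' z
      have h2 : -l + (c : ℤ) = -(k + 1) := by push_cast at h; omega
      rw [iter, GrMod.comp_app_apply, ih _ _ _ h2]
      have h3 := sum_take_drop (i := c) (j := 1) rfl (fun q α =>
        T.pathOp c (k + 1) l (by push_cast at h; omega) q (T.Y k α
          ((I.X k).act h' z (A.mul rfl (D.x q) (D.x α))))) (fun q α hqα => by
            rw [D.x_mul, atJoin_of_ne rfl _ hqα, map_zero, map_zero, map_zero])
      refine Eq.trans (Finset.sum_congr rfl fun q _ => ?_)
        (h3.symm.trans (Finset.sum_congr rfl fun r _ => ?_))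
      · rw [← (I.d k).comm, hY, map_sum]
        refine Finset.sum_congr rfl fun α _ => ?_
        rw [(I.X k).act_act h2 (h1 k) rfl h']
      · rw [D.x_mul, atJoin_take_drop]
        rfl
  have hR : ∀ f ∈ D.R, ∀ (k l : ℤ) (h : k + n = l) (w : (I.X k).obj (-k)), T.op h f w = 0 := by
    intro f hf k l h w
    obtain ⟨g, hg⟩ := D.exists_extend f hf
    have h' : -l + (n : ℤ) = -k := by omega
    -- the relation `f` applied to `w` is the value of the zero map `X^k → X^{k+n}` at an element
    -- `z` with `z x_q = f(q) w e`, `e` the last vertex of `q`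
    let G : A.obj n →ₗ[K] (I.X k).obj (-k) :=
      ∑ v, LinearMap.toSpanSingleton K _ ((I.X k).act (h0 k) w (D.x v)) ∘ₗ g ∘ₗ
        (A.mul (add_zero n)).flip (D.x v)
    have hG : ∀ q, G (D.x q) = f q • (I.X k).act (h0 k) w (D.x (QPath.nil q.tgt)) := fun q => by
      rw [LinearMap.sum_apply, Finset.sum_eq_single (QPath.nil q.tgt)]
      · change g (A.mul (add_zero n) (D.x q) (D.x (QPath.nil q.tgt))) •
          (I.X k).act (h0 k) w (D.x (QPath.nil q.tgt)) = _
        rw [D.x_mul, atJoin_nil_right, if_pos (show q.tgt = (QPath.nil q.tgt).src from rfl), hg]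
      · intro v _ hv
        change g (A.mul (add_zero n) (D.x q) (D.x v)) • (I.X k).act (h0 k) w (D.x v) = 0
        rw [D.x_mul, atJoin_nil_right, if_neg, map_zero, zero_smul]
        exact fun h => hv (by rw [h]; exact QPath.eq_nil v)
      · simp
    obtain ⟨z, hz⟩ := D.exists_act_of_basis (hX k) h' G fun q v => by
      rw [hG, map_smul, LinearMap.smul_apply, D.act_x_x (h0 k)]
      change f q • (if q.tgt = v.src then _ else _) = _
      rw [smul_ite, smul_zero]
    have h2 := hiter n k l h h' z
    rw [I.iter_eq_zero] at h2
    refine Eq.trans ?_ h2.symm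
    rw [T.op_apply]
    refine Finset.sum_congr rfl fun q _ => ?_
    rw [hz, hG, map_smul]
    congr 1
    refine Eq.symm ((T.pathOp_ρ h q (QPath.nil q.tgt) w).trans (if_pos rfl))
  refine ⟨T.toMod D hR, ⟨⟨hX, fun k => LinearEquiv.refl K _, fun k z v => ?_, fun k z => ?_⟩⟩⟩
  · exact (T.toMod_act_y D hR (show k + (0 : ℕ) = k by simp) z v).symm
  · have h2 := hiter 1 k (k + 1) (by simp) (h1 k) z
    have h3 : (iter I.X I.d 1 k (k + 1) (by simp)).app _ z = (I.d k).app _ z := by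
      change (I.d k ≫ 𝟙 _).app _ z = _
      rw [Category.comp_id]
    refine (h3.symm.trans h2).trans (Finset.sum_congr rfl fun α _ => ?_)
    exact (T.toMod_act_y D hR (show k + (1 : ℕ) = k + 1 by simp) _ α).symm

end DualPair

end

section

/-! ### Restriction of modules over the dual algebra to the Yoneda algebra -/

/-- The additivity of `δ_m` and `δ` fails only at pairs of odd numbers, and only if `n ≠ 2`. -/
theorem deltaZ_add_iff (n : ℕ) (m : ℤ) {i l : ℤ} {j : ℕ} (h : i + j = l) :
    deltaZ n m i + delta n j = deltaZ n m l ↔ n = 2 ∨ ¬ (i % 2 = 1 ∧ j % 2 = 1) := by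
  subst h
  unfold deltaZ delta
  push_cast
  rcases Int.emod_two_eq_zero_or_one i with hi | hi <;>
  rcases Nat.mod_two_eq_zero_or_one j with hj | hj
  · have h1 : (i + j) / 2 = i / 2 + j / 2 := by omega
    have h2 : (i + j) % 2 = 0 := by omega
    have h3 : (j : ℤ) % 2 = 0 := by omega
    rw [h1, h2, h3, hi, hj]
    exact ⟨fun _ => Or.inr (by omega), fun _ => by ring⟩
  · have h1 : (i + j) / 2 = i / 2 + j / 2 := by omega
    have h2 : (i + j) % 2 = 1 := by omega
    have h3 : (j : ℤ) % 2 = 1 := by omega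
    rw [h1, h2, h3, hi, hj]
    exact ⟨fun _ => Or.inr (by omega), fun _ => by ring⟩
  · have h1 : (i + j) / 2 = i / 2 + j / 2 := by omega
    have h2 : (i + j) % 2 = 1 := by omega
    have h3 : (j : ℤ) % 2 = 0 := by omega
    rw [h1, h2, h3, hi, hj]
    exact ⟨fun _ => Or.inr (by omega), fun _ => by ring⟩
  · have h1 : (i + j) / 2 = i / 2 + j / 2 + 1 := by omega
    have h2 : (i + j) % 2 = 0 := by omega
    have h3 : (j : ℤ) % 2 = 1 := by omega
    rw [h1, h2, h3, hi, hj, add_mul, add_mul]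
    generalize i / 2 * (n : ℤ) = x
    generalize (j : ℤ) / 2 * (n : ℤ) = y
    constructor <;> intro _ <;> omega

section Restrict

variable {K : Type u} [Field K] {E B : GrAlg.{u, u} K} {n : ℕ} (ψ : E.Iso (B.regrade n))

/-- The identification of `E_j` with `B_{δ(j)}`. -/
def GrAlg.Iso.toDelta (j : ℕ) : E.obj j ≃ₗ[K] B.obj (delta n j) := ψ.equiv j

theorem GrAlg.Iso.toDelta_mul {i j k : ℕ} (h : i + j = k) (hδ : delta n i + delta n j = delta n k)
    (a : E.obj i) (b : E.obj j) :
    ψ.toDelta k (E.mul h a b) = B.mul hδ (ψ.toDelta i a) (ψ.toDelta j b) :=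
  (ψ.map_mul h a b).trans (LinearMap.congr_fun₂ (B.regrade_mul_of_eq h hδ) _ _)

include ψ in
theorem GrAlg.Iso.toDelta_mul_of_ne {i j k : ℕ} (h : i + j = k)
    (hδ : delta n i + delta n j ≠ delta n k) (a : E.obj i) (b : E.obj j) : E.mul h a b = 0 := by
  refine (ψ.toDelta k).injective ?_
  rw [map_zero]
  exact (ψ.map_mul h a b).trans (LinearMap.congr_fun₂ (B.regrade_mul_of_ne h hδ) _ _)

theorem GrAlg.Iso.toDelta_one (h : delta n 0 = 0) {M : GrMod B} {i : ℤ}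
    (h' : i + (delta n 0 : ℕ) = i) (x : M.obj i) : M.act h' x (ψ.toDelta 0 E.one) = x := by
  have key : ∀ (z : ℕ) (hz : 0 = z) (h : i + (z : ℤ) = i), M.act h x (hz ▸ B.one) = x := by
    rintro _ rfl h; exact M.act_one x
  have := ψ.map_one
  refine (congrArg (M.act h' x) this).trans (key _ h.symm h')

/-- The graded `E`-module with components `W_{δ_m(j)}`, for a graded `B`-module `W`. -/
def restr (m : ℤ) (W : GrMod B) : GrMod E where
  obj j := W.obj (deltaZ n m j)
  act {i j l} _ := if hδ : deltaZ n m i + delta n j = deltaZ n m l then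
    (W.act hδ).compl₂ (ψ.toDelta j).toLinearMap else 0
  act_one {i} x := by
    have h0 : deltaZ n m i + delta n 0 = deltaZ n m i := by simp [delta]
    rw [dif_pos h0]
    exact ψ.toDelta_one (by simp [delta]) h0 x
  act_act {i j k jk l l'} hij h hjk h' x a b := by
    by_cases h1 : deltaZ n m i + delta n j = deltaZ n m l ∧
        deltaZ n m l + delta n k = deltaZ n m l'
    · obtain ⟨h1, h2⟩ := h1
      have h3 : delta n j + delta n k = delta n jk := by
        rw [delta_add_iff n hjk]; rw [deltaZ_add_iff n m hij] at h1
        rw [deltaZ_add_iff n m h] at h2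
        omega
      have h4 : deltaZ n m i + delta n jk = deltaZ n m l' := by push_cast [← h3]; omega
      rw [dif_pos h1, dif_pos h2, dif_pos h4]
      change W.act h2 (W.act h1 x (ψ.toDelta j a)) (ψ.toDelta k b) =
        W.act h4 x (ψ.toDelta jk (E.mul hjk a b))
      rw [ψ.toDelta_mul hjk h3, W.act_act]
    · have h2 : ¬ (delta n j + delta n k = delta n jk ∧
          deltaZ n m i + delta n jk = deltaZ n m l') := by
        rw [deltaZ_add_iff n m hij, deltaZ_add_iff n m h] at h1
        rw [delta_add_iff n hjk, deltaZ_add_iff n m h']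
        omega
      rw [not_and_or] at h1 h2
      trans (0 : W.obj (deltaZ n m l'))
      · rcases h1 with h1 | h1 <;> simp [dif_neg h1]
      · rcases h2 with h2 | h2
        · rw [ψ.toDelta_mul_of_ne hjk h2, map_zero]
        · simp [dif_neg h2]

theorem restr_act_of_eq (m : ℤ) (W : GrMod B) {i l : ℤ} {j : ℕ} (h : i + j = l)
    (hδ : deltaZ n m i + delta n j = deltaZ n m l) (x : W.obj (deltaZ n m i)) (e : E.obj j) :
    (restr ψ m W).act h x e = W.act hδ x (ψ.toDelta j e) :=
  LinearMap.congr_fun₂ (dif_pos hδ : (restr ψ m W).act h = _) x e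

theorem restr_act_of_ne (m : ℤ) (W : GrMod B) {i l : ℤ} {j : ℕ} (h : i + j = l)
    (hδ : deltaZ n m i + delta n j ≠ deltaZ n m l) (x : W.obj (deltaZ n m i)) (e : E.obj j) :
    (restr ψ m W).act h x e = 0 :=
  LinearMap.congr_fun₂ (dif_neg hδ : (restr ψ m W).act h = _) x e

variable {ψ} in
/-- The components of a morphism of restricted modules, as maps between components of the original
modules. -/
def restrApp {m : ℤ} {W W' : GrMod B} (g : restr ψ m W ⟶ restr ψ m W') (j : ℤ) :
    W.obj (deltaZ n m j) →ₗ[K] W'.obj (deltaZ n m j) := g.app j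

theorem restrApp_act {m : ℤ} {W W' : GrMod B} (g : restr ψ m W ⟶ restr ψ m W') {i l : ℤ} {j : ℕ}
    (h : i + j = l) (hδ : deltaZ n m i + delta n j = deltaZ n m l) (x : W.obj (deltaZ n m i))
    (b : B.obj (delta n j)) :
    restrApp g l (W.act hδ x b) = W'.act hδ (restrApp g i x) b := by
  have h1 := g.comm h x ((ψ.toDelta j).symm b)
  rw [restr_act_of_eq ψ m W h hδ] at h1
  rw [LinearEquiv.apply_symm_apply] at h1
  refine h1.trans ((restr_act_of_eq ψ m W' h hδ _ _).trans ?_)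
  rw [LinearEquiv.apply_symm_apply]
  rfl

theorem restrApp_act' {m : ℤ} {W W' : GrMod B} (g : restr ψ m W ⟶ restr ψ m W') {i l : ℤ} (j : ℕ)
    {c : ℕ} (hc : delta n j = c) (h : i + j = l) (hδ : deltaZ n m i + c = deltaZ n m l)
    (x : W.obj (deltaZ n m i)) (b : B.obj c) :
    restrApp g l (W.act hδ x b) = W'.act hδ (restrApp g i x) b := by
  subst hc
  exact restrApp_act ψ g h hδ x b

variable (n) in
/-- If `n > 2`, the condition `W_{m+kn+1} = W_{m+kn} B_1` for all `k`. -/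
def OddGen (m : ℤ) (W : GrMod B) : Prop :=
  2 < n → ∀ (j : ℤ) (h : deltaZ n m (2 * j) + (1 : ℕ) = deltaZ n m (2 * j + 1)),
    ⊤ ≤ Submodule.span K { x | ∃ w b, x = W.act h w b }

variable {V : Type v} [Quiver.{w + 1} V] [Finite V] [∀ a b : V, Finite (a ⟶ b)]
  {A : GrAlg.{u, u} K} (D : DualPair A B V n)

theorem DualPair.y_hom_ext {c : ℕ} {W : Type*} [AddCommGroup W] [Module K W]
    {f g : B.obj c →ₗ[K] W} (H : ∀ q : QPath V c, f (D.y q) = g (D.y q)) : f = g :=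
  LinearMap.ext fun b => by
    obtain ⟨γ, rfl⟩ := D.y_surjective b
    simp only [map_sum, map_smul, H]

variable {ψ}

theorem deltaZ_even (n : ℕ) (m j : ℤ) : deltaZ n m (2 * j) = m + j * n := by
  unfold deltaZ
  have h1 : 2 * j / 2 = j := by omega
  have h2 : 2 * j % 2 = 0 := by omega
  rw [h1, h2, add_zero]

theorem deltaZ_odd (n : ℕ) (m j : ℤ) : deltaZ n m (2 * j + 1) = m + j * n + 1 := by
  unfold deltaZ
  have h1 : (2 * j + 1) / 2 = j := by omega
  have h2 : (2 * j + 1) % 2 = 1 := by omega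
  rw [h1, h2]

/-- A map of restricted modules commutes with `B_{n-1}` in odd degrees, although `B_{n-1}` is not a
component of the Yoneda algebra, provided that the odd components are generated by the even ones. -/
theorem restrApp_act_jump (hn : 2 ≤ n) {m : ℤ} {W W' : GrMod B} (hW : OddGen n m W)
    (g : restr ψ m W ⟶ restr ψ m W') (j : ℤ) (x : W.obj (deltaZ n m j)) (b : B.obj (jump n j)) :
    restrApp g (j + 1) (W.act (deltaZ_add_jump hn m j) x b) =
      W'.act (deltaZ_add_jump hn m j) (restrApp g j x) b := by
  by_cases hc : delta n 1 = jump n j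
  · exact restrApp_act' ψ g 1 hc (by simp) _ x b
  · have hj : j % 2 = 1 := by
      by_contra hj
      exact hc (by rw [delta_one, jump, if_pos (by omega)])
    have hj' : jump n j = n - 1 := by rw [jump, if_neg (by omega)]
    rw [hj', delta_one] at hc
    obtain ⟨k, rfl⟩ : ∃ k, j = 2 * k + 1 := ⟨j / 2, by omega⟩
    have h1 : deltaZ n m (2 * k) + (1 : ℕ) = deltaZ n m (2 * k + 1) := by
      rw [deltaZ_even, deltaZ_odd]; push_cast; ring
    have h2 := deltaZ_add_jump hn m (2 * k + 1)
    have h3 : 1 + jump n (2 * k + 1) = delta n 2 := by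
      rw [hj', delta_two]; omega
    have h4 : deltaZ n m (2 * k) + (delta n 2 : ℕ) = deltaZ n m (2 * k + 1 + 1) := by
      rw [← h2, ← h1, add_assoc, ← h3]; push_cast; rfl
    -- both sides agree on the products of elements of even degree with elements of `B_1`
    have key : ⊤ ≤ LinearMap.eqLocus (restrApp g (2 * k + 1 + 1) ∘ₗ (W.act h2).flip b)
        ((W'.act h2).flip b ∘ₗ restrApp g (2 * k + 1)) := by
      refine (hW (by omega) k h1).trans (Submodule.span_le.2 ?_)
      rintro _ ⟨w, b', rfl⟩
      change restrApp g (2 * k + 1 + 1) (W.act h2 (W.act h1 w b') b) =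
        W'.act h2 (restrApp g (2 * k + 1) (W.act h1 w b')) b
      rw [W.act_act _ _ h3 h4, restrApp_act' ψ g 1 (delta_one n) (by simp) h1,
        W'.act_act _ _ h3 h4]
      exact restrApp_act ψ g (j := 2) (by push_cast; ring) h4 w _
    exact key (Submodule.mem_top (x := x))

include D in
/-- Maps that commute with the vertices and with the paths of length `δ_m(j+1) - δ_m(j)` commute
with the action of the Yoneda algebra. -/
theorem exists_restr_hom (hn : 2 ≤ n) {m : ℤ} {W W' : GrMod B}
    (g : ∀ j, W.obj (deltaZ n m j) →ₗ[K] W'.obj (deltaZ n m j))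
    (h0 : ∀ (j : ℤ) (x : W.obj (deltaZ n m j)) (v : QPath V 0),
      g j (W.act (by simp) x (D.y v)) = W'.act (by simp) (g j x) (D.y v))
    (h1 : ∀ (j : ℤ) (x : W.obj (deltaZ n m j)) (q : QPath V (jump n j)),
      g (j + 1) (W.act (deltaZ_add_jump hn m j) x (D.y q)) =
        W'.act (deltaZ_add_jump hn m j) (g j x) (D.y q)) :
    ∃ G : restr ψ m W ⟶ restr ψ m W', ∀ j, restrApp G j = g j := by
  -- By induction on the number of steps, the maps commute with the action of all of `B` between the
  -- degrees `δ_m(j)`.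
  have key : ∀ (i : ℕ) (j l : ℤ) (_ : j + i = l) (c : ℕ) (h : deltaZ n m j + c = deltaZ n m l)
      (x : W.obj (deltaZ n m j)) (b : B.obj c), g l (W.act h x b) = W'.act h (g j x) b := by
    intro i
    induction i with
    | zero =>
      intro j l hl c h x b
      obtain rfl : j = l := by simpa using hl
      obtain rfl : c = 0 := by omega
      exact LinearMap.congr_fun (f := g j ∘ₗ W.act h x) (g := W'.act h (g j x))
        (D.y_hom_ext fun v => h0 j x v) b
    | succ i ih =>
      intro j l hl c h x b
      have e1 := deltaZ_add_jump hn m j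
      have hle : jump n j ≤ c := by
        have : deltaZ n m (j + 1) ≤ deltaZ n m l := by
          have hi : ∀ (i : ℕ) (a : ℤ), deltaZ n m a ≤ deltaZ n m (a + i) := by
            intro i
            induction i with
            | zero => intro a; simp
            | succ i ih =>
              intro a
              refine (ih a).trans ?_
              have := deltaZ_add_jump hn m (a + i)
              push_cast
              rw [← add_assoc, ← this]
              omega
          have := hi i (j + 1)
          rwa [show j + 1 + (i : ℤ) = l by push_cast at hl; omega] at this
        omega
      obtain ⟨c', rfl⟩ : ∃ c', c = c' + jump n j := ⟨c - jump n j, by omega⟩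
      have e2 : deltaZ n m (j + 1) + c' = deltaZ n m l := by push_cast at h; omega
      refine LinearMap.congr_fun (f := g l ∘ₗ W.act h x) (g := W'.act h (g j x))
        (D.y_hom_ext fun r => ?_) b
      have e3 : D.y r = B.mul (add_comm _ _) (D.y (r.drop rfl)) (D.y (r.take rfl)) := by
        rw [D.y_mul rfl, atJoin_take_drop]
      change g l (W.act h x (D.y r)) = W'.act h (g j x) (D.y r)
      rw [e3, ← W.act_act e1 e2, ← W'.act_act e1 e2, ih (j + 1) l (by push_cast at hl; omega), h1]
  refine ⟨{ app := g, comm := fun {i j l} h x e => ?_ }, fun j => rfl⟩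
  by_cases hδ : deltaZ n m i + delta n j = deltaZ n m l
  · refine (congrArg (g l) (restr_act_of_eq ψ m W h hδ x e)).trans ((key j i l h _ hδ x _).trans ?_)
    exact (restr_act_of_eq ψ m W' h hδ _ _).symm
  · refine (congrArg (g l) (restr_act_of_ne ψ m W h hδ x e)).trans ((map_zero (g l)).trans ?_)
    exact (restr_act_of_ne ψ m W' h hδ _ _).symm

end Restrict

end

section

/-! ### The correspondence between complexes and modules over the Yoneda algebra -/

section Contraction

variable {K : Type u} [Field K] {A : GrAlg.{u, u} K} {n : ℕ} (hn : 2 ≤ n) {m : ℤ}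

/-- The components of a map between contractions. -/
def contrHom {I I' : NComplex n A} (F : I.contraction hn m ⟶ I'.contraction hn m) (j : ℤ) :
    I.X (deltaZ n m j) ⟶ I'.X (deltaZ n m j) := F.f j

theorem contraction_d (I : NComplex n A) (j : ℤ) :
    (I.contraction hn m).d j (j + 1) =
      iter I.X I.d (jump n j) _ _ (deltaZ_add_jump hn m j) :=
  CochainComplex.of_d (fun j => I.X (deltaZ n m j))
    (fun j => iter I.X I.d (jump n j) _ _ (deltaZ_add_jump hn m j)) j

theorem contrHom_comm {I I' : NComplex n A} (F : I.contraction hn m ⟶ I'.contraction hn m) (j : ℤ) :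
    contrHom hn F j ≫ iter I'.X I'.d (jump n j) _ _ (deltaZ_add_jump hn m j) =
      iter I.X I.d (jump n j) _ _ (deltaZ_add_jump hn m j) ≫ contrHom hn F (j + 1) := by
  rw [← contraction_d hn I j, ← contraction_d hn I' j]
  exact F.comm j (j + 1)

theorem exists_contrHom {I I' : NComplex n A}
    (f : ∀ j, I.X (deltaZ n m j) ⟶ I'.X (deltaZ n m j))
    (hf : ∀ j, f j ≫ iter I'.X I'.d (jump n j) _ _ (deltaZ_add_jump hn m j) =
      iter I.X I.d (jump n j) _ _ (deltaZ_add_jump hn m j) ≫ f (j + 1)) :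
    ∃ F : I.contraction hn m ⟶ I'.contraction hn m, ∀ j, contrHom hn F j = f j :=
  ⟨{ f := f
     comm' := fun i j (hij : i + 1 = j) => by
      subst hij
      rw [contraction_d, contraction_d]
      exact hf i }, fun _ => rfl⟩

end Contraction

namespace DualPair.Link

variable {K : Type u} [Field K] {A B : GrAlg.{u, u} K} {V : Type v} [Quiver.{w + 1} V]
  [Finite V] [∀ a b : V, Finite (a ⟶ b)] {n : ℕ} {D : DualPair A B V n}
  {X : ℤ → GrMod A} {d : ∀ k, X k ⟶ X (k + 1)} {W : GrMod B} (L : D.Link X d W)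

open Classical in
include L in
/-- The paths of length `c < n` act through the maps `X^k → X^{k+c}`, because they are linearly
independent in `A_c`: there is an element `z` of `X^k` with `z x_q = w` at the last vertex of `q`
and `z x_p = 0` for `p ≠ q`. -/
theorem exists_lam_iter {c : ℕ} (hc : c < n) {k l : ℤ} (h : k + c = l) (w : W.obj k)
    (q : QPath V c) :
    ∃ z : (X k).obj (-l), L.lam l ((iter X d c k l h).app _ z) = W.act h w (D.y q) ∧
      ∀ (h' : -l + c = -k) (p : QPath V c), L.lam k ((X k).act h' z (D.x p)) =
        if p = q then W.act (by simp) w (D.y (QPath.nil q.tgt)) else 0 := by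
  have h0 : -k + (0 : ℕ) = -k := by simp
  have h0' : k + (0 : ℕ) = k := by simp
  have h' : -l + (c : ℤ) = -k := by omega
  let f : A.obj c →ₗ[K] (X k).obj (-k) := (D.basis hc).constr K fun p =>
    if p = q then (X k).act h0 ((L.lam k).symm w) (D.x (QPath.nil q.tgt)) else 0
  have hf : ∀ p, f (D.x p) =
      if p = q then (X k).act h0 ((L.lam k).symm w) (D.x (QPath.nil q.tgt)) else 0 := fun p => by
    rw [← D.basis_apply hc]
    exact (D.basis _).constr_basis K _ p
  obtain ⟨z, hz⟩ := D.exists_act_of_basis (L.isCofree k) h' f fun p v => by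
    rw [hf]
    by_cases hp : p = q
    · rw [if_pos hp, D.act_x_x h0, hp]
      rfl
    · rw [if_neg hp, map_zero, LinearMap.zero_apply, ite_self]
  have hz' : ∀ p, L.lam k ((X k).act h' z (D.x p)) =
      if p = q then W.act h0' w (D.y (QPath.nil q.tgt)) else 0 := fun p => by
    rw [hz, hf]
    split_ifs
    · rw [L.lam_act, LinearEquiv.apply_symm_apply]
    · exact map_zero _
  refine ⟨z, ?_, fun _ => hz'⟩
  rw [L.lam_iter c k l h h' z, Finset.sum_eq_single q]
  · change W.act h (L.lam k ((X k).act h' z (D.x q))) (D.y q) = _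
    rw [hz', if_pos rfl, W.act_act h0' h (Nat.zero_add c) h, D.y_mul (add_zero c),
      atJoin_nil_right, if_pos]
    rfl
  · intro p _ hp
    change W.act h (L.lam k ((X k).act h' z (D.x p))) (D.y p) = 0
    rw [hz', if_neg hp, map_zero, LinearMap.zero_apply]
  · simp

variable {E : GrAlg.{u, u} K} {ψ : E.Iso (B.regrade n)} {hn : 2 ≤ n} {m : ℤ}

theorem jump_lt (hn : 2 ≤ n) (j : ℤ) : jump n j < n := by
  unfold jump; split_ifs <;> omega

/-- The compatibility of a map between the contractions of two `n`-complexes and a map between the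
corresponding modules over the Yoneda algebra. -/
def Compat {I I' : NComplex n A} {W W' : GrMod B} (L : D.Link I.X I.d W) (L' : D.Link I'.X I'.d W')
    (F : I.contraction hn m ⟶ I'.contraction hn m) (g : restr ψ m W ⟶ restr ψ m W') : Prop :=
  ∀ (j : ℤ) (z : (I.X (deltaZ n m j)).obj (-deltaZ n m j)),
    L'.lam _ ((contrHom hn F j).app _ z) = restrApp g j (L.lam _ z)

variable {I I' : NComplex n A} {W W' : GrMod B} (L : D.Link I.X I.d W) (L' : D.Link I'.X I'.d W')

variable {L L'} in
theorem Compat.eq_left {F F' : I.contraction hn m ⟶ I'.contraction hn m}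
    {g : restr ψ m W ⟶ restr ψ m W'} (h : Compat L L' F g) (h' : Compat L L' F' g) : F = F' := by
  refine HomologicalComplex.hom_ext _ _ fun j => ?_
  refine GrMod.IsCofree.hom_ext (L'.isCofree (deltaZ n m j))
    (f := contrHom hn F j) (g := contrHom hn F' j) fun z => ?_
  exact (L'.lam _).injective ((h j z).trans (h' j z).symm)

variable {L L'} in
theorem Compat.eq_right {F : I.contraction hn m ⟶ I'.contraction hn m}
    {g g' : restr ψ m W ⟶ restr ψ m W'} (h : Compat L L' F g) (h' : Compat L L' F g') : g = g' := by
  refine GrMod.hom_ext fun j => LinearMap.ext fun x => ?_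
  obtain ⟨z, rfl⟩ := (L.lam (deltaZ n m j)).surjective x
  exact (h j z).symm.trans (h' j z)

/-- A map between contractions induces a map of modules over the Yoneda algebra, since its
components in the degrees `-δ_m(j)` commute with paths of length `δ_m(j+1) - δ_m(j) < n`. -/
theorem Compat.exists_right (F : I.contraction hn m ⟶ I'.contraction hn m) :
    ∃ g : restr ψ m W ⟶ restr ψ m W', Compat L L' F g := by
  classical
  let g : ∀ j, W.obj (deltaZ n m j) →ₗ[K] W'.obj (deltaZ n m j) := fun j =>
    (L'.lam _).toLinearMap ∘ₗ (contrHom hn F j).app _ ∘ₗ (L.lam _).symm.toLinearMap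
  have hg : ∀ j z, g j (L.lam _ z) = L'.lam _ ((contrHom hn F j).app _ z) := fun j z => by
    change L'.lam _ ((contrHom hn F j).app _ ((L.lam _).symm (L.lam _ z))) = _
    rw [LinearEquiv.symm_apply_apply]
  have h0 : ∀ (j : ℤ) (x : W.obj (deltaZ n m j)) (v : QPath V 0),
      g j (W.act (by simp) x (D.y v)) = W'.act (by simp) (g j x) (D.y v) := fun j x v => by
    obtain ⟨z, rfl⟩ := (L.lam (deltaZ n m j)).surjective x
    rw [← L.lam_act, hg, hg, (contrHom hn F j).comm, L'.lam_act]
  obtain ⟨G, hG⟩ := exists_restr_hom D (ψ := ψ) hn g h0 fun j x q => by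
    obtain ⟨z, hz, hz'⟩ := L.exists_lam_iter (jump_lt hn j) (deltaZ_add_jump hn m j) x q
    have h' : -deltaZ n m (j + 1) + (jump n j : ℤ) = -deltaZ n m j := by
      rw [← deltaZ_add_jump hn m j]; ring
    have h1 : (contrHom hn F (j + 1)).app _
        ((iter I.X I.d (jump n j) _ _ (deltaZ_add_jump hn m j)).app _ z) =
        (iter I'.X I'.d (jump n j) _ _ (deltaZ_add_jump hn m j)).app _
          ((contrHom hn F j).app _ z) :=
      (LinearMap.congr_fun (congrArg (fun f => GrMod.Hom.app f _) (contrHom_comm hn F j)) z).symm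
    rw [← hz, hg, h1, L'.lam_iter _ _ _ _ h', Finset.sum_eq_single q]
    · change W'.act _ (L'.lam _ ((I'.X _).act h' ((contrHom hn F j).app _ z) (D.x q))) (D.y q) = _
      rw [← (contrHom hn F j).comm, ← hg, hz' h', if_pos rfl, h0,
        W'.act_act _ (deltaZ_add_jump hn m j) (Nat.zero_add _) (deltaZ_add_jump hn m j),
        D.y_mul (add_zero _), atJoin_nil_right, if_pos]
      rfl
    · intro p _ hp
      change W'.act _ (L'.lam _ ((I'.X _).act h' ((contrHom hn F j).app _ z) (D.x p))) (D.y p) = 0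
      rw [← (contrHom hn F j).comm, ← hg, hz' h', if_neg hp, map_zero, map_zero,
        LinearMap.zero_apply]
    · simp
  exact ⟨G, fun j z => by rw [hG, hg]⟩

/-- A map of modules over the Yoneda algebra extends to the cofree modules, and commutes with their
differentials because it commutes with the paths of length `δ_m(j+1) - δ_m(j)`. -/
theorem Compat.exists_left (hW : OddGen n m W) (g : restr ψ m W ⟶ restr ψ m W') :
    ∃ F : I.contraction hn m ⟶ I'.contraction hn m, Compat L L' F g := by
  have hδ : ∀ j, deltaZ n m j + (delta n 0 : ℕ) = deltaZ n m j := fun j => by simp [delta]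
  have hgA : ∀ (j : ℤ) (x : W.obj (deltaZ n m j)) (b : B.obj 0),
      restrApp g j (W.act (by simp) x b) = W'.act (by simp) (restrApp g j x) b := fun j x b =>
    restrApp_act' ψ g 0 (by simp [delta]) (by simp) _ x b
  have ex : ∀ j, ∃ f : I.X (deltaZ n m j) ⟶ I'.X (deltaZ n m j), ∀ z : (I.X (deltaZ n m j)).obj _,
      f.app (-deltaZ n m j) z = (L'.lam _).symm (restrApp g j (L.lam _ z)) := fun j =>
    (L'.isCofree (deltaZ n m j)).exists_hom
      ((L'.lam _).symm.toLinearMap ∘ₗ restrApp g j ∘ₗ (L.lam _).toLinearMap) fun x e => by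
        refine LinearMap.congr_fun (f := ((L'.lam _).symm.toLinearMap ∘ₗ restrApp g j ∘ₗ
          (L.lam _).toLinearMap) ∘ₗ (I.X (deltaZ n m j)).act (by simp) x)
          (g := (I'.X (deltaZ n m j)).act (by simp)
            (((L'.lam _).symm.toLinearMap ∘ₗ restrApp g j ∘ₗ (L.lam _).toLinearMap) x))
          (D.hom_ext fun v => ?_) e
        change (L'.lam _).symm (restrApp g j (L.lam _ ((I.X (deltaZ n m j)).act _ x (D.x v)))) =
          (I'.X (deltaZ n m j)).act _ ((L'.lam _).symm (restrApp g j (L.lam _ x))) (D.x v)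
        rw [LinearEquiv.symm_apply_eq, L'.lam_act, LinearEquiv.apply_symm_apply, L.lam_act, hgA]
  choose f hf using ex
  have hf' : ∀ j z, L'.lam _ ((f j).app _ z) = restrApp g j (L.lam _ z) := fun j z => by
    rw [hf, LinearEquiv.apply_symm_apply]
  obtain ⟨F, hF⟩ := exists_contrHom hn (I := I) (I' := I') f fun j => by
    have h' : -deltaZ n m (j + 1) + (jump n j : ℤ) = -deltaZ n m j := by
      rw [← deltaZ_add_jump hn m j]; ring
    refine (L'.isCofree (deltaZ n m (j + 1))).hom_ext fun z => (L'.lam _).injective ?_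
    rw [GrMod.comp_app_apply, GrMod.comp_app_apply, hf', L.lam_iter _ _ _ _ h',
      L'.lam_iter _ _ _ _ h', map_sum]
    refine Finset.sum_congr rfl fun q _ => ?_
    change W'.act _ (L'.lam _ ((I'.X _).act h' ((f j).app _ z) (D.x q))) (D.y q) =
      restrApp g (j + 1) (W.act _ (L.lam _ ((I.X _).act h' z (D.x q))) (D.y q))
    rw [restrApp_act_jump hn hW, ← (f j).comm, hf']
  exact ⟨F, fun j z => by rw [hF, hf']⟩

/-- If `n > 2`, the condition `W_{m+kn+1} = W_{m+kn} B_1` means that the socles of the terms of odd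
index of the contraction consist of boundaries. -/
theorem oddGen_iff (L : D.Link I.X I.d W) : OddGen n m W ↔ (2 < n → ∀ j i : ℤ,
    ((I.contraction hn m).X (2 * j + 1)).socle i ≤
      LinearMap.range (((I.contraction hn m).d (2 * j) (2 * j + 1)).app i)) := by
  have hj : ∀ j : ℤ, jump n (2 * j) = 1 := fun j => by rw [jump, if_pos (by omega)]
  have hd : ∀ (j : ℤ) (h : deltaZ n m (2 * j) + (1 : ℕ) = deltaZ n m (2 * j + 1)),
      (I.contraction hn m).d (2 * j) (2 * j + 1) = iter I.X I.d 1 _ _ h := fun j h => by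
    rw [contraction_d]
    have key : ∀ (c : ℕ) (hc : jump n (2 * j) = c) (h : deltaZ n m (2 * j) + c = _),
        iter I.X I.d (jump n (2 * j)) _ _ (deltaZ_add_jump hn m (2 * j)) =
          iter I.X I.d c _ (deltaZ n m (2 * j + 1)) h := by
      rintro _ rfl _; rfl
    exact key 1 (hj j) h
  refine forall_congr' fun h2 => forall_congr' fun j => ?_
  have h : deltaZ n m (2 * j) + (1 : ℕ) = deltaZ n m (2 * j + 1) := by
    rw [deltaZ_even, deltaZ_odd]; push_cast; ring
  have h' : -deltaZ n m (2 * j + 1) + (1 : ℕ) = -deltaZ n m (2 * j) := by rw [← h]; ring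
  rw [hd j h]
  change _ ↔ ∀ i : ℤ, (I.X (deltaZ n m (2 * j + 1))).socle i ≤
    LinearMap.range ((iter I.X I.d 1 _ _ h).app i)
  constructor
  · intro hW i x hx
    -- The socle is concentrated in degree `-δ_m(2j+1)`, where it is the whole component.
    by_cases hi : i = -deltaZ n m (2 * j + 1)
    · subst hi
      have key : ⊤ ≤ (LinearMap.range ((iter I.X I.d 1 _ _ h).app
          (-deltaZ n m (2 * j + 1)))).map (L.lam (deltaZ n m (2 * j + 1))).toLinearMap := by
        refine (hW h).trans (Submodule.span_le.2 ?_)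
        rintro _ ⟨w, b, rfl⟩
        obtain ⟨γ, rfl⟩ := D.y_surjective b
        rw [map_sum]
        refine Submodule.sum_mem _ fun q _ => ?_
        rw [map_smul]
        refine Submodule.smul_mem _ _ ?_
        obtain ⟨z, hz, -⟩ := L.exists_lam_iter (by omega : 1 < n) h w q
        exact ⟨_, ⟨z, rfl⟩, hz⟩
      obtain ⟨y, hy, hxy⟩ := key (Submodule.mem_top (x := L.lam _ x))
      rwa [← (L.lam _).injective hxy]
    · have hx0 : x = 0 := (L.isCofree (deltaZ n m (2 * j + 1))).eq_zero x fun p hp a =>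
        hx p _ hp (by
          rcases Nat.eq_zero_or_pos p with rfl | h0
          · exact (hi (by simpa using hp)).elim
          · exact h0) a
      rw [hx0]
      exact zero_mem _
  · intro hs h1 x _
    obtain ⟨y, rfl⟩ := (L.lam _).surjective x
    obtain ⟨z, rfl⟩ := hs (-deltaZ n m (2 * j + 1)) (x := y) fun p l hp h0 a =>
      (L.isCofree _).eq_zero _ fun p' hp' => by omega
    rw [L.lam_iter 1 _ _ h h' z]
    exact Submodule.sum_mem _ fun q _ => Submodule.subset_span ⟨_, _, rfl⟩

end DualPair.Link

end

section

/-! ### The equivalence of categories -/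

section

variable {K : Type u} [Field K] {A B E : GrAlg.{u, u} K} {V : Type v} [Quiver.{w + 1} V]
  [Finite V] [∀ a b : V, Finite (a ⟶ b)] {n : ℕ}

/-- A linear `n`-complex and a graded `B`-module that are linked to each other, such that the
restriction of the module to the Yoneda algebra and the contraction of the complex belong to the
two categories to be compared. -/
structure LinkedPair (D : DualPair A B V n) (ψ : E.Iso (B.regrade n)) (hn : 2 ≤ n) (m : ℤ) where
  I : NComplex n A
  W : GrMod B
  link : D.Link I.X I.d W
  oddGen : OddGen n m W

namespace LinkedPair

variable {D : DualPair A B V n} {ψ : E.Iso (B.regrade n)} {hn : 2 ≤ n} {m : ℤ}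

/-- The morphisms of linked pairs: the compatible pairs of a map between contractions and a map of
modules over the Yoneda algebra. Each of the two maps determines the other one. -/
@[ext]
structure Hom (S T : LinkedPair D ψ hn m) where
  left : S.I.contraction hn m ⟶ T.I.contraction hn m
  right : restr ψ m S.W ⟶ restr ψ m T.W
  compat : DualPair.Link.Compat S.link T.link left right

instance : Category (LinkedPair D ψ hn m) where
  Hom := Hom
  id S := ⟨𝟙 _, 𝟙 _, fun _ _ => rfl⟩
  comp f g := ⟨f.left ≫ g.left, f.right ≫ g.right, fun j z =>
    (g.compat j _).trans (congrArg (restrApp g.right j) (f.compat j z))⟩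

variable (D ψ hn m) in
/-- The contraction of the complex of a linked pair. -/
def toComplex : LinkedPair D ψ hn m ⥤ CochainComplex (GrMod A) ℤ where
  obj S := S.I.contraction hn m
  map f := Hom.left f

variable (D ψ hn m) in
/-- The restriction of the module of a linked pair to the Yoneda algebra. -/
def toModule : LinkedPair D ψ hn m ⥤ GrMod E where
  obj S := restr ψ m S.W
  map f := Hom.right f

instance : (toComplex D ψ hn m).Faithful where
  map_injective {_ _} f g h := by
    have h' : f.left = g.left := h
    exact Hom.ext h' (f.compat.eq_right (by rw [h']; exact g.compat))

instance : (toComplex D ψ hn m).Full where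
  map_surjective {S T} F := by
    obtain ⟨g, hg⟩ := DualPair.Link.Compat.exists_right (ψ := ψ) S.link T.link F
    exact ⟨⟨F, g, hg⟩, rfl⟩

instance : (toModule D ψ hn m).Faithful where
  map_injective {_ _} f g h := by
    have h' : f.right = g.right := h
    exact Hom.ext (f.compat.eq_left (by rw [h']; exact g.compat)) h'

instance : (toModule D ψ hn m).Full where
  map_surjective {S T} g := by
    obtain ⟨F, hF⟩ := DualPair.Link.Compat.exists_left (hn := hn) S.link T.link S.oddGen g
    exact ⟨⟨F, g, hF⟩, rfl⟩

theorem isLinear (S : LinkedPair D ψ hn m) : S.I.IsLinear := fun k =>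
  ⟨D.isAlmostInjective (by omega) (S.link.isCofree k), (S.link.isCofree k).cogeneratedIn⟩

theorem isY (S : LinkedPair D ψ hn m) : IsY A hn m (S.I.contraction hn m) :=
  ⟨⟨S.I, S.isLinear, ⟨Iso.refl _⟩⟩, fun j => S.isLinear (deltaZ n m j),
    S.link.oddGen_iff.1 S.oddGen⟩

theorem exists_iso_of_isY (C : CochainComplex (GrMod A) ℤ) (hC : IsY A hn m C) :
    ∃ S : LinkedPair D ψ hn m, Nonempty (S.I.contraction hn m ≅ C) := by
  obtain ⟨⟨I, hI, ⟨e⟩⟩, -, hb⟩ := hC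
  obtain ⟨W, ⟨L⟩⟩ := D.exists_link_of_isLinear hn I hI
  refine ⟨⟨I, W, L, (DualPair.Link.oddGen_iff (hn := hn) L).2 fun h2 j i x hx => ?_⟩, ⟨e.symm⟩⟩
  -- The socle condition is transported from `C` to the contraction along the isomorphism.
  have h1 : (e.inv.f (2 * j + 1)).app i x ∈ (C.X (2 * j + 1)).socle i := fun p l h hp a => by
    rw [← (e.inv.f (2 * j + 1)).comm, hx p l h hp, map_zero]
  obtain ⟨y, hy⟩ := hb h2 j i h1
  refine ⟨(e.hom.f (2 * j)).app i y, ?_⟩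
  have h3 : e.hom.f (2 * j) ≫ (I.contraction hn m).d (2 * j) (2 * j + 1) =
      C.d (2 * j) (2 * j + 1) ≫ e.hom.f (2 * j + 1) := e.hom.comm _ _
  have h4 : e.inv.f (2 * j + 1) ≫ e.hom.f (2 * j + 1) = 𝟙 _ := by
    rw [← HomologicalComplex.comp_f, e.inv_hom_id]; rfl
  refine (LinearMap.congr_fun (congrArg (fun f => GrMod.Hom.app f i) h3) y).trans ?_
  rw [GrMod.comp_app_apply, hy]
  exact LinearMap.congr_fun (congrArg (fun f => GrMod.Hom.app f i) h4) x

end LinkedPair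

/-- A category of graded modules over the Yoneda algebra is equivalent to `Y(S, U)` if it consists,
up to isomorphism, of the restrictions of the graded `B`-modules `W` with
`W_{m+kn+1} = W_{m+kn} B_1`. -/
theorem nonempty_equivalence (D : DualPair A B V n) (ψ : E.Iso (B.regrade n)) (hn : 2 ≤ n) (m : ℤ)
    (P : ObjectProperty (GrMod E)) (hP : ∀ W : GrMod B, OddGen n m W → P (restr ψ m W))
    (hP' : ∀ M, P M → ∃ W : GrMod B, OddGen n m W ∧ Nonempty (restr ψ m W ≅ M)) :
    Nonempty (P.FullSubcategory ≌ (IsY A hn m).FullSubcategory) := by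
  let F : LinkedPair D ψ hn m ⥤ P.FullSubcategory :=
    P.lift (LinkedPair.toModule D ψ hn m) fun S => hP S.W S.oddGen
  let G : LinkedPair D ψ hn m ⥤ (IsY A hn m).FullSubcategory :=
    (IsY A hn m).lift (LinkedPair.toComplex D ψ hn m) fun S => S.isY
  have hF : F.EssSurj := ⟨fun M => by
    obtain ⟨W, hW, ⟨e⟩⟩ := hP' M.obj M.property
    obtain ⟨X, d, ⟨L⟩⟩ := D.exists_link (by omega) W
    exact ⟨⟨L.nComplex, W, L, hW⟩, ⟨P.isoMk e⟩⟩⟩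
  have hG : G.EssSurj := ⟨fun C => by
    obtain ⟨S, ⟨e⟩⟩ := LinkedPair.exists_iso_of_isY (D := D) (ψ := ψ) C.obj C.property
    exact ⟨S, ⟨(IsY A hn m).isoMk e⟩⟩⟩
  have : F.Faithful := Functor.Faithful.of_comp_iso (P.liftCompιIso _ _)
  have : F.Full := Functor.Full.of_comp_faithful_iso (P.liftCompιIso _ _)
  have : G.Faithful := Functor.Faithful.of_comp_iso ((IsY A hn m).liftCompιIso _ _)
  have : G.Full := Functor.Full.of_comp_faithful_iso ((IsY A hn m).liftCompιIso _ _)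
  have : F.IsEquivalence := {}
  have : G.IsEquivalence := {}
  exact ⟨F.asEquivalence.symm.trans G.asEquivalence⟩

end

end

section

/-! ### The image of the restriction functor -/

theorem deltaZ_lt_deltaZ {n : ℕ} (hn : 2 ≤ n) (m : ℤ) {i j : ℤ} (h : i < j) :
    deltaZ n m i < deltaZ n m j :=
  strictMono_int_of_lt_succ (fun k => by
    have h1 := deltaZ_add_jump hn m k
    have h2 : 0 < jump n k := by unfold jump; split_ifs <;> omega
    omega) h

/-- The degrees `i` such that `δ_m(i + j) = δ_m(i) + δ(j)` for all `j`. -/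
def IsSplit (n : ℕ) (i : ℤ) : Prop := n = 2 ∨ Even i

theorem IsSplit.add {n : ℕ} {i : ℤ} (hi : IsSplit n i) (m : ℤ) {j : ℕ} {l : ℤ} (h : i + j = l) :
    deltaZ n m i + delta n j = deltaZ n m l := by
  rw [deltaZ_add_iff n m h]
  rcases hi with hi | hi
  · exact Or.inl hi
  · right
    have := Int.even_iff.1 hi
    omega

theorem IsSplit.exists_eq {n : ℕ} (hn : 2 ≤ n) {m i l : ℤ} (hi : IsSplit n i) {c : ℕ}
    (h : deltaZ n m i + c = deltaZ n m l) : ∃ j : ℕ, i + j = l ∧ delta n j = c := by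
  have h1 : i ≤ l := by
    by_contra h1
    have := deltaZ_lt_deltaZ hn m (not_le.1 h1)
    omega
  refine ⟨(l - i).toNat, by omega, ?_⟩
  have h2 := hi.add m (j := (l - i).toNat) (l := l) (by omega)
  omega

section

variable {K : Type u} [Field K] {E B : GrAlg.{u, u} K} {n : ℕ} (ψ : E.Iso (B.regrade n))

/-- The action on a graded `E`-module of the component `B_c`, if it is a component `E_j` with
`j = l - i`; zero otherwise. -/
def dualAct (M : GrMod E) (i l : ℤ) (c : ℕ) : M.obj i →ₗ[K] B.obj c →ₗ[K] M.obj l :=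
  open scoped Classical in
  if h : ∃ j : ℕ, i + j = l ∧ delta n j = c then
    (M.act h.choose_spec.1).compl₂
      ((ψ.toDelta h.choose).symm.toLinearMap ∘ₗ
        (LinearEquiv.cast (R := K) (M := B.obj) h.choose_spec.2.symm).toLinearMap)
  else 0

theorem dualAct_toDelta (M : GrMod E) {i l : ℤ} {j : ℕ} (h : i + j = l) (x : M.obj i)
    (e : E.obj j) : dualAct ψ M i l (delta n j) x (ψ.toDelta j e) = M.act h x e := by
  have h' : ∃ j' : ℕ, i + j' = l ∧ delta n j' = delta n j := ⟨j, h, rfl⟩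
  have key : ∀ (j' : ℕ) (h1 : i + j' = l) (h2 : delta n j' = delta n j),
      M.act h1 x ((ψ.toDelta j').symm
        (LinearEquiv.cast (R := K) (M := B.obj) h2.symm (ψ.toDelta j e))) = M.act h x e := by
    intro j' h1 h2
    obtain rfl : j' = j := by omega
    congr 1
    exact (ψ.toDelta j').symm_apply_apply e
  rw [dualAct, dif_pos h']
  exact key _ h'.choose_spec.1 h'.choose_spec.2

theorem dualAct_one (M : GrMod E) (i : ℤ) (x : M.obj i) : dualAct ψ M i i 0 x B.one = x := by
  have key : ∀ (z : ℕ) (hz : 0 = z), dualAct ψ M i i z x (hz ▸ B.one) = x →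
      dualAct ψ M i i 0 x B.one = x := by
    rintro _ rfl h
    exact h
  refine key (delta n 0) (delta_zero n).symm ?_
  refine (congrArg (dualAct ψ M i i (delta n 0) x) ψ.map_one.symm).trans ?_
  refine (dualAct_toDelta ψ M (j := 0) (by simp) x E.one).trans (M.act_one x)

/-- The action of `E` on `x b`, for `x` of split degree, if it corresponds to an action of `B`. -/
theorem act_dualAct (hn : 2 ≤ n) (m : ℤ) (M : GrMod E) {i l l' : ℤ} (hi : IsSplit n i) {c d p : ℕ}
    (hc : deltaZ n m i + c = deltaZ n m l) (h : l + p = l')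
    (hδ : deltaZ n m l + delta n p = deltaZ n m l') (hd : c + delta n p = d) (x : M.obj i)
    (b : B.obj c) (e : E.obj p) :
    M.act h (dualAct ψ M i l c x b) e = dualAct ψ M i l' d x (B.mul hd b (ψ.toDelta p e)) := by
  obtain ⟨j, hj, rfl⟩ := hi.exists_eq hn hc
  obtain ⟨a, rfl⟩ := (ψ.toDelta j).surjective b
  have h1 := hi.add m (j := j + p) (l := l') (by push_cast; omega)
  obtain rfl : d = delta n (j + p) := by omega
  rw [dualAct_toDelta ψ M hj, ← ψ.toDelta_mul rfl, dualAct_toDelta ψ M (by push_cast; omega)]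
  exact M.act_act _ _ _ _ _ _ _

include ψ in
theorem act_dualAct_of_ne (hn : 2 ≤ n) (m : ℤ) (M : GrMod E) {i l l' : ℤ} (hi : IsSplit n i)
    {c p : ℕ} (hc : deltaZ n m i + c = deltaZ n m l) (h : l + p = l')
    (hδ : deltaZ n m l + delta n p ≠ deltaZ n m l') (x : M.obj i)
    (b : B.obj c) (e : E.obj p) : M.act h (dualAct ψ M i l c x b) e = 0 := by
  obtain ⟨j, hj, rfl⟩ := hi.exists_eq hn hc
  obtain ⟨a, rfl⟩ := (ψ.toDelta j).surjective b
  have h1 := hi.add m (j := j + p) (l := l') (by push_cast; omega)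
  rw [dualAct_toDelta ψ M hj, M.act_act hj h rfl (by push_cast; omega),
    ψ.toDelta_mul_of_ne rfl (by omega), map_zero]

/-- The action of `B` on `x b`, for `x` and `x b` of split degree. -/
theorem dualAct_dualAct (hn : 2 ≤ n) (m : ℤ) (M : GrMod E) {i l l' : ℤ} (hi : IsSplit n i)
    (hl : IsSplit n l) {c c' d : ℕ} (hc : deltaZ n m i + c = deltaZ n m l)
    (hc' : deltaZ n m l + c' = deltaZ n m l') (hd : c + c' = d) (x : M.obj i) (b : B.obj c)
    (b' : B.obj c') :
    dualAct ψ M l l' c' (dualAct ψ M i l c x b) b' = dualAct ψ M i l' d x (B.mul hd b b') := by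
  obtain ⟨p, hp, rfl⟩ := hl.exists_eq hn hc'
  obtain ⟨e, rfl⟩ := (ψ.toDelta p).surjective b'
  rw [dualAct_toDelta ψ M hp]
  exact act_dualAct ψ hn m M hi hc hp hc' hd x b e

/-- The graded `B`-module of the families of maps `B_u → M_s`, for `k + u = δ_m(s)`, in
degree `k`. -/
def homMod (m : ℤ) (M : GrMod E) (n : ℕ) : GrMod B where
  obj k := ∀ t : { t : ℤ × ℕ // k + t.2 = deltaZ n m t.1 }, B.obj t.1.2 →ₗ[K] M.obj t.1.1
  act {i j l} h := LinearMap.mk₂ K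
    (fun f b t => f ⟨(t.1.1, j + t.1.2), by have := t.2; push_cast; omega⟩ ∘ₗ B.mul rfl b)
    (fun _ _ _ => rfl) (fun _ _ _ => rfl)
    (fun f a b => by funext t; ext z; simp) (fun c f a => by funext t; ext z; simp)
  act_one {i} f := by
    funext t
    ext z
    have key : ∀ (q : ℕ) (h : 0 + t.1.2 = q) (h' : i + q = deltaZ n m t.1.1),
        f ⟨(t.1.1, q), h'⟩ (B.mul h B.one z) = f t z := by
      intro q h h'
      obtain rfl : t.1.2 = q := by omega
      rw [B.one_mul]
    exact key _ rfl _
  act_act {i j k jk l l'} hij h hjk h' f a b := by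
    funext t
    ext z
    have key : ∀ (q : ℕ) (hq : jk + t.1.2 = q) (hq' : j + (k + t.1.2) = q)
        (h1 : i + q = deltaZ n m t.1.1) (h2 : i + (j + (k + t.1.2) : ℕ) = deltaZ n m t.1.1),
        f ⟨(t.1.1, j + (k + t.1.2)), h2⟩ (B.mul rfl a (B.mul rfl b z)) =
          f ⟨(t.1.1, q), h1⟩ (B.mul hq (B.mul hjk a b) z) := by
      intro q hq hq' h1 h2
      subst hq'
      rw [B.mul_assoc hjk rfl hq rfl]
    exact key _ rfl (by omega) _ _

/-- The values of an element of `homMod m M n`. -/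
def homVal {m : ℤ} {M : GrMod E} {k : ℤ} (f : (homMod (B := B) m M n).obj k) {s : ℤ} {u : ℕ}
    (h : k + u = deltaZ n m s) : B.obj u →ₗ[K] M.obj s := f ⟨(s, u), h⟩

theorem homMod_ext {m : ℤ} {M : GrMod E} {k : ℤ} {f g : (homMod (B := B) m M n).obj k}
    (H : ∀ (s : ℤ) (u : ℕ) (h : k + u = deltaZ n m s) (z : B.obj u),
      homVal f h z = homVal g h z) : f = g :=
  funext fun t => LinearMap.ext (H t.1.1 t.1.2 t.2)

theorem homVal_act {m : ℤ} {M : GrMod E} {k l : ℤ} {c : ℕ} (h : k + c = l)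
    (f : (homMod (B := B) m M n).obj k) (b : B.obj c) {s : ℤ} {u q : ℕ}
    (hu : l + u = deltaZ n m s) (hq : c + u = q) (hq' : k + q = deltaZ n m s) (z : B.obj u) :
    homVal ((homMod m M n).act h f b) hu z = homVal f hq' (B.mul hq b z) := by
  subst hq
  rfl

/-- The map `z ↦ x (y z)`. -/
def dualHom (m : ℤ) (M : GrMod E) (i : ℤ) {c : ℕ} {k : ℤ} (_hc : deltaZ n m i + c = k) :
    M.obj i →ₗ[K] B.obj c →ₗ[K] (homMod (B := B) m M n).obj k :=
  LinearMap.mk₂ K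
    (fun x y t => dualAct ψ M i t.1.1 (c + t.1.2) x ∘ₗ B.mul rfl y)
    (fun _ _ _ => by funext t; ext z; simp; rfl) (fun _ _ _ => by funext t; ext z; simp; rfl)
    (fun _ _ _ => by funext t; ext z; simp; rfl) (fun _ _ _ => by funext t; ext z; simp; rfl)

theorem homVal_dualHom {m : ℤ} {M : GrMod E} {i : ℤ} {c : ℕ} {k : ℤ} (hc : deltaZ n m i + c = k)
    (x : M.obj i) (y : B.obj c) {s : ℤ} {u q : ℕ} (hu : k + u = deltaZ n m s) (hq : c + u = q)
    (z : B.obj u) :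
    homVal (dualHom ψ m M i hc x y) hu z = dualAct ψ M i s q x (B.mul hq y z) := by
  subst hq
  rfl

theorem dualHom_act {m : ℤ} {M : GrMod E} {i : ℤ} {c d e : ℕ} {k l : ℤ}
    (hc : deltaZ n m i + c = k) (h : k + d = l) (he : c + d = e) (hl : deltaZ n m i + e = l)
    (x : M.obj i) (y : B.obj c) (b : B.obj d) :
    (homMod m M n).act h (dualHom ψ m M i hc x y) b = dualHom ψ m M i hl x (B.mul he y b) :=
  homMod_ext fun s u hu z => by
    have h1 : e + u = c + (d + u) := by omega
    rw [homVal_act h _ b hu rfl (by push_cast; omega), homVal_dualHom ψ hc x y _ rfl,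
      homVal_dualHom ψ hl x _ hu h1, B.mul_assoc he rfl _ rfl]

/-- The submodule of `homMod m M n` that is generated by the maps `z ↦ x z`, for `x` of split
degree. Its restriction to `E` is `M`, if `M` belongs to the image of the restriction functor. -/
def dualSub (m : ℤ) (M : GrMod E) : (homMod (B := B) m M n).Submod where
  carrier k := Submodule.span K { f | ∃ (i : ℤ) (c : ℕ) (hc : deltaZ n m i + c = k)
    (x : M.obj i) (y : B.obj c), IsSplit n i ∧ f = dualHom ψ m M i hc x y }
  act_mem {k d l} h f hf b := by
    refine Submodule.span_induction (p := fun f _ => (homMod m M n).act h f b ∈ _)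
      ?_ (by simp) (fun x y _ _ hx hy => by
        rw [map_add, LinearMap.add_apply]; exact add_mem hx hy)
      (fun c x _ hx => by
        rw [map_smul, LinearMap.smul_apply]; exact Submodule.smul_mem _ c hx) hf
    rintro _ ⟨i, c, hc, x, y, hi, rfl⟩
    rw [dualHom_act ψ hc h rfl (by push_cast; omega)]
    exact Submodule.subset_span ⟨i, c + d, _, x, _, hi, rfl⟩

/-- On elements of `dualSub`, the values on `B_{δ(p)}` are determined by the value at the unit. -/
theorem homVal_toDelta (hn : 2 ≤ n) {m : ℤ} {M : GrMod E} {j l : ℤ} {p : ℕ} (h : j + p = l)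
    (hδ : deltaZ n m j + delta n p = deltaZ n m l)
    {f : (homMod (B := B) m M n).obj (deltaZ n m j)} (hf : f ∈ (dualSub ψ m M).carrier _)
    (e : E.obj p) :
    homVal f hδ (ψ.toDelta p e) =
      M.act h (homVal f (show deltaZ n m j + (0 : ℕ) = deltaZ n m j by simp) B.one) e := by
  refine Submodule.span_induction (p := fun f _ => homVal f hδ (ψ.toDelta p e) =
      M.act h (homVal f (show deltaZ n m j + (0 : ℕ) = deltaZ n m j by simp) B.one) e)
    ?_ ?_ (fun x y _ _ hx hy => ?_) (fun c x _ hx => ?_) hf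
  · rintro _ ⟨i, c, hc, x, y, hi, rfl⟩
    rw [homVal_dualHom ψ hc x y _ rfl, homVal_dualHom ψ hc x y _ (add_zero c), B.mul_one,
      act_dualAct ψ hn m M hi hc h hδ rfl]
  · exact ((congrArg (fun y => M.act h y e) (rfl : _ = (0 : M.obj j))).trans (by simp; rfl)).symm
  · refine (congrArg₂ (· + ·) hx hy).trans ?_
    exact (LinearMap.congr_fun (map_add (M.act h) _ _) e).symm
  · refine (congrArg (c • ·) hx).trans ?_
    exact (LinearMap.congr_fun (map_smul (M.act h) _ _) e).symm

/-- The case of `dualEval` commuting with the action of `E` in which this action is zero on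
restricted modules. -/
theorem homVal_act_of_ne (hn : 2 ≤ n) {m : ℤ} {M : GrMod E} {j l : ℤ} {p : ℕ} (h : j + p = l)
    (hδ : deltaZ n m j + delta n p ≠ deltaZ n m l)
    {f : (homMod (B := B) m M n).obj (deltaZ n m j)} (hf : f ∈ (dualSub ψ m M).carrier _)
    (e : E.obj p) :
    M.act h (homVal f (show deltaZ n m j + (0 : ℕ) = deltaZ n m j by simp) B.one) e = 0 := by
  refine Submodule.span_induction (p := fun f _ =>
      M.act h (homVal f (show deltaZ n m j + (0 : ℕ) = deltaZ n m j by simp) B.one) e = 0)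
    ?_ ?_ (fun x y _ _ hx hy => ?_) (fun c x _ hx => ?_) hf
  · rintro _ ⟨i, c, hc, x, y, hi, rfl⟩
    rw [homVal_dualHom ψ hc x y _ (add_zero c), B.mul_one]
    exact act_dualAct_of_ne ψ hn m M hi hc h hδ x y e
  · exact (congrArg (fun y => M.act h y e) (rfl : _ = (0 : M.obj j))).trans (by simp)
  · refine (LinearMap.congr_fun (map_add (M.act h) _ _) e).trans ?_
    exact (congrArg₂ (· + ·) hx hy).trans (add_zero 0)
  · refine (LinearMap.congr_fun (map_smul (M.act h) _ _) e).trans ?_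
    exact (congrArg (c • ·) hx).trans (smul_zero c)

/-- The components of `dualEval`. -/
def dualEvalApp (m : ℤ) (M : GrMod E) (j : ℤ) :
    (dualSub ψ m M).toMod.obj (deltaZ n m j) →ₗ[K] M.obj j where
  toFun f := homVal f.1 (show deltaZ n m j + (0 : ℕ) = deltaZ n m j by simp) B.one
  map_add' _ _ := rfl
  map_smul' _ _ := rfl

/-- The evaluation of maps `B_u → M_s` at the unit of `B`. -/
def dualEval (hn : 2 ≤ n) (m : ℤ) (M : GrMod E) : restr ψ m (dualSub ψ m M).toMod ⟶ M where
  app j := dualEvalApp ψ m M j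
  comm {j p l} h f e := by
    by_cases hδ : deltaZ n m j + delta n p = deltaZ n m l
    · refine (congrArg (dualEvalApp ψ m M l)
        (restr_act_of_eq ψ m (dualSub ψ m M).toMod h hδ f e)).trans
        (Eq.trans ?_ (homVal_toDelta ψ hn h hδ f.2 e))
      refine (homVal_act hδ f.1 (ψ.toDelta p e) (by simp) (add_zero _) hδ B.one).trans ?_
      rw [B.mul_one]
    · exact ((congrArg (dualEvalApp ψ m M l)
        (restr_act_of_ne ψ m (dualSub ψ m M).toMod h hδ f e)).trans (map_zero _)).trans
        (homVal_act_of_ne ψ hn h hδ f.2 e).symm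

end

end

section

/-! ### The kernel condition on modules over the Yoneda algebra -/

section

variable {K : Type u} [Field K] {E B : GrAlg.{u, u} K} {n : ℕ} (ψ : E.Iso (B.regrade n))

/-- The map `E_1 → E_2` given by the right multiplication by an element of `B_{n-1}`, as a map
`B_1 → B_n`. -/
def oneMul (h : delta n 1 + (n - 1) = delta n 2) (b : B.obj (n - 1)) : E.obj 1 →ₗ[K] E.obj 2 :=
  (ψ.toDelta 2).symm.toLinearMap ∘ₗ (B.mul h).flip b ∘ₗ (ψ.toDelta 1).toLinearMap

theorem toDelta_oneMul (h : delta n 1 + (n - 1) = delta n 2) (b : B.obj (n - 1)) (e : E.obj 1) :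
    ψ.toDelta 2 (oneMul ψ h b e) = B.mul h (ψ.toDelta 1 e) b :=
  (ψ.toDelta 2).apply_symm_apply _

/-- The defining property of the objects of `L_E`, for an algebra `E` identified with `B_U`. -/
def EvenGenKer : ObjectProperty (GrMod E) := fun M =>
  2 < n → M.GeneratedIn {i | Even i} ∧
    ∀ (k : ℤ) (h : delta n 1 + (n - 1) = delta n 2) (b : B.obj (n - 1))
      (t : TensorProduct K (M.obj (2 * k)) (E.obj 1)),
      TensorProduct.lift (M.act (show 2 * k + (1 : ℕ) = 2 * k + 1 by simp)) t = 0 →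
      TensorProduct.lift (M.act (show 2 * k + (2 : ℕ) = 2 * k + 2 by simp))
        (TensorProduct.map LinearMap.id (oneMul ψ h b) t) = 0

/-- The odd components of a restricted module are generated by the even ones. -/
theorem surjective_lift_act_restr (hn : 2 < n) {m : ℤ} {W : GrMod B} (hW : OddGen n m W) (k : ℤ) :
    Function.Surjective (TensorProduct.lift
      ((restr ψ m W).act (show 2 * k + (1 : ℕ) = 2 * k + 1 by simp))) := by
  have h1 : ∀ (c : ℕ) (_ : c = 1) (h : deltaZ n m (2 * k) + c = deltaZ n m (2 * k + 1)),
      ⊤ ≤ Submodule.span K { x | ∃ w b, x = W.act h w b } := by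
    rintro _ rfl h
    exact hW hn k h
  have h2 : deltaZ n m (2 * k) + delta n 1 = deltaZ n m (2 * k + 1) := by
    rw [deltaZ_even, deltaZ_odd, delta_one]; push_cast; ring
  refine LinearMap.range_eq_top.1 (eq_top_iff.2 ((h1 _ (delta_one n) h2).trans
    (Submodule.span_le.2 ?_)))
  rintro _ ⟨w, b, rfl⟩
  obtain ⟨e, rfl⟩ := (ψ.toDelta 1).surjective b
  exact ⟨w ⊗ₜ e, restr_act_of_eq ψ m W _ h2 w e⟩

/-- The kernel condition holds on restricted modules `W`, since the multiplication by `E_1` followed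
by that by `b ∈ B_{n-1}` is a multiplication by elements of `B_n = E_2`. -/
theorem evenGenKer_restr {m : ℤ} {W : GrMod B} (hW : OddGen n m W) :
    EvenGenKer ψ (restr ψ m W) := by
  intro h2
  constructor
  · rintro N f hf ⟨i, hi⟩
    by_cases hi' : Even i
    · exact ⟨i, hi', hi⟩
    obtain ⟨k, rfl⟩ := Int.not_even_iff_odd.1 hi'
    refine ⟨2 * k, even_two_mul k, ?_⟩
    by_contra h3
    rw [not_nontrivial_iff_subsingleton] at h3
    obtain ⟨y, hy⟩ := exists_ne (0 : N.obj (2 * k + 1))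
    obtain ⟨x, rfl⟩ := hf _ y
    obtain ⟨t, rfl⟩ := surjective_lift_act_restr ψ h2 hW k x
    refine hy ?_
    clear hy
    induction t using TensorProduct.induction_on with
    | zero => rw [map_zero, map_zero]
    | tmul w e =>
      rw [TensorProduct.lift.tmul, f.comm, Subsingleton.elim (f.app (2 * k) w) 0, map_zero,
        LinearMap.zero_apply]
    | add x y hx hy => rw [map_add, map_add, hx, hy, add_zero]
  · intro k h b t ht
    have h3 : IsSplit n (2 * k) := Or.inr (even_two_mul k)
    have h4 := h3.add m (show 2 * k + (1 : ℕ) = 2 * k + 1 by simp)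
    have h5 := h3.add m (show 2 * k + (2 : ℕ) = 2 * k + 2 by simp)
    have h6 : deltaZ n m (2 * k + 1) + (n - 1 : ℕ) = deltaZ n m (2 * k + 2) := by
      rw [← h4, ← h5, ← h]; push_cast; ring
    have key : TensorProduct.lift ((restr ψ m W).act (show 2 * k + (2 : ℕ) = 2 * k + 2 by simp)) ∘ₗ
        TensorProduct.map LinearMap.id (oneMul ψ h b) =
        ((W.act h6).flip b : W.obj _ →ₗ[K] W.obj _) ∘ₗ
          TensorProduct.lift ((restr ψ m W).act (show 2 * k + (1 : ℕ) = 2 * k + 1 by simp)) := by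
      refine TensorProduct.ext' fun w e => ?_
      change (restr ψ m W).act _ w (oneMul ψ h b e) =
        W.act h6 ((restr ψ m W).act (show 2 * k + (1 : ℕ) = 2 * k + 1 by simp) w e) b
      refine (restr_act_of_eq ψ m W _ h5 w _).trans ?_
      refine Eq.trans ?_ (congrArg (fun z => W.act h6 z b) (restr_act_of_eq ψ m W _ h4 w e).symm)
      rw [toDelta_oneMul]
      exact (W.act_act h4 h6 h h5 _ _ _).symm
    refine (LinearMap.congr_fun key t).trans ?_
    exact (congrArg (fun z => W.act h6 z b) ht).trans (LinearMap.congr_fun (map_zero _) b)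

variable {V : Type v} [Quiver.{w + 1} V] [Finite V] [∀ a b : V, Finite (a ⟶ b)]
  {A : GrAlg.{u, u} K} (D : DualPair A B V n)

include D in
theorem DualPair.mul_span {c d e : ℕ} (h : c + d = e) :
    ⊤ ≤ Submodule.span K { x | ∃ (a : B.obj c) (b : B.obj d), x = B.mul h a b } := by
  intro b _
  obtain ⟨γ, rfl⟩ := D.y_surjective b
  refine Submodule.sum_mem _ fun q _ => Submodule.smul_mem _ _ (Submodule.subset_span ?_)
  have h' : d + c = e := by omega
  refine ⟨D.y (q.drop h'), D.y (q.take h'), ?_⟩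
  rw [D.y_mul h', atJoin_take_drop]

theorem dualHom_dualAct (hn : 2 ≤ n) {m : ℤ} {M : GrMod E} {i l : ℤ} (hi : IsSplit n i)
    (hl : IsSplit n l) {c d e : ℕ} {k : ℤ} (hc : deltaZ n m i + c = deltaZ n m l)
    (hd : deltaZ n m l + d = k) (he : c + d = e) (hk : deltaZ n m i + e = k) (x : M.obj i)
    (y : B.obj c) (b : B.obj d) :
    dualHom ψ m M l hd (dualAct ψ M i l c x y) b = dualHom ψ m M i hk x (B.mul he y b) :=
  homMod_ext fun s u hu z => by
    have h1 : e + u = c + (d + u) := by omega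
    rw [homVal_dualHom ψ hd _ b hu rfl, homVal_dualHom ψ hk x _ hu h1, B.mul_assoc he rfl _ rfl]
    exact dualAct_dualAct ψ hn m M hi hl hc (by push_cast; omega) rfl x y _

theorem dualHom_mem (m : ℤ) {M : GrMod E} {i k : ℤ} (hi : IsSplit n i) {c : ℕ}
    (hc : deltaZ n m i + c = k) (x : M.obj i) (y : B.obj c) :
    dualHom ψ m M i hc x y ∈ (dualSub ψ m M).carrier k :=
  Submodule.subset_span ⟨i, c, hc, x, y, hi, rfl⟩

include D in
/-- The elements of odd degree of `dualSub` come from the preceding even degree: if `x` has smaller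
even degree and `y b` is a product with `b ∈ B_1`, then `z ↦ x (y b z)` is the map `z ↦ (x y) (b
z)`. -/
theorem dualSub_odd_le (hn : 2 < n) {m : ℤ} {M : GrMod E} {k : ℤ} {c : ℕ} (hc : c = 1)
    (h : deltaZ n m (2 * k) + c = deltaZ n m (2 * k + 1)) :
    (dualSub ψ m M).carrier (deltaZ n m (2 * k + 1)) ≤
      Submodule.span K { f | ∃ x b, f = dualHom ψ m M (2 * k) h x b } := by
  refine Submodule.span_le.2 ?_
  rintro _ ⟨i, d, hd, x, y, hi, rfl⟩
  have hi' : Even i := hi.resolve_left (by omega)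
  obtain ⟨j, hj, hj'⟩ := hi.exists_eq hn.le hd
  obtain ⟨r, rfl⟩ : ∃ r, i = 2 * r := ⟨i / 2, by have := Int.even_iff.1 hi'; omega⟩
  have h1 : deltaZ n m (2 * r) ≤ deltaZ n m (2 * k) := by
    rcases (show 2 * r ≤ 2 * k by omega).eq_or_lt with h2 | h2
    · rw [h2]
    · exact (deltaZ_lt_deltaZ hn.le m h2).le
  obtain ⟨d', rfl⟩ : ∃ d', d = d' + c := ⟨d - c, by omega⟩
  have h2 : deltaZ n m (2 * r) + d' = deltaZ n m (2 * k) := by push_cast at hd; omega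
  have h3 : ⊤ ≤ (Submodule.span K { f | ∃ x b, f = dualHom ψ m M (2 * k) h x b }).comap
      (dualHom ψ m M (2 * r) hd x) := by
    refine (D.mul_span rfl).trans (Submodule.span_le.2 ?_)
    rintro _ ⟨y, b, rfl⟩
    exact Submodule.subset_span
      ⟨dualAct ψ M _ _ d' x y, b,
        (dualHom_dualAct ψ hn.le hi (Or.inr (even_two_mul k)) h2 h rfl hd x y b).symm⟩
  exact h3 (Submodule.mem_top (x := y))

include D in
theorem oddGen_dualSub (m : ℤ) (M : GrMod E) : OddGen n m (dualSub ψ m M).toMod := by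
  intro h2 k h
  rintro ⟨f, hf⟩ -
  have h3 := dualSub_odd_le ψ D h2 (M := M) rfl h hf
  have h4 : Submodule.span K { f | ∃ x b, f = dualHom ψ m M (2 * k) h x b } ≤
      (Submodule.span K { x | ∃ w b, x = (dualSub ψ m M).toMod.act h w b }).map
        ((dualSub ψ m M).incl.app (deltaZ n m (2 * k + 1))) := by
    refine Submodule.span_le.2 ?_
    rintro _ ⟨x, b, rfl⟩
    have h5 : deltaZ n m (2 * k) + (0 : ℕ) = deltaZ n m (2 * k) := by simp
    refine ⟨_, Submodule.subset_span
      ⟨⟨_, dualHom_mem ψ m (Or.inr (even_two_mul k)) h5 x B.one⟩, b, rfl⟩, ?_⟩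
    refine (dualHom_act ψ h5 h (zero_add 1) h x B.one b).trans ?_
    rw [B.one_mul]
  obtain ⟨g, hg, hg'⟩ := h4 h3
  obtain rfl : g = ⟨f, hf⟩ := Subtype.ext hg'
  exact hg

/-- `dualEval` is injective in split degrees, where all values are determined by that at the unit.
-/
theorem eq_zero_of_dualEval (hn : 2 ≤ n) {m : ℤ} {M : GrMod E} {j : ℤ} (hj : IsSplit n j)
    {f : (homMod (B := B) m M n).obj (deltaZ n m j)} (hf : f ∈ (dualSub ψ m M).carrier _)
    (h0 : homVal f (show deltaZ n m j + (0 : ℕ) = deltaZ n m j by simp) B.one = 0) : f = 0 :=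
  homMod_ext fun s u h z => by
    obtain ⟨p, hp, rfl⟩ := hj.exists_eq hn h
    obtain ⟨e, rfl⟩ := (ψ.toDelta p).surjective z
    rw [homVal_toDelta ψ hn hp h hf, h0, map_zero]
    rfl

include D in
/-- `dualEval` is injective in odd degrees. This is where the kernel condition is needed. -/
theorem eq_zero_of_dualEval_odd (hn : 2 < n) {m : ℤ} {M : GrMod E} (hM : EvenGenKer ψ M) {k : ℤ}
    {f : (homMod (B := B) m M n).obj (deltaZ n m (2 * k + 1))}
    (hf : f ∈ (dualSub ψ m M).carrier _)
    (h0 : homVal f (show deltaZ n m (2 * k + 1) + (0 : ℕ) = deltaZ n m (2 * k + 1) by simp)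
      B.one = 0) : f = 0 := by
  have hk : IsSplit n (2 * k) := Or.inr (even_two_mul k)
  have hk2 : IsSplit n (2 * k + 2) := Or.inr (by
    rw [show 2 * k + 2 = 2 * (k + 1) by ring]; exact even_two_mul _)
  have h1 := hk.add m (show 2 * k + (1 : ℕ) = 2 * k + 1 by simp)
  have h2 := hk.add m (show 2 * k + (2 : ℕ) = 2 * k + 2 by simp)
  have h3 : delta n 1 + (n - 1) = delta n 2 := by rw [delta_one, delta_two]; omega
  let τ : TensorProduct K (M.obj (2 * k)) (E.obj 1) →ₗ[K]
      (homMod (B := B) m M n).obj (deltaZ n m (2 * k + 1)) :=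
    TensorProduct.lift ((dualHom ψ m M (2 * k) h1).compl₂ (ψ.toDelta 1).toLinearMap)
  have hτ : ∀ x e, τ (x ⊗ₜ e) = dualHom ψ m M (2 * k) h1 x (ψ.toDelta 1 e) := fun x e => rfl
  -- `f` is given by a tensor `t` in `M_{2k} ⊗ E_1`, and the value of `f` at the unit is the image
  -- of `t` in `M_{2k+1}`; so `t` belongs to the kernel of the multiplication.
  obtain ⟨t, rfl⟩ : f ∈ LinearMap.range τ := by
    refine Submodule.span_le.2 ?_ (dualSub_odd_le ψ D hn (delta_one n) h1 hf)
    rintro _ ⟨x, b, rfl⟩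
    exact ⟨x ⊗ₜ (ψ.toDelta 1).symm b, by rw [hτ, LinearEquiv.apply_symm_apply]⟩
  have h4 : TensorProduct.lift (M.act (show 2 * k + (1 : ℕ) = 2 * k + 1 by simp)) t = 0 := by
    have h5 : ∀ t, TensorProduct.lift (M.act (show 2 * k + (1 : ℕ) = 2 * k + 1 by simp)) t =
        homVal (τ t)
          (show deltaZ n m (2 * k + 1) + (0 : ℕ) = deltaZ n m (2 * k + 1) by simp) B.one := by
      intro t
      induction t using TensorProduct.induction_on with
      | zero => rw [map_zero, map_zero]; rfl
      | tmul x e =>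
        rw [hτ, homVal_dualHom ψ h1 x _ _ (add_zero _), B.mul_one, dualAct_toDelta ψ M (by simp)]
        rfl
      | add x y hx hy => rw [map_add, hx, hy, map_add]; rfl
    rw [h5, h0]
  refine homMod_ext fun s u h z => ?_
  -- The values on `B_0 = E_0`, and those on `B_u` with `u ≥ n - 1`, where `B_u = B_{n-1} B_{u-n+1}`
  -- and the kernel condition applies.
  rcases eq_or_ne u (delta n 0) with rfl | hu
  · obtain ⟨e, rfl⟩ := (ψ.toDelta 0).surjective z
    obtain rfl : 2 * k + 1 = s := by
      rw [delta_zero] at h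
      rcases lt_trichotomy (2 * k + 1) s with h5 | h5 | h5
      · have := deltaZ_lt_deltaZ hn.le m h5; omega
      · exact h5
      · have := deltaZ_lt_deltaZ hn.le m h5; omega
    rw [homVal_toDelta ψ hn.le (by simp) h hf, h0, map_zero]
    rfl
  · have h5 : 2 * k + 2 ≤ s := by
      by_contra h5
      rcases (show s ≤ 2 * k + 1 by omega).eq_or_lt with h6 | h6
      · rw [delta_zero] at hu; subst h6; omega
      · have := deltaZ_lt_deltaZ hn.le m h6; omega
    have h6 : deltaZ n m (2 * k + 2) ≤ deltaZ n m s := by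
      rcases h5.eq_or_lt with h6 | h6
      · rw [h6]
      · exact (deltaZ_lt_deltaZ hn.le m h6).le
    obtain ⟨u', rfl⟩ : ∃ u', u = (n - 1) + u' := ⟨u - (n - 1), by omega⟩
    have h7 : deltaZ n m (2 * k + 2) + u' = deltaZ n m s := by push_cast at h; omega
    have h8 : ⊤ ≤ LinearMap.ker (homVal (τ t) h) := by
      refine (D.mul_span rfl).trans (Submodule.span_le.2 ?_)
      rintro _ ⟨b, z, rfl⟩
      have h9 : ∀ t, homVal (τ t) h (B.mul rfl b z) = dualAct ψ M (2 * k + 2) s u'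
          (TensorProduct.lift (M.act (show 2 * k + (2 : ℕ) = 2 * k + 2 by simp))
            (TensorProduct.map LinearMap.id (oneMul ψ h3 b) t)) z := by
        intro t
        induction t using TensorProduct.induction_on with
        | zero => simp only [map_zero, LinearMap.zero_apply]; rfl
        | tmul x e =>
          rw [hτ, homVal_dualHom ψ h1 x _ _ rfl, TensorProduct.map_tmul, TensorProduct.lift.tmul,
            ← dualAct_toDelta ψ M (by simp), LinearMap.id_apply, toDelta_oneMul,
            dualAct_dualAct ψ hn.le m M hk hk2 h2 h7 (show _ = delta n 1 + (n - 1 + u') by omega),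
            B.mul_assoc h3 rfl _ rfl]
        | add x y hx hy =>
          simp only [map_add, LinearMap.add_apply] at hx hy ⊢
          rw [← hx, ← hy]
          rfl
      refine (h9 t).trans ?_
      rw [(hM hn).2 k h3 b t h4, map_zero, LinearMap.zero_apply]
    exact h8 (Submodule.mem_top (x := z))

/-- The image of `dualEval` contains the components of split degree, hence everything if these
generate the module. -/
theorem dualEval_surjective (hn : 2 ≤ n) (m : ℤ) {M : GrMod E}
    (hM : 2 < n → M.GeneratedIn {i | Even i}) (j : ℤ) :
    Function.Surjective ((dualEval ψ hn m M).app j) := by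
  have h1 : ∀ j, IsSplit n j → (GrMod.range (dualEval ψ hn m M)).carrier j = ⊤ := by
    intro j hj
    refine eq_top_iff.2 fun x _ => ?_
    have h2 : deltaZ n m j + (0 : ℕ) = deltaZ n m j := by simp
    refine ⟨⟨_, dualHom_mem ψ m hj h2 x B.one⟩, ?_⟩
    refine (homVal_dualHom ψ h2 x B.one _ (add_zero 0) B.one).trans ?_
    rw [B.mul_one, dualAct_one]
  have h3 : (GrMod.range (dualEval ψ hn m M)).carrier j = ⊤ := by
    rcases hn.eq_or_lt with h2 | h2
    · exact h1 j (Or.inl h2.symm)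
    · exact (hM h2).eq_top _ (fun i hi => h1 i (Or.inr hi)) j
  exact LinearMap.range_eq_top.1 h3

include D in
/-- The objects of `L_E` are the restrictions of the graded `B`-modules `W` with
`W_{m+kn+1} = W_{m+kn} B_1`. -/
theorem exists_restr_iso (hn : 2 ≤ n) (m : ℤ) (M : GrMod E) (hM : EvenGenKer ψ M) :
    ∃ W : GrMod B, OddGen n m W ∧ Nonempty (restr ψ m W ≅ M) := by
  refine ⟨(dualSub ψ m M).toMod, oddGen_dualSub ψ D m M,
    ⟨GrMod.isoOfBijective (dualEval ψ hn m M) fun j => ⟨?_, ?_⟩⟩⟩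
  · refine (injective_iff_map_eq_zero (dualEvalApp ψ m M j)).2 fun f hf => Subtype.ext ?_
    rcases Classical.em (IsSplit n j) with hj | hj
    · exact eq_zero_of_dualEval ψ hn hj f.2 hf
    · rw [IsSplit, not_or, Int.not_even_iff_odd] at hj
      obtain ⟨h1, k, rfl⟩ := hj
      exact eq_zero_of_dualEval_odd ψ D (by omega) hM f.2 hf
  · exact dualEval_surjective ψ hn m (fun h => (hM h).1) j

/-! ### Modules presented in even degrees -/

theorem lift_act_naturality {M N : GrMod E} (f : M ⟶ N) {i l : ℤ} {j : ℕ} (h : i + j = l)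
    (t : TensorProduct K (M.obj i) (E.obj j)) :
    f.app l (TensorProduct.lift (M.act h) t) =
      TensorProduct.lift (N.act h) (TensorProduct.map (f.app i) LinearMap.id t) :=
  LinearMap.congr_fun (f := f.app l ∘ₗ TensorProduct.lift (M.act h))
    (g := TensorProduct.lift (N.act h) ∘ₗ TensorProduct.map (f.app i) LinearMap.id)
    (TensorProduct.ext' fun x e => f.comm h x e) t

theorem oneMul_map {W W' : Type u} [AddCommGroup W] [Module K W] [AddCommGroup W'] [Module K W']
    (f : W →ₗ[K] W') (h : delta n 1 + (n - 1) = delta n 2) (b : B.obj (n - 1))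
    (t : TensorProduct K W (E.obj 1)) :
    TensorProduct.map LinearMap.id (oneMul ψ h b) (TensorProduct.map f LinearMap.id t) =
      TensorProduct.map f LinearMap.id (TensorProduct.map LinearMap.id (oneMul ψ h b) t) := by
  rw [← LinearMap.comp_apply, ← LinearMap.comp_apply, ← TensorProduct.map_comp,
    ← TensorProduct.map_comp]
  rfl

include ψ D in
/-- As a quotient of a restricted module, a module generated in even degrees satisfies
`M_{2k+1} = M_{2k} E_1`. -/
theorem surjective_lift_act (hn : 2 < n) {M : GrMod E} (hM : M.GeneratedIn {i | Even i}) (k : ℤ) :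
    Function.Surjective (TensorProduct.lift
      (M.act (show 2 * k + (1 : ℕ) = 2 * k + 1 by simp))) := by
  intro x
  obtain ⟨w, rfl⟩ := dualEval_surjective ψ hn.le 0 (fun _ => hM) _ x
  obtain ⟨t, rfl⟩ := surjective_lift_act_restr ψ hn (oddGen_dualSub ψ D 0 M) k w
  exact ⟨_, (lift_act_naturality _ _ t).symm⟩

include D in
/-- A projective module generated in even degrees is a direct summand of a restricted module. -/
theorem evenGenKer_of_projective (hn : 2 ≤ n) {P : GrMod E} [Projective P]
    (hP : P.GeneratedIn {i | Even i}) : EvenGenKer ψ P := by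
  refine fun h2 => ⟨hP, fun k h b t ht => ?_⟩
  have : Epi (dualEval ψ hn 0 P) :=
    GrMod.epi_of_surjective _ (dualEval_surjective ψ hn 0 fun _ => hP)
  obtain ⟨s, hs⟩ := Projective.factors (𝟙 P) (dualEval ψ hn 0 P)
  have h3 := (evenGenKer_restr ψ (oddGen_dualSub ψ D 0 P) h2).2 k h b
    (TensorProduct.map (s.app (2 * k)) LinearMap.id t)
    (by rw [← lift_act_naturality, ht, map_zero])
  rw [oneMul_map, ← lift_act_naturality] at h3
  have h5 : ∀ x, (dualEval ψ hn 0 P).app (2 * k + 2) (s.app (2 * k + 2) x) = x := fun x => by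
    rw [← GrMod.comp_app_apply, hs]; rfl
  rw [← h5 (TensorProduct.lift _ _), h3, map_zero]

include D in
/-- If `P₁ → P₀ → M → 0` is a presentation, a tensor in the kernel for `M` lifts to `P₀`, and can be
corrected by a tensor from `P₁` to an element of the kernel for `P₀`. -/
theorem evenGenKer_of_presentedIn (hn : 2 ≤ n) {M : GrMod E} (hM : M.PresentedIn {i | Even i}) :
    EvenGenKer ψ M := by
  obtain ⟨P₁, P₀, f, g, -, hP₀, h₁, h₀, hg⟩ := hM
  refine fun h2 => ⟨h₀.of_surjective g fun i => (hg i).1, fun k h b t ht => ?_⟩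
  obtain ⟨t, rfl⟩ := TensorProduct.map_surjective (hg (2 * k)).1
    (g' := LinearMap.id) Function.surjective_id t
  change TensorProduct.lift _ (TensorProduct.map (g.app (2 * k)) LinearMap.id t) = 0 at ht
  rw [← lift_act_naturality] at ht
  obtain ⟨p, hp⟩ : TensorProduct.lift (P₀.act (show 2 * k + (1 : ℕ) = 2 * k + 1 by simp)) t ∈
      LinearMap.range (f.app (2 * k + 1)) := (hg _).2 ▸ LinearMap.mem_ker.2 ht
  obtain ⟨t₁, rfl⟩ := surjective_lift_act ψ D h2 h₁ k p
  rw [lift_act_naturality] at hp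
  have h3 := (evenGenKer_of_projective ψ D hn h₀ h2).2 k h b
    (t - TensorProduct.map (f.app (2 * k)) LinearMap.id t₁) (by rw [map_sub, hp, sub_self])
  have h4 := congrArg (g.app (2 * k + 2)) h3
  rw [map_sub, map_sub, map_sub, map_zero, sub_eq_zero, oneMul_map, ← lift_act_naturality] at h4
  have h5 : ∀ x, g.app (2 * k + 2) (f.app (2 * k + 2) x) = 0 := fun x => by
    have : f.app (2 * k + 2) x ∈ LinearMap.ker (g.app (2 * k + 2)) := (hg _).2 ▸ ⟨x, rfl⟩
    exact this
  rw [h5, lift_act_naturality, ← oneMul_map] at h4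
  exact h4

end

end

section

/-! ### The category `L_E` of the Yoneda algebra -/

namespace QuiverOf

variable {K : Type u} [Field K] {Λ : Type u} [Ring Λ] [Algebra K Λ]
  {𝒜 : ℕ → Submodule K Λ} [GradedAlgebra 𝒜] {V : Type v} [Quiver.{w + 1} V]
  [Finite V] [∀ a b : V, Finite (a ⟶ b)] (Φ : QuiverOf 𝒜 V) {n : ℕ}

/-- The identification of the Yoneda algebra with the copy of `Λ^!_U` in the universe of `K`. -/
def shrinkIso (φ : (yonedaAlgebra 𝒜).Iso (Φ.dualAlgU n)) :
    (yonedaAlgebra 𝒜).Iso ((Φ.dualAlg n).shrink.regrade n) :=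
  φ.trans ((Φ.dualAlg n).regradeShrink n)

theorem oneMul_shrinkIso (φ : (yonedaAlgebra 𝒜).Iso (Φ.dualAlgU n))
    (h : delta n 1 + (n - 1) = delta n 2) (b : (Φ.dualAlg n).obj (n - 1)) :
    oneMul (Φ.shrinkIso φ) h ((Φ.dualAlg n).shrinkEquiv (n - 1) b) =
      (φ.equiv 2).symm.toLinearMap ∘ₗ ((Φ.dualAlg n).mul h).flip b ∘ₗ
        (φ.equiv 1).toLinearMap := by
  refine LinearMap.ext fun e => ((Φ.shrinkIso φ).toDelta 2).injective ?_
  rw [toDelta_oneMul]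
  refine ((Φ.dualAlg n).shrinkEquiv_mul h (φ.equiv 1 e) b).symm.trans ?_
  refine congrArg ((Φ.dualAlg n).shrinkEquiv (delta n 2)) ?_
  exact ((φ.equiv 2).apply_symm_apply _).symm

/-- The definition of `L_E` in terms of submodules of tensor products amounts to `EvenGenKer`. -/
theorem isLE_iff (φ : (yonedaAlgebra 𝒜).Iso (Φ.dualAlgU n)) (M : GrMod (yonedaAlgebra 𝒜)) :
    Φ.IsLE n φ M ↔ EvenGenKer (Φ.shrinkIso φ) M := by
  refine forall_congr' fun _ => and_congr_right fun _ => forall₂_congr fun k h => ?_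
  constructor
  · intro H b t ht
    obtain ⟨b, rfl⟩ := ((Φ.dualAlg n).shrinkEquiv (n - 1)).surjective b
    rw [oneMul_shrinkIso]
    exact H b (Submodule.mem_map_of_mem (LinearMap.mem_ker.2 ht))
  · rintro H b _ ⟨t, ht, rfl⟩
    rw [← oneMul_shrinkIso]
    exact H _ t ht

end QuiverOf

end

end NKoszul

end

theorem mainTheorem1 {K : Type u} [Field K] {Λ : Type u} [Ring Λ] [Algebra K Λ]
    (𝒜 : ℕ → Submodule K Λ) [GradedAlgebra 𝒜]
    {V : Type v} [Quiver.{w + 1} V] [Finite V] [∀ a b : V, Finite (a ⟶ b)]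
    (Φ : QuiverOf 𝒜 V) (n : ℕ) (hn : 2 ≤ n) (m : ℤ) (hΛ : Φ.IsNKoszul n) :
    Nonempty ((yonedaAlgebra 𝒜).Iso (Φ.dualAlgU n)) ∧
    ∀ φ : (yonedaAlgebra 𝒜).Iso (Φ.dualAlgU n),
      Nonempty ((Φ.IsLE n φ).FullSubcategory ≌
        (IsY (GrAlg.ofGraded 𝒜) hn m).FullSubcategory) ∧
      ∀ M : GrMod (yonedaAlgebra 𝒜), M.PresentedIn {i | Even i} → Φ.IsLE n φ M := by
  refine ⟨⟨Φ.yonedaIso hn hΛ⟩, fun φ => ⟨?_, fun M hM => ?_⟩⟩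
  · exact nonempty_equivalence (Φ.dualPair hΛ.1) (Φ.shrinkIso φ) hn m _
      (fun W hW => (Φ.isLE_iff φ _).2 (evenGenKer_restr _ hW))
      fun M hM => exists_restr_iso _ (Φ.dualPair hΛ.1) hn m M ((Φ.isLE_iff φ M).1 hM)
  · exact (Φ.isLE_iff φ M).2 (evenGenKer_of_presentedIn _ (Φ.dualPair hΛ.1) hn hM)
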